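/- Let $X$ be a smooth compact four-manifold, $a$ a nowhere vanishing smooth one-form on $X$ such that $da$ has rank two on $E=\ker a$ (a quasi-contact form), and $g$ a smooth metric on $E$. Let $L=\ker(a\wedge da)\subset E$ be the characteristic line field and $L^\perp$ its orthogonal complement in $E$. Let $\alpha$ be a Popp one-form: a smooth one-form with $\ker\alpha=E$ for which $d\alpha|_{L^\perp}$ is the metric area form for some orientation of $L^\perp$. Let $R$ be the quasi-contact Reeb field: $\alpha(R)=1$, $d\alpha(R,\cdot)|_{L^\perp}=0$ and $R\in L^\perp+[L^\perp,L^\perp]$. Let $Z$ be a unit vector of $L$ (defined up to sign), $Z^*$ the form with $Z^*(Z)=1$ annihilating $L^\perp\oplus\mathbb{R}R$, and $\mu_{\mathrm{Popp}}=|Z^*\wedge\alpha\wedge d\alpha|$ the Popp measure. Let $M=T^*X\setminus 0$ with symplectic form $\omega=\sum dx_i\wedge d\xi_i$ and Hamilton fields $H_f$ given by $\omega(H_f,\cdot)=df$. Let $\sigma(x,\xi)=|\xi|_{E}|^2$ be the symbol of the sub-Riemannian Laplacian, $\sigma(R)(x,\xi)=\xi(R)$, $\Sigma=\{\sigma=0\}\subset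 M$, and $\pi:M\to X$ the projection. On the normal bundle $N\Sigma=TM/T\Sigma$ let $\nabla^2\sigma$ be half the Hessian of $\sigma$ (positive definite), and let $SN\Sigma$ be its unit sphere bundle. Let $\beta:[M;\Sigma]\to M$ be the blowup of $M$ along $\Sigma$, a manifold with boundary $SN\Sigma$ and interior $M\setminus\Sigma$. Let $N_1\Sigma\subset N\Sigma$ be the image of the symplectic complement of $T\Sigma$, with the symplectic form $\omega_0$ induced by $\omega$, and $N_0\Sigma$ its $\nabla^2\sigma$-orthogonal complement, a line bundle. Define $\mathfrak{J}$ on $N_1\Sigma$ by $\nabla^2\sigma(\cdot,\mathfrak{J}\,\cdot)=\omega_0$. The circle acts on $SN\Sigma$ by $e^{i\theta}(v_0+v_1)=v_0+\cos\theta\,v_1+\sin\theta\,\frac{\mathfrak{J}}{|\mathfrak{J}|}v_1$ for $v_j\in N_j\Sigma$; let $R_0$ be its generator and let $|\Xi_0|(v_0+v_1)=\|v_0\|$. Let $\mathbb{R}_+$ act by dilations, and put $SNS^*\Sigma=SN\Sigma/\mathbb{R}_+$. The quotient $SNS^*\Sigma/S^1$ is a bundle with fibre an interval $[-1,1]$,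 with coordinate $\Xi_0$ determined up to sign, over $\Sigma/\mathbb{R}_+=X_+\sqcup X_-$, $X_\pm=\{(x,\pm\alpha(x))\}\cong X$; it carries the lifted Popp measure $\mu=(1-\Xi_0^2)\,d\Xi_0\wedge\mu_{\mathrm{Popp}}$. Then there are a smooth function $\Omega$, homogeneous of degree one, on a conic neighbourhood of $\Sigma$ in $M$, and a smooth vector field $\hat Z$ on $SN\Sigma$, homogeneous of degree zero (hence a vector field on $SNS^*\Sigma$), such that: 1. $H_\Omega$ extends continuously to the boundary of the blowup and restricts to it as $H_\Omega|_{SN\Sigma}=R_0$; 2. near the boundary of $[M;\Sigma]$, $$H_{\sigma^{1/2}}=\frac{|\sigma(R)|}{\sigma^{1/2}}\,H_\Omega+\hat Z+o(1),$$ that is, for every smooth function $F$ on the blowup, $\big(H_{\sigma^{1/2}}-\tfrac{|\sigma(R)|}{\sigma^{1/2}}H_\Omega\big)F\to\hat ZF$ at each boundary point; 3. $(\pi\circ\beta)_*\hat Z\in L$ and $|(\pi\circ\beta)_*\hat Z|=|\Xi_0|$; 4. $\hat Z$ maps $S^1$-invariant functions to $S^1$-invariant functions, hence induces a vector field $[\hat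 Z]$ on the quotient by $S^1$, and its flow on $SNS^*\Sigma/S^1$ preserves the lifted Popp measure: $L_{[\hat Z]}\mu=0$, i.e. $\int [\hat Z]F\,d\mu=0$ for all smooth $F$. -/

import Mathlib

open scoped Manifold ContDiff Topology Bundle
open Set Filter MeasureTheory

noncomputable section

namespace QuasiContact

/-! ### The cotangent bundle, Hamilton vector fields, exterior derivative of a one-form -/

/-- The model space of four-dimensional manifolds. -/
abbrev E4 := EuclideanSpace ℝ (Fin 4)

/-- The fibre `T*ₓX`. -/
abbrev CoFib (X : Type*) [TopologicalSpace X] [ChartedSpace E4 X] (x : X) :=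
  TangentSpace (𝓡 4) x →L[ℝ] ℝ

/-- The cotangent bundle `M = T*X`. -/
abbrev CoTan (X : Type*) [TopologicalSpace X] [ChartedSpace E4 X] [IsManifold (𝓡 4) ∞ X] :=
  Bundle.TotalSpace (E4 →L[ℝ] ℝ) (CoFib X)

/-- The Whitney sum `T*X ⊕ TX`; its points are written `⟨x, (ξ, v)⟩`. -/
abbrev CoTanSum (X : Type*) [TopologicalSpace X] [ChartedSpace E4 X] [IsManifold (𝓡 4) ∞ X] :=
  Bundle.TotalSpace ((E4 →L[ℝ] ℝ) × E4) (fun x : X => CoFib X x × TangentSpace (𝓡 4) x)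

/-- Model with corners of `T*X`. -/
abbrev IC := (𝓡 4).prod 𝓘(ℝ, E4 →L[ℝ] ℝ)

/-- Model with corners of `T*X ⊕ TX`. -/
abbrev IS := (𝓡 4).prod 𝓘(ℝ, (E4 →L[ℝ] ℝ) × E4)

/-- Tangent vectors to a subset `S` of a manifold at `q`: those annihilating every germ of smooth
function that vanishes on `S`. For an embedded submanifold `S` this is `T_q S`. -/
def tangentTo {E H M : Type*} [NormedAddCommGroup E] [NormedSpace ℝ E] [TopologicalSpace H]
    (I : ModelWithCorners ℝ E H) [TopologicalSpace M] [ChartedSpace H M] (S : Set M) (q : M) :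
    Set (TangentSpace I q) :=
  {w | ∀ F : M → ℝ, ContMDiffAt I 𝓘(ℝ, ℝ) ∞ F q → (∀ᶠ s in 𝓝[S] q, F s = 0) →
    mfderiv I 𝓘(ℝ, ℝ) F q w = (0 : ℝ)}

variable {X : Type*} [TopologicalSpace X] [ChartedSpace E4 X] [IsManifold (𝓡 4) ∞ X]

/-- Derivative of a real function along a tangent vector of `T*X`. Here
`T_p(T*X) = E4 × (E4 →L[ℝ] ℝ)` through the canonical coordinates `(x, ξ)` that the preferred chart
of `X` at the base point induces on `T*X`. -/
def dC (f : CoTan X → ℝ) (p : CoTan X) (w : E4 × (E4 →L[ℝ] ℝ)) : ℝ :=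
  mfderiv IC 𝓘(ℝ, ℝ) f p (w : TangentSpace IC p)

/-- The canonical symplectic form `ω = ∑ dxᵢ ∧ dξᵢ` on `T_p(T*X)`. -/
def omega (w w' : E4 × (E4 →L[ℝ] ℝ)) : ℝ := w'.2 w.1 - w.2 w'.1

/-- The Hamilton vector field `H_f = ∑ᵢ f_{ξᵢ} ∂_{xᵢ} - f_{xᵢ} ∂_{ξᵢ}`. -/
def ham (f : CoTan X → ℝ) (p : CoTan X) : E4 × (E4 →L[ℝ] ℝ) :=
  (∑ i : Fin 4, dC f p (0, EuclideanSpace.proj i) • EuclideanSpace.single i (1 : ℝ),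
    -∑ i : Fin 4, dC f p (EuclideanSpace.single i (1 : ℝ), 0) •
      (EuclideanSpace.proj i : E4 →L[ℝ] ℝ))

/-- `ω(H_f, ·) = df`. -/
theorem omega_ham (f : CoTan X → ℝ) (p : CoTan X) (w : E4 × (E4 →L[ℝ] ℝ)) :
    omega (ham f p) w = dC f p w := by
  let A : E4 × (E4 →L[ℝ] ℝ) →L[ℝ] ℝ := mfderiv IC 𝓘(ℝ, ℝ) f p
  have hA : ∀ z, dC f p z = A z := fun z => rfl
  have h1 : w.1 = ∑ i : Fin 4, w.1 i • EuclideanSpace.single i (1 : ℝ) := by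
    ext j; simp [Finset.sum_apply, Pi.single_apply]
  have h2 : w.2 = ∑ i : Fin 4, w.2 (EuclideanSpace.single i (1 : ℝ)) •
      (EuclideanSpace.proj i : E4 →L[ℝ] ℝ) := by
    ext v
    have hv : v = ∑ i : Fin 4, v i • EuclideanSpace.single i (1 : ℝ) := by
      ext j; simp [Finset.sum_apply, Pi.single_apply]
    conv_lhs => rw [hv]
    simp [mul_comm]
  have hw : w = (∑ i : Fin 4, w.1 i • ((EuclideanSpace.single i (1 : ℝ), 0) : E4 × (E4 →L[ℝ] ℝ)))
      + ∑ i : Fin 4, w.2 (EuclideanSpace.single i (1 : ℝ)) •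
        ((0, EuclideanSpace.proj i) : E4 × (E4 →L[ℝ] ℝ)) := by
    refine Prod.ext ?_ ?_
    · simpa [Prod.fst_sum] using h1
    · simpa [Prod.snd_sum] using h2
  conv_rhs => rw [hA, hw]
  simp only [omega, ham, hA, map_add, map_sum, map_smul, neg_apply,
    sum_apply, smul_apply, PiLp.proj_apply, smul_eq_mul, sub_neg_eq_add]
  rw [add_comm]
  congr 1 <;> exact Finset.sum_congr rfl fun i _ => mul_comm _ _

/-- Smooth vector fields on `X`. -/
def SmoothVF (V : ∀ x : X, TangentSpace (𝓡 4) x) : Prop :=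
  ContMDiff (𝓡 4) (𝓡 4).tangent ∞ (fun x => (⟨x, V x⟩ : TangentBundle (𝓡 4) X))

/-- Smooth one-forms on `X`. -/
def SmoothForm (α : ∀ x : X, CoFib X x) : Prop :=
  ContMDiff (𝓡 4) IC ∞ (fun x => (⟨x, α x⟩ : CoTan X))

/-- The exterior derivative `dα(u, v) = (∂_u α)(v) - (∂_v α)(u)` of a one-form, in the preferred
chart at `x`: the fibre component of the differential of the section `α` is its derivative in the
canonical coordinates. -/
def extD (α : ∀ x : X, CoFib X x) (x : X) (u v : TangentSpace (𝓡 4) x) : ℝ :=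
  let D : E4 →L[ℝ] E4 × (E4 →L[ℝ] ℝ) := mfderiv (𝓡 4) IC (fun x => (⟨x, α x⟩ : CoTan X)) x
  (D u).2 v - (D v).2 u

/-- The symbol `σ(V)(x, ξ) = ξ(V(x))` of a vector field. -/
def symb (V : ∀ x : X, TangentSpace (𝓡 4) x) (p : CoTan X) : ℝ := p.2 (V p.1)

/-- Fibre dilations of `T*X`. -/
def dil (c : ℝ) (p : CoTan X) : CoTan X := ⟨p.1, c • p.2⟩

/-- The corresponding dilations of `T*X ⊕ TX`, acting on the covector only. -/
def dilS (c : ℝ) (q : CoTanSum X) : CoTanSum X := ⟨q.1, (c • q.2.1, q.2.2)⟩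

/-- The projection `T*X ⊕ TX → T*X`; on the blowup it is the blow-down map `β`. -/
def beta (q : CoTanSum X) : CoTan X := ⟨q.1, q.2.1⟩

end QuasiContact

open QuasiContact

/-! ### Quasi-contact sub-Riemannian structures -/

/-- A quasi-contact sub-Riemannian structure on a four-manifold `X`: a nowhere vanishing smooth
one-form `a` with `da` of rank two on `E = ker a`, and a smooth metric on `E`. The metric is given
by a smooth symmetric two-tensor `g` on `X` that is positive definite on `E`; every smooth metric
on the subbundle `E` is the restriction of such a tensor, and only the values of `g` on `E` are
used. -/
structure QCStructure (X : Type*) [TopologicalSpace X] [ChartedSpace E4 X]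
    [IsManifold (𝓡 4) ∞ X] where
  a : ∀ x : X, CoFib X x
  smooth_a : SmoothForm a
  a_ne_zero : ∀ x, a x ≠ 0
  rank_two : ∀ x, ∃ B : LinearMap.BilinForm ℝ (LinearMap.ker (a x).toLinearMap),
    (∀ u v, B u v = extD a x u v) ∧ Module.finrank ℝ (LinearMap.range B) = 2
  g : ∀ x : X, TangentSpace (𝓡 4) x →L[ℝ] TangentSpace (𝓡 4) x →L[ℝ] ℝ
  smooth_g : ContMDiff (𝓡 4) ((𝓡 4).prod 𝓘(ℝ, E4 →L[ℝ] E4 →L[ℝ] ℝ)) ∞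
    (fun x => Bundle.TotalSpace.mk' (E4 →L[ℝ] E4 →L[ℝ] ℝ) x (g x))
  symm_g : ∀ x u v, g x u v = g x v u
  pos_g : ∀ x v, a x v = 0 → v ≠ 0 → 0 < g x v v

namespace QCStructure

variable {X : Type*} [TopologicalSpace X] [ChartedSpace E4 X] [IsManifold (𝓡 4) ∞ X]
  (S : QCStructure X)

/-- The distribution `E = ker a`. -/
def E (x : X) : Submodule ℝ (TangentSpace (𝓡 4) x) := LinearMap.ker (S.a x).toLinearMap

/-- The characteristic line `L^E = ker (a ∧ da)`. -/
def L (x : X) : Set (TangentSpace (𝓡 4) x) :=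
  {v | ∀ u w, S.a x v * extD S.a x u w + S.a x u * extD S.a x w v + S.a x w * extD S.a x v u = 0}

/-- The orthogonal complement `(L^E)^⊥` of the characteristic line in `E`. -/
def Lperp (x : X) : Set (TangentSpace (𝓡 4) x) := {v | v ∈ S.E x ∧ ∀ z ∈ S.L x, S.g x v z = 0}

/-- `α` is a Popp one-form: `E = ker α` and `dα` is, up to orientation, the area form of
`(L^E)^⊥`. It is determined up to a sign (on each component of `X`). -/
structure IsPoppForm (α : ∀ x : X, CoFib X x) : Prop where
  smooth : SmoothForm α
  ker_eq : ∀ x v, α x v = 0 ↔ v ∈ S.E x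
  area : ∀ x, ∀ e ∈ S.Lperp x, ∀ e' ∈ S.Lperp x,
    S.g x e e = 1 → S.g x e' e' = 1 → S.g x e e' = 0 → |extD α x e e'| = 1

/-- `R` is the quasi-contact Reeb vector field of the Popp form `α`: `α(R) = 1`, `R` is
`dα`-orthogonal to `(L^E)^⊥`, and `R ∈ (L^E)^⊥ + [(L^E)^⊥, (L^E)^⊥]`. -/
structure IsReeb (α : ∀ x : X, CoFib X x) (R : ∀ x : X, TangentSpace (𝓡 4) x) : Prop where
  smooth : SmoothVF R
  normalized : ∀ x, α x (R x) = 1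
  orthogonal : ∀ x, ∀ e ∈ S.Lperp x, extD α x (R x) e = 0
  mem_bracket : ∀ x, R x ∈ Submodule.span ℝ
    {w : TangentSpace (𝓡 4) x | w ∈ S.Lperp x ∨ ∃ V W : ∀ y : X, TangentSpace (𝓡 4) y,
      SmoothVF V ∧ SmoothVF W ∧ (∀ y, V y ∈ S.Lperp y) ∧ (∀ y, W y ∈ S.Lperp y) ∧
      w = VectorField.mlieBracket (𝓡 4) V W x}

theorem exists_sharp (p : CoTan X) :
    ∃ v : TangentSpace (𝓡 4) p.1, v ∈ S.E p.1 ∧ ∀ e ∈ S.E p.1, S.g p.1 v e = p.2 e := by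
  let x := p.1
  have : FiniteDimensional ℝ (TangentSpace (𝓡 4) x) :=
    inferInstanceAs (FiniteDimensional ℝ E4)
  let T : S.E x →ₗ[ℝ] Module.Dual ℝ (S.E x) :=
    { toFun := fun v => (S.g x v).toLinearMap.comp (S.E x).subtype
      map_add' := fun u v => by ext; simp
      map_smul' := fun c v => by ext; simp }
  have hinj : Function.Injective T := by
    rw [← LinearMap.ker_eq_bot, LinearMap.ker_eq_bot']
    intro v hv
    by_contra hne
    have h0 : S.g x v v = 0 := by
      have := congrArg (fun l : Module.Dual ℝ (S.E x) => l v) hv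
      simpa [T] using this
    have := S.pos_g x v v.2 (fun h => hne (Subtype.ext h))
    exact absurd h0 this.ne'
  have hsurj : Function.Surjective T :=
    (LinearMap.injective_iff_surjective_of_finrank_eq_finrank
      (Subspace.dual_finrank_eq).symm).1 hinj
  obtain ⟨v, hv⟩ := hsurj (p.2.toLinearMap.comp (S.E x).subtype)
  refine ⟨v, v.2, fun e he => ?_⟩
  have := congrArg (fun l : Module.Dual ℝ (S.E x) => l ⟨e, he⟩) hv
  simpa [T] using this

/-- The vector of `E` that represents `ξ|_E` through the metric. -/
def sharp (p : CoTan X) : TangentSpace (𝓡 4) p.1 := (S.exists_sharp p).choose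

/-- The symbol `σ(x, ξ) = |ξ|_E|²` of the sub-Riemannian Laplacian (dual norm). -/
def sigma (p : CoTan X) : ℝ := S.g p.1 (S.sharp p) (S.sharp p)

/-- The square root `σ^{1/2}`. -/
def sqrtSigma (p : CoTan X) : ℝ := √(S.sigma p)

/-- The characteristic variety `Σ = {σ = 0}`, without the zero section. -/
def Char : Set (CoTan X) := {p | p.2 ≠ 0 ∧ S.sigma p = 0}

/-! ### The blowup `[T*X; Σ]` and the spherical normal bundle

At `p = (x, ξ) ∈ Σ` the normal space `N_pΣ = T_p(T*X) / T_pΣ` is `T*ₓX / Eₓ^⊥ = Eₓ^*`, which the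
metric identifies with `Eₓ`; half the Hessian of `σ`, i.e. the quadratic part of `σ` transversally
to `Σ`, then becomes the metric `g` of `Eₓ`. Normal vectors are therefore written as vectors of
`Eₓ`, and unit normal vectors as unit vectors. -/

/-- `v ∈ Eₓ` is the normal vector at `p ∈ Σ` given by the class of `w ∈ T_p(T*X)` modulo `T_pΣ`:
for each section `V` of `E` the derivative along `w` of the function `σ(V)`, which vanishes on `Σ`,
is `g(v, V)`. -/
def IsNormalClass (p : CoTan X) (w : E4 × (E4 →L[ℝ] ℝ)) (v : TangentSpace (𝓡 4) p.1) : Prop :=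
  v ∈ S.E p.1 ∧ ∀ V : ∀ x : X, TangentSpace (𝓡 4) x, SmoothVF V → (∀ x, V x ∈ S.E x) →
    dC (symb V) p w = S.g p.1 v (V p.1)

/-- The blowup `[T*X; Σ]` (over the complement of the zero section): the pairs of a covector `ξ`
and a unit vector `v ∈ E` with `ξ|_E = r ⟨v, ·⟩` and `r ≥ 0`. It is a closed submanifold with
boundary of `{(ξ, v) ∈ T*X ⊕ TX : ξ ≠ 0}`; `(x, ρ, r, v) ↦ (ρ a + r ⟨v, ·⟩, v)`, with `⟨v, ·⟩`
extended by zero to a complement of `E`, are polar coordinates, and smooth functions on it are the restrictions of smooth functions on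
`{(ξ, v) ∈ T*X ⊕ TX : ξ ≠ 0}`. -/
def Blowup : Set (CoTanSum X) :=
  {q | q.2.1 ≠ 0 ∧ q.2.2 ∈ S.E q.1 ∧ S.g q.1 q.2.2 q.2.2 = 1 ∧
    ∃ r : ℝ, 0 ≤ r ∧ ∀ e ∈ S.E q.1, q.2.1 e = r * S.g q.1 q.2.2 e}

/-- The boundary `SNΣ` of the blowup: the spherical normal bundle of `Σ`. -/
def SN : Set (CoTanSum X) := {q | q ∈ S.Blowup ∧ beta q ∈ S.Char}

/-- The inverse of the blow-down map, from `T*X ∖ Σ` to the interior of the blowup. -/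
def lift (p : CoTan X) : CoTanSum X := ⟨p.1, (p.2, (S.sqrtSigma p)⁻¹ • S.sharp p)⟩

/-- Test functions: smooth functions on `{(ξ, v) ∈ T*X ⊕ TX : ξ ≠ 0}`. -/
def TestFn (F : CoTanSum X → ℝ) : Prop :=
  ContMDiffOn IS 𝓘(ℝ, ℝ) ∞ F {q | q.2.1 ≠ 0}

/-- The derivative, at an interior point `q` of the blowup, of a function `F` on the blowup along
the Hamilton vector field `H_f`. -/
def hamLift (f : CoTan X → ℝ) (F : CoTanSum X → ℝ) (q : CoTanSum X) : ℝ :=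
  dC (F ∘ S.lift) (beta q) (ham f (beta q))

/-- The filter of interior points of the blowup tending to `q`. -/
def interiorNhds (q : CoTanSum X) : Filter (CoTanSum X) := 𝓝[S.Blowup \ S.SN] q

/-! ### The circle action on `SNΣ` -/

/-- The symplectic complement of `T_pΣ`. -/
def symplCompl (p : CoTan X) : Set (E4 × (E4 →L[ℝ] ℝ)) :=
  {w | ∀ t ∈ tangentTo IC S.Char p, omega w t = 0}

/-- The image `N₁Σ` of the symplectic complement of `TΣ` in the normal space. -/
def N1 (p : CoTan X) : Set (TangentSpace (𝓡 4) p.1) :=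
  {v | ∃ w ∈ S.symplCompl p, S.IsNormalClass p w v}

/-- The orthogonal complement `N₀Σ` of `N₁Σ` in the normal space. -/
def N0 (p : CoTan X) : Set (TangentSpace (𝓡 4) p.1) :=
  {v | v ∈ S.E p.1 ∧ ∀ u ∈ S.N1 p, S.g p.1 v u = 0}

/-- `j = (𝔍/|𝔍|) v` for the endomorphism `𝔍` of `N₁Σ` with `⟨u, 𝔍 v⟩ = ω₀(u, v)`, where `ω₀` is the
symplectic form that `ω` induces on `N₁Σ`: `j` is a positive multiple of `𝔍 v`, of the length
of `v`. -/
def IsJ (p : CoTan X) (v j : TangentSpace (𝓡 4) p.1) : Prop :=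
  j ∈ S.N1 p ∧ S.g p.1 j j = S.g p.1 v v ∧ ∃ c : ℝ, 0 < c ∧
    ∀ u ∈ S.N1 p, ∀ wu ∈ S.symplCompl p, ∀ wv ∈ S.symplCompl p,
      S.IsNormalClass p wu u → S.IsNormalClass p wv v → S.g p.1 u j = c * omega wu wv

/-- `(𝔍/|𝔍|) v`. -/
def J (p : CoTan X) (v : TangentSpace (𝓡 4) p.1) : TangentSpace (𝓡 4) p.1 :=
  Classical.epsilon (S.IsJ p v)

/-- The `N₀Σ`-component of a normal vector in `NΣ = N₀Σ ⊕ N₁Σ`. -/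
def proj0 (p : CoTan X) (v : TangentSpace (𝓡 4) p.1) : TangentSpace (𝓡 4) p.1 :=
  Classical.epsilon fun v0 => v0 ∈ S.N0 p ∧ v - v0 ∈ S.N1 p

/-- The function `|Ξ₀| = ‖π_{N₀Σ}(v)‖` on `SNΣ`. -/
def absXi (q : CoTanSum X) : ℝ :=
  √(S.g q.1 (S.proj0 (beta q) q.2.2) (S.proj0 (beta q) q.2.2))

/-- The circle action on `SNΣ`: `e^{iθ}` fixes `N₀Σ` and acts on `v₁ ∈ N₁Σ` by
`cos θ v₁ + sin θ (𝔍/|𝔍|) v₁`. -/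
def rot (θ : ℝ) (q : CoTanSum X) : CoTanSum X :=
  let v0 : TangentSpace (𝓡 4) q.1 := S.proj0 (beta q) q.2.2
  let v1 : TangentSpace (𝓡 4) q.1 := q.2.2 - v0
  let j1 : TangentSpace (𝓡 4) q.1 := S.J (beta q) v1
  ⟨q.1, (q.2.1, v0 + Real.cos θ • v1 + Real.sin θ • j1)⟩

/-- The generator `R₀ = d/dθ` of the circle action at `θ = 0`, applied to a function. -/
def rotDeriv (F : CoTanSum X → ℝ) (q : CoTanSum X) : ℝ := deriv (fun θ => F (S.rot θ q)) 0

/-! ### The Popp measure and its lift -/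

/-- A unit vector of the characteristic line (`Z` up to sign; the sign plays no role in the
density below). -/
def charUnit (x : X) : TangentSpace (𝓡 4) x :=
  Classical.epsilon fun z => z ∈ S.L x ∧ S.g x z z = 1

/-- The one-form with `Z^*(Z) = 1` that annihilates `(L^E)^⊥ ⊕ ℝR`. -/
def Zstar (α : ∀ x : X, CoFib X x) (R : ∀ x : X, TangentSpace (𝓡 4) x) (x : X)
    (u : TangentSpace (𝓡 4) x) : ℝ :=
  S.g x (S.charUnit x) (u - α x u • R x)

/-- The Popp density `|μ_Popp(u₀, u₁, u₂, u₃)|` with `μ_Popp = Z^* ∧ α ∧ dα`. -/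
def poppDensity (α : ∀ x : X, CoFib X x) (R : ∀ x : X, TangentSpace (𝓡 4) x) (x : X)
    (u : Fin 4 → TangentSpace (𝓡 4) x) : ℝ :=
  |(1 / 2 : ℝ) * ∑ s : Equiv.Perm (Fin 4), ((Equiv.Perm.sign s : ℤ) : ℝ) *
    (S.Zstar α R x (u (s 0)) * α x (u (s 1)) * extD α x (u (s 2)) (u (s 3)))|

/-- The Popp measure on the domain of the preferred chart at `c`, extended by zero: the density
integrated in the coordinates. -/
def chartPopp [MeasurableSpace X] (α : ∀ x : X, CoFib X x) (R : ∀ x : X, TangentSpace (𝓡 4) x)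
    (c : X) : Measure X :=
  (((volume : Measure E4).restrict (chartAt E4 c).target).withDensity fun y =>
    ENNReal.ofReal (S.poppDensity α R ((chartAt E4 c).symm y) fun i =>
      mfderiv (𝓡 4) (𝓡 4) (chartAt E4 c).symm y
        (EuclideanSpace.single i (1 : ℝ) : E4))).map (chartAt E4 c).symm

/-- The Popp measure on `X`: as the local measures agree on overlaps of chart domains, the global
measure is their supremum. -/
def popp [MeasurableSpace X] (α : ∀ x : X, CoFib X x) (R : ∀ x : X, TangentSpace (𝓡 4) x) :
    Measure X :=
  ⨆ c : X, S.chartPopp α R c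

/-- The integral of a function `G` that is constant on circle orbits over the fibre `[-1, 1]` of
`SNΣ / S¹ → Σ` at `p`, for the measure `(1 - Ξ₀²) dΞ₀`: the orbit with coordinate `Ξ₀ = t` is the
one of `t n₀ + √(1 - t²) n₁`, for unit vectors `n₀ ∈ N₀Σ` and `n₁ ∈ N₁Σ`. -/
def fibreIntegral (p : CoTan X) (G : CoTanSum X → ℝ) : ℝ :=
  let n0 : TangentSpace (𝓡 4) p.1 := Classical.epsilon fun n => n ∈ S.N0 p ∧ S.g p.1 n n = 1
  let n1 : TangentSpace (𝓡 4) p.1 := Classical.epsilon fun n => n ∈ S.N1 p ∧ S.g p.1 n n = 1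
  ∫ t in (-1 : ℝ)..1, G ⟨p.1, (p.2, t • n0 + √(1 - t ^ 2) • n1)⟩ * (1 - t ^ 2)

/-! ### Vector fields on `SNΣ` -/

/-- The derivative of a function along a field of tangent vectors of `T*X ⊕ TX`. -/
def derivAlong (Y : ∀ q : CoTanSum X, TangentSpace IS q) (F : CoTanSum X → ℝ)
    (q : CoTanSum X) : ℝ :=
  mfderiv IS 𝓘(ℝ, ℝ) F q (Y q)

/-- The projection `(π ∘ β)_* Y` of a tangent vector field to the base `X`. -/
def pushBase (Y : ∀ q : CoTanSum X, TangentSpace IS q) (q : CoTanSum X) : TangentSpace (𝓡 4) q.1 :=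
  mfderiv IS (𝓡 4) (fun q' : CoTanSum X => q'.1) q (Y q)

/-- `Y` restricts to a smooth vector field on the manifold `SNΣ`. -/
structure IsSmoothFieldSN (Y : ∀ q : CoTanSum X, TangentSpace IS q) : Prop where
  smooth : ContMDiffOn IS IS.tangent ∞ (fun q => (⟨q, Y q⟩ : TangentBundle IS (CoTanSum X))) S.SN
  tangent : ∀ q ∈ S.SN, Y q ∈ tangentTo IS S.SN q

/-- `Y` is homogeneous of degree zero, i.e. invariant under the dilations of `SNΣ`: it is a vector
field on the quotient `SNS^*Σ = SNΣ / ℝ₊`. -/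
def IsHomogeneousField (Y : ∀ q : CoTanSum X, TangentSpace IS q) : Prop :=
  ∀ q ∈ S.SN, ∀ c : ℝ, 0 < c → mfderiv IS IS (dilS c) q (Y q) = Y (dilS c q)

/-- The Hamilton vector field of `Ω` extends to the boundary of the blowup and restricts there to
the rotational vector field `R₀`. -/
def HamRestrictsToRotation (Ω : CoTan X → ℝ) : Prop :=
  ∀ F, TestFn F → ∀ q ∈ S.SN, Tendsto (S.hamLift Ω F) (S.interiorNhds q) (𝓝 (S.rotDeriv F q))

/-- The expansion `H_{σ^{1/2}} = (|σ(R)| / σ^{1/2}) H_Ω + Y + o(1)` at the boundary of the blowup: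
each smooth function on the blowup (in particular each coordinate), differentiated along
`H_{σ^{1/2}} - (|σ(R)| / σ^{1/2}) H_Ω`, tends at each boundary point to its derivative
along `Y`. -/
def HasSingularExpansion (R : ∀ x : X, TangentSpace (𝓡 4) x) (Ω : CoTan X → ℝ)
    (Y : ∀ q : CoTanSum X, TangentSpace IS q) : Prop :=
  ∀ F, TestFn F → ∀ q ∈ S.SN,
    Tendsto (fun q' => S.hamLift S.sqrtSigma F q' -
        |symb R (beta q')| / S.sqrtSigma (beta q') * S.hamLift Ω F q')
      (S.interiorNhds q) (𝓝 (derivAlong Y F q))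

/-- `F` is invariant under the circle action on `SNΣ`. -/
def CircleInvariant (F : CoTanSum X → ℝ) : Prop := ∀ q ∈ S.SN, ∀ θ : ℝ, F (S.rot θ q) = F q

/-- `F` is invariant under the dilations of `SNΣ`. -/
def DilInvariant (F : CoTanSum X → ℝ) : Prop := ∀ q ∈ S.SN, ∀ c : ℝ, 0 < c → F (dilS c q) = F q

/-- `Y` induces a vector field `[Y]` on the quotient by the circle action: it maps invariant
functions to invariant functions. -/
def DescendsToQuotient (Y : ∀ q : CoTanSum X, TangentSpace IS q) : Prop :=
  ∀ F, TestFn F → S.CircleInvariant F → S.CircleInvariant (derivAlong Y F)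

/-- `L_{[Y]} μ = 0` on `SNS^*Σ / S¹` for the lift `μ = (1 - Ξ₀²) dΞ₀ ∧ μ_Popp` of the Popp measure:
`∫ [Y]F dμ = 0` for each smooth function `F` on the compact quotient, that is, for each smooth
function on `SNΣ` that is invariant under dilations and rotations. Here
`SNS^*Σ / S¹ → S^*Σ = X₊ ∪ X₋` with `X_± = {(x, ± α(x))}`. -/
def PreservesLiftedPopp [MeasurableSpace X] (α : ∀ x : X, CoFib X x)
    (R : ∀ x : X, TangentSpace (𝓡 4) x) (Y : ∀ q : CoTanSum X, TangentSpace IS q) : Prop :=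
  ∀ F, TestFn F → S.CircleInvariant F → S.DilInvariant F → ∀ s : ℝ, s = 1 ∨ s = -1 →
    Integrable (fun x => S.fibreIntegral ⟨x, s • α x⟩ (derivAlong Y F)) (S.popp α R) ∧
    (∫ x, S.fibreIntegral ⟨x, s • α x⟩ (derivAlong Y F) ∂(S.popp α R)) = 0

end QCStructure

end

open QuasiContact

/-! Everything is computed in a local frame `Z, e₁, e₂, R` adapted to the structure (`AdaptedFrame`,
numbered 0 to 3), with `[e_j, e_k] = ∑ c_{jk}^l e_l`. Let `h₀, h₁, h₂` be the symbols of `Z, e₁, e₂`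
and `ρ` that of `R`. Then `σ = h₀² + h₁² + h₂²`, `Σ = {h = 0}`, and `h = r v` with `|v| = 1` are
polar coordinates on the blowup. Since `{σ(V), σ(W)} = σ([V, W])`, the structure functions determine
all Hamilton fields. The `R`-components of the brackets are `c_{12}^3 = -1` and `c_{01}^3 = c_{02}^3
= 0` (`structFn_three_values`), so on `Σ` one has `{h₁, h₂} = -ρ` while `h₀` commutes with `h₁` and
`h₂`: transversally there is a harmonic oscillator in `(h₁, h₂)` and a free direction `h₀`.

Therefore the Hamilton field of `(h₁² + h₂²) / (2ρ)` tends to the unit speed rotation of `(v₁, v₂)`,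
and the factor `sign ρ` turns it into `R₀` (`tendsto_ham_local`, `J_eq`). As `H_{σ^{1/2}} = ∑ v_i
H_{h_i}`, subtracting `ρ / r` times this field cancels `v₁ H_{h₁} + v₂ H_{h₂}` and leaves `v₀
H_{h₀}` plus terms of order `r` (`sub_blowH`). The limit exists but is not yet rotation invariant. A
first normal form step repairs this: a cubic form in `h` divided by `ρ²` is added to `Ω`, and its
bracket with the oscillator removes the part of the limit that is not equivariant (`cubicCoeff`,
`tendsto_singular`). The remaining field moves the base point with velocity `v₀ Z`, has `v₀' = -(1 -
v₀²) b / 2` and `ρ' = v₀ b ρ` with `b = c_{03}^3`, and otherwise scales and rotates `(v₁, v₂)`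
(`fieldVec`).

The Jacobi identity for `Z, e₁, e₂`, evaluated by `α`, gives `c_{01}^1 + c_{02}^2 = b`
(`structFn_trace`). It fixes the coefficient of the radial part of the limit, and it yields the
invariance of the measure: the Popp density is the one dual to the frame (`poppDensity_eq`), so the
divergence of `Z` is `-∑ c_{0k}^k = -2b` (`integral_divergence`). On the quotient the field is `Ξ₀ Z
- (b/2)(1 - Ξ₀²) ∂_{Ξ₀}`. The first term has divergence `-2bΞ₀` for the Popp measure, the second
`+2bΞ₀` for `(1 - Ξ₀²) dΞ₀` (`integral_meridField`), and the sum vanishes.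

The local objects are glued by a partition of unity `χ_i`. The leading term of `Ω` does not depend
on the frame, so the derivatives of the cutoffs only meet the cubic terms, which are of order `r³`
and disappear in both limits (`dC_glueFn`, `tendsto_ham_cutoff`). In the integral they contribute `∑
dχ_i(Z)` times a moment of the test function, which is zero because `∑ χ_i = 1`
(`sum_moment_eq_zero`). -/

noncomputable section

namespace QuasiContact

/-! ### Derivatives in the preferred charts of a vector bundle -/

section Bundle
variable {EB HB B F : Type*} [NormedAddCommGroup EB] [NormedSpace ℝ EB] [TopologicalSpace HB]
  {IB : ModelWithCorners ℝ EB HB} [TopologicalSpace B] [ChartedSpace HB B] [IsManifold IB 1 B]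
  [NormedAddCommGroup F] [NormedSpace ℝ F] {V : B → Type*} [TopologicalSpace (Bundle.TotalSpace F V)]
  [∀ b, AddCommGroup (V b)] [∀ b, Module ℝ (V b)] [∀ b, TopologicalSpace (V b)]
  [FiberBundle F V] [VectorBundle ℝ F V] [ContMDiffVectorBundle 1 F V IB]

/-- The fibre component of the preferred chart has the fibre projection as its derivative. -/
theorem hasMFDerivAt_trivializationAt_snd (p : Bundle.TotalSpace F V) :
    HasMFDerivAt (IB.prod 𝓘(ℝ, F)) 𝓘(ℝ, F) (fun q => (trivializationAt F V p.1 q).2) p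
      (ContinuousLinearMap.snd ℝ EB F) := by
  have h1 := (mdifferentiableAt_extChartAt (I := IB.prod 𝓘(ℝ, F))
    (mem_chart_source _ p)).hasMFDerivAt
  rw [mfderiv_extChartAt_self] at h1
  have h2 := ((ContinuousLinearMap.snd ℝ EB F).hasMFDerivAt
    (x := extChartAt (IB.prod 𝓘(ℝ, F)) p p)).comp p h1
  refine h2.congr_of_eventuallyEq (Eventually.of_forall fun q => ?_)
  rw [FiberBundle.extChartAt]
  rfl

/-- In preferred charts the bundle projection has the base projection as its derivative. -/
theorem hasMFDerivAt_proj (p : Bundle.TotalSpace F V) :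
    HasMFDerivAt (IB.prod 𝓘(ℝ, F)) IB (Bundle.TotalSpace.proj : Bundle.TotalSpace F V → B) p
      (ContinuousLinearMap.fst ℝ EB F) := by
  have h1 := (mdifferentiableAt_extChartAt (I := IB.prod 𝓘(ℝ, F))
    (mem_chart_source _ p)).hasMFDerivAt
  rw [mfderiv_extChartAt_self] at h1
  have h2 := ((ContinuousLinearMap.fst ℝ EB F).hasMFDerivAt
    (x := extChartAt (IB.prod 𝓘(ℝ, F)) p p)).comp p h1
  have h3 : MDifferentiableAt (IB.prod 𝓘(ℝ, F)) IB
      (Bundle.TotalSpace.proj : Bundle.TotalSpace F V → B) p :=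
    Bundle.mdifferentiableAt_proj V
  have h4 := (mdifferentiableAt_extChartAt (I := IB) (mem_chart_source _ p.1)).hasMFDerivAt
  rw [mfderiv_extChartAt_self] at h4
  have h5 := h4.comp p h3.hasMFDerivAt
  have h6 : HasMFDerivAt (IB.prod 𝓘(ℝ, F)) 𝓘(ℝ, EB)
      (extChartAt IB p.1 ∘ Bundle.TotalSpace.proj) p (ContinuousLinearMap.fst ℝ EB F) := by
    refine h2.congr_of_eventuallyEq ?_
    have : (trivializationAt F V p.1).source ∈ 𝓝 p :=
      (trivializationAt F V p.1).open_source.mem_nhds (by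
        rw [Bundle.Trivialization.mem_source]; exact FiberBundle.mem_baseSet_trivializationAt' p.1)
    filter_upwards [this] with q hq
    rw [FiberBundle.extChartAt]
    change extChartAt IB p.1 q.1 = extChartAt IB p.1 (trivializationAt F V p.1 q).1
    rw [(trivializationAt F V p.1).coe_fst hq]
  have h7 := hasMFDerivAt_unique h5 h6
  have h8 := h3.hasMFDerivAt
  have h9 : mfderiv (IB.prod 𝓘(ℝ, F)) IB (Bundle.TotalSpace.proj : Bundle.TotalSpace F V → B) p
      = ContinuousLinearMap.fst ℝ EB F := h7
  rwa [h9] at h8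
end Bundle

variable {X : Type*} [TopologicalSpace X] [ChartedSpace E4 X] [IsManifold (𝓡 4) ∞ X]

-- The trivialisation of the cotangent bundle is contragredient to that of the tangent bundle over
-- the same chart, so the pairing may be computed from the two fibre coordinates.
open ContinuousLinearMap in
theorem trivializationAt_pairing (x : X) (q : CoTan X) (v : TangentSpace (𝓡 4) q.1)
    (hq : q.1 ∈ (chartAt E4 x).source) :
    (trivializationAt (E4 →L[ℝ] ℝ) (CoFib X) x q).2
      (trivializationAt E4 (TangentSpace (𝓡 4) : X → Type _) x ⟨q.1, v⟩).2 = q.2 v := by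
  have h := hom_trivializationAt_apply (E₁ := (TangentSpace (𝓡 4) : X → Type _)) (F₁ := E4)
    (F₂ := ℝ) (E₂ := Bundle.Trivial X ℝ) (σ := RingHom.id ℝ) x q
  rw [show (trivializationAt (E4 →L[ℝ] ℝ) (CoFib X) x q) = _ from h]
  have hb : q.1 ∈ (trivializationAt E4 (TangentSpace (𝓡 4) : X → Type _) x).baseSet := hq
  change inCoordinates E4 (TangentSpace (𝓡 4) : X → Type _) ℝ (Bundle.Trivial X ℝ) x q.1 x q.1 q.2
    _ = q.2 v
  rw [inCoordinates_eq hb (by trivial)]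
  have h1 : (trivializationAt E4 (TangentSpace (𝓡 4) : X → Type _) x ⟨q.1, v⟩).2 =
    (trivializationAt E4 (TangentSpace (𝓡 4) : X → Type _) x).continuousLinearEquivAt ℝ q.1 hb v := rfl
  rw [h1]
  simp only [comp_apply, ContinuousLinearEquiv.coe_coe, ContinuousLinearEquiv.symm_apply_apply]
  rfl
end QuasiContact

/-! ### Vector fields, one-forms and Lie brackets in the preferred chart -/

namespace QuasiContact
variable {X : Type*} [TopologicalSpace X] [ChartedSpace E4 X] [IsManifold (𝓡 4) ∞ X]

/-- Differentiability of a vector field at a point. -/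
abbrev VFDiffAt (V : ∀ x : X, TangentSpace (𝓡 4) x) (x : X) : Prop :=
  MDifferentiableAt (𝓡 4) (𝓡 4).tangent (fun x => (⟨x, V x⟩ : TangentBundle (𝓡 4) X)) x

/-- Smoothness of a vector field at a point. -/
abbrev VFSmoothAt (V : ∀ x : X, TangentSpace (𝓡 4) x) (x : X) : Prop :=
  ContMDiffAt (𝓡 4) (𝓡 4).tangent ∞ (fun x => (⟨x, V x⟩ : TangentBundle (𝓡 4) X)) x

theorem VFSmoothAt.diffAt {V : ∀ x : X, TangentSpace (𝓡 4) x} {x : X} (h : VFSmoothAt V x) :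
    VFDiffAt V x := h.mdifferentiableAt (by simp)

/-- The derivative of a vector field in the preferred chart at the point. -/
def vfDeriv (V : ∀ x : X, TangentSpace (𝓡 4) x) (x : X) : E4 →L[ℝ] E4 :=
  (ContinuousLinearMap.snd ℝ E4 E4).comp
    (mfderiv (𝓡 4) (𝓡 4).tangent (fun x => (⟨x, V x⟩ : TangentBundle (𝓡 4) X)) x)

/-- The derivative of a one-form in the preferred chart at the point. -/
def formDeriv (α : ∀ x : X, CoFib X x) (x : X) : E4 →L[ℝ] (E4 →L[ℝ] ℝ) :=
  (ContinuousLinearMap.snd ℝ E4 (E4 →L[ℝ] ℝ)).comp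
    (mfderiv (𝓡 4) IC (fun x => (⟨x, α x⟩ : CoTan X)) x)

theorem extD_eq (α : ∀ x : X, CoFib X x) (x : X) (u v : TangentSpace (𝓡 4) x) :
    extD α x u v = formDeriv α x u v - formDeriv α x v u := rfl

theorem hasMFDerivAt_vf {V : ∀ x : X, TangentSpace (𝓡 4) x} {x : X} (hV : VFDiffAt V x) :
    HasMFDerivAt (𝓡 4) 𝓘(ℝ, E4)
      (fun y => (trivializationAt E4 (TangentSpace (𝓡 4) : X → Type _) x ⟨y, V y⟩).2) x
      (vfDeriv V x) := by
  have h1 := hasMFDerivAt_trivializationAt_snd (IB := 𝓡 4)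
    (V := (TangentSpace (𝓡 4) : X → Type _)) (⟨x, V x⟩ : TangentBundle (𝓡 4) X)
  exact HasMFDerivAt.comp (g := fun q : TangentBundle (𝓡 4) X =>
    (trivializationAt E4 (TangentSpace (𝓡 4) : X → Type _) x q).2)
    (f := fun y => (⟨y, V y⟩ : TangentBundle (𝓡 4) X)) x h1 hV.hasMFDerivAt

theorem continuousLinearMapAt_tangent {x y : X} (hy : y ∈ (chartAt E4 x).source)
    (v : TangentSpace (𝓡 4) y) :
    (trivializationAt E4 (TangentSpace (𝓡 4) : X → Type _) x).continuousLinearMapAt ℝ y v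
      = (trivializationAt E4 (TangentSpace (𝓡 4) : X → Type _) x ⟨y, v⟩).2 :=
  congrFun (Bundle.Trivialization.coe_linearMapAt_of_mem (R := ℝ)
    (trivializationAt E4 (TangentSpace (𝓡 4) : X → Type _) x) (b := y) hy) v

theorem trivializationAt_self (x : X) (v : TangentSpace (𝓡 4) x) :
    (trivializationAt E4 (TangentSpace (𝓡 4) : X → Type _) x ⟨x, v⟩).2 = v := by
  have h := TangentBundle.continuousLinearMapAt_trivializationAt (I := 𝓡 4)
    (mem_chart_source E4 x)
  rw [mfderiv_extChartAt_self] at h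
  have h2 := congrArg (fun l : TangentSpace (𝓡 4) x →L[ℝ] E4 => l v) h
  have h3 := continuousLinearMapAt_tangent (mem_chart_source E4 x) v
  exact h3.symm.trans h2

theorem trivializationAt_coTan_self (p : CoTan X) :
    (trivializationAt (E4 →L[ℝ] ℝ) (CoFib X) p.1 p).2 = (p.2 : E4 →L[ℝ] ℝ) := by
  refine ContinuousLinearMap.ext fun v => ?_
  have h := trivializationAt_pairing p.1 p v (mem_chart_source E4 p.1)
  have h2 := trivializationAt_self p.1 v
  exact (congrArg (trivializationAt (E4 →L[ℝ] ℝ) (CoFib X) p.1 p).2 h2).symm.trans h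

/-- The differential of `σ(V)`. -/
def symbDeriv (V : ∀ x : X, TangentSpace (𝓡 4) x) (p : CoTan X) : E4 × (E4 →L[ℝ] ℝ) →L[ℝ] ℝ :=
  (ContinuousLinearMap.apply ℝ ℝ (show E4 from V p.1)).comp
    (ContinuousLinearMap.snd ℝ E4 (E4 →L[ℝ] ℝ)) +
    ((show E4 →L[ℝ] ℝ from p.2).comp (vfDeriv V p.1)).comp
      (ContinuousLinearMap.fst ℝ E4 (E4 →L[ℝ] ℝ))

theorem symbDeriv_apply (V : ∀ x : X, TangentSpace (𝓡 4) x) (p : CoTan X)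
    (w : E4 × (E4 →L[ℝ] ℝ)) : symbDeriv V p w = w.2 (V p.1) + p.2 (vfDeriv V p.1 w.1) := rfl

theorem hasMFDerivAt_pairing {E H M F : Type*} [NormedAddCommGroup E] [NormedSpace ℝ E]
    [TopologicalSpace H] {I : ModelWithCorners ℝ E H} [TopologicalSpace M] [ChartedSpace H M]
    [NormedAddCommGroup F] [NormedSpace ℝ F] {f : M → F →L[ℝ] ℝ} {g : M → F} {x : M}
    {f' : E →L[ℝ] F →L[ℝ] ℝ} {g' : E →L[ℝ] F}
    (hf : HasMFDerivAt I 𝓘(ℝ, F →L[ℝ] ℝ) f x f') (hg : HasMFDerivAt I 𝓘(ℝ, F) g x g') :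
    HasMFDerivAt I 𝓘(ℝ, ℝ) (fun y => f y (g y)) x
      ((ContinuousLinearMap.apply ℝ ℝ (g x)).comp f' + (f x).comp g') := by
  refine ⟨?_, ?_⟩
  · exact (isBoundedBilinearMap_apply (𝕜 := ℝ) (E := F) (F := ℝ)).continuous.continuousAt.comp
      (hf.1.prodMk hg.1)
  · have := hf.2.clm_apply hg.2
    simp only [writtenInExtChartAt, extChartAt_model_space_eq_id, PartialEquiv.refl_coe,
      Function.id_comp, Function.comp_apply, extChartAt_to_inv] at this ⊢
    refine this.congr_fderiv ?_
    ext w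
    simp [add_comm]

theorem hasMFDerivAt_symb {V : ∀ x : X, TangentSpace (𝓡 4) x} {p : CoTan X}
    (hV : VFDiffAt V p.1) :
    HasMFDerivAt IC 𝓘(ℝ, ℝ) (symb V) p (symbDeriv V p) := by
  have h1 := hasMFDerivAt_trivializationAt_snd (IB := 𝓡 4) (V := CoFib X) p
  have h2 := HasMFDerivAt.comp (f := (Bundle.TotalSpace.proj : CoTan X → X)) p
    (hasMFDerivAt_vf hV) (hasMFDerivAt_proj (IB := 𝓡 4) (V := CoFib X) p)
  have h3 := hasMFDerivAt_pairing h1 h2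
  have h5 : HasMFDerivAt IC 𝓘(ℝ, ℝ) (symb V) p _ := h3.congr_of_eventuallyEq (by
    have : (Bundle.TotalSpace.proj ⁻¹' (chartAt E4 p.1).source : Set (CoTan X)) ∈ 𝓝 p :=
      (FiberBundle.continuous_proj (E4 →L[ℝ] ℝ) (CoFib X)).continuousAt.preimage_mem_nhds
        ((chartAt E4 p.1).open_source.mem_nhds (mem_chart_source E4 p.1))
    filter_upwards [this] with q hq
    exact (trivializationAt_pairing p.1 q (V q.1) hq).symm)
  have h6 : symbDeriv V p = ((ContinuousLinearMap.apply ℝ ℝ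
      ((trivializationAt E4 (TangentSpace (𝓡 4) : X → Type _) p.1 ⟨p.1, V p.1⟩).2)).comp
        (ContinuousLinearMap.snd ℝ E4 (E4 →L[ℝ] ℝ)) +
      ((trivializationAt (E4 →L[ℝ] ℝ) (CoFib X) p.1 p).2).comp ((vfDeriv V p.1).comp
        (ContinuousLinearMap.fst ℝ E4 (E4 →L[ℝ] ℝ)))) := by
    refine ContinuousLinearMap.ext fun w => ?_
    have e1 := trivializationAt_self p.1 (V p.1)
    have e2 := trivializationAt_coTan_self p
    change (w.2 : E4 →L[ℝ] ℝ) (show E4 from V p.1) + (show E4 →L[ℝ] ℝ from p.2) _ =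
      w.2 (trivializationAt E4 (TangentSpace (𝓡 4) : X → Type _) p.1 ⟨p.1, V p.1⟩).2 +
      (trivializationAt (E4 →L[ℝ] ℝ) (CoFib X) p.1 p).2 _
    exact congrArg₂ (· + ·) (congrArg w.2 e1.symm)
      (congrArg (fun l : E4 →L[ℝ] ℝ => l (vfDeriv V p.1 w.1)) e2.symm)
  rw [h6]
  exact h5

theorem dC_symb {V : ∀ x : X, TangentSpace (𝓡 4) x} {p : CoTan X} (hV : VFDiffAt V p.1)
    (w : E4 × (E4 →L[ℝ] ℝ)) : dC (symb V) p w = w.2 (V p.1) + p.2 (vfDeriv V p.1 w.1) := by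
  rw [dC, (hasMFDerivAt_symb hV).mfderiv]; rfl

/-- The pullback of `V` by the inverse chart agrees near the point with the fibre coordinate of `V`
in the tangent trivialisation, because that trivialisation is the derivative of the chart. Manifold
Lie brackets are defined through this pullback. -/
theorem hasFDerivAt_mpullback_chart_symm {V : ∀ x : X, TangentSpace (𝓡 4) x} {x : X}
    (hV : VFDiffAt V x) :
    HasFDerivAt (fun y : E4 => (show E4 from
      VectorField.mpullbackWithin 𝓘(ℝ, E4) (𝓡 4) (extChartAt (𝓡 4) x).symm V (range (𝓡 4)) y))
      (vfDeriv V x) (extChartAt (𝓡 4) x x) := by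
  have h2 := (hasMFDerivAt_vf hV).2
  simp only [writtenInExtChartAt, ModelWithCorners.range_eq_univ] at h2
  have h3 := hasFDerivWithinAt_univ.1 h2
  refine h3.congr_of_eventuallyEq ?_
  have : (extChartAt (𝓡 4) x).target ∈ 𝓝 (extChartAt (𝓡 4) x x) := extChartAt_target_mem_nhds x
  filter_upwards [this] with y hy
  have e0 := mfderivWithin_extChartAt_symm_comp_mfderiv_extChartAt hy
  have e0' := mfderiv_extChartAt_comp_mfderivWithin_extChartAt_symm hy
  have e1 := ContinuousLinearMap.inverse_eq e0 e0'
  have e2 := TangentBundle.continuousLinearMapAt_trivializationAt (I := 𝓡 4) (x₀ := x)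
    (x := (extChartAt (𝓡 4) x).symm y) (by
      simpa using (extChartAt (𝓡 4) x).map_target hy)
  have e3 := continuousLinearMapAt_tangent (x := x) (y := (extChartAt (𝓡 4) x).symm y) (by
      simpa using (extChartAt (𝓡 4) x).map_target hy) (V ((extChartAt (𝓡 4) x).symm y))
  refine Eq.trans ?_ e3
  rw [e2]
  exact congrArg (fun l => l (V ((extChartAt (𝓡 4) x).symm y))) e1

/-- The derivative at `x` of the preferred chart at `x` is the identity of the model space, so the
bracket of the pulled back fields is already the bracket on the manifold. -/
theorem mlieBracket_eq {V W : ∀ x : X, TangentSpace (𝓡 4) x} {x : X} (hV : VFDiffAt V x)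
    (hW : VFDiffAt W x) :
    VectorField.mlieBracket (𝓡 4) V W x = vfDeriv W x (V x) - vfDeriv V x (W x) := by
  have hV' := hasFDerivAt_mpullback_chart_symm hV
  have hW' := hasFDerivAt_mpullback_chart_symm hW
  have hv : ∀ V : ∀ x : X, TangentSpace (𝓡 4) x, (VectorField.mpullbackWithin 𝓘(ℝ, E4) (𝓡 4)
      (extChartAt (𝓡 4) x).symm V (range (𝓡 4)) (extChartAt (𝓡 4) x x)) = V x := by
    intro V
    have := mfderivWithin_extChartAt_symm_inverse_apply (I := 𝓡 4) (x := x) (V x)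
    have e : (extChartAt (𝓡 4) x).symm (extChartAt (𝓡 4) x x) = x :=
      extChartAt_to_inv x
    refine Eq.trans ?_ this
    change (_ : E4 →L[ℝ] E4) (show E4 from V ((extChartAt (𝓡 4) x).symm (extChartAt (𝓡 4) x x))) =
      (_ : E4 →L[ℝ] E4) (show E4 from V x)
    congr 1
    exact congrArg (fun y => (show E4 from V y)) e
  have h0 : VectorField.mlieBracket (𝓡 4) V W x = (mfderiv (𝓡 4) 𝓘(ℝ, E4) (extChartAt (𝓡 4) x)
      x).inverse
    ((VectorField.lieBracketWithin ℝ
      (VectorField.mpullbackWithin 𝓘(ℝ, E4) (𝓡 4) (extChartAt (𝓡 4) x).symm V (range (𝓡 4)))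
      (VectorField.mpullbackWithin 𝓘(ℝ, E4) (𝓡 4) (extChartAt (𝓡 4) x).symm W (range (𝓡 4)))
      ((extChartAt (𝓡 4) x).symm ⁻¹' univ ∩ range (𝓡 4))) ((extChartAt (𝓡 4) x x))) := rfl
  have h1 : (mfderiv (𝓡 4) 𝓘(ℝ, E4) (extChartAt (𝓡 4) x) x).inverse =
      ContinuousLinearMap.id ℝ E4 := by
    rw [mfderiv_extChartAt_self]; exact ContinuousLinearMap.inverse_id
  rw [h0, h1]
  have h2 : (extChartAt (𝓡 4) x).symm ⁻¹' univ ∩ range (𝓡 4) = univ := by simp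
  rw [h2]
  have h3 := congrFun (VectorField.lieBracketWithin_univ (𝕜 := ℝ)
    (V := fun y : E4 => (show E4 from VectorField.mpullbackWithin 𝓘(ℝ, E4) (𝓡 4)
      (extChartAt (𝓡 4) x).symm V (range (𝓡 4)) y))
    (W := fun y : E4 => (show E4 from VectorField.mpullbackWithin 𝓘(ℝ, E4) (𝓡 4)
      (extChartAt (𝓡 4) x).symm W (range (𝓡 4)) y))) (extChartAt (𝓡 4) x x)
  refine Eq.trans h3 ?_
  have a1 := congrArg (fun l : E4 →L[ℝ] E4 => l (V x)) hW'.fderiv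
  have a2 := congrArg (fun l : E4 →L[ℝ] E4 => l (W x)) hV'.fderiv
  refine Eq.trans ?_ (congrArg₂ (fun a b : E4 => a - b) a1 a2)
  change fderiv ℝ _ _ _ - fderiv ℝ _ _ _ = fderiv ℝ _ _ _ - fderiv ℝ _ _ _
  exact congrArg₂ (fun a b : E4 => a - b) (congrArg _ (hv V)) (congrArg _ (hv W))
end QuasiContact

/-! ### Cartan's formula for one-forms -/

namespace QuasiContact

/-- The directional derivative of a smooth function depends smoothly on the tangent vector. -/
theorem contMDiffOn_mfderiv_apply {E H M : Type*} [NormedAddCommGroup E] [NormedSpace ℝ E]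
    [TopologicalSpace H] {I : ModelWithCorners ℝ E H} [TopologicalSpace M] [ChartedSpace H M]
    [IsManifold I ∞ M] {G : M → ℝ} {O : Set M} (hO : IsOpen O)
    (hG : ContMDiffOn I 𝓘(ℝ, ℝ) ∞ G O) :
    ContMDiffOn I.tangent 𝓘(ℝ, ℝ) ∞
      (fun w : TangentBundle I M => (mfderiv I 𝓘(ℝ, ℝ) G w.1 w.2 : ℝ))
      (Bundle.TotalSpace.proj ⁻¹' O) := by
  have : IsManifold I 1 M := IsManifold.of_le (n := ∞) (by simp)
  have h := hG.contMDiffOn_tangentMapWithin (m := ∞) (by simp) hO.uniqueMDiffOn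
  have h2 := (contMDiff_snd_tangentBundle_modelSpace ℝ 𝓘(ℝ, ℝ) (n := ∞)).comp_contMDiffOn h
  refine h2.congr fun w hw => ?_
  simp only [Function.comp, tangentMapWithin]
  rw [mfderivWithin_of_isOpen hO hw]

variable {X : Type*} [TopologicalSpace X] [ChartedSpace E4 X] [IsManifold (𝓡 4) ∞ X]

/-- The differential of a function on `X`. -/
def dX (f : X → ℝ) (x : X) : E4 →L[ℝ] ℝ := mfderiv (𝓡 4) 𝓘(ℝ, ℝ) f x

/-- Smoothness of a one-form at a point. -/
abbrev FormSmoothAt (α : ∀ x : X, CoFib X x) (x : X) : Prop :=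
  ContMDiffAt (𝓡 4) IC ∞ (fun x => (⟨x, α x⟩ : CoTan X)) x

theorem FormSmoothAt.diffAt {α : ∀ x : X, CoFib X x} {x : X} (h : FormSmoothAt α x) :
    MDifferentiableAt (𝓡 4) IC (fun x => (⟨x, α x⟩ : CoTan X)) x :=
  h.mdifferentiableAt (by simp)

theorem hasMFDerivAt_form {α : ∀ x : X, CoFib X x} {x : X}
    (hα : MDifferentiableAt (𝓡 4) IC (fun x => (⟨x, α x⟩ : CoTan X)) x) :
    HasMFDerivAt (𝓡 4) 𝓘(ℝ, E4 →L[ℝ] ℝ)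
      (fun y => (trivializationAt (E4 →L[ℝ] ℝ) (CoFib X) x ⟨y, α y⟩).2) x (formDeriv α x) := by
  have h1 := hasMFDerivAt_trivializationAt_snd (IB := 𝓡 4) (V := CoFib X) (⟨x, α x⟩ : CoTan X)
  exact HasMFDerivAt.comp (g := fun q : CoTan X =>
    (trivializationAt (E4 →L[ℝ] ℝ) (CoFib X) x q).2)
    (f := fun y => (⟨y, α y⟩ : CoTan X)) x h1 hα.hasMFDerivAt

theorem mfderiv_form_fst {α : ∀ x : X, CoFib X x} {x : X}
    (hα : MDifferentiableAt (𝓡 4) IC (fun x => (⟨x, α x⟩ : CoTan X)) x) (u : E4) :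
    (mfderiv (𝓡 4) IC (fun x => (⟨x, α x⟩ : CoTan X)) x u : E4 × (E4 →L[ℝ] ℝ)) =
      (u, formDeriv α x u) := by
  refine Prod.ext ?_ rfl
  have h1 := hasMFDerivAt_proj (IB := 𝓡 4) (V := CoFib X) (⟨x, α x⟩ : CoTan X)
  have h2 := HasMFDerivAt.comp (f := fun y => (⟨y, α y⟩ : CoTan X)) x h1 hα.hasMFDerivAt
  have h3 := hasMFDerivAt_unique h2 (hasMFDerivAt_id x)
  exact congrArg (fun l : E4 →L[ℝ] E4 => l u) h3

/-- The differential of `α(W)`. -/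
theorem hasMFDerivAt_form_vf {α : ∀ x : X, CoFib X x} {W : ∀ x : X, TangentSpace (𝓡 4) x} {x : X}
    (hα : MDifferentiableAt (𝓡 4) IC (fun x => (⟨x, α x⟩ : CoTan X)) x) (hW : VFDiffAt W x) :
    HasMFDerivAt (𝓡 4) 𝓘(ℝ, ℝ) (fun y => α y (W y)) x
      ((symbDeriv W ⟨x, α x⟩).comp (mfderiv (𝓡 4) IC (fun x => (⟨x, α x⟩ : CoTan X)) x)) :=
  HasMFDerivAt.comp (g := symb W) (f := fun y => (⟨y, α y⟩ : CoTan X)) x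
    (hasMFDerivAt_symb (p := ⟨x, α x⟩) hW) hα.hasMFDerivAt

theorem mfderiv_form_vf {α : ∀ x : X, CoFib X x} {W : ∀ x : X, TangentSpace (𝓡 4) x} {x : X}
    (hα : MDifferentiableAt (𝓡 4) IC (fun x => (⟨x, α x⟩ : CoTan X)) x) (hW : VFDiffAt W x)
    (u : E4) :
    dX (fun y => α y (W y)) x u = formDeriv α x u (W x) + α x (vfDeriv W x u) := by
  rw [dX, (hasMFDerivAt_form_vf hα hW).mfderiv]
  change symbDeriv W ⟨x, α x⟩ (mfderiv (𝓡 4) IC (fun x => (⟨x, α x⟩ : CoTan X)) x u) = _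
  rw [mfderiv_form_fst hα, symbDeriv_apply]

/-- Cartan's formula for the exterior derivative of a one-form. -/
theorem form_mlieBracket {α : ∀ x : X, CoFib X x} {V W : ∀ x : X, TangentSpace (𝓡 4) x} {x : X}
    (hα : MDifferentiableAt (𝓡 4) IC (fun x => (⟨x, α x⟩ : CoTan X)) x) (hV : VFDiffAt V x)
    (hW : VFDiffAt W x) :
    α x (VectorField.mlieBracket (𝓡 4) V W x) =
      dX (fun y => α y (W y)) x (V x) - dX (fun y => α y (V y)) x (W x) -
        extD α x (V x) (W x) := by
  rw [mlieBracket_eq hV hW]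
  refine Eq.trans ?_ (congrArg₂ (fun a b : ℝ => a - b - _) (mfderiv_form_vf hα hW (V x)).symm
    (mfderiv_form_vf hα hV (W x)).symm)
  have h := (show E4 →L[ℝ] ℝ from α x).map_sub (vfDeriv W x (V x)) (vfDeriv V x (W x))
  refine h.trans ?_
  rw [extD_eq]
  ring_nf
  rfl

/-! ### Hamilton vector fields of symbols -/

/-- The form `ω` is nondegenerate: vectors `(v, 0)` detect the fibre component, vectors `(0, ⟨v,
·⟩)` the base component. -/
theorem ham_eq_of_omega {f : CoTan X → ℝ} {p : CoTan X} {z : E4 × (E4 →L[ℝ] ℝ)}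
    (h : ∀ w, omega z w = dC f p w) : ham f p = z := by
  have h1 : ∀ w, omega (ham f p) w = omega z w := fun w => (omega_ham f p w).trans (h w).symm
  have e1 : (ham f p).2 = z.2 := by
    refine ContinuousLinearMap.ext fun v => ?_
    have := h1 (v, 0)
    simpa [omega] using this
  refine Prod.ext ?_ e1
  refine (ext_iff_inner_left ℝ).2 fun v => ?_
  have := h1 (0, innerSL ℝ v)
  simpa [omega] using this

theorem ham_symb {V : ∀ x : X, TangentSpace (𝓡 4) x} {p : CoTan X} (hV : VFDiffAt V p.1) :
    ham (symb V) p = ((show E4 from V p.1), -((show E4 →L[ℝ] ℝ from p.2).comp (vfDeriv V p.1))) := by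
  refine ham_eq_of_omega fun w => ?_
  rw [dC_symb hV]
  simp only [omega, neg_apply, sub_neg_eq_add]
  rfl

/-- `{σ(V), σ(W)} = σ([V, W])`. -/
theorem dC_symb_ham_symb {V W : ∀ x : X, TangentSpace (𝓡 4) x} {p : CoTan X}
    (hV : VFDiffAt V p.1) (hW : VFDiffAt W p.1) :
    dC (symb W) p (ham (symb V) p) = symb (VectorField.mlieBracket (𝓡 4) V W) p := by
  rw [dC_symb hW, ham_symb hV, symb, mlieBracket_eq hV hW]
  have h := (show E4 →L[ℝ] ℝ from p.2).map_sub (vfDeriv W p.1 (V p.1)) (vfDeriv V p.1 (W p.1))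
  refine Eq.trans ?_ h.symm
  exact neg_add_eq_sub (show ℝ from p.2 (vfDeriv V p.1 (W p.1))) (p.2 (vfDeriv W p.1 (V p.1)))

theorem dC_comp_proj {f : X → ℝ} {p : CoTan X} (hf : MDifferentiableAt (𝓡 4) 𝓘(ℝ, ℝ) f p.1)
    (w : E4 × (E4 →L[ℝ] ℝ)) :
    dC (fun q : CoTan X => f q.1) p w = dX f p.1 w.1 := by
  have h := HasMFDerivAt.comp (f := (Bundle.TotalSpace.proj : CoTan X → X)) p hf.hasMFDerivAt
    (hasMFDerivAt_proj (IB := 𝓡 4) (V := CoFib X) p)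
  have h2 := h.mfderiv
  exact congrArg (fun l : E4 × (E4 →L[ℝ] ℝ) →L[ℝ] ℝ => l w) h2

theorem ham_comp_proj {f : X → ℝ} {p : CoTan X} (hf : MDifferentiableAt (𝓡 4) 𝓘(ℝ, ℝ) f p.1) :
    ham (fun q : CoTan X => f q.1) p =
      ((0 : E4), -dX f p.1) := by
  refine ham_eq_of_omega fun w => ?_
  rw [dC_comp_proj hf]
  simp [omega]

/-! ### Smoothness of pairings -/

section pairing
variable {E H M : Type*} [NormedAddCommGroup E] [NormedSpace ℝ E]
    [TopologicalSpace H] {I : ModelWithCorners ℝ E H} [TopologicalSpace M] [ChartedSpace H M]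
    {b : M → X} {s : Set M} {m : M}

theorem contMDiffWithinAt_pairing {ξ : ∀ y, CoFib X (b y)} {v : ∀ y, TangentSpace (𝓡 4) (b y)}
    (hξ : ContMDiffWithinAt I IC ∞ (fun y => (⟨b y, ξ y⟩ : CoTan X)) s m)
    (hv : ContMDiffWithinAt I (𝓡 4).tangent ∞ (fun y => (⟨b y, v y⟩ : TangentBundle (𝓡 4) X)) s m) :
    ContMDiffWithinAt I 𝓘(ℝ, ℝ) ∞ (fun y => ξ y (v y)) s m := by
  have h := ContMDiffWithinAt.clm_bundle_apply (E₂ := Bundle.Trivial X ℝ) (F₂ := ℝ) (IB := 𝓡 4)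
    (b := b) (ϕ := ξ) (v := v) hξ hv
  exact (Bundle.contMDiffWithinAt_totalSpace.1 h).2

theorem contMDiffWithinAt_metric (S : QCStructure X) {v w : ∀ y, TangentSpace (𝓡 4) (b y)}
    (hv : ContMDiffWithinAt I (𝓡 4).tangent ∞ (fun y => (⟨b y, v y⟩ : TangentBundle (𝓡 4) X)) s m)
    (hw : ContMDiffWithinAt I (𝓡 4).tangent ∞ (fun y => (⟨b y, w y⟩ : TangentBundle (𝓡 4) X)) s m) :
    ContMDiffWithinAt I 𝓘(ℝ, ℝ) ∞ (fun y => S.g (b y) (v y) (w y)) s m := by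
  have hb : ContMDiffWithinAt I (𝓡 4) ∞ b s m := (Bundle.contMDiffWithinAt_totalSpace.1 hv).1
  have hg := S.smooth_g.contMDiffAt.comp_contMDiffWithinAt m hb
  have h := ContMDiffWithinAt.clm_bundle_apply₂ (E₃ := Bundle.Trivial X ℝ) (F₃ := ℝ) (IB := 𝓡 4)
    (b := b) (ψ := fun y => S.g (b y)) (v := v) (w := w) hg hv hw
  exact (Bundle.contMDiffWithinAt_totalSpace.1 h).2
end pairing

theorem contMDiff_coTan_proj : ContMDiff IC (𝓡 4) ∞ (fun p : CoTan X => p.1) :=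
  Bundle.contMDiff_proj (CoFib X)

theorem contMDiffAt_symb {V : ∀ x : X, TangentSpace (𝓡 4) x} {p : CoTan X}
    (hV : VFSmoothAt V p.1) : ContMDiffAt IC 𝓘(ℝ, ℝ) ∞ (symb V) p := by
  have h1 : ContMDiffAt IC (𝓡 4).tangent ∞
      (fun q : CoTan X => (⟨q.1, V q.1⟩ : TangentBundle (𝓡 4) X)) p :=
    ContMDiffAt.comp (g := fun x => (⟨x, V x⟩ : TangentBundle (𝓡 4) X)) p hV
      contMDiff_coTan_proj.contMDiffAt
  exact contMDiffWithinAt_pairing (b := fun q : CoTan X => q.1) (ξ := fun q => q.2)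
    (contMDiff_id (I := IC) (M := CoTan X)).contMDiffAt.contMDiffWithinAt h1.contMDiffWithinAt

theorem contMDiffAt_form_vf {α : ∀ x : X, CoFib X x} {V : ∀ x : X, TangentSpace (𝓡 4) x} {x : X}
    (hα : FormSmoothAt α x) (hV : VFSmoothAt V x) :
    ContMDiffAt (𝓡 4) 𝓘(ℝ, ℝ) ∞ (fun y => α y (V y)) x :=
  contMDiffWithinAt_pairing (b := fun y : X => y) hα.contMDiffWithinAt hV.contMDiffWithinAt

theorem contMDiffAt_metric (S : QCStructure X) {V W : ∀ x : X, TangentSpace (𝓡 4) x} {x : X}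
    (hV : VFSmoothAt V x) (hW : VFSmoothAt W x) :
    ContMDiffAt (𝓡 4) 𝓘(ℝ, ℝ) ∞ (fun y => S.g y (V y) (W y)) x :=
  contMDiffWithinAt_metric S (b := fun y : X => y) hV.contMDiffWithinAt hW.contMDiffWithinAt

theorem contMDiffAt_mfderiv_vf {f : X → ℝ} {V : ∀ x : X, TangentSpace (𝓡 4) x} {U : Set X}
    (hU : IsOpen U) {x : X} (hx : x ∈ U) (hf : ContMDiffOn (𝓡 4) 𝓘(ℝ, ℝ) ∞ f U)
    (hV : VFSmoothAt V x) :
    ContMDiffAt (𝓡 4) 𝓘(ℝ, ℝ) ∞ (fun y => dX f y (V y)) x := by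
  have h := contMDiffOn_mfderiv_apply hU hf
  have h2 := (h ⟨x, V x⟩ hx).contMDiffAt (((FiberBundle.continuous_proj E4
    (TangentSpace (𝓡 4) : X → Type _)).isOpen_preimage _ hU).mem_nhds hx)
  exact ContMDiffAt.comp (f := fun y => (⟨y, V y⟩ : TangentBundle (𝓡 4) X)) x h2 hV

theorem vfSmoothAt_mlieBracket {V W : ∀ x : X, TangentSpace (𝓡 4) x} {x : X}
    (hV : VFSmoothAt V x) (hW : VFSmoothAt W x) :
    VFSmoothAt (VectorField.mlieBracket (𝓡 4) V W) x :=
  haveI : IsManifold (𝓡 4) (minSmoothness ℝ 2) X := by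
    rw [minSmoothness_of_isRCLikeNormedField]
    exact IsManifold.of_le (n := ∞) (WithTop.coe_le_coe.2 le_top)
  haveI : IsManifold (𝓡 4) ((⊤ : ℕ∞) + 1) X := ‹IsManifold (𝓡 4) ∞ X›
  ContMDiffAt.mlieBracket_vectorField (m := ⊤) (n := ⊤) hV hW (by simp)

/-- The chart used in `extD` varies with the point, so its formula does not show smoothness.
Cartan's formula, solved for `dα(V, W)`, expresses it by derivatives of smooth functions and a
bracket. -/
theorem contMDiffAt_extD {α : ∀ x : X, CoFib X x} (hα : SmoothForm α)
    {V W : ∀ x : X, TangentSpace (𝓡 4) x} {U : Set X} (hU : IsOpen U)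
    (hV : ∀ x ∈ U, VFSmoothAt V x) (hW : ∀ x ∈ U, VFSmoothAt W x) {x : X} (hx : x ∈ U) :
    ContMDiffAt (𝓡 4) 𝓘(ℝ, ℝ) ∞ (fun y => extD α y (V y) (W y)) x := by
  have h1 := contMDiffAt_mfderiv_vf hU hx
    (fun y hy => (contMDiffAt_form_vf hα.contMDiffAt (hW y hy)).contMDiffWithinAt) (hV x hx)
  have h2 := contMDiffAt_mfderiv_vf hU hx
    (fun y hy => (contMDiffAt_form_vf hα.contMDiffAt (hV y hy)).contMDiffWithinAt) (hW x hx)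
  have h3 := contMDiffAt_form_vf hα.contMDiffAt (vfSmoothAt_mlieBracket (hV x hx) (hW x hx))
  refine ((h1.sub h2).sub h3).congr_of_eventuallyEq ?_
  filter_upwards [hU.mem_nhds hx] with y hy
  have h4 := form_mlieBracket (FormSmoothAt.diffAt (hα.contMDiffAt (x := y))) (hV y hy).diffAt
    (hW y hy).diffAt
  have h5 : ∀ a b c d : ℝ, a = b - c - d → d = b - c - a := fun a b c d h => by linarith
  exact h5 _ _ _ _ h4
end QuasiContact

/-! ### Linear algebra of `E` and of `dα`; global extension of tangent vectors -/

namespace QuasiContact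

/-- An orthonormal triple in the kernel of a nonzero linear form on `ℝ⁴` spans the kernel. -/
theorem eq_sum_of_orthonormal_ker {W : Type*} [AddCommGroup W] [Module ℝ W]
    [FiniteDimensional ℝ W] (hW : Module.finrank ℝ W = 4) (a : W →ₗ[ℝ] ℝ) (ha : a ≠ 0)
    (g : W →ₗ[ℝ] W →ₗ[ℝ] ℝ) (e : Fin 3 → W) (he : ∀ i, a (e i) = 0)
    (hg : ∀ i j, g (e i) (e j) = if i = j then 1 else 0) (w : W) (hw : a w = 0) :
    w = ∑ i, g (e i) w • e i := by
  have hk : Module.finrank ℝ (LinearMap.ker a) = 3 := by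
    have h1 := LinearMap.finrank_range_add_finrank_ker a
    have h2 : LinearMap.range a = ⊤ :=
      LinearMap.range_eq_top.2 (LinearMap.surjective ha)
    rw [h2, finrank_top, Module.finrank_self, hW] at h1
    omega
  let e' : Fin 3 → LinearMap.ker a := fun i => ⟨e i, he i⟩
  have hli : LinearIndependent ℝ e' := by
    rw [Fintype.linearIndependent_iff]
    intro c hc i
    have h1 : ∑ j, c j • e j = 0 := by
      have := congrArg (fun z : LinearMap.ker a => (z : W)) hc
      simpa [e'] using this
    have h2 := congrArg (g (e i)) h1
    simpa [hg] using h2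
  have hspan := hli.span_eq_top_of_card_eq_finrank' (by simp [hk])
  have hmem : (⟨w, hw⟩ : LinearMap.ker a) ∈ Submodule.span ℝ (range e') := by
    rw [hspan]; trivial
  obtain ⟨c, hc⟩ := (Submodule.mem_span_range_iff_exists_fun ℝ).1 hmem
  have h1 : ∑ j, c j • e j = w := by
    have := congrArg (fun z : LinearMap.ker a => (z : W)) hc
    simpa [e'] using this
  have h2 : ∀ i, g (e i) w = c i := fun i => by rw [← h1]; simp [hg]
  simp only [h2, h1]

variable {X : Type*} [TopologicalSpace X] [ChartedSpace E4 X] [IsManifold (𝓡 4) ∞ X]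

theorem extD_add_left (α : ∀ x : X, CoFib X x) (x : X) (u v w : TangentSpace (𝓡 4) x) :
    extD α x (u + v) w = extD α x u w + extD α x v w := by
  have h1 := (formDeriv α x).map_add u v
  have h2 := (formDeriv α x w).map_add u v
  have h3 : formDeriv α x (u + v) w = formDeriv α x u w + formDeriv α x v w :=
    congrArg (fun l : E4 →L[ℝ] ℝ => l w) h1
  rw [extD_eq, extD_eq, extD_eq]
  have h4 : ∀ a b c d e f : ℝ, a = b + c → d = e + f → a - d = b - e + (c - f) :=
    fun a b c d e f h h' => by linarith
  exact h4 _ _ _ _ _ _ h3 h2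

theorem extD_smul_left (α : ∀ x : X, CoFib X x) (x : X) (c : ℝ) (u w : TangentSpace (𝓡 4) x) :
    extD α x (c • u) w = c * extD α x u w := by
  have h1 := (formDeriv α x).map_smul c u
  have h2 := (formDeriv α x w).map_smul c u
  have h3 : formDeriv α x (c • u) w = c * formDeriv α x u w :=
    congrArg (fun l : E4 →L[ℝ] ℝ => l w) h1
  rw [extD_eq, extD_eq]
  have h4 : ∀ a b d e : ℝ, a = c * b → d = c * e → a - d = c * (b - e) :=
    fun a b d e h h' => by rw [h, h']; ring
  exact h4 _ _ _ _ h3 h2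

theorem extD_swap (α : ∀ x : X, CoFib X x) (x : X) (u w : TangentSpace (𝓡 4) x) :
    extD α x u w = -extD α x w u := by
  rw [extD_eq, extD_eq]; exact (neg_sub _ _).symm

theorem extD_self (α : ∀ x : X, CoFib X x) (x : X) (u : TangentSpace (𝓡 4) x) :
    extD α x u u = 0 := by
  rw [extD_eq]; exact sub_self _

/-- The exterior derivative at a point as a bilinear form. -/
def extDBilin (α : ∀ x : X, CoFib X x) (x : X) :
    TangentSpace (𝓡 4) x →ₗ[ℝ] TangentSpace (𝓡 4) x →ₗ[ℝ] ℝ :=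
  LinearMap.mk₂ ℝ (extD α x) (extD_add_left α x) (extD_smul_left α x)
    (fun u v w => by
      rw [extD_swap, extD_add_left, extD_swap α x u v, extD_swap α x u w]; ring)
    (fun c u w => by rw [extD_swap, extD_smul_left, extD_swap α x u w, smul_eq_mul]; ring)

theorem extDBilin_apply (α : ∀ x : X, CoFib X x) (x : X) (u v : TangentSpace (𝓡 4) x) :
    extDBilin α x u v = extD α x u v := rfl

theorem VFSmoothAt.add {V W : ∀ x : X, TangentSpace (𝓡 4) x} {x : X} (hV : VFSmoothAt V x)
    (hW : VFSmoothAt W x) : VFSmoothAt (fun y => V y + W y) x :=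
  ContMDiffAt.add_section hV hW

theorem VFSmoothAt.sub {V W : ∀ x : X, TangentSpace (𝓡 4) x} {x : X} (hV : VFSmoothAt V x)
    (hW : VFSmoothAt W x) : VFSmoothAt (fun y => V y - W y) x :=
  ContMDiffAt.sub_section hV hW

theorem VFSmoothAt.smul {f : X → ℝ} {V : ∀ x : X, TangentSpace (𝓡 4) x} {x : X}
    (hf : ContMDiffAt (𝓡 4) 𝓘(ℝ, ℝ) ∞ f x) (hV : VFSmoothAt V x) :
    VFSmoothAt (fun y => f y • V y) x :=
  ContMDiffAt.smul_section hf hV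

/-- A local extension of `v` is cut off by a bump function, which is smooth on all of `X` as `X` is
Hausdorff. Global fields are required because normal classes in `IsNormalClass` are tested on global
sections of `E`. -/
theorem exists_smoothVF [T2Space X] (x : X) (v : TangentSpace (𝓡 4) x) :
    ∃ V : ∀ y : X, TangentSpace (𝓡 4) y, SmoothVF V ∧ V x = v := by
  obtain ⟨s, hs, hV⟩ := FiberBundle.exists_contMDiffOn_extend (I := 𝓡 4) (k := ∞) E4
    (V := (TangentSpace (𝓡 4) : X → Type _)) v
  obtain ⟨f, hf⟩ := (SmoothBumpFunction.nhds_basis_tsupport (I := 𝓡 4) x).mem_iff.1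
    (interior_mem_nhds.2 hs)
  refine ⟨fun y => f y • FiberBundle.extend E4 (E := (TangentSpace (𝓡 4) : X → Type _)) v y, ?_, ?_⟩
  · intro y
    by_cases hy : y ∈ tsupport f
    · exact VFSmoothAt.smul f.contMDiff.contMDiffAt
        (hV.contMDiffAt (mem_interior_iff_mem_nhds.1 (hf.2 hy)))
    · have h0 : ContMDiffAt (𝓡 4) (𝓡 4).tangent ∞
          (fun y => (⟨y, 0⟩ : TangentBundle (𝓡 4) X)) y :=
        (Bundle.contMDiff_zeroSection ℝ (TangentSpace (𝓡 4) : X → Type _)).contMDiffAt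
      refine h0.congr_of_eventuallyEq ?_
      filter_upwards [(isClosed_tsupport f).isOpen_compl.mem_nhds hy] with z hz
      have : f z = 0 := image_eq_zero_of_notMem_tsupport hz
      simp only [this, zero_smul]
  · simp only [f.eq_one, one_smul]
    simp
end QuasiContact

/-! ### The characteristic line and adapted frames -/

namespace QCStructure
open QuasiContact

variable {X : Type*} [TopologicalSpace X] [ChartedSpace E4 X] [IsManifold (𝓡 4) ∞ X]
  {S : QCStructure X} {α : ∀ x : X, CoFib X x} {R : ∀ x : X, TangentSpace (𝓡 4) x}

instance (x : X) : FiniteDimensional ℝ (TangentSpace (𝓡 4) x) :=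
  inferInstanceAs (FiniteDimensional ℝ E4)

theorem finrank_tangentSpace (x : X) : Module.finrank ℝ (TangentSpace (𝓡 4) x) = 4 :=
  (finrank_euclideanSpace_fin : Module.finrank ℝ E4 = 4)

theorem mem_E_iff {x : X} {v : TangentSpace (𝓡 4) x} : v ∈ S.E x ↔ S.a x v = 0 := Iff.rfl

theorem IsPoppForm.apply_eq_zero (hα : S.IsPoppForm α) {x : X} {v : TangentSpace (𝓡 4) x}
    (hv : v ∈ S.E x) : α x v = 0 := (hα.ker_eq x v).2 hv

theorem sub_smul_mem_E (hα : S.IsPoppForm α) (hR : S.IsReeb α R) (x : X)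
    (v : TangentSpace (𝓡 4) x) : v - α x v • R x ∈ S.E x := by
  rw [← hα.ker_eq, map_sub, map_smul, hR.normalized, smul_eq_mul, mul_one, sub_self]

theorem a_eq (hα : S.IsPoppForm α) (hR : S.IsReeb α R) (x : X)
    (v : TangentSpace (𝓡 4) x) : S.a x v = S.a x (R x) * α x v := by
  have h := sub_smul_mem_E hα hR x v
  rw [mem_E_iff, map_sub, map_smul, smul_eq_mul] at h
  linarith

theorem a_R_ne_zero (hα : S.IsPoppForm α) (hR : S.IsReeb α R) (x : X) : S.a x (R x) ≠ 0 := by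
  intro h
  have h1 : R x ∈ S.E x := h
  have h2 := hα.apply_eq_zero h1
  rw [hR.normalized] at h2
  exact one_ne_zero h2

/-- The projection of a vector field to `E` along `R`. -/
def toE (α : ∀ x : X, CoFib X x) (R V : ∀ x : X, TangentSpace (𝓡 4) x) (x : X) :
    TangentSpace (𝓡 4) x := V x - α x (V x) • R x

theorem smooth_toE (hα : S.IsPoppForm α) (hR : S.IsReeb α R) {V : ∀ x : X, TangentSpace (𝓡 4) x}
    (hV : SmoothVF V) : SmoothVF (toE α R V) := fun _ =>
  VFSmoothAt.sub hV.contMDiffAt (VFSmoothAt.smul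
    (contMDiffAt_form_vf hα.smooth.contMDiffAt hV.contMDiffAt) hR.smooth.contMDiffAt)

theorem exists_smoothVF_E [T2Space X] (hα : S.IsPoppForm α) (hR : S.IsReeb α R) {x : X}
    {v : TangentSpace (𝓡 4) x} (hv : v ∈ S.E x) :
    ∃ V : ∀ y : X, TangentSpace (𝓡 4) y, SmoothVF V ∧ V x = v ∧ ∀ y, V y ∈ S.E y := by
  obtain ⟨V, hV, hx⟩ := exists_smoothVF x v
  refine ⟨toE α R V, smooth_toE hα hR hV, ?_, fun y => sub_smul_mem_E hα hR y _⟩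
  rw [toE, hx, hα.apply_eq_zero hv, zero_smul, sub_zero]

/-- On `E` the exterior derivatives of `a` and of the Popp form are proportional. -/
theorem extD_a_eq [T2Space X] (hα : S.IsPoppForm α) (hR : S.IsReeb α R) {x : X}
    {u v : TangentSpace (𝓡 4) x} (hu : u ∈ S.E x) (hv : v ∈ S.E x) :
    extD S.a x u v = S.a x (R x) * extD α x u v := by
  obtain ⟨U, hU, hUx, hUE⟩ := exists_smoothVF_E hα hR hu
  obtain ⟨V, hV, hVx, hVE⟩ := exists_smoothVF_E hα hR hv
  have h0 : ∀ u : TangentSpace (𝓡 4) x, dX (fun _ : X => (0 : ℝ)) x u = 0 := fun u =>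
    congrArg (fun l : E4 →L[ℝ] ℝ => l u) (mfderiv_const (I := 𝓡 4) (I' := 𝓘(ℝ, ℝ)) (x := x))
  -- For a form that annihilates `E`, Cartan's formula on sections of `E` reduces to `β([U, V]) =
  -- -dβ(u, v)`. Applied to `a` and to `α`, this avoids differentiating the factor `a(R)` in `a =
  -- a(R) α`.
  have key : ∀ β : ∀ x : X, CoFib X x, SmoothForm β → (∀ y, ∀ v ∈ S.E y, β y v = 0) →
      β x (VectorField.mlieBracket (𝓡 4) U V x) = -extD β x u v := by
    intro β hβ hβE
    have h := form_mlieBracket (FormSmoothAt.diffAt (hβ.contMDiffAt (x := x)))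
      (VFSmoothAt.diffAt hU.contMDiffAt) (VFSmoothAt.diffAt hV.contMDiffAt)
    have e1 : (fun y => β y (V y)) = fun _ => 0 := funext fun y => hβE y _ (hVE y)
    have e2 : (fun y => β y (U y)) = fun _ => 0 := funext fun y => hβE y _ (hUE y)
    rw [e1, e2, h0, h0, hUx, hVx] at h
    simpa using h
  have h1 := key S.a S.smooth_a fun y v hv => hv
  have h2 := key α hα.smooth fun y v hv => hα.apply_eq_zero hv
  rw [a_eq hα hR, h2] at h1
  linarith

/-- If `a(v) ≠ 0`, contracting `a ∧ da` with `v` and restricting to `E` gives `a(v) da|_E`, which is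
nonzero by the rank condition; so `L ⊂ E`. For `v ∈ E` the condition says that `v` is in the radical
of `da|_E`, which is proportional to `dα|_E`. -/
theorem mem_L_iff [T2Space X] (hα : S.IsPoppForm α) (hR : S.IsReeb α R) {x : X}
    {v : TangentSpace (𝓡 4) x} :
    v ∈ S.L x ↔ v ∈ S.E x ∧ ∀ w ∈ S.E x, extD α x v w = 0 := by
  have hn := a_R_ne_zero hα hR x
  constructor
  · intro h
    have hE : v ∈ S.E x := by
      by_contra hv
      have hv' : S.a x v ≠ 0 := hv
      obtain ⟨B, hB, hr⟩ := S.rank_two x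
      have hB0 : B = 0 := by
        ext u w
        have hu : S.a x u = 0 := u.2
        have hw : S.a x w = 0 := w.2
        have := h u w
        rw [hu, hw, zero_mul, zero_mul, add_zero, add_zero] at this
        rw [hB]
        simpa [hv'] using this
      rw [hB0, LinearMap.range_zero, finrank_bot] at hr
      omega
    refine ⟨hE, fun w hw => ?_⟩
    have := h (R x) w
    have hw' : S.a x w = 0 := hw
    have hv' : S.a x v = 0 := hE
    rw [hw', hv', zero_mul, zero_mul, zero_add, add_zero, extD_a_eq hα hR hw hE] at this
    rw [extD_swap]
    simpa [hn] using this
  · rintro ⟨hE, h⟩ u w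
    have hv' : S.a x v = 0 := hE
    -- For `v` in the radical, `da(v, ·)` vanishes on `E` and is thus a multiple of `a`; the
    -- multiple is found by evaluation on `R`.
    have key : ∀ z, S.a x (R x) * extD S.a x v z = S.a x z * extD S.a x v (R x) := by
      intro z
      have h1 := h _ (sub_smul_mem_E hα hR x z)
      have h2 := extD_a_eq hα hR hE (sub_smul_mem_E hα hR x z)
      rw [h1, mul_zero, ← extDBilin_apply, map_sub, map_smul, extDBilin_apply, extDBilin_apply,
        smul_eq_mul] at h2
      rw [a_eq hα hR x z]
      linear_combination S.a x (R x) * h2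
    have h1 := key u
    have h2 := key w
    rw [extD_swap S.a x w v, hv', zero_mul, zero_add]
    refine mul_left_cancel₀ hn ?_
    linear_combination S.a x w * h1 - S.a x u * h2

/-- A smooth frame `Z, e₁, e₂, R` over an open set, with `Z` a unit vector of the characteristic
line and `e₁, e₂` an orthonormal basis of its complement, oriented by the Popp form. -/
structure AdaptedFrame (S : QCStructure X) (α : ∀ x : X, CoFib X x)
    (R : ∀ x : X, TangentSpace (𝓡 4) x) (U : Set X)
    (e : Fin 4 → ∀ x : X, TangentSpace (𝓡 4) x) : Prop where
  isOpen : IsOpen U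
  smooth : ∀ j, ∀ x ∈ U, VFSmoothAt (e j) x
  last : e 3 = R
  mem_E : ∀ i : Fin 3, ∀ x ∈ U, e i.castSucc x ∈ S.E x
  orthonormal : ∀ i j : Fin 3, ∀ x ∈ U,
    S.g x (e i.castSucc x) (e j.castSucc x) = if i = j then 1 else 0
  mem_L : ∀ x ∈ U, e 0 x ∈ S.L x
  oriented : ∀ x ∈ U, extD α x (e 1 x) (e 2 x) = 1

/-- The metric at a point as a bilinear form. -/
def gBilin (S : QCStructure X) (x : X) :
    TangentSpace (𝓡 4) x →ₗ[ℝ] TangentSpace (𝓡 4) x →ₗ[ℝ] ℝ :=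
  LinearMap.mk₂ ℝ (fun u v => S.g x u v) (fun u v w => by simp) (fun c u w => by simp)
    (fun u v w => by simp) (fun c u w => by simp)

theorem gBilin_apply (x : X) (u v : TangentSpace (𝓡 4) x) : S.gBilin x u v = S.g x u v := rfl

theorem smooth_normalize {V : ∀ x : X, TangentSpace (𝓡 4) x} {x : X} (hV : VFSmoothAt V x)
    (hE : V x ∈ S.E x) (h0 : V x ≠ 0) :
    VFSmoothAt (fun y => (√(S.g y (V y) (V y)))⁻¹ • V y) x := by
  have hpos := S.pos_g x (V x) hE h0
  refine VFSmoothAt.smul ?_ hV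
  have h1 := contMDiffAt_metric S hV hV
  have h2 : ContDiffAt ℝ ∞ (fun t : ℝ => (√t)⁻¹) (S.g x (V x) (V x)) :=
    (Real.contDiffAt_sqrt hpos.ne').inv (Real.sqrt_pos.2 hpos).ne'
  exact ContMDiffAt.comp (g := fun t : ℝ => (√t)⁻¹) (f := fun y => S.g y (V y) (V y)) x
    h2.contMDiffAt h1

theorem normalize_self {x : X} {v : TangentSpace (𝓡 4) x} (hE : v ∈ S.E x) (h0 : v ≠ 0) :
    S.g x ((√(S.g x v v))⁻¹ • v) ((√(S.g x v v))⁻¹ • v) = 1 := by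
  have hpos := S.pos_g x v hE h0
  have h1 := Real.mul_self_sqrt hpos.le
  have h2 := (Real.sqrt_pos.2 hpos).ne'
  rw [← gBilin_apply, map_smul, map_smul, LinearMap.smul_apply, gBilin_apply, smul_eq_mul,
    smul_eq_mul]
  field_simp
  linarith

theorem exists_extD_ne_zero [T2Space X] (hα : S.IsPoppForm α) (hR : S.IsReeb α R) (x : X) :
    ∃ u ∈ S.E x, ∃ v ∈ S.E x, extD α x u v ≠ 0 := by
  by_contra! h
  obtain ⟨B, hB, hr⟩ := S.rank_two x
  have hB0 : B = 0 := by
    ext u w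
    rw [hB, extD_a_eq hα hR u.2 w.2, h u u.2 w w.2]
    simp
  rw [hB0, LinearMap.range_zero, finrank_bot] at hr
  omega

theorem finrank_E (x : X) : Module.finrank ℝ (S.E x) = 3 := by
  have h1 := LinearMap.finrank_range_add_finrank_ker (S.a x).toLinearMap
  have h2 : LinearMap.range (S.a x).toLinearMap = ⊤ :=
    LinearMap.range_eq_top.2 (LinearMap.surjective fun h => S.a_ne_zero x (by
      ext v; exact congrArg (fun l : TangentSpace (𝓡 4) x →ₗ[ℝ] ℝ => l v) h))
  rw [h2, finrank_top, Module.finrank_self, finrank_tangentSpace] at h1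
  change Module.finrank ℝ (LinearMap.ker (S.a x).toLinearMap) = 3
  omega

theorem exists_notMem_span (x : X) (u v : TangentSpace (𝓡 4) x) :
    ∃ w ∈ S.E x, w ∉ Submodule.span ℝ {u, v} := by
  by_contra! h
  have h1 : S.E x ≤ Submodule.span ℝ {u, v} := h
  have h2 := Submodule.finrank_mono h1
  rw [finrank_E] at h2
  have h3 : Module.finrank ℝ (Submodule.span ℝ ({u, v} : Set (TangentSpace (𝓡 4) x))) ≤ 2 := by
    classical
    have := finrank_span_finset_le_card (R := ℝ) ({u, v} : Finset (TangentSpace (𝓡 4) x))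
    have h4 := Finset.card_le_two (a := u) (b := v)
    have e : ((({u, v} : Finset (TangentSpace (𝓡 4) x)) : Set (TangentSpace (𝓡 4) x))) = {u, v} := by
      ext; simp
    rw [e] at this
    exact this.trans h4
  omega

/-- A two-form `dα` on a three-dimensional space with basis `V₁, V₂, W` has the explicit radical `z
= dα(V₁, V₂) W + dα(V₂, W) V₁ + dα(W, V₁) V₂`; it is smooth, and nonzero near `x₀` when `dα(V₁, V₂)
≠ 0` there. Gram–Schmidt applied to `z, V₁, V₂` gives the frame. The vectors stay independent
because subtracting multiples of `Z` does not change `dα`, which remains nonzero on the last two. -/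
theorem exists_adaptedFrame [T2Space X] (hα : S.IsPoppForm α) (hR : S.IsReeb α R) (x₀ : X) :
    ∃ U e, AdaptedFrame S α R U e ∧ x₀ ∈ U := by
  obtain ⟨u, hu, v, hv, huv⟩ := exists_extD_ne_zero hα hR x₀
  obtain ⟨w, hw, hwu⟩ := exists_notMem_span (S := S) x₀ u v
  obtain ⟨V₁, hV₁, hV₁x, hV₁E⟩ := exists_smoothVF_E hα hR hu
  obtain ⟨V₂, hV₂, hV₂x, hV₂E⟩ := exists_smoothVF_E hα hR hv
  obtain ⟨W, hW, hWx, hWE⟩ := exists_smoothVF_E hα hR hw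
  have sm : ∀ {A B : ∀ x : X, TangentSpace (𝓡 4) x}, SmoothVF A → SmoothVF B → ∀ x,
      ContMDiffAt (𝓡 4) 𝓘(ℝ, ℝ) ∞ (fun y => extD α y (A y) (B y)) x := fun hA hB x =>
    contMDiffAt_extD hα.smooth isOpen_univ (fun x _ => hA.contMDiffAt) (fun x _ => hB.contMDiffAt)
      (mem_univ x)
  let z : ∀ x : X, TangentSpace (𝓡 4) x := fun x => extD α x (V₁ x) (V₂ x) • W x +
    extD α x (V₂ x) (W x) • V₁ x + extD α x (W x) (V₁ x) • V₂ x
  have hz : ∀ x, VFSmoothAt z x := fun x =>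
    ((VFSmoothAt.smul (sm hV₁ hV₂ x) hW.contMDiffAt).add
      (VFSmoothAt.smul (sm hV₂ hW x) hV₁.contMDiffAt)).add
      (VFSmoothAt.smul (sm hW hV₁ x) hV₂.contMDiffAt)
  have hzE : ∀ x, z x ∈ S.E x := fun x =>
    (S.E x).add_mem ((S.E x).add_mem ((S.E x).smul_mem _ (hWE x)) ((S.E x).smul_mem _ (hV₁E x)))
      ((S.E x).smul_mem _ (hV₂E x))
  let O : Set X := {x | S.g x (z x) (z x) ≠ 0 ∧ extD α x (V₁ x) (V₂ x) ≠ 0}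
  have hO : IsOpen O := by
    refine IsOpen.and ?_ ?_
    · exact isOpen_ne_fun (continuous_iff_continuousAt.2 fun x =>
        (contMDiffAt_metric S (hz x) (hz x)).continuousAt) continuous_const
    · exact isOpen_ne_fun (continuous_iff_continuousAt.2 fun x =>
        (sm hV₁ hV₂ x).continuousAt) continuous_const
  have hz0 : ∀ x ∈ O, z x ≠ 0 := fun x hx h => hx.1 (by rw [h]; simp)
  have hx₀ : x₀ ∈ O := by
    have h1 : extD α x₀ (V₁ x₀) (V₂ x₀) ≠ 0 := by rw [hV₁x, hV₂x]; exact huv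
    -- If `z` vanished at `x₀`, the nonzero coefficient of `w` would put `w` in the span of `u` and
    -- `v`.
    refine ⟨(S.pos_g x₀ _ (hzE x₀) fun h => hwu ?_).ne', h1⟩
    have h2 : extD α x₀ u v • w + extD α x₀ v w • u + extD α x₀ w u • v = 0 := by
      have := h; simp only [z] at this; rwa [hV₁x, hV₂x, hWx] at this
    refine Submodule.mem_span_pair.2 ⟨-(extD α x₀ v w / extD α x₀ u v),
      -(extD α x₀ w u / extD α x₀ u v), ?_⟩
    refine smul_right_injective _ huv ?_
    change extD α x₀ u v • _ = extD α x₀ u v • w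
    rw [add_assoc] at h2
    rw [eq_neg_of_add_eq_zero_left h2, smul_add, smul_smul, smul_smul, mul_neg, mul_neg,
      mul_div_cancel₀ _ huv, mul_div_cancel₀ _ huv, neg_smul, neg_smul, neg_add]
  let Z : ∀ x : X, TangentSpace (𝓡 4) x := fun y => (√(S.g y (z y) (z y)))⁻¹ • z y
  have hZ : ∀ x ∈ O, VFSmoothAt Z x := fun x hx => smooth_normalize (hz x) (hzE x) (hz0 x hx)
  have hZE : ∀ x, Z x ∈ S.E x := fun x => (S.E x).smul_mem _ (hzE x)
  have hZZ : ∀ x ∈ O, S.g x (Z x) (Z x) = 1 := fun x hx => normalize_self (hzE x) (hz0 x hx)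
  have hzV₁ : ∀ x, extD α x (z x) (V₁ x) = 0 := fun x => by
    simp only [z, extD_add_left, extD_smul_left, extD_self]
    rw [extD_swap α x (V₂ x) (V₁ x)]; ring
  have hzV₂ : ∀ x, extD α x (z x) (V₂ x) = 0 := fun x => by
    simp only [z, extD_add_left, extD_smul_left, extD_self]
    rw [extD_swap α x (V₂ x) (W x)]; ring
  have hZV₁ : ∀ x, extD α x (Z x) (V₁ x) = 0 := fun x => by
    simp only [Z, extD_smul_left, hzV₁, mul_zero]
  have hZV₂ : ∀ x, extD α x (Z x) (V₂ x) = 0 := fun x => by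
    simp only [Z, extD_smul_left, hzV₂, mul_zero]
  let A : ∀ x : X, TangentSpace (𝓡 4) x := fun y => V₁ y - S.g y (Z y) (V₁ y) • Z y
  have hA : ∀ x ∈ O, VFSmoothAt A x := fun x hx => VFSmoothAt.sub hV₁.contMDiffAt
    (VFSmoothAt.smul (contMDiffAt_metric S (hZ x hx) hV₁.contMDiffAt) (hZ x hx))
  have hAE : ∀ x, A x ∈ S.E x := fun x => (S.E x).sub_mem (hV₁E x) ((S.E x).smul_mem _ (hZE x))
  have hZA : ∀ x, extD α x (Z x) (A x) = 0 := fun x => by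
    simp only [A, ← extDBilin_apply, map_sub, map_smul]
    simp only [extDBilin_apply, hZV₁, extD_self, smul_zero, sub_zero]
  have hAV₂ : ∀ x, extD α x (A x) (V₂ x) = extD α x (V₁ x) (V₂ x) := fun x => by
    simp only [A, ← extDBilin_apply, map_sub, map_smul, LinearMap.sub_apply, LinearMap.smul_apply]
    simp only [extDBilin_apply, hZV₂, smul_zero, sub_zero]
  have hA0 : ∀ x ∈ O, A x ≠ 0 := fun x hx h => hx.2 (by
    rw [← hAV₂, h, ← extDBilin_apply, map_zero, LinearMap.zero_apply])
  let e₁ : ∀ x : X, TangentSpace (𝓡 4) x := fun y => (√(S.g y (A y) (A y)))⁻¹ • A y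
  have he₁ : ∀ x ∈ O, VFSmoothAt e₁ x := fun x hx => smooth_normalize (hA x hx) (hAE x) (hA0 x hx)
  have he₁E : ∀ x, e₁ x ∈ S.E x := fun x => (S.E x).smul_mem _ (hAE x)
  have h11 : ∀ x ∈ O, S.g x (e₁ x) (e₁ x) = 1 := fun x hx => normalize_self (hAE x) (hA0 x hx)
  have hZe₁ : ∀ x, extD α x (Z x) (e₁ x) = 0 := fun x => by
    rw [extD_swap, extD_smul_left, extD_swap, hZA, neg_zero, mul_zero, neg_zero]
  have h01 : ∀ x ∈ O, S.g x (Z x) (e₁ x) = 0 := fun x hx => by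
    simp only [e₁, A, ← gBilin_apply, map_sub, map_smul, smul_eq_mul]
    simp only [gBilin_apply, hZZ x hx]; ring
  have he₁V₂ : ∀ x ∈ O, extD α x (e₁ x) (V₂ x) ≠ 0 := fun x hx => by
    simp only [e₁, extD_smul_left, hAV₂]
    exact mul_ne_zero (inv_ne_zero (Real.sqrt_pos.2 (S.pos_g x _ (hAE x) (hA0 x hx))).ne') hx.2
  let B : ∀ x : X, TangentSpace (𝓡 4) x := fun y =>
    V₂ y - S.g y (Z y) (V₂ y) • Z y - S.g y (e₁ y) (V₂ y) • e₁ y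
  have hB : ∀ x ∈ O, VFSmoothAt B x := fun x hx => (VFSmoothAt.sub hV₂.contMDiffAt
    (VFSmoothAt.smul (contMDiffAt_metric S (hZ x hx) hV₂.contMDiffAt) (hZ x hx))).sub
    (VFSmoothAt.smul (contMDiffAt_metric S (he₁ x hx) hV₂.contMDiffAt) (he₁ x hx))
  have hBE : ∀ x, B x ∈ S.E x := fun x => (S.E x).sub_mem ((S.E x).sub_mem (hV₂E x)
    ((S.E x).smul_mem _ (hZE x))) ((S.E x).smul_mem _ (he₁E x))
  have he₁B : ∀ x ∈ O, extD α x (e₁ x) (B x) ≠ 0 := fun x hx => by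
    have h := he₁V₂ x hx
    have h2 := hZe₁ x
    rw [extD_swap, neg_eq_zero] at h2
    simp only [B, ← extDBilin_apply, map_sub, map_smul]
    simp only [extDBilin_apply, h2, extD_self, smul_zero, sub_zero]
    exact h
  have hB0 : ∀ x ∈ O, B x ≠ 0 := fun x hx h => he₁B x hx (by
    rw [h, ← extDBilin_apply, map_zero])
  have hZB : ∀ x, extD α x (Z x) (B x) = 0 := fun x => by
    simp only [B, ← extDBilin_apply, map_sub, map_smul]
    simp only [extDBilin_apply, hZV₂, hZe₁, extD_self, smul_zero, sub_zero]
  let n : ∀ x : X, TangentSpace (𝓡 4) x := fun y => (√(S.g y (B y) (B y)))⁻¹ • B y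
  have hn : ∀ x ∈ O, VFSmoothAt n x := fun x hx => smooth_normalize (hB x hx) (hBE x) (hB0 x hx)
  have hnE : ∀ x, n x ∈ S.E x := fun x => (S.E x).smul_mem _ (hBE x)
  have hnn : ∀ x ∈ O, S.g x (n x) (n x) = 1 := fun x hx => normalize_self (hBE x) (hB0 x hx)
  have hZn : ∀ x, extD α x (Z x) (n x) = 0 := fun x => by
    rw [extD_swap, extD_smul_left, extD_swap, hZB, neg_zero, mul_zero, neg_zero]
  have h0n : ∀ x ∈ O, S.g x (Z x) (n x) = 0 := fun x hx => by
    simp only [n, B, ← gBilin_apply, map_sub, map_smul, smul_eq_mul]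
    simp only [gBilin_apply, hZZ x hx, h01 x hx]; ring
  have h1n : ∀ x ∈ O, S.g x (e₁ x) (n x) = 0 := fun x hx => by
    simp only [n, B, ← gBilin_apply, map_sub, map_smul, smul_eq_mul]
    simp only [gBilin_apply, h11 x hx, S.symm_g x (e₁ x) (Z x), h01 x hx]; ring
  have hdn : ∀ x ∈ O, extD α x (e₁ x) (n x) ≠ 0 := fun x hx => by
    rw [extD_swap, extD_smul_left, extD_swap]
    exact neg_ne_zero.2 (mul_ne_zero (inv_ne_zero (Real.sqrt_pos.2
      (S.pos_g x _ (hBE x) (hB0 x hx))).ne') (neg_ne_zero.2 (he₁B x hx)))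
  -- the characteristic line is spanned by `Z`
  have hspan : ∀ x ∈ O, ∀ w ∈ S.E x,
      w = S.g x (Z x) w • Z x + S.g x (e₁ x) w • e₁ x + S.g x (n x) w • n x := by
    intro x hx w hw
    have h := eq_sum_of_orthonormal_ker (finrank_tangentSpace x) (S.a x).toLinearMap
      (fun h => S.a_ne_zero x (by
        ext v; exact congrArg (fun l : TangentSpace (𝓡 4) x →ₗ[ℝ] ℝ => l v) h)) (S.gBilin x)
      ![Z x, e₁ x, n x] (fun i => by fin_cases i; exacts [hZE x, he₁E x, hnE x])
      (fun i j => by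
        fin_cases i <;> fin_cases j <;>
          simp [gBilin_apply, hZZ x hx, h01 x hx, h0n x hx, h11 x hx, h1n x hx, hnn x hx,
            S.symm_g x (e₁ x) (Z x), S.symm_g x (n x) (Z x), S.symm_g x (n x) (e₁ x)]) w hw
    rw [Fin.sum_univ_three] at h
    exact h
  have hZL : ∀ x ∈ O, Z x ∈ S.L x := fun x hx => (mem_L_iff hα hR).2 ⟨hZE x, fun w hw => by
    rw [hspan x hx w hw]
    simp only [← extDBilin_apply, map_add, map_smul]
    simp only [extDBilin_apply, extD_self, hZe₁, hZn, smul_zero, add_zero]⟩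
  have hL : ∀ x ∈ O, ∀ l ∈ S.L x, l = S.g x (Z x) l • Z x := by
    intro x hx l hl
    obtain ⟨hlE, hl⟩ := (mem_L_iff hα hR).1 hl
    have hs := hspan x hx l hlE
    have h1 := hl _ (he₁E x)
    have h2 := hl _ (hnE x)
    rw [hs] at h1 h2
    simp only [extD_add_left, extD_smul_left, hZe₁, hZn, extD_self, mul_zero, zero_add,
      add_zero] at h1 h2
    rw [extD_swap] at h1
    have h3 : S.g x (e₁ x) l = 0 := (mul_eq_zero.1 h2).resolve_right (hdn x hx)
    have h4 : S.g x (n x) l = 0 := (mul_eq_zero.1 h1).resolve_right (neg_ne_zero.2 (hdn x hx))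
    rw [h3, h4, zero_smul, zero_smul, add_zero, add_zero] at hs
    exact hs
  have hperp : ∀ x ∈ O, ∀ v ∈ S.E x, S.g x (Z x) v = 0 → v ∈ S.Lperp x := by
    intro x hx v hv h
    refine ⟨hv, fun l hl => ?_⟩
    rw [hL x hx l hl, map_smul, S.symm_g x v, h, smul_zero]
  have hdn1 : ∀ x ∈ O, |extD α x (e₁ x) (n x)| = 1 := fun x hx =>
    hα.area x _ (hperp x hx _ (he₁E x) (h01 x hx)) _ (hperp x hx _ (hnE x) (h0n x hx))
      (h11 x hx) (hnn x hx) (h1n x hx)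
  have hdn2 : ∀ x ∈ O, extD α x (e₁ x) (n x) * extD α x (e₁ x) (n x) = 1 := fun x hx => by
    rw [← abs_mul_abs_self, hdn1 x hx, one_mul]
  -- By the area condition `dα(e₁, n)` is `±1`. It is also a smooth function, so multiplying `n` by
  -- it fixes the orientation without choosing a sign.
  let e₂ : ∀ x : X, TangentSpace (𝓡 4) x := fun x => extD α x (e₁ x) (n x) • n x
  refine ⟨O, ![Z, e₁, e₂, R], ⟨hO, ?_, rfl, ?_, ?_, hZL, ?_⟩, hx₀⟩
  · intro j x hx
    fin_cases j
    · exact hZ x hx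
    · exact he₁ x hx
    · exact VFSmoothAt.smul (contMDiffAt_extD hα.smooth hO he₁ hn hx) (hn x hx)
    · exact hR.smooth.contMDiffAt
  · intro i x hx
    fin_cases i
    exacts [hZE x, he₁E x, (S.E x).smul_mem _ (hnE x)]
  · intro i j x hx
    have h20 : S.g x (Z x) (e₂ x) = 0 := by
      simp only [e₂, map_smul, h0n x hx, smul_zero]
    have h21 : S.g x (e₁ x) (e₂ x) = 0 := by
      simp only [e₂, map_smul, h1n x hx, smul_zero]
    have h22 : S.g x (e₂ x) (e₂ x) = 1 := by
      have h1 : S.g x (n x) (e₂ x) = extD α x (e₁ x) (n x) := by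
        simp only [e₂, map_smul, hnn x hx, smul_eq_mul, mul_one]
      have h2 : S.g x (e₂ x) (extD α x (e₁ x) (n x) • n x) = 1 := by
        rw [map_smul, S.symm_g x (e₂ x) (n x), h1, smul_eq_mul, hdn2 x hx]
      exact h2
    fin_cases i <;> fin_cases j
    · exact hZZ x hx
    · exact h01 x hx
    · exact h20
    · exact (S.symm_g x _ _).trans (h01 x hx)
    · exact h11 x hx
    · exact h21
    · exact (S.symm_g x _ _).trans h20
    · exact (S.symm_g x _ _).trans h21
    · exact h22
  · intro x hx
    change extD α x (e₁ x) (extD α x (e₁ x) (n x) • n x) = 1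
    rw [extD_swap, extD_smul_left, extD_swap α x (n x)]
    have := hdn2 x hx
    linarith
end QCStructure

/-! ### The dual coframe and the structure functions -/

namespace QCStructure
open QuasiContact

variable {X : Type*} [TopologicalSpace X] [ChartedSpace E4 X] [IsManifold (𝓡 4) ∞ X]
  {S : QCStructure X} {α : ∀ x : X, CoFib X x} {R : ∀ x : X, TangentSpace (𝓡 4) x}
  {U : Set X} {e : Fin 4 → ∀ x : X, TangentSpace (𝓡 4) x}

/-- The dual coframe of an adapted frame. -/
def coframe (S : QCStructure X) (α : ∀ x : X, CoFib X x)
    (e : Fin 4 → ∀ x : X, TangentSpace (𝓡 4) x) (j : Fin 4) (x : X) : CoFib X x :=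
  if j = 3 then α x else S.g x (e j x) - (S.g x (e j x) (e 3 x)) • α x

theorem coframe_three (x : X) : coframe S α e 3 x = α x := if_pos rfl

theorem coframe_castSucc (i : Fin 3) (x : X) (u : TangentSpace (𝓡 4) x) :
    coframe S α e i.castSucc x u =
      S.g x (e i.castSucc x) u - S.g x (e i.castSucc x) (e 3 x) * α x u := by
  have h : i.castSucc ≠ (3 : Fin 4) := by fin_cases i <;> decide
  rw [coframe, if_neg h]
  rfl

/-- The structure functions of a frame: `[e_j, e_k] = ∑ c_{jk}^l e_l`. -/
def structFn (S : QCStructure X) (α : ∀ x : X, CoFib X x)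
    (e : Fin 4 → ∀ x : X, TangentSpace (𝓡 4) x) (j k l : Fin 4) (x : X) : ℝ :=
  coframe S α e l x (VectorField.mlieBracket (𝓡 4) (e j) (e k) x)

namespace AdaptedFrame

theorem apply_castSucc (h : AdaptedFrame S α R U e) (hα : S.IsPoppForm α) {x : X} (hx : x ∈ U)
    (i : Fin 3) : α x (e i.castSucc x) = 0 := hα.apply_eq_zero (h.mem_E i x hx)

theorem apply_three (h : AdaptedFrame S α R U e) (hR : S.IsReeb α R) (x : X) :
    α x (e 3 x) = 1 := by rw [h.last, hR.normalized]

theorem coframe_frame (h : AdaptedFrame S α R U e) (hα : S.IsPoppForm α) (hR : S.IsReeb α R)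
    {x : X} (hx : x ∈ U) (j k : Fin 4) :
    coframe S α e j x (e k x) = if j = k then 1 else 0 := by
  induction j using Fin.lastCases with
  | last =>
    rw [show Fin.last 3 = 3 from rfl, coframe_three]
    induction k using Fin.lastCases with
    | last => exact (h.apply_three hR x).trans (if_pos rfl).symm
    | cast k =>
      rw [h.apply_castSucc hα hx, if_neg]
      exact (Fin.castSucc_ne_last k).symm
  | cast j =>
    rw [coframe_castSucc]
    induction k using Fin.lastCases with
    | last =>
      rw [show Fin.last 3 = 3 from rfl, h.apply_three hR, mul_one, sub_self, if_neg]
      exact Fin.castSucc_ne_last j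
    | cast k =>
      rw [h.apply_castSucc hα hx, mul_zero, sub_zero, h.orthonormal j k x hx]
      simp

theorem eq_sum_E (h : AdaptedFrame S α R U e) {x : X} (hx : x ∈ U) {w : TangentSpace (𝓡 4) x}
    (hw : w ∈ S.E x) : w = ∑ i : Fin 3, S.g x (e i.castSucc x) w • e i.castSucc x :=
  eq_sum_of_orthonormal_ker (finrank_tangentSpace x) (S.a x).toLinearMap
    (fun h => S.a_ne_zero x (by
      ext v; exact congrArg (fun l : TangentSpace (𝓡 4) x →ₗ[ℝ] ℝ => l v) h)) (S.gBilin x)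
    (fun i => e i.castSucc x) (fun i => h.mem_E i x hx) (fun i j => h.orthonormal i j x hx) w hw

theorem eq_sum (h : AdaptedFrame S α R U e) (hα : S.IsPoppForm α) (hR : S.IsReeb α R)
    {x : X} (hx : x ∈ U) (u : TangentSpace (𝓡 4) x) :
    u = ∑ j, coframe S α e j x u • e j x := by
  have h1 := h.eq_sum_E hx (sub_smul_mem_E hα hR x u)
  rw [Fin.sum_univ_castSucc, show Fin.last 3 = 3 from rfl, coframe_three, h.last,
    ← sub_eq_iff_eq_add, h1]
  refine Finset.sum_congr rfl fun i _ => ?_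
  rw [coframe_castSucc, map_sub, map_smul, h.last, smul_eq_mul, mul_comm (α x u)]

theorem formSmoothAt_coframe (h : AdaptedFrame S α R U e) (hα : S.IsPoppForm α) {x : X}
    (hx : x ∈ U) (j : Fin 4) : FormSmoothAt (coframe S α e j) x := by
  by_cases hj : j = 3
  · have : coframe S α e j = α := by funext y; rw [coframe, if_pos hj]
    rw [this]; exact hα.smooth.contMDiffAt
  · have : coframe S α e j = fun y => S.g y (e j y) - (S.g y (e j y) (e 3 y)) • α y := by
      funext y; rw [coframe, if_neg hj]
    rw [this]
    have h1 : FormSmoothAt (fun y => S.g y (e j y)) x :=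
      ContMDiffAt.clm_bundle_apply (IB := 𝓡 4) (b := fun y : X => y) (ϕ := fun y => S.g y)
        (E₂ := CoFib X) (v := fun y => e j y) S.smooth_g.contMDiffAt (h.smooth j x hx)
    exact ContMDiffAt.sub_section h1 (ContMDiffAt.smul_section
      (contMDiffAt_metric S (h.smooth j x hx) (h.smooth 3 x hx)) hα.smooth.contMDiffAt)

theorem contMDiffAt_structFn (h : AdaptedFrame S α R U e) (hα : S.IsPoppForm α) {x : X}
    (hx : x ∈ U) (j k l : Fin 4) :
    ContMDiffAt (𝓡 4) 𝓘(ℝ, ℝ) ∞ (structFn S α e j k l) x :=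
  contMDiffAt_form_vf (h.formSmoothAt_coframe hα hx l)
    (vfSmoothAt_mlieBracket (h.smooth j x hx) (h.smooth k x hx))

theorem mlieBracket_eq_sum (h : AdaptedFrame S α R U e) (hα : S.IsPoppForm α) (hR : S.IsReeb α R)
    {x : X} (hx : x ∈ U) (j k : Fin 4) :
    VectorField.mlieBracket (𝓡 4) (e j) (e k) x = ∑ l, structFn S α e j k l x • e l x :=
  h.eq_sum hα hR hx _

theorem structFn_swap (j k l : Fin 4) (x : X) :
    structFn S α e j k l x = -structFn S α e k j l x := by
  rw [structFn, VectorField.mlieBracket_swap_apply, map_neg]; rfl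

/-- The Poisson brackets of the symbols of a frame. -/
theorem dC_symb_ham (h : AdaptedFrame S α R U e) (hα : S.IsPoppForm α) (hR : S.IsReeb α R)
    {p : CoTan X} (hp : p.1 ∈ U) (j k : Fin 4) :
    dC (symb (e k)) p (ham (symb (e j)) p) = ∑ l, structFn S α e j k l p.1 * symb (e l) p := by
  rw [dC_symb_ham_symb (h.smooth j _ hp).diffAt (h.smooth k _ hp).diffAt, symb,
    h.mlieBracket_eq_sum hα hR hp, map_sum]
  refine Finset.sum_congr rfl fun l _ => ?_
  rw [map_smul]; rfl

theorem dX_eq_zero_of_const {f : X → ℝ} {c : ℝ} (hU : IsOpen U) {x : X} (hx : x ∈ U)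
    (hf : ∀ y ∈ U, f y = c) (u : TangentSpace (𝓡 4) x) : dX f x u = 0 := by
  have h1 : f =ᶠ[𝓝 x] fun _ => c := by filter_upwards [hU.mem_nhds hx] with y hy using hf y hy
  have h2 := h1.mfderiv_eq (I := 𝓡 4) (I' := 𝓘(ℝ, ℝ))
  have h3 := h2.trans mfderiv_const
  exact congrArg (fun l : E4 →L[ℝ] ℝ => l u) h3

theorem apply_const (h : AdaptedFrame S α R U e) (hα : S.IsPoppForm α) (hR : S.IsReeb α R)
    (j : Fin 4) : ∃ c, ∀ y ∈ U, α y (e j y) = c := by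
  induction j using Fin.lastCases with
  | last => exact ⟨1, fun y _ => h.apply_three hR y⟩
  | cast j => exact ⟨0, fun y hy => h.apply_castSucc hα hy j⟩

/-- In Cartan's formula the two derivative terms vanish, as `α(V)` and `α(W)` are locally constant.
This covers the frame itself and those of its brackets whose `R`-component is constant. -/
theorem apply_mlieBracket (h : AdaptedFrame S α R U e) (hα : S.IsPoppForm α)
    {V W : ∀ x : X, TangentSpace (𝓡 4) x} {x : X} (hx : x ∈ U) (hV : VFSmoothAt V x)
    (hW : VFSmoothAt W x) (hV' : ∃ c, ∀ y ∈ U, α y (V y) = c) (hW' : ∃ c, ∀ y ∈ U, α y (W y) = c) :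
    α x (VectorField.mlieBracket (𝓡 4) V W x) = -extD α x (V x) (W x) := by
  obtain ⟨c, hV'⟩ := hV'
  obtain ⟨d, hW'⟩ := hW'
  have h1 := form_mlieBracket (FormSmoothAt.diffAt (hα.smooth.contMDiffAt (x := x))) hV.diffAt
    hW.diffAt
  rw [dX_eq_zero_of_const h.isOpen hx hV', dX_eq_zero_of_const h.isOpen hx hW'] at h1
  simpa using h1

theorem structFn_three (h : AdaptedFrame S α R U e) (hα : S.IsPoppForm α) (hR : S.IsReeb α R)
    {x : X} (hx : x ∈ U) (j k : Fin 4) :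
    structFn S α e j k 3 x = -extD α x (e j x) (e k x) := by
  rw [structFn, coframe_three]
  exact h.apply_mlieBracket hα hx (h.smooth j x hx) (h.smooth k x hx) (h.apply_const hα hR j)
    (h.apply_const hα hR k)

theorem extD_zero [T2Space X] (h : AdaptedFrame S α R U e) (hα : S.IsPoppForm α)
    (hR : S.IsReeb α R) {x : X} (hx : x ∈ U) {w : TangentSpace (𝓡 4) x} (hw : w ∈ S.E x) :
    extD α x (e 0 x) w = 0 := ((mem_L_iff hα hR).1 (h.mem_L x hx)).2 w hw

theorem mem_L_iff_smul [T2Space X] (h : AdaptedFrame S α R U e) (hα : S.IsPoppForm α)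
    (hR : S.IsReeb α R) {x : X} (hx : x ∈ U) {l : TangentSpace (𝓡 4) x} :
    l ∈ S.L x ↔ ∃ c : ℝ, l = c • e 0 x := by
  constructor
  · intro hl
    obtain ⟨hlE, hl⟩ := (mem_L_iff hα hR).1 hl
    have hs := h.eq_sum_E hx hlE
    rw [Fin.sum_univ_three] at hs
    have h1 := hl _ (h.mem_E 1 x hx)
    have h2 := hl _ (h.mem_E 2 x hx)
    rw [hs] at h1 h2
    have h01 := h.extD_zero hα hR hx (h.mem_E 1 x hx)
    have h02 := h.extD_zero hα hR hx (h.mem_E 2 x hx)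
    have h12 := h.oriented x hx
    simp only [Fin.castSucc_zero, show (Fin.castSucc 1 : Fin 4) = 1 from rfl,
      show (Fin.castSucc 2 : Fin 4) = 2 from rfl] at h1 h2 hs h01 h02
    simp only [extD_add_left, extD_smul_left, h01, h02, extD_self, h12,
      extD_swap α x (e 2 x) (e 1 x)] at h1 h2
    have h3 : S.g x (e 1 x) l = 0 := by linarith
    have h4 : S.g x (e 2 x) l = 0 := by linarith
    rw [h3, h4, zero_smul, zero_smul, add_zero, add_zero] at hs
    exact ⟨_, hs⟩
  · rintro ⟨c, rfl⟩
    obtain ⟨h1, h2⟩ := (mem_L_iff hα hR).1 (h.mem_L x hx)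
    refine (mem_L_iff hα hR).2 ⟨(S.E x).smul_mem _ h1, fun w hw => ?_⟩
    rw [extD_smul_left, h2 w hw, mul_zero]

theorem mem_Lperp_iff [T2Space X] (h : AdaptedFrame S α R U e) (hα : S.IsPoppForm α)
    (hR : S.IsReeb α R) {x : X} (hx : x ∈ U) {v : TangentSpace (𝓡 4) x} :
    v ∈ S.Lperp x ↔ v ∈ S.E x ∧ S.g x (e 0 x) v = 0 := by
  refine and_congr_right fun _ => ⟨fun hv => ?_, fun hv z hz => ?_⟩
  · rw [S.symm_g]; exact hv _ (h.mem_L x hx)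
  · obtain ⟨c, rfl⟩ := (h.mem_L_iff_smul hα hR hx).1 hz
    rw [map_smul, S.symm_g x v, hv, smul_zero]

theorem extD_three_perp [T2Space X] (h : AdaptedFrame S α R U e) (hα : S.IsPoppForm α)
    (hR : S.IsReeb α R) {x : X} (hx : x ∈ U) :
    extD α x (e 3 x) (e 1 x) = 0 ∧ extD α x (e 3 x) (e 2 x) = 0 := by
  rw [h.last]
  constructor
  · exact hR.orthogonal x _ ((h.mem_Lperp_iff hα hR hx).2 ⟨h.mem_E 1 x hx, by
      simpa using h.orthonormal 0 1 x hx⟩)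
  · exact hR.orthogonal x _ ((h.mem_Lperp_iff hα hR hx).2 ⟨h.mem_E 2 x hx, by
      simpa using h.orthonormal 0 2 x hx⟩)

/-- The components along `R` of the brackets of an adapted frame. -/
theorem structFn_three_values [T2Space X] (h : AdaptedFrame S α R U e) (hα : S.IsPoppForm α)
    (hR : S.IsReeb α R) {x : X} (hx : x ∈ U) :
    structFn S α e 0 1 3 x = 0 ∧ structFn S α e 0 2 3 x = 0 ∧ structFn S α e 1 2 3 x = -1 ∧
      structFn S α e 1 3 3 x = 0 ∧ structFn S α e 2 3 3 x = 0 := by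
  simp only [h.structFn_three hα hR hx]
  obtain ⟨h1, h2⟩ := h.extD_three_perp hα hR hx
  refine ⟨?_, ?_, ?_, ?_, ?_⟩
  · rw [h.extD_zero hα hR hx (w := e 1 x) (h.mem_E 1 x hx), neg_zero]
  · rw [h.extD_zero hα hR hx (w := e 2 x) (h.mem_E 2 x hx), neg_zero]
  · rw [h.oriented x hx]
  · rw [extD_swap, h1, neg_zero, neg_zero]
  · rw [extD_swap, h2, neg_zero, neg_zero]

/-- The Jacobi identity for `Z, e₁, e₂`, evaluated by the Popp form. -/
theorem structFn_trace [T2Space X] (h : AdaptedFrame S α R U e) (hα : S.IsPoppForm α)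
    (hR : S.IsReeb α R) {x : X} (hx : x ∈ U) :
    structFn S α e 0 1 1 x + structFn S α e 0 2 2 x = structFn S α e 0 3 3 x := by
  have hs : ∀ j, VFSmoothAt (e j) x := fun j => h.smooth j x hx
  have hb : ∀ j k, VFSmoothAt (VectorField.mlieBracket (𝓡 4) (e j) (e k)) x := fun j k =>
    vfSmoothAt_mlieBracket (hs j) (hs k)
  have : IsManifold (𝓡 4) (minSmoothness ℝ 3) X := by
    rw [minSmoothness_of_isRCLikeNormedField]
    exact IsManifold.of_le (n := ∞) (WithTop.coe_le_coe.2 le_top)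
  have hle : minSmoothness ℝ 2 ≤ (∞ : WithTop ℕ∞) := by
    rw [minSmoothness_of_isRCLikeNormedField]
    exact WithTop.coe_le_coe.2 le_top
  have hj := VectorField.leibniz_identity_mlieBracket_apply (I := 𝓡 4) ((hs 0).of_le hle)
    ((hs 1).of_le hle) ((hs 2).of_le hle)
  have hj2 := congrArg (α x) hj
  have hc := fun j => h.apply_const hα hR j
  have h3 := fun y hy => h.structFn_three_values hα hR (x := y) hy
  -- The `R`-components of these three brackets are constant on all of `U`, so `apply_mlieBracket`
  -- also applies to the iterated brackets in the Jacobi identity.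
  have hcb : ∀ j k, (j = 0 ∧ k = 1 ∨ j = 0 ∧ k = 2 ∨ j = 1 ∧ k = 2) →
      ∃ c, ∀ y ∈ U, α y (VectorField.mlieBracket (𝓡 4) (e j) (e k) y) = c := by
    rintro j k (⟨rfl, rfl⟩ | ⟨rfl, rfl⟩ | ⟨rfl, rfl⟩)
    · exact ⟨0, fun y hy => by simpa [structFn, coframe_three] using (h3 y hy).1⟩
    · exact ⟨0, fun y hy => by simpa [structFn, coframe_three] using (h3 y hy).2.1⟩
    · exact ⟨-1, fun y hy => by simpa [structFn, coframe_three] using (h3 y hy).2.2.1⟩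
  rw [map_add, h.apply_mlieBracket hα hx (hs 0) (hb 1 2) (hc 0) (hcb 1 2 (by simp)),
    h.apply_mlieBracket hα hx (hb 0 1) (hs 2) (hcb 0 1 (by simp)) (hc 2),
    h.apply_mlieBracket hα hx (hs 1) (hb 0 2) (hc 1) (hcb 0 2 (by simp))] at hj2
  -- After expansion in the frame, `dα(e₁, e₂) = 1` selects `c_{01}^1` and `c_{02}^2`. The component
  -- `-1` of `[e₁, e₂]` along `R` leaves `dα(Z, R) = -c_{03}^3`, and the other values of `dα`
  -- vanish.
  simp only [h.mlieBracket_eq_sum hα hR hx, Fin.sum_univ_four] at hj2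
  obtain ⟨a1, a2, a3, a4, a5⟩ := h3 x hx
  obtain ⟨b1, b2⟩ := h.extD_three_perp hα hR hx
  have b3 := h.extD_zero hα hR hx (h.mem_E 1 x hx)
  have b4 := h.extD_zero hα hR hx (h.mem_E 2 x hx)
  have b5 := h.oriented x hx
  have b6 := h.structFn_three hα hR hx 0 3
  simp only [show (Fin.castSucc 1 : Fin 4) = 1 from rfl,
      show (Fin.castSucc 2 : Fin 4) = 2 from rfl] at b3 b4
  simp only [← extDBilin_apply, map_add, map_smul, LinearMap.add_apply, LinearMap.smul_apply,
    smul_eq_mul] at hj2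
  simp only [extDBilin_apply, a1, a2, a3, extD_self, b1, b2, b3, b4, b5,
    extD_swap α x (e 1 x) (e 3 x), extD_swap α x (e 1 x) (e 0 x)] at hj2
  rw [b6]
  linarith

end AdaptedFrame
end QCStructure

namespace QCStructure
open QuasiContact

variable {X : Type*} [TopologicalSpace X] [ChartedSpace E4 X] [IsManifold (𝓡 4) ∞ X]
  {S : QCStructure X} {α : ∀ x : X, CoFib X x} {R : ∀ x : X, TangentSpace (𝓡 4) x}
  {U : Set X} {e : Fin 4 → ∀ x : X, TangentSpace (𝓡 4) x}

/-! ### The characteristic variety and the circle action in an adapted frame -/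

theorem sharp_mem (p : CoTan X) : S.sharp p ∈ S.E p.1 := (S.exists_sharp p).choose_spec.1

theorem metric_sharp {p : CoTan X} {u : TangentSpace (𝓡 4) p.1} (hu : u ∈ S.E p.1) :
    S.g p.1 (S.sharp p) u = p.2 u := (S.exists_sharp p).choose_spec.2 u hu

theorem sigma_eq_zero_iff {p : CoTan X} : S.sigma p = 0 ↔ ∀ u ∈ S.E p.1, p.2 u = 0 := by
  constructor
  · intro h u hu
    have h0 : S.sharp p = 0 := by
      by_contra hne
      exact (S.pos_g p.1 _ (sharp_mem p) hne).ne' h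
    rw [← metric_sharp hu, h0, map_zero]; rfl
  · intro h
    rw [sigma, metric_sharp (sharp_mem p), h _ (sharp_mem p)]

theorem eq_smul_of_apply_E (hα : S.IsPoppForm α) (hR : S.IsReeb α R) {x : X} {ξ : CoFib X x}
    (h : ∀ u ∈ S.E x, ξ u = 0) : ξ = ξ (R x) • α x := by
  ext u
  have h1 := h _ (sub_smul_mem_E hα hR x u)
  rw [map_sub, map_smul, smul_eq_mul, sub_eq_zero] at h1
  rw [h1, smul_apply, smul_eq_mul, mul_comm]

/-- A covector that annihilates `E` is determined by its value on `R`, namely `ξ = ξ(R) α`. So `Σ`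
is parametrised by a base point and a nonzero real number. -/
theorem mem_Char_iff (hα : S.IsPoppForm α) (hR : S.IsReeb α R) {p : CoTan X} :
    p ∈ S.Char ↔ p.2 (R p.1) ≠ 0 ∧ p.2 = p.2 (R p.1) • α p.1 := by
  rw [Char, Set.mem_ofPred_eq, sigma_eq_zero_iff]
  constructor
  · rintro ⟨h0, h⟩
    have h1 := eq_smul_of_apply_E hα hR h
    exact ⟨fun h2 => h0 (by rw [h1, h2, zero_smul]), h1⟩
  · rintro ⟨h0, h1⟩
    refine ⟨fun h2 => h0 (by rw [h2]; rfl), fun u hu => ?_⟩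
    rw [h1, smul_apply, hα.apply_eq_zero hu, smul_zero]

theorem smul_mem_Char (hα : S.IsPoppForm α) (hR : S.IsReeb α R) (x : X) {c : ℝ} (hc : c ≠ 0) :
    (⟨x, c • α x⟩ : CoTan X) ∈ S.Char := by
  have : (c • α x) (R x) = c := by rw [smul_apply, hR.normalized, smul_eq_mul, mul_one]
  refine (mem_Char_iff hα hR).2 ⟨?_, ?_⟩
  · change (c • α x) (R x) ≠ 0
    rw [this]; exact hc
  · change c • α x = (c • α x) (R x) • α x
    rw [this]

theorem mem_SN_iff (hα : S.IsPoppForm α) (hR : S.IsReeb α R) {q : CoTanSum X} :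
    q ∈ S.SN ↔ q.2.1 (R q.1) ≠ 0 ∧ q.2.1 = q.2.1 (R q.1) • α q.1 ∧ q.2.2 ∈ S.E q.1 ∧
      S.g q.1 q.2.2 q.2.2 = 1 := by
  constructor
  · rintro ⟨⟨_, h2, h3, _⟩, h5⟩
    obtain ⟨h6, h7⟩ := (mem_Char_iff hα hR).1 h5
    exact ⟨h6, h7, h2, h3⟩
  · rintro ⟨h1, h2, h3, h4⟩
    have h5 : beta q ∈ S.Char := (mem_Char_iff hα hR).2 ⟨h1, h2⟩
    refine ⟨⟨h5.1, h3, h4, 0, le_rfl, fun u hu => ?_⟩, h5⟩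
    rw [zero_mul]
    exact sigma_eq_zero_iff.1 h5.2 u hu

/-- The function `α(V)` is identically zero; this is its derivative, by the product rule in the
chart. It converts derivatives of `V` into derivatives of `α`, so that only the value of `V` at the
point remains. -/
theorem dX_form_vf_eq_zero (hα : S.IsPoppForm α) {V : ∀ x : X, TangentSpace (𝓡 4) x}
    (hV : SmoothVF V) (hE : ∀ x, V x ∈ S.E x) (x : X) (u : E4) :
    formDeriv α x u (V x) + α x (vfDeriv V x u) = 0 := by
  have h := mfderiv_form_vf (FormSmoothAt.diffAt (hα.smooth.contMDiffAt (x := x)))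
    (VFSmoothAt.diffAt hV.contMDiffAt) u
  rw [← h]
  exact AdaptedFrame.dX_eq_zero_of_const (U := univ) (c := 0) isOpen_univ (mem_univ x)
    (fun y _ => hα.apply_eq_zero (hE y)) u

/-- The differential of `σ(V)` at a point of `Σ`, for a section `V` of `E`. -/
theorem dC_symb_char (hα : S.IsPoppForm α) {V : ∀ x : X, TangentSpace (𝓡 4) x}
    (hV : SmoothVF V) (hE : ∀ x, V x ∈ S.E x) (x : X) (c : ℝ) (w : E4 × (E4 →L[ℝ] ℝ)) :
    dC (symb V) ⟨x, c • α x⟩ w = w.2 (V x) - c * formDeriv α x w.1 (V x) := by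
  have h := dX_form_vf_eq_zero hα hV hE x w.1
  refine (dC_symb (p := ⟨x, c • α x⟩) (VFSmoothAt.diffAt hV.contMDiffAt) w).trans ?_
  have h2 : ((c • α x : CoFib X x)) (vfDeriv V x w.1) = c * α x (vfDeriv V x w.1) := rfl
  refine (congrArg (fun t : ℝ => w.2 (V x) + t) h2).trans ?_
  linear_combination c * h

/-- For a section `V` of `E` the function `σ(V)` is smooth and vanishes on `Σ`, hence is annihilated
by tangent vectors. These equations are all that is needed about an arbitrary tangent vector of `Σ`.
-/
theorem tangentTo_char_snd [T2Space X] (hα : S.IsPoppForm α) (hR : S.IsReeb α R) {x : X} {c : ℝ}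
    {t : E4 × (E4 →L[ℝ] ℝ)}
    (ht : t ∈ tangentTo IC S.Char (⟨x, c • α x⟩ : CoTan X)) {v : TangentSpace (𝓡 4) x}
    (hv : v ∈ S.E x) : t.2 v = c * formDeriv α x t.1 v := by
  obtain ⟨V, hV, hVx, hVE⟩ := exists_smoothVF_E hα hR hv
  have h1 := ht (symb V) (contMDiffAt_symb hV.contMDiffAt) (by
    filter_upwards [self_mem_nhdsWithin] with s hs
    exact sigma_eq_zero_iff.1 hs.2 _ (hVE s.1))
  have h2 := (dC_symb_char hα hV hVE x c t).symm.trans h1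
  rw [hVx] at h2
  exact sub_eq_zero.1 h2

/-- A function that vanishes on `A` vanishes after composition with `Φ`, and the chain rule applies.
This is how tangent vectors are produced. -/
theorem mem_tangentTo_of_curve {E H M E' H' N : Type*} [NormedAddCommGroup E] [NormedSpace ℝ E]
    [TopologicalSpace H] {I : ModelWithCorners ℝ E H} [TopologicalSpace M] [ChartedSpace H M]
    [NormedAddCommGroup E'] [NormedSpace ℝ E'] [TopologicalSpace H']
    {I' : ModelWithCorners ℝ E' H'} [TopologicalSpace N] [ChartedSpace H' N]
    {A : Set M} {Φ : N → M} {n : N} {Φ' : TangentSpace I' n →L[ℝ] TangentSpace I (Φ n)}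
    (h : HasMFDerivAt I' I Φ n Φ')
    (hA : ∀ᶠ s in 𝓝 n, Φ s ∈ A) (u : TangentSpace I' n) :
    Φ' u ∈ tangentTo I A (Φ n) := by
  intro F hF hF0
  have h1 : Tendsto Φ (𝓝 n) (𝓝[A] (Φ n)) := tendsto_nhdsWithin_iff.2 ⟨h.1, hA⟩
  have h2 := h1.eventually hF0
  have h3 := HasMFDerivAt.comp (g := F) (f := Φ) n (hF.mdifferentiableAt (by simp)).hasMFDerivAt h
  have h4 : HasMFDerivAt I' 𝓘(ℝ, ℝ) (F ∘ Φ) n 0 :=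
    (hasMFDerivAt_const (I := I') (I' := 𝓘(ℝ, ℝ)) (0 : ℝ) n).congr_of_eventuallyEq h2
  exact congrArg (fun l : E' →L[ℝ] ℝ => l u) (hasMFDerivAt_unique h3 h4)

/-- The section `x ↦ c α(x)` takes values in `Σ`; its differential supplies the tangent vectors that
project onto the whole of `TX`. -/
theorem mem_tangentTo_char_section (hα : S.IsPoppForm α) (hR : S.IsReeb α R) (x : X) {c : ℝ}
    (hc : c ≠ 0) (u : E4) :
    ((u, c • formDeriv α x u) : E4 × (E4 →L[ℝ] ℝ)) ∈
      tangentTo IC S.Char (⟨x, c • α x⟩ : CoTan X) := by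
  have hs : FormSmoothAt (fun y => c • α y) x :=
    ContMDiffAt.const_smul_section hα.smooth.contMDiffAt
  have h1 := mem_tangentTo_of_curve (A := S.Char) hs.diffAt.hasMFDerivAt
    (Eventually.of_forall fun y => smul_mem_Char hα hR y hc) u
  have h2 : formDeriv (fun y => c • α y) x = c • formDeriv α x := by
    have ha := hasMFDerivAt_form (FormSmoothAt.diffAt (hα.smooth.contMDiffAt (x := x)))
    have hb := hasMFDerivAt_form hs.diffAt
    have hc' : HasMFDerivAt (𝓡 4) 𝓘(ℝ, E4 →L[ℝ] ℝ)
      (fun y => (trivializationAt (E4 →L[ℝ] ℝ) (CoFib X) x ⟨y, c • α y⟩).2) x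
        (c • formDeriv α x) := by
      refine (ha.const_smul c).congr_of_eventuallyEq ?_
      filter_upwards [(chartAt E4 x).open_source.mem_nhds (mem_chart_source E4 x)] with y hy
      have hl : y ∈ (trivializationAt (E4 →L[ℝ] ℝ) (CoFib X) x).baseSet := by
        rw [hom_trivializationAt_baseSet]
        exact ⟨hy, mem_univ _⟩
      exact ((trivializationAt (E4 →L[ℝ] ℝ) (CoFib X) x).linear ℝ hl).map_smul c (α y)
    exact hasMFDerivAt_unique hb hc'
  have h3 := mfderiv_form_fst hs.diffAt u
  rw [h2] at h3
  have h4 : (mfderiv (𝓡 4) IC (fun x => (⟨x, c • α x⟩ : CoTan X)) x u : E4 × (E4 →L[ℝ] ℝ)) ∈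
    tangentTo IC S.Char (⟨x, c • α x⟩ : CoTan X) := h1
  rw [h3] at h4
  exact h4

end QCStructure

/-! ### The symplectic complement of `TΣ`, the splitting of `NΣ` and `𝔍` in a frame -/

namespace QCStructure
open QuasiContact

variable {X : Type*} [TopologicalSpace X] [ChartedSpace E4 X] [IsManifold (𝓡 4) ∞ X]
  {S : QCStructure X} {α : ∀ x : X, CoFib X x} {R : ∀ x : X, TangentSpace (𝓡 4) x}
  {U : Set X} {e : Fin 4 → ∀ x : X, TangentSpace (𝓡 4) x}

theorem hasMFDerivAt_totalSpace {EB HB B F E H N : Type*} [NormedAddCommGroup EB]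
    [NormedSpace ℝ EB] [TopologicalSpace HB]
    {IB : ModelWithCorners ℝ EB HB} [TopologicalSpace B] [ChartedSpace HB B] [IsManifold IB 1 B]
    [NormedAddCommGroup F] [NormedSpace ℝ F] {V : B → Type*}
    [TopologicalSpace (Bundle.TotalSpace F V)]
    [∀ b, AddCommGroup (V b)] [∀ b, Module ℝ (V b)] [∀ b, TopologicalSpace (V b)]
    [FiberBundle F V] [VectorBundle ℝ F V] [ContMDiffVectorBundle 1 F V IB]
    [NormedAddCommGroup E] [NormedSpace ℝ E]
    [TopologicalSpace H] {I : ModelWithCorners ℝ E H} [TopologicalSpace N] [ChartedSpace H N]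
    {f : N → Bundle.TotalSpace F V} {n : N} {f₁ : E →L[ℝ] EB} {f₂ : E →L[ℝ] F}
    (h₁ : HasMFDerivAt I IB (fun m => (f m).proj) n f₁)
    (h₂ : HasMFDerivAt I 𝓘(ℝ, F) (fun m => (trivializationAt F V (f n).proj (f m)).2) n f₂) :
    HasMFDerivAt I (IB.prod 𝓘(ℝ, F)) f n (f₁.prod f₂) := by
  have hd : MDifferentiableAt I (IB.prod 𝓘(ℝ, F)) f n :=
    (mdifferentiableAt_totalSpace IB f).2 ⟨h₁.mdifferentiableAt, h₂.mdifferentiableAt⟩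
  have h3 := HasMFDerivAt.comp (f := f) n (hasMFDerivAt_proj (IB := IB) (V := V) (f n))
    hd.hasMFDerivAt
  have h4 := HasMFDerivAt.comp (f := f) n (hasMFDerivAt_trivializationAt_snd (IB := IB) (V := V)
    (f n)) hd.hasMFDerivAt
  have h5 := hasMFDerivAt_unique h3 h₁
  have h6 := hasMFDerivAt_unique h4 h₂
  have h7 : mfderiv I (IB.prod 𝓘(ℝ, F)) f n = f₁.prod f₂ := by
    refine ContinuousLinearMap.ext fun v => Prod.ext ?_ ?_
    · exact congrArg (fun l : E →L[ℝ] EB => l v) h5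
    · exact congrArg (fun l : E →L[ℝ] F => l v) h6
  rw [← h7]
  exact hd.hasMFDerivAt

/-- Here the curve is the ray `t ↦ t α(x)` in the fibre of `Σ`. Together with the lifts from the
base it tests membership in the symplectic complement. -/
theorem mem_tangentTo_char_vertical (hα : S.IsPoppForm α) (hR : S.IsReeb α R) (x : X) {c : ℝ}
    (hc : c ≠ 0) :
    ((0, (show E4 →L[ℝ] ℝ from α x)) : E4 × (E4 →L[ℝ] ℝ)) ∈
      tangentTo IC S.Char (⟨x, c • α x⟩ : CoTan X) := by
  let f : ℝ → CoTan X := fun t => ⟨x, t • α x⟩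
  have h1 : HasMFDerivAt 𝓘(ℝ, ℝ) (𝓡 4) (fun t => (f t).proj) c (0 : ℝ →L[ℝ] E4) :=
    hasMFDerivAt_const (I := 𝓘(ℝ, ℝ)) (I' := 𝓡 4) x c
  have hx : x ∈ (trivializationAt (E4 →L[ℝ] ℝ) (CoFib X) x).baseSet :=
    FiberBundle.mem_baseSet_trivializationAt' x
  have h2 : HasMFDerivAt 𝓘(ℝ, ℝ) 𝓘(ℝ, E4 →L[ℝ] ℝ)
      (fun t => (trivializationAt (E4 →L[ℝ] ℝ) (CoFib X) (f c).proj (f t)).2) c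
      ((ContinuousLinearMap.id ℝ ℝ).smulRight (show E4 →L[ℝ] ℝ from α x)) := by
    have h3 : (fun t => (trivializationAt (E4 →L[ℝ] ℝ) (CoFib X) (f c).proj (f t)).2) =
        fun t => t • (show E4 →L[ℝ] ℝ from α x) := by
      funext t
      exact trivializationAt_coTan_self (⟨x, t • α x⟩ : CoTan X)
    rw [h3]
    exact ((hasFDerivAt_id c).smul_const (show E4 →L[ℝ] ℝ from α x)).hasMFDerivAt
  have h3 := mem_tangentTo_of_curve (A := S.Char) (hasMFDerivAt_totalSpace h1 h2) (by
    filter_upwards [isOpen_ne.mem_nhds hc] with t ht using smul_mem_Char hα hR x ht) (1 : ℝ)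
  have h4 : (((0 : ℝ →L[ℝ] E4).prod ((ContinuousLinearMap.id ℝ ℝ).smulRight
      (show E4 →L[ℝ] ℝ from α x))) (1 : ℝ) : E4 × (E4 →L[ℝ] ℝ)) =
      (0, (show E4 →L[ℝ] ℝ from α x)) := by
    refine Prod.ext rfl ?_
    exact one_smul ℝ _
  rw [← h4]
  exact h3

/-- Orthogonality to the fibre direction forces the base component into `ker α = E`, and
orthogonality to the lifts `(u, c Dα u)` then determines the fibre component. Conversely,
`tangentTo_char_snd` controls every tangent vector on `E`. The complement is thus a copy of `E`,
through the base component. -/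
theorem mem_symplCompl_iff [T2Space X] (hα : S.IsPoppForm α) (hR : S.IsReeb α R) {x : X} {c : ℝ}
    (hc : c ≠ 0) {w : E4 × (E4 →L[ℝ] ℝ)} :
    w ∈ S.symplCompl (⟨x, c • α x⟩ : CoTan X) ↔
      (w.1 : TangentSpace (𝓡 4) x) ∈ S.E x ∧ ∀ u : E4, w.2 u = c * formDeriv α x u w.1 := by
  constructor
  · intro h
    refine ⟨(hα.ker_eq x w.1).1 ?_, fun u => ?_⟩
    · have h1 := h _ (mem_tangentTo_char_vertical hα hR x hc)
      have h2 : α x w.1 - w.2 0 = 0 := h1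
      rwa [map_zero, sub_zero] at h2
    · have h1 := h _ (mem_tangentTo_char_section hα hR x hc u)
      have h2 : c * formDeriv α x u w.1 - w.2 u = 0 := h1
      linarith
  · rintro ⟨h1, h2⟩ t ht
    have h3 := tangentTo_char_snd hα hR ht h1
    have h4 := h2 t.1
    change t.2 w.1 - w.2 t.1 = 0
    exact sub_eq_zero.2 (h3.trans h4.symm)

theorem mul_extD (α : ∀ x : X, CoFib X x) (x : X) (c : ℝ) (u v : E4) :
    c * extD α x u v = c * formDeriv α x u v - c * formDeriv α x v u := mul_sub _ _ _

/-- The derivative of `σ(V)` along `w` contains the derivative of `α` in one order of arguments, and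
the fibre component of `w` contains it in the other; together they form `c dα`. Hence `N₁Σ` consists
of the metric duals of the forms `c dα(·, w)` on `E`, for `w ∈ E`. -/
theorem isNormalClass_iff [T2Space X] (hα : S.IsPoppForm α) (hR : S.IsReeb α R) {x : X} {c : ℝ}
    (hc : c ≠ 0) {w : E4 × (E4 →L[ℝ] ℝ)} (hw : w ∈ S.symplCompl (⟨x, c • α x⟩ : CoTan X))
    {v : TangentSpace (𝓡 4) x} :
    S.IsNormalClass (⟨x, c • α x⟩ : CoTan X) w v ↔
      v ∈ S.E x ∧ ∀ u ∈ S.E x, S.g x v u = c * extD α x u w.1 := by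
  obtain ⟨h1, h2⟩ := (mem_symplCompl_iff hα hR hc).1 hw
  refine and_congr_right fun _ => ⟨fun h u hu => ?_, fun h V hV hE => ?_⟩
  · obtain ⟨V, hV, hVx, hVE⟩ := exists_smoothVF_E hα hR hu
    have h3 := h V hV hVE
    rw [dC_symb_char hα hV hVE] at h3
    change _ = S.g x v (V x) at h3
    rw [hVx] at h3
    exact h3.symm.trans ((congrArg (fun t : ℝ => t - _) (h2 u)).trans (mul_extD α x c u w.1).symm)
  · rw [dC_symb_char hα hV hE]
    change _ = S.g x v (V x)
    rw [h _ (hE x)]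
    exact (congrArg (fun t : ℝ => t - _) (h2 (V x))).trans (mul_extD α x c (V x) w.1).symm

theorem exists_symplCompl [T2Space X] (hα : S.IsPoppForm α) (hR : S.IsReeb α R) {x : X} {c : ℝ}
    (hc : c ≠ 0) {u : TangentSpace (𝓡 4) x} (hu : u ∈ S.E x) :
    ∃ w ∈ S.symplCompl (⟨x, c • α x⟩ : CoTan X), w.1 = u := by
  refine ⟨((show E4 from u), c • (ContinuousLinearMap.apply ℝ ℝ (show E4 from u)).comp
    (formDeriv α x)), (mem_symplCompl_iff hα hR hc).2 ⟨hu, fun z => rfl⟩, rfl⟩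

/-- The fibre components of both vectors are given by `Dα`, and `ω` antisymmetrises them. So `ω₀`
becomes `c dα` on the base components. -/
theorem omega_symplCompl [T2Space X] (hα : S.IsPoppForm α) (hR : S.IsReeb α R) {x : X} {c : ℝ}
    (hc : c ≠ 0) {w w' : E4 × (E4 →L[ℝ] ℝ)} (hw : w ∈ S.symplCompl (⟨x, c • α x⟩ : CoTan X))
    (hw' : w' ∈ S.symplCompl (⟨x, c • α x⟩ : CoTan X)) :
    omega w w' = c * extD α x w.1 w'.1 := by
  have h1 := ((mem_symplCompl_iff hα hR hc).1 hw).2 w'.1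
  have h2 := ((mem_symplCompl_iff hα hR hc).1 hw').2 w.1
  change w'.2 w.1 - w.2 w'.1 = _
  rw [h1, h2]
  exact (mul_extD α x c w.1 w'.1).symm

namespace AdaptedFrame


theorem metric_frame (h : AdaptedFrame S α R U e) {x : X} (hx : x ∈ U) (v w : Fin 3 → ℝ) :
    S.g x (∑ i, v i • e (Fin.castSucc i) x) (∑ i, w i • e (Fin.castSucc i) x) = ∑ i, v i * w i := by
  change S.gBilin x _ _ = _
  simp only [map_sum, map_smul, LinearMap.sum_apply, LinearMap.smul_apply, smul_eq_mul,
    gBilin_apply, h.orthonormal _ _ x hx]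
  simp [mul_comm]

theorem frame_mem_E (h : AdaptedFrame S α R U e) {x : X} (hx : x ∈ U) (v : Fin 3 → ℝ) :
    ∑ i, v i • e (Fin.castSucc i) x ∈ S.E x :=
  (S.E x).sum_mem fun i _ => (S.E x).smul_mem _ (h.mem_E i x hx)

theorem exists_coords (h : AdaptedFrame S α R U e) {x : X} (hx : x ∈ U)
    {v : TangentSpace (𝓡 4) x} (hv : v ∈ S.E x) :
    ∃ c : Fin 3 → ℝ, v = ∑ i, c i • e (Fin.castSucc i) x := ⟨_, h.eq_sum_E hx hv⟩

theorem extD_frame [T2Space X] (h : AdaptedFrame S α R U e) (hα : S.IsPoppForm α)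
    (hR : S.IsReeb α R) {x : X} (hx : x ∈ U) (v w : Fin 3 → ℝ) :
    extD α x (∑ i, v i • e (Fin.castSucc i) x) (∑ i, w i • e (Fin.castSucc i) x) =
      v 1 * w 2 - v 2 * w 1 := by
  have h0 : ∀ i : Fin 3, extD α x (e 0 x) (e i.castSucc x) = 0 := fun i =>
    h.extD_zero hα hR hx (h.mem_E i x hx)
  have h0' : ∀ i : Fin 3, extD α x (e i.castSucc x) (e 0 x) = 0 := fun i => by
    rw [extD_swap, h0, neg_zero]
  have h1 := h0' 1
  have h2 := h0' 2
  have h3 := h0 1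
  have h4 := h0 2
  have h5 := h.oriented x hx
  have h6 : extD α x (e 2 x) (e 1 x) = -1 := by rw [extD_swap, h5]
  simp only [show (Fin.castSucc 1 : Fin 4) = 1 from rfl,
      show (Fin.castSucc 2 : Fin 4) = 2 from rfl] at h1 h2 h3 h4
  simp only [Fin.sum_univ_three, Fin.castSucc_zero, show (Fin.castSucc 1 : Fin 4) = 1 from rfl,
      show (Fin.castSucc 2 : Fin 4) = 2 from rfl]
  simp only [← extDBilin_apply, map_add, map_smul, LinearMap.add_apply, LinearMap.smul_apply,
    smul_eq_mul]
  simp only [extDBilin_apply, h1, h2, h3, h4, h5, h6, extD_self]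
  ring

/-- `Z` lies in the radical of `dα|_E`, so the metric dual of `dα(·, w)` has no `Z`-component; on
`e₁, e₂` the form `dα` is invertible. -/
theorem mem_N1_iff [T2Space X] (h : AdaptedFrame S α R U e) (hα : S.IsPoppForm α)
    (hR : S.IsReeb α R) {x : X} (hx : x ∈ U) {c : ℝ} (hc : c ≠ 0) (v : Fin 3 → ℝ) :
    (∑ i, v i • e (Fin.castSucc i) x) ∈ S.N1 (⟨x, c • α x⟩ : CoTan X) ↔ v 0 = 0 := by
  constructor
  · rintro ⟨w, hw, hv⟩
    obtain ⟨-, h2⟩ := (isNormalClass_iff hα hR hc hw).1 hv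
    have h3 := h2 _ (h.frame_mem_E hx ![1, 0, 0])
    obtain ⟨d, hd⟩ := h.exists_coords hx ((mem_symplCompl_iff hα hR hc).1 hw).1
    rw [hd, h.extD_frame hα hR hx, h.metric_frame hx] at h3
    simpa [Fin.sum_univ_three] using h3
  · intro h0
    -- Since `dα(u, w) = u₁ w₂ - u₂ w₁`, the vector `w` is `v / c` turned by a right angle.
    obtain ⟨w, hw, hw1⟩ := exists_symplCompl hα hR hc (h.frame_mem_E hx ![0, -(v 2 / c), v 1 / c])
    refine ⟨w, hw, (isNormalClass_iff hα hR hc hw).2 ⟨h.frame_mem_E hx v, fun u hu => ?_⟩⟩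
    obtain ⟨d, rfl⟩ := h.exists_coords hx hu
    rw [hw1, h.extD_frame hα hR hx, h.metric_frame hx]
    simp [Fin.sum_univ_three, h0]
    field_simp

theorem N1_subset_E {p : CoTan X} {v : TangentSpace (𝓡 4) p.1} (hv : v ∈ S.N1 p) : v ∈ S.E p.1 := by
  obtain ⟨w, _, hw⟩ := hv
  exact hw.1

theorem mem_N0_iff [T2Space X] (h : AdaptedFrame S α R U e) (hα : S.IsPoppForm α)
    (hR : S.IsReeb α R) {x : X} (hx : x ∈ U) {c : ℝ} (hc : c ≠ 0) (v : Fin 3 → ℝ) :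
    (∑ i, v i • e (Fin.castSucc i) x) ∈ S.N0 (⟨x, c • α x⟩ : CoTan X) ↔ v 1 = 0 ∧ v 2 = 0 := by
  constructor
  · rintro ⟨-, h2⟩
    have h3 := h2 _ ((h.mem_N1_iff hα hR hx hc ![0, 1, 0]).2 rfl)
    have h4 := h2 _ ((h.mem_N1_iff hα hR hx hc ![0, 0, 1]).2 rfl)
    change S.g x _ _ = 0 at h3 h4
    rw [h.metric_frame hx] at h3 h4
    simp [Fin.sum_univ_three] at h3 h4
    exact ⟨h3, h4⟩
  · rintro ⟨h1, h2⟩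
    refine ⟨h.frame_mem_E hx v, fun u hu => ?_⟩
    obtain ⟨d, rfl⟩ := h.exists_coords hx (N1_subset_E hu)
    have h3 := (h.mem_N1_iff hα hR hx hc d).1 hu
    refine (h.metric_frame hx v d).trans ?_
    simp [Fin.sum_univ_three, h1, h2, h3]

theorem frame_sub (x : X) (v w : Fin 3 → ℝ) :
    ∑ i, v i • e (Fin.castSucc i) x - ∑ i, w i • e (Fin.castSucc i) x =
      ∑ i, (v i - w i) • e (Fin.castSucc i) x := by
  simp only [sub_smul, Finset.sum_sub_distrib]

/-- The decomposition in `N₀Σ ⊕ N₁Σ` exists and is unique, so the choice operator can only return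
the `Z`-component. -/
theorem proj0_eq [T2Space X] (h : AdaptedFrame S α R U e) (hα : S.IsPoppForm α)
    (hR : S.IsReeb α R) {x : X} (hx : x ∈ U) {c : ℝ} (hc : c ≠ 0) (v : Fin 3 → ℝ) :
    S.proj0 (⟨x, c • α x⟩ : CoTan X) (∑ i, v i • e (Fin.castSucc i) x) =
      ∑ i, ![v 0, 0, 0] i • e (Fin.castSucc i) x := by
  have hex : ∃ v0, v0 ∈ S.N0 (⟨x, c • α x⟩ : CoTan X) ∧
      (∑ i, v i • e (Fin.castSucc i) x) - v0 ∈ S.N1 (⟨x, c • α x⟩ : CoTan X) := by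
    refine ⟨∑ i, ![v 0, 0, 0] i • e (Fin.castSucc i) x,
      (h.mem_N0_iff hα hR hx hc _).2 ⟨rfl, rfl⟩, ?_⟩
    rw [frame_sub]
    exact (h.mem_N1_iff hα hR hx hc _).2 (sub_self _)
  obtain ⟨h1, h2⟩ := Classical.epsilon_spec hex
  change S.proj0 (⟨x, c • α x⟩ : CoTan X) _ ∈ _ at h1
  change _ - S.proj0 (⟨x, c • α x⟩ : CoTan X) _ ∈ _ at h2
  obtain ⟨d, hd⟩ := h.exists_coords hx h1.1
  rw [hd] at h1 h2 ⊢
  have h3 := (h.mem_N0_iff hα hR hx hc _).1 h1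
  rw [frame_sub] at h2
  have h4 := (h.mem_N1_iff hα hR hx hc _).1 h2
  congr 1
  funext i
  fin_cases i
  · simp only [Fin.zero_eta]
    rw [← sub_eq_zero.1 h4]; rfl
  · simp [h3.1]
  · simp [h3.2]

/-- In frame components `c ω₀(u, v) = u₁ v₂ - u₂ v₁`. So `𝔍` is a right angle rotation divided by
`c`, and its direction depends on the sign of `c`. The scalar allowed in `IsJ` is pinned down by the
condition on lengths. -/
theorem J_eq [T2Space X] (h : AdaptedFrame S α R U e) (hα : S.IsPoppForm α)
    (hR : S.IsReeb α R) {x : X} (hx : x ∈ U) {c : ℝ} (hc : c ≠ 0) {v : Fin 3 → ℝ} (hv : v 0 = 0) :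
    S.J (⟨x, c • α x⟩ : CoTan X) (∑ i, v i • e (Fin.castSucc i) x) =
      ∑ i, ![0, SignType.sign c * v 2, -(SignType.sign c * v 1)] i • e (Fin.castSucc i) x := by
  have hs : (SignType.sign c : ℝ) * SignType.sign c = 1 := by
    rcases lt_or_gt_of_ne hc with h | h
    · simp [sign_neg h]
    · simp [sign_pos h]
  have hsc : (SignType.sign c : ℝ) * c = |c| := sign_mul_self c
  -- the coordinates of the symplectic lifts
  have hcl : ∀ {u : Fin 3 → ℝ} {w : E4 × (E4 →L[ℝ] ℝ)},
      w ∈ S.symplCompl (⟨x, c • α x⟩ : CoTan X) →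
      S.IsNormalClass (⟨x, c • α x⟩ : CoTan X) w (∑ i, u i • e (Fin.castSucc i) x) →
      ∃ d : Fin 3 → ℝ, (w.1 : TangentSpace (𝓡 4) x) = ∑ i, d i • e (Fin.castSucc i) x ∧
        u 1 = c * d 2 ∧ u 2 = -(c * d 1) := by
    intro u w hw hu
    obtain ⟨-, h2⟩ := (isNormalClass_iff hα hR hc hw).1 hu
    obtain ⟨d, hd⟩ := h.exists_coords hx ((mem_symplCompl_iff hα hR hc).1 hw).1
    have h3 := h2 _ (h.frame_mem_E hx ![0, 1, 0])
    have h4 := h2 _ (h.frame_mem_E hx ![0, 0, 1])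
    rw [hd, h.extD_frame hα hR hx, h.metric_frame hx] at h3 h4
    simp [Fin.sum_univ_three] at h3 h4
    exact ⟨d, hd, h3, h4⟩
  have hom : ∀ {u : Fin 3 → ℝ} {wu wv : E4 × (E4 →L[ℝ] ℝ)},
      wu ∈ S.symplCompl (⟨x, c • α x⟩ : CoTan X) → wv ∈ S.symplCompl (⟨x, c • α x⟩ : CoTan X) →
      S.IsNormalClass (⟨x, c • α x⟩ : CoTan X) wu (∑ i, u i • e (Fin.castSucc i) x) →
      S.IsNormalClass (⟨x, c • α x⟩ : CoTan X) wv (∑ i, v i • e (Fin.castSucc i) x) →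
      c * omega wu wv = u 1 * v 2 - u 2 * v 1 := by
    intro u wu wv hwu hwv hu hv
    obtain ⟨d, hd, h1, h2⟩ := hcl hwu hu
    obtain ⟨d', hd', h1', h2'⟩ := hcl hwv hv
    have h3 := omega_symplCompl hα hR hc hwu hwv
    rw [hd, hd', h.extD_frame hα hR hx] at h3
    rw [h3, h1, h2, h1', h2']
    ring
  have hex : ∃ j, S.IsJ (⟨x, c • α x⟩ : CoTan X) (∑ i, v i • e (Fin.castSucc i) x) j := by
    refine ⟨∑ i, ![0, SignType.sign c * v 2, -(SignType.sign c * v 1)] i • e (Fin.castSucc i) x,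
      (h.mem_N1_iff hα hR hx hc _).2 rfl, ?_, |c|, abs_pos.2 hc, ?_⟩
    · refine (h.metric_frame hx _ _).trans (Eq.trans ?_ (h.metric_frame hx _ _).symm)
      simp [Fin.sum_univ_three, hv]
      linear_combination (v 2 * v 2 + v 1 * v 1) * hs
    · intro u hu wu hwu wv hwv hcu hcv
      obtain ⟨u', rfl⟩ := h.exists_coords hx (N1_subset_E hu)
      refine (h.metric_frame hx _ _).trans ?_
      rw [← hsc, mul_assoc, hom hwu hwv hcu hcv]
      simp [Fin.sum_univ_three]
      ring
  obtain ⟨h1, h2, k, hk, h3⟩ := Classical.epsilon_spec hex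
  change S.J (⟨x, c • α x⟩ : CoTan X) _ ∈ _ at h1
  change S.g x (S.J (⟨x, c • α x⟩ : CoTan X) _) (S.J (⟨x, c • α x⟩ : CoTan X) _) = _ at h2
  change ∀ u ∈ _, ∀ wu ∈ _, ∀ wv ∈ _, _ → _ →
    S.g x u (S.J (⟨x, c • α x⟩ : CoTan X) _) = _ at h3
  obtain ⟨d, hd⟩ := h.exists_coords hx (N1_subset_E h1)
  change S.J (⟨x, c • α x⟩ : CoTan X) _ = _ at hd
  rw [hd] at h1 h2 h3 ⊢
  have h0 := (h.mem_N1_iff hα hR hx hc _).1 h1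
  have h2' : ∑ i, d i * d i = ∑ i, v i * v i :=
    (h.metric_frame hx _ _).symm.trans (h2.trans (h.metric_frame hx _ _))
  obtain ⟨wv, hwv, hcv⟩ := (h.mem_N1_iff hα hR hx hc _).2 hv
  have h4 : ∀ u : Fin 3 → ℝ, u 0 = 0 → c * ∑ i, u i * d i = k * (u 1 * v 2 - u 2 * v 1) := by
    intro u hu
    obtain ⟨wu, hwu, hcu⟩ := (h.mem_N1_iff hα hR hx hc _).2 hu
    have h5 := h3 _ ((h.mem_N1_iff hα hR hx hc _).2 hu) wu hwu wv hwv hcu hcv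
    rw [h.metric_frame hx] at h5
    rw [h5, ← hom hwu hwv hcu hcv]
    ring
  have h5 := h4 ![0, 1, 0] rfl
  have h6 := h4 ![0, 0, 1] rfl
  simp [Fin.sum_univ_three] at h5 h6 h2'
  rw [hv, h0] at h2'
  -- normalisation of the constant
  have h7 : (k ^ 2 - c ^ 2) * (v 1 * v 1 + v 2 * v 2) = 0 := by
    have : c ^ 2 * (d 1 * d 1 + d 2 * d 2) = k ^ 2 * (v 1 * v 1 + v 2 * v 2) := by
      linear_combination (c * d 1 + k * v 2) * h5 + (c * d 2 - k * v 1) * h6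
    linear_combination -this + c ^ 2 * h2'
  have h8 : k * v 2 = |c| * v 2 ∧ k * v 1 = |c| * v 1 := by
    rcases mul_eq_zero.1 h7 with h9 | h9
    · have : k = |c| := by
        rw [← abs_of_pos hk]
        exact (sq_eq_sq_iff_abs_eq_abs _ _).1 (sub_eq_zero.1 h9)
      rw [this]; exact ⟨rfl, rfl⟩
    · have h10 : v 1 = 0 := by nlinarith [mul_self_nonneg (v 1), mul_self_nonneg (v 2)]
      have h11 : v 2 = 0 := by nlinarith [mul_self_nonneg (v 1), mul_self_nonneg (v 2)]
      rw [h10, h11]; simp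
  have h9 : d 1 = SignType.sign c * v 2 := by
    refine mul_left_cancel₀ hc ?_
    rw [h5, h8.1, ← hsc]; ring
  have h10 : d 2 = -(SignType.sign c * v 1) := by
    refine mul_left_cancel₀ hc ?_
    rw [h6, h8.2, ← hsc]; ring
  congr 1
  funext i
  fin_cases i
  · simp [h0]
  · simp [h9]
  · simp [h10]

end AdaptedFrame
end QCStructure

namespace QuasiContact

/-! ### Smooth maps into bundles -/

section along
variable {E H N : Type*} [NormedAddCommGroup E] [NormedSpace ℝ E]
    [TopologicalSpace H] {I : ModelWithCorners ℝ E H} [TopologicalSpace N] [ChartedSpace H N]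
    {EB HB B F : Type*} [NormedAddCommGroup EB]
    [NormedSpace ℝ EB] [TopologicalSpace HB]
    {IB : ModelWithCorners ℝ EB HB} [TopologicalSpace B] [ChartedSpace HB B]
    [NormedAddCommGroup F] [NormedSpace ℝ F] {V : B → Type*}
    [TopologicalSpace (Bundle.TotalSpace F V)]
    [∀ b, AddCommGroup (V b)] [∀ b, Module ℝ (V b)] [∀ b, TopologicalSpace (V b)]
    [FiberBundle F V] [VectorBundle ℝ F V] {b : N → B} {n : N}

theorem contMDiffAt_totalSpace_sum {ι : Type*} [Fintype ι] {c : ι → N → ℝ} {s : ι → ∀ x, V x}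
    (hb : ContMDiffAt I IB ∞ b n) (hc : ∀ i, ContMDiffAt I 𝓘(ℝ, ℝ) ∞ (c i) n)
    (hs : ∀ i, ContMDiffAt IB (IB.prod 𝓘(ℝ, F)) ∞ (fun x => (⟨x, s i x⟩ : Bundle.TotalSpace F V))
      (b n)) :
    ContMDiffAt I (IB.prod 𝓘(ℝ, F)) ∞
      (fun m => (⟨b m, ∑ i, c i m • s i (b m)⟩ : Bundle.TotalSpace F V)) n := by
  rw [Bundle.contMDiffAt_totalSpace]
  refine ⟨hb, ?_⟩
  have h1 : ∀ i, ContMDiffAt I 𝓘(ℝ, F) ∞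
      (fun m => (trivializationAt F V (b n) ⟨b m, s i (b m)⟩).2) n := fun i =>
    (Bundle.contMDiffAt_totalSpace.1 ((hs i).comp n hb)).2
  have h2 : ContMDiffAt I 𝓘(ℝ, F) ∞
      (fun m => ∑ i, c i m • (trivializationAt F V (b n) ⟨b m, s i (b m)⟩).2) n := by
    have := contMDiffAt_finsetSum (t := Finset.univ) (fun i _ => (hc i).smul (h1 i))
    exact this
  refine h2.congr_of_eventuallyEq ?_
  filter_upwards [hb.continuousAt.preimage_mem_nhds
    ((trivializationAt F V (b n)).open_baseSet.mem_nhds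
      (FiberBundle.mem_baseSet_trivializationAt' (b n)))] with m hm
  have hl := (trivializationAt F V (b n)).linear ℝ hm
  let l : V (b m) →ₗ[ℝ] F := hl.mk' _
  change l (∑ i, c i m • s i (b m)) = ∑ i, c i m • l (s i (b m))
  simp

end along

variable {X : Type*} [TopologicalSpace X] [ChartedSpace E4 X] [IsManifold (𝓡 4) ∞ X]

section
variable {E H N : Type*} [NormedAddCommGroup E] [NormedSpace ℝ E]
    [TopologicalSpace H] {I : ModelWithCorners ℝ E H} [TopologicalSpace N] [ChartedSpace H N]
    {b : N → X} {n : N} {ξ : ∀ m, CoFib X (b m)} {v : ∀ m, TangentSpace (𝓡 4) (b m)}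

theorem contMDiffAt_coTanSum_mk
    (hξ : ContMDiffAt I IC ∞ (fun m => (⟨b m, ξ m⟩ : CoTan X)) n)
    (hv : ContMDiffAt I (𝓡 4).tangent ∞ (fun m => (⟨b m, v m⟩ : TangentBundle (𝓡 4) X)) n) :
    ContMDiffAt I IS ∞ (fun m => (⟨b m, (ξ m, v m)⟩ : CoTanSum X)) n := by
  rw [Bundle.contMDiffAt_totalSpace] at hξ hv ⊢
  exact ⟨hξ.1, hξ.2.prodMk_space hv.2⟩

theorem contMDiff_coTanSum_proj : ContMDiff IS (𝓡 4) ∞ (fun q : CoTanSum X => q.1) :=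
  Bundle.contMDiff_proj (fun x : X => CoFib X x × TangentSpace (𝓡 4) x)

theorem contMDiff_beta : ContMDiff IS IC ∞ (beta : CoTanSum X → CoTan X) := by
  intro q
  have h := (Bundle.contMDiffAt_totalSpace (x₀ := q)).1
    (contMDiff_id (I := IS) (M := CoTanSum X) (n := ∞)).contMDiffAt
  rw [Bundle.contMDiffAt_totalSpace]
  exact ⟨h.1, ContMDiffAt.comp (g := fun z : (E4 →L[ℝ] ℝ) × E4 => z.1) q
    contDiff_fst.contMDiff.contMDiffAt h.2⟩

theorem contMDiff_coTanSum_snd : ContMDiff IS (𝓡 4).tangent ∞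
    (fun q : CoTanSum X => (⟨q.1, q.2.2⟩ : TangentBundle (𝓡 4) X)) := by
  intro q
  have h := (Bundle.contMDiffAt_totalSpace (x₀ := q)).1
    (contMDiff_id (I := IS) (M := CoTanSum X) (n := ∞)).contMDiffAt
  rw [Bundle.contMDiffAt_totalSpace]
  exact ⟨h.1, ContMDiffAt.comp (g := fun z : (E4 →L[ℝ] ℝ) × E4 => z.2) q
    contDiff_snd.contMDiff.contMDiffAt h.2⟩
end

end QuasiContact

namespace QCStructure
open QuasiContact

variable {X : Type*} [TopologicalSpace X] [ChartedSpace E4 X] [IsManifold (𝓡 4) ∞ X]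
  {S : QCStructure X} {α : ∀ x : X, CoFib X x} {R : ∀ x : X, TangentSpace (𝓡 4) x}
  {U : Set X} {e : Fin 4 → ∀ x : X, TangentSpace (𝓡 4) x}

/-! ### Coordinates on `T*X ⊕ E` from an adapted frame -/

/-- The components of a covector and of a vector of `E` in an adapted frame. -/
abbrev FrameCoord := (Fin 4 → ℝ) × (Fin 3 → ℝ)

/-- Model with corners of `X × FrameCoord`. -/
abbrev IY := (𝓡 4).prod 𝓘(ℝ, FrameCoord)

/-- The point of `T*X ⊕ E` with given components. -/
def psi (S : QCStructure X) (α : ∀ x : X, CoFib X x)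
    (e : Fin 4 → ∀ x : X, TangentSpace (𝓡 4) x) (y : X × FrameCoord) : CoTanSum X :=
  ⟨y.1, (∑ j, y.2.1 j • coframe S α e j y.1, ∑ i, y.2.2 i • e (Fin.castSucc i) y.1)⟩

/-- The components of a point of `T*X ⊕ E`. -/
def coord (S : QCStructure X) (e : Fin 4 → ∀ x : X, TangentSpace (𝓡 4) x) (q : CoTanSum X) :
    X × FrameCoord :=
  (q.1, (fun j => q.2.1 (e j q.1), fun i => S.g q.1 (e (Fin.castSucc i) q.1) q.2.2))

/-- The components of the lift of a covector to the blowup. -/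
def liftCoord (S : QCStructure X) (e : Fin 4 → ∀ x : X, TangentSpace (𝓡 4) x) (p : CoTan X) :
    X × FrameCoord :=
  (p.1, (fun j => symb (e j) p, fun i => symb (e (Fin.castSucc i)) p * (S.sqrtSigma p)⁻¹))

namespace AdaptedFrame

theorem contMDiffAt_psi (h : AdaptedFrame S α R U e) (hα : S.IsPoppForm α) {y : X × FrameCoord}
    (hy : y.1 ∈ U) : ContMDiffAt IY IS ∞ (psi S α e) y := by
  have h2 : ContMDiffAt IY 𝓘(ℝ, FrameCoord) ∞ (fun y : X × FrameCoord => y.2) y :=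
    contMDiffAt_snd
  have h3 : ∀ j, ContMDiffAt IY 𝓘(ℝ, ℝ) ∞ (fun y : X × FrameCoord => y.2.1 j) y := fun j =>
    ContMDiffAt.comp (g := fun z : FrameCoord => z.1 j) (f := fun y : X × FrameCoord => y.2) y
      (ContDiff.contMDiff (by fun_prop)).contMDiffAt h2
  have h4 : ∀ i, ContMDiffAt IY 𝓘(ℝ, ℝ) ∞ (fun y : X × FrameCoord => y.2.2 i) y := fun i =>
    ContMDiffAt.comp (g := fun z : FrameCoord => z.2 i) (f := fun y : X × FrameCoord => y.2) y
      (ContDiff.contMDiff (by fun_prop)).contMDiffAt h2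
  refine contMDiffAt_coTanSum_mk (b := fun y : X × FrameCoord => y.1)
    (contMDiffAt_totalSpace_sum contMDiffAt_fst h3 fun j => h.formSmoothAt_coframe hα hy j)
    (contMDiffAt_totalSpace_sum contMDiffAt_fst h4 fun _ => h.smooth _ y.1 hy)

theorem contMDiffAt_eval (h : AdaptedFrame S α R U e) {q : CoTanSum X} (hq : q.1 ∈ U) (j : Fin 4) :
    ContMDiffAt IS 𝓘(ℝ, ℝ) ∞ (fun q : CoTanSum X => q.2.1 (e j q.1)) q :=
  ContMDiffAt.comp (g := symb (e j)) (f := beta) q (contMDiffAt_symb (h.smooth j q.1 hq))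
    contMDiff_beta.contMDiffAt

theorem contMDiffAt_comp_frame (h : AdaptedFrame S α R U e) {q : CoTanSum X} (hq : q.1 ∈ U)
    (j : Fin 4) :
    ContMDiffAt IS 𝓘(ℝ, ℝ) ∞ (fun q : CoTanSum X => S.g q.1 (e j q.1) q.2.2) q := by
  have h1 : ContMDiffAt IS (𝓡 4).tangent ∞
      (fun q : CoTanSum X => (⟨q.1, e j q.1⟩ : TangentBundle (𝓡 4) X)) q :=
    ContMDiffAt.comp (g := fun x => (⟨x, e j x⟩ : TangentBundle (𝓡 4) X)) q
      (h.smooth j q.1 hq) contMDiff_coTanSum_proj.contMDiffAt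
  exact contMDiffWithinAt_metric S (b := fun q : CoTanSum X => q.1) (v := fun q => e j q.1)
    (w := fun q => q.2.2) h1.contMDiffWithinAt
    contMDiff_coTanSum_snd.contMDiffAt.contMDiffWithinAt

theorem contMDiffAt_coord (h : AdaptedFrame S α R U e) {q : CoTanSum X} (hq : q.1 ∈ U) :
    ContMDiffAt IS IY ∞ (coord S e) q :=
  contMDiff_coTanSum_proj.contMDiffAt.prodMk
    ((contMDiffAt_pi_space.2 fun j => h.contMDiffAt_eval hq j).prodMk_space
      (contMDiffAt_pi_space.2 fun _ => h.contMDiffAt_comp_frame hq _))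

theorem form_eq_sum (h : AdaptedFrame S α R U e) (hα : S.IsPoppForm α) (hR : S.IsReeb α R)
    {x : X} (hx : x ∈ U) (ξ : CoFib X x) : ∑ j, ξ (e j x) • coframe S α e j x = ξ := by
  ext u
  refine Eq.trans ?_ (congrArg ξ (h.eq_sum hα hR hx u)).symm
  rw [map_sum, sum_apply]
  refine Finset.sum_congr rfl fun j _ => ?_
  rw [map_smul, smul_apply, smul_eq_mul, smul_eq_mul, mul_comm]

theorem psi_coord (h : AdaptedFrame S α R U e) (hα : S.IsPoppForm α) (hR : S.IsReeb α R)
    {q : CoTanSum X} (hq : q.1 ∈ U) (hE : q.2.2 ∈ S.E q.1) : psi S α e (coord S e q) = q := by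
  obtain ⟨x, ξ, v⟩ := q
  exact congrArg (Bundle.TotalSpace.mk x) (Prod.ext (h.form_eq_sum hα hR hq ξ)
    (h.eq_sum_E hq hE).symm)

theorem coord_psi (h : AdaptedFrame S α R U e) (hα : S.IsPoppForm α) (hR : S.IsReeb α R)
    {y : X × FrameCoord} (hy : y.1 ∈ U) : coord S e (psi S α e y) = y := by
  obtain ⟨x, η, v⟩ := y
  refine Prod.ext rfl (Prod.ext ?_ ?_)
  · funext j
    change (∑ i, η i • coframe S α e i x) (e j x) = η j
    rw [sum_apply]
    have : ∀ i, (η i • coframe S α e i x) (e j x) = η i * (if i = j then 1 else 0) := fun i => by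
      rw [smul_apply, h.coframe_frame hα hR hy, smul_eq_mul]
    simp [this]
  · funext i
    change S.g x (e (Fin.castSucc i) x) (∑ k, v k • e (Fin.castSucc k) x) = v i
    rw [map_sum]
    simp [h.orthonormal _ _ x hy]

/-- The symbols of the frame, as functions on the cotangent bundle, give the covector. -/
theorem sharp_eq (h : AdaptedFrame S α R U e) {p : CoTan X} (hp : p.1 ∈ U) :
    S.sharp p = ∑ i, symb (e (Fin.castSucc i)) p • e (Fin.castSucc i) p.1 := by
  refine (h.eq_sum_E hp (sharp_mem p)).trans (Finset.sum_congr rfl fun i _ => ?_)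
  rw [S.symm_g, metric_sharp (h.mem_E i _ hp)]; rfl

theorem sigma_eq (h : AdaptedFrame S α R U e) {p : CoTan X} (hp : p.1 ∈ U) :
    S.sigma p = ∑ i : Fin 3, symb (e (Fin.castSucc i)) p ^ 2 := by
  rw [sigma, h.sharp_eq hp, h.metric_frame hp]
  exact Finset.sum_congr rfl fun i _ => (sq _).symm

theorem lift_eq (h : AdaptedFrame S α R U e) (hα : S.IsPoppForm α) (hR : S.IsReeb α R)
    {p : CoTan X} (hp : p.1 ∈ U) : S.lift p = psi S α e (liftCoord S e p) := by
  have hE : (S.lift p).2.2 ∈ S.E (S.lift p).1 := (S.E p.1).smul_mem _ (sharp_mem p)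
  refine (h.psi_coord hα hR (q := S.lift p) hp hE).symm.trans (congrArg _ ?_)
  refine Prod.ext rfl (Prod.ext rfl ?_)
  funext i
  change S.g p.1 (e (Fin.castSucc i) p.1) ((S.sqrtSigma p)⁻¹ • S.sharp p) =
    symb (e (Fin.castSucc i)) p * (S.sqrtSigma p)⁻¹
  rw [map_smul, S.symm_g, metric_sharp (h.mem_E i _ hp), smul_eq_mul, mul_comm]; rfl

end AdaptedFrame
end QCStructure

namespace QuasiContact

variable {X : Type*} [TopologicalSpace X] [ChartedSpace E4 X] [IsManifold (𝓡 4) ∞ X]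

/-! ### Calculus of functions on the cotangent bundle -/

/-- `f` is differentiable at `p`, with derivative `d` along `w`. -/
def HasDC (f : CoTan X → ℝ) (p : CoTan X) (w : E4 × (E4 →L[ℝ] ℝ)) (d : ℝ) : Prop :=
  MDifferentiableAt IC 𝓘(ℝ, ℝ) f p ∧ dC f p w = d

section HasDC
variable {f g : CoTan X → ℝ} {p : CoTan X} {w : E4 × (E4 →L[ℝ] ℝ)} {d d' : ℝ}

theorem HasDC.congr_of_eventuallyEq (h : HasDC f p w d) (hfg : g =ᶠ[𝓝 p] f) : HasDC g p w d :=
  ⟨h.1.congr_of_eventuallyEq hfg, by rw [← h.2, dC, dC, hfg.mfderiv_eq]; rfl⟩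

theorem HasDC.comp {φ : ℝ → ℝ} {φ' : ℝ} (hφ : HasDerivAt φ φ' (f p)) (h : HasDC f p w d) :
    HasDC (fun q => φ (f q)) p w (φ' * d) := by
  have h1 := HasMFDerivAt.comp (g := φ) (f := f) p hφ.hasFDerivAt.hasMFDerivAt h.1.hasMFDerivAt
  refine ⟨h1.mdifferentiableAt, ?_⟩
  have h2 := congrArg (fun l : E4 × (E4 →L[ℝ] ℝ) →L[ℝ] ℝ => l w) h1.mfderiv
  refine Eq.trans h2 ?_
  rw [← h.2, mul_comm]
  rfl

theorem HasDC.add (hf : HasDC f p w d) (hg : HasDC g p w d') :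
    HasDC (fun q => f q + g q) p w (d + d') := by
  have h1 := hf.1.hasMFDerivAt.add hg.1.hasMFDerivAt
  refine ⟨h1.mdifferentiableAt, ?_⟩
  have h2 := congrArg (fun l : E4 × (E4 →L[ℝ] ℝ) →L[ℝ] ℝ => l w) h1.mfderiv
  refine Eq.trans h2 ?_
  rw [← hf.2, ← hg.2]
  rfl

theorem HasDC.mul (hf : HasDC f p w d) (hg : HasDC g p w d') :
    HasDC (fun q => f q * g q) p w (f p * d' + g p * d) := by
  have h1 := hf.1.hasMFDerivAt.mul hg.1.hasMFDerivAt
  refine ⟨h1.mdifferentiableAt, ?_⟩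
  have h2 := congrArg (fun l : E4 × (E4 →L[ℝ] ℝ) →L[ℝ] ℝ => l w) h1.mfderiv
  refine Eq.trans h2 ?_
  rw [← hf.2, ← hg.2]
  rfl

theorem HasDC.const (c : ℝ) (p : CoTan X) (w : E4 × (E4 →L[ℝ] ℝ)) :
    HasDC (fun _ => c) p w 0 := by
  have h1 := hasMFDerivAt_const (I := IC) (I' := 𝓘(ℝ, ℝ)) c p
  exact ⟨h1.mdifferentiableAt, congrArg (fun l : E4 × (E4 →L[ℝ] ℝ) →L[ℝ] ℝ => l w) h1.mfderiv⟩

theorem HasDC.const_mul (c : ℝ) (hf : HasDC f p w d) : HasDC (fun q => c * f q) p w (c * d) := by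
  have := (HasDC.const c p w).mul hf
  simpa using this

theorem HasDC.sum {ι : Type*} {s : Finset ι} {f : ι → CoTan X → ℝ} {d : ι → ℝ}
    (hf : ∀ i ∈ s, HasDC (f i) p w (d i)) : HasDC (fun q => ∑ i ∈ s, f i q) p w (∑ i ∈ s, d i) := by
  classical
  induction s using Finset.induction_on with
  | empty => simpa using HasDC.const 0 p w
  | insert a s ha ih =>
    simp only [Finset.sum_insert ha]
    exact (hf a (Finset.mem_insert_self a s)).add
      (ih fun i hi => hf i (Finset.mem_insert_of_mem hi))

theorem HasDC.sq (hf : HasDC f p w d) : HasDC (fun q => f q ^ 2) p w (2 * f p * d) := by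
  have h := hf.mul hf
  simp only [← _root_.sq] at h
  convert h using 1
  ring

theorem HasDC.inv (hf : HasDC f p w d) (h0 : f p ≠ 0) :
    HasDC (fun q => (f q)⁻¹) p w (-(f p ^ 2)⁻¹ * d) :=
  HasDC.comp (hasDerivAt_inv h0) hf

theorem HasDC.of_contMDiffAt (hf : ContMDiffAt IC 𝓘(ℝ, ℝ) ∞ f p) (w : E4 × (E4 →L[ℝ] ℝ)) :
    HasDC f p w (dC f p w) := ⟨hf.mdifferentiableAt (by simp), rfl⟩

end HasDC

theorem dC_add_vec (f : CoTan X → ℝ) (p : CoTan X) (w w' : E4 × (E4 →L[ℝ] ℝ)) :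
    dC f p (w + w') = dC f p w + dC f p w' :=
  (show E4 × (E4 →L[ℝ] ℝ) →L[ℝ] ℝ from mfderiv IC 𝓘(ℝ, ℝ) f p).map_add w w'

theorem dC_smul_vec (f : CoTan X → ℝ) (p : CoTan X) (c : ℝ) (w : E4 × (E4 →L[ℝ] ℝ)) :
    dC f p (c • w) = c * dC f p w :=
  (show E4 × (E4 →L[ℝ] ℝ) →L[ℝ] ℝ from mfderiv IC 𝓘(ℝ, ℝ) f p).map_smul c w

theorem dC_sum_vec {ι : Type*} (s : Finset ι) (f : CoTan X → ℝ) (p : CoTan X)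
    (c : ι → ℝ) (w : ι → E4 × (E4 →L[ℝ] ℝ)) :
    dC f p (∑ i ∈ s, c i • w i) = ∑ i ∈ s, c i * dC f p (w i) := by
  have := map_sum (show E4 × (E4 →L[ℝ] ℝ) →L[ℝ] ℝ from mfderiv IC 𝓘(ℝ, ℝ) f p)
    (fun i => c i • w i) s
  refine Eq.trans this (Finset.sum_congr rfl fun i _ => dC_smul_vec f p (c i) (w i))

/-- The Hamilton field depends linearly on the differential at the point, so the coefficients are
the values at `p` of the partial derivatives of `f` with respect to the `g i`. -/
theorem ham_eq_sum {ι : Type*} {s : Finset ι} {f : CoTan X → ℝ} {p : CoTan X} {c : ι → ℝ}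
    {g : ι → CoTan X → ℝ} (h : ∀ w, dC f p w = ∑ i ∈ s, c i * dC (g i) p w) :
    ham f p = ∑ i ∈ s, c i • ham (g i) p := by
  refine ham_eq_of_omega fun w => ?_
  rw [h w]
  simp only [← omega_ham, omega, Prod.fst_sum, Prod.snd_sum, Prod.smul_fst, Prod.smul_snd,
    map_sum, map_smul, sum_apply, smul_apply, smul_eq_mul, mul_sub, Finset.sum_sub_distrib]

end QuasiContact

/-! ### Directional derivatives in frame coordinates and their limits -/

namespace QCStructure
open QuasiContact

variable {X : Type*} [TopologicalSpace X] [ChartedSpace E4 X] [IsManifold (𝓡 4) ∞ X]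
  {S : QCStructure X} {α : ∀ x : X, CoFib X x} {R : ∀ x : X, TangentSpace (𝓡 4) x}
  {U : Set X} {e : Fin 4 → ∀ x : X, TangentSpace (𝓡 4) x}

/-- Derivative of a real function on `X × FrameCoord`. -/
def dY (G : X × FrameCoord → ℝ) (y : X × FrameCoord) (w : E4 × FrameCoord) : ℝ :=
  mfderiv IY 𝓘(ℝ, ℝ) G y w

/-- The coordinates of a tangent vector of `X × FrameCoord`. -/
def frameVec (e : Fin 4 → ∀ x : X, TangentSpace (𝓡 4) x) (x : X) (c η : Fin 4 → ℝ)
    (v : Fin 3 → ℝ) : E4 × FrameCoord := ((show E4 from ∑ k, c k • e k x), (η, v))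

/-- The basic tangent vectors. -/
def baseVec (e : Fin 4 → ∀ x : X, TangentSpace (𝓡 4) x) (x : X) :
    Fin 4 ⊕ Fin 4 ⊕ Fin 3 → E4 × FrameCoord :=
  Sum.elim (fun k => ((show E4 from e k x), 0))
    (Sum.elim (fun j => (0, (Pi.single j 1, 0))) fun i => (0, (0, Pi.single i 1)))

theorem frameVec_eq (e : Fin 4 → ∀ x : X, TangentSpace (𝓡 4) x) (x : X) (c η : Fin 4 → ℝ)
    (v : Fin 3 → ℝ) : frameVec e x c η v =
      ∑ m, (Sum.elim c (Sum.elim η v) : Fin 4 ⊕ Fin 4 ⊕ Fin 3 → ℝ) m • baseVec e x m := by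
  simp only [Fintype.sum_sum_type, Sum.elim_inl, Sum.elim_inr, baseVec, frameVec]
  refine Prod.ext ?_ (Prod.ext ?_ ?_)
  · simp only [Prod.fst_add, Prod.fst_sum, Prod.smul_fst, smul_zero, Finset.sum_const_zero,
      add_zero]
    rfl
  · funext j
    simp [Prod.fst_sum, Prod.snd_sum, Finset.sum_apply, Pi.single_apply]
  · funext j
    simp [Prod.snd_sum, Finset.sum_apply, Pi.single_apply]

theorem dY_frameVec (G : X × FrameCoord → ℝ) (y : X × FrameCoord) (c η : Fin 4 → ℝ)
    (v : Fin 3 → ℝ) : dY G y (frameVec e y.1 c η v) =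
      ∑ m, (Sum.elim c (Sum.elim η v) : Fin 4 ⊕ Fin 4 ⊕ Fin 3 → ℝ) m *
        dY G y (baseVec e y.1 m) := by
  rw [frameVec_eq]
  let A : E4 × FrameCoord →L[ℝ] ℝ := mfderiv IY 𝓘(ℝ, ℝ) G y
  change A _ = ∑ m, _ * A _
  simp

namespace AdaptedFrame

theorem contMDiffAt_tangent_mk {E H N : Type*} [NormedAddCommGroup E] [NormedSpace ℝ E]
    [TopologicalSpace H] {I : ModelWithCorners ℝ E H} [TopologicalSpace N] [ChartedSpace H N]
    {b : N → X} {u : ∀ m, TangentSpace (𝓡 4) (b m)} {y : N → FrameCoord} {z : N → FrameCoord}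
    {n : N} (hu : ContMDiffAt I (𝓡 4).tangent ∞ (fun m => (⟨b m, u m⟩ : TangentBundle (𝓡 4) X)) n)
    (hy : ContMDiffAt I 𝓘(ℝ, FrameCoord) ∞ y n) (hz : ContMDiffAt I 𝓘(ℝ, FrameCoord) ∞ z n) :
    ContMDiffAt I IY.tangent ∞ (fun m => (⟨(b m, y m), ((show E4 from u m), z m)⟩ :
      TangentBundle IY (X × FrameCoord))) n := by
  have h1 : ContMDiffAt I 𝓘(ℝ, FrameCoord).tangent ∞
      (fun m => (⟨y m, z m⟩ : TangentBundle 𝓘(ℝ, FrameCoord) FrameCoord)) n := by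
    rw [Bundle.contMDiffAt_totalSpace]
    refine ⟨hy, ?_⟩
    refine hz.congr_of_eventuallyEq (Eventually.of_forall fun m => ?_)
    refine (congrArg Prod.snd (TangentBundle.trivializationAt_apply
      (x := (⟨y n, z n⟩ : TangentBundle 𝓘(ℝ, FrameCoord) FrameCoord).1)
      (z := (⟨y m, z m⟩ : TangentBundle 𝓘(ℝ, FrameCoord) FrameCoord)))).trans ?_
    change fderivWithin ℝ (id ∘ id) (range id) (y m) (z m) = z m
    rw [range_id, fderivWithin_univ, Function.id_comp, fderiv_id]
    rfl
  exact ContMDiffAt.comp (f := fun m => ((⟨b m, u m⟩ : TangentBundle (𝓡 4) X),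
      (⟨y m, z m⟩ : TangentBundle 𝓘(ℝ, FrameCoord) FrameCoord))) n
    (contMDiff_equivTangentBundleProd_symm (I := 𝓡 4) (M := X) (I' := 𝓘(ℝ, FrameCoord))
      (M' := FrameCoord) (n := ∞)).contMDiffAt (hu.prodMk h1)

/-- Tangent vectors at different points are written in different charts, so continuity has to be
seen on the tangent bundle: `(y, w) ↦ dG_y(w)` is smooth there, and the frame fields are smooth
sections. With `dY_frameVec`, limits of derivatives then reduce to limits of frame components. -/
theorem continuousAt_dY_baseVec (h : AdaptedFrame S α R U e) {G : X × FrameCoord → ℝ}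
    {O : Set (X × FrameCoord)} (hO : IsOpen O) (hG : ContMDiffOn IY 𝓘(ℝ, ℝ) ∞ G O)
    {y : X × FrameCoord} (hy : y ∈ O) (hU : y.1 ∈ U) (m : Fin 4 ⊕ Fin 4 ⊕ Fin 3) :
    ContinuousAt (fun z => dY G z (baseVec e z.1 m)) y := by
  have h1 := contMDiffOn_mfderiv_apply hO hG
  have hs : ∀ u : ∀ x : X, TangentSpace (𝓡 4) x, VFSmoothAt u y.1 → ∀ z : FrameCoord,
      ContinuousAt (fun z' : X × FrameCoord => dY G z' ((show E4 from u z'.1), z)) y := by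
    intro u hu z
    have h2 := contMDiffAt_tangent_mk (I := IY) (b := fun z' : X × FrameCoord => z'.1)
      (u := fun z' => u z'.1) (y := fun z' => z'.2) (z := fun _ => z) (n := y)
      (ContMDiffAt.comp (g := fun x => (⟨x, u x⟩ : TangentBundle (𝓡 4) X)) y hu contMDiffAt_fst)
      contMDiffAt_snd contMDiffAt_const
    have h3 := (h1 ⟨y, ((show E4 from u y.1), z)⟩ hy).contMDiffAt
      (((FiberBundle.continuous_proj (E4 × FrameCoord)
        (TangentSpace IY : X × FrameCoord → Type _)).isOpen_preimage _ hO).mem_nhds hy)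
    exact ContinuousAt.comp (f := fun z' : X × FrameCoord =>
      (⟨z', ((show E4 from u z'.1), z)⟩ : TangentBundle IY (X × FrameCoord)))
      h3.continuousAt h2.continuousAt
  have h0 : VFSmoothAt (fun x : X => (0 : TangentSpace (𝓡 4) x)) y.1 :=
    (Bundle.contMDiff_zeroSection ℝ (TangentSpace (𝓡 4) : X → Type _)).contMDiffAt
  rcases m with k | j | i
  · exact hs (e k) (h.smooth k _ hU) 0
  · exact hs _ h0 _
  · exact hs _ h0 _

/-- Passage to the limit in the derivative of a function along a field with given components. -/
theorem tendsto_dY (h : AdaptedFrame S α R U e) {G : X × FrameCoord → ℝ}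
    {O : Set (X × FrameCoord)} (hO : IsOpen O) (hG : ContMDiffOn IY 𝓘(ℝ, ℝ) ∞ G O)
    {Q : Type*} {l : Filter Q} {y : Q → X × FrameCoord} {y₀ : X × FrameCoord}
    (hy : Tendsto y l (𝓝 y₀)) (hy₀ : y₀ ∈ O) (hU : y₀.1 ∈ U) {c η : Q → Fin 4 → ℝ}
    {v : Q → Fin 3 → ℝ} {c₀ η₀ : Fin 4 → ℝ} {v₀ : Fin 3 → ℝ}
    (hc : ∀ k, Tendsto (fun q => c q k) l (𝓝 (c₀ k)))
    (hη : ∀ k, Tendsto (fun q => η q k) l (𝓝 (η₀ k)))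
    (hv : ∀ k, Tendsto (fun q => v q k) l (𝓝 (v₀ k))) :
    Tendsto (fun q => dY G (y q) (frameVec e (y q).1 (c q) (η q) (v q))) l
      (𝓝 (dY G y₀ (frameVec e y₀.1 c₀ η₀ v₀))) := by
  simp only [dY_frameVec]
  refine tendsto_finsetSum _ fun m _ => Tendsto.mul ?_
    ((h.continuousAt_dY_baseVec hO hG hy₀ hU m).tendsto.comp hy)
  rcases m with k | j | i
  exacts [hc k, hη j, hv i]

end AdaptedFrame
end QCStructure

namespace QCStructure
open QuasiContact

variable {X : Type*} [TopologicalSpace X] [ChartedSpace E4 X] [IsManifold (𝓡 4) ∞ X]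
  {S : QCStructure X} {α : ∀ x : X, CoFib X x} {R : ∀ x : X, TangentSpace (𝓡 4) x}
  {U : Set X} {e : Fin 4 → ∀ x : X, TangentSpace (𝓡 4) x}

/-! ### Test functions and interior points in frame coordinates -/

theorem TestFn.contMDiffAt {F : CoTanSum X → ℝ} (hF : TestFn F)
    {V : ∀ x : X, TangentSpace (𝓡 4) x} {q : CoTanSum X} {U : Set X}
    (hV : ∀ x ∈ U, VFSmoothAt V x) (hqU : q.1 ∈ U) (hq : q.2.1 (V q.1) ≠ 0) :
    ContMDiffAt IS 𝓘(ℝ, ℝ) ∞ F q := by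
  have h1 : ContinuousAt (fun q : CoTanSum X => q.2.1 (V q.1)) q :=
    ContinuousAt.comp (g := symb V) (f := beta) (contMDiffAt_symb (hV _ hqU)).continuousAt
      contMDiff_beta.continuous.continuousAt
  refine (hF q fun h => hq (by rw [h]; rfl)).contMDiffAt ?_
  filter_upwards [h1.eventually_ne hq] with q' hq' h
  exact hq' (by rw [h]; rfl)

/-- The domain of a frame, in coordinates. -/
def coordDomain (U : Set X) : Set (X × FrameCoord) := {y | y.1 ∈ U ∧ y.2.1 3 ≠ 0}

theorem isOpen_coordDomain (hU : IsOpen U) : IsOpen (coordDomain U) :=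
  (hU.preimage continuous_fst).inter (isOpen_ne.preimage
    ((continuous_apply (3 : Fin 4)).comp (continuous_fst.comp continuous_snd)))

theorem sigma_nonneg (p : CoTan X) : 0 ≤ S.sigma p := by
  by_cases h : S.sharp p = 0
  · rw [sigma, h]; simp
  · exact (S.pos_g p.1 _ (sharp_mem p) h).le

theorem sharp_beta {q : CoTanSum X} {r : ℝ} (hE : q.2.2 ∈ S.E q.1)
    (h : ∀ u ∈ S.E q.1, q.2.1 u = r * S.g q.1 q.2.2 u) : S.sharp (beta q) = r • q.2.2 := by
  let z : TangentSpace (𝓡 4) q.1 := S.sharp (beta q)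
  change z = r • q.2.2
  have hm : z ∈ S.E q.1 := sharp_mem (beta q)
  have hd : z - r • q.2.2 ∈ S.E q.1 := (S.E q.1).sub_mem hm ((S.E q.1).smul_mem _ hE)
  by_contra hne
  have hpos := S.pos_g q.1 _ hd (sub_ne_zero.2 hne)
  have h1 : S.g q.1 z (z - r • q.2.2) = q.2.1 (z - r • q.2.2) := metric_sharp (p := beta q) hd
  have h2 : S.g q.1 (r • q.2.2) (z - r • q.2.2) = q.2.1 (z - r • q.2.2) := by
    rw [h _ hd, ← gBilin_apply, map_smul, LinearMap.smul_apply, gBilin_apply, smul_eq_mul]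
  rw [← gBilin_apply, LinearMap.map_sub₂, gBilin_apply, gBilin_apply, h1, h2, sub_self] at hpos
  exact lt_irrefl _ hpos

/-- Interior points of the blowup. -/
theorem interior_spec {q : CoTanSum X} (hq : q ∈ S.Blowup \ S.SN) :
    0 < q.2.1 q.2.2 ∧ S.sqrtSigma (beta q) = q.2.1 q.2.2 ∧
      (∀ u ∈ S.E q.1, q.2.1 u = q.2.1 q.2.2 * S.g q.1 q.2.2 u) := by
  obtain ⟨⟨h0, hE, h1, r, hr, h⟩, hSN⟩ := hq
  have hrq : q.2.1 q.2.2 = r := by rw [h _ hE, h1, mul_one]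
  have hs : S.sigma (beta q) = r ^ 2 := by
    rw [sigma, sharp_beta hE h]
    change S.g q.1 (r • q.2.2) (r • q.2.2) = r ^ 2
    rw [← gBilin_apply, map_smul, map_smul, LinearMap.smul_apply, gBilin_apply, h1]
    simp [sq]
  rw [hrq]
  refine ⟨lt_of_le_of_ne hr fun h2 => hSN ⟨⟨h0, hE, h1, r, hr, h⟩, h0, ?_⟩, ?_, h⟩
  · rw [hs, ← h2]; simp
  · rw [sqrtSigma, hs, Real.sqrt_sq hr]

namespace AdaptedFrame

theorem contMDiffOn_comp_psi (h : AdaptedFrame S α R U e) (hα : S.IsPoppForm α)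
    (hR : S.IsReeb α R) {F : CoTanSum X → ℝ} (hF : TestFn F) :
    ContMDiffOn IY 𝓘(ℝ, ℝ) ∞ (F ∘ psi S α e) (coordDomain U) := by
  intro y hy
  have h1 : (psi S α e y).2.1 (e 3 y.1) = y.2.1 3 :=
    congrArg (fun z : X × FrameCoord => z.2.1 3) (h.coord_psi hα hR hy.1)
  exact ((TestFn.contMDiffAt hF (h.smooth 3) hy.1
    (q := psi S α e y) (fun hz => hy.2 (h1.symm.trans hz))).comp y
    (h.contMDiffAt_psi hα hy.1)).contMDiffWithinAt

theorem liftCoord_beta (h : AdaptedFrame S α R U e) {q : CoTanSum X} (hq : q ∈ S.Blowup \ S.SN)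
    (hU : q.1 ∈ U) : liftCoord S e (beta q) = coord S e q := by
  obtain ⟨h1, h2, h3⟩ := interior_spec hq
  refine Prod.ext rfl (Prod.ext rfl ?_)
  funext i
  change q.2.1 (e (Fin.castSucc i) q.1) * (S.sqrtSigma (beta q))⁻¹ =
    S.g q.1 (e (Fin.castSucc i) q.1) q.2.2
  rw [h2, h3 _ (h.mem_E i _ hU), S.symm_g q.1 q.2.2, mul_assoc, mul_comm, mul_assoc,
    inv_mul_cancel₀ h1.ne', mul_one]

theorem hasDC_symb (h : AdaptedFrame S α R U e) {p : CoTan X} (hp : p.1 ∈ U) (j : Fin 4)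
    (w : E4 × (E4 →L[ℝ] ℝ)) : HasDC (symb (e j)) p w (dC (symb (e j)) p w) :=
  HasDC.of_contMDiffAt (contMDiffAt_symb (h.smooth j _ hp)) w

theorem eventually_mem (h : AdaptedFrame S α R U e) {p : CoTan X} (hp : p.1 ∈ U) :
    ∀ᶠ p' in 𝓝 p, p'.1 ∈ U :=
  (FiberBundle.continuous_proj (E4 →L[ℝ] ℝ) (CoFib X)).continuousAt.preimage_mem_nhds
    (h.isOpen.mem_nhds hp)

theorem hasDC_sqrtSigma (h : AdaptedFrame S α R U e) {p : CoTan X} (hp : p.1 ∈ U)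
    (h0 : S.sigma p ≠ 0) (w : E4 × (E4 →L[ℝ] ℝ)) :
    HasDC S.sqrtSigma p w (∑ i : Fin 3, symb (e (Fin.castSucc i)) p * (S.sqrtSigma p)⁻¹ *
      dC (symb (e (Fin.castSucc i))) p w) := by
  have h1 : HasDC (fun p => ∑ i : Fin 3, symb (e (Fin.castSucc i)) p ^ 2) p w _ :=
    HasDC.sum fun i _ => (h.hasDC_symb hp _ w).sq
  have h2 := h.sigma_eq hp
  have h3 := HasDC.comp (φ := Real.sqrt) (Real.hasDerivAt_sqrt (h2 ▸ h0)) h1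
  have h4 := h3.congr_of_eventuallyEq (g := S.sqrtSigma) (by
    filter_upwards [h.eventually_mem hp] with p' hp'
    rw [sqrtSigma, h.sigma_eq hp'])
  rw [← h2, Finset.mul_sum] at h4
  convert h4 using 1
  refine Finset.sum_congr rfl fun i _ => ?_
  rw [sqrtSigma]
  have : √(S.sigma p) ≠ 0 := (Real.sqrt_pos.2 (lt_of_le_of_ne (sigma_nonneg p) h0.symm)).ne'
  field_simp

/-- The differential of a function on the blowup, lifted to the cotangent bundle. -/
theorem dC_comp_lift (h : AdaptedFrame S α R U e) (hα : S.IsPoppForm α)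
    (hR : S.IsReeb α R) {F : CoTanSum X → ℝ} (hF : TestFn F) {p : CoTan X} (hp : p.1 ∈ U)
    (h0 : S.sigma p ≠ 0) (hρ : symb (e 3) p ≠ 0) (w : E4 × (E4 →L[ℝ] ℝ)) :
    dC (F ∘ S.lift) p w = dY (F ∘ psi S α e) (liftCoord S e p) (w.1,
      (fun j => dC (symb (e j)) p w, fun i => (S.sqrtSigma p)⁻¹ *
        (dC (symb (e (Fin.castSucc i))) p w - (liftCoord S e p).2.2 i *
          ∑ l : Fin 3, (liftCoord S e p).2.2 l * dC (symb (e (Fin.castSucc l))) p w))) := by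
  have hr : S.sqrtSigma p ≠ 0 :=
    (Real.sqrt_pos.2 (lt_of_le_of_ne (sigma_nonneg p) h0.symm)).ne'
  -- For `v_i = h_i / σ^{1/2}` the derivative of `σ^{1/2}` is `∑ v_l dh_l`. The quotient rule thus
  -- gives the projection of `dh` to the tangent space of the sphere, divided by `σ^{1/2}`: the only
  -- singular factor in the lift.
  have hv : ∀ i : Fin 3, HasDC (fun p => symb (e (Fin.castSucc i)) p * (S.sqrtSigma p)⁻¹) p w
      ((S.sqrtSigma p)⁻¹ * (dC (symb (e (Fin.castSucc i))) p w - (liftCoord S e p).2.2 i *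
          ∑ l : Fin 3, (liftCoord S e p).2.2 l * dC (symb (e (Fin.castSucc l))) p w)) := by
    intro i
    have h1 := (h.hasDC_symb hp (Fin.castSucc i) w).mul ((h.hasDC_sqrtSigma hp h0 w).inv hr)
    convert h1 using 1
    simp only [liftCoord]
    field_simp
    ring
  -- the second component of the coordinates
  let k : CoTan X → FrameCoord := fun p => (liftCoord S e p).2
  have hk : MDifferentiableAt IC 𝓘(ℝ, FrameCoord) k p := by
    refine MDifferentiableAt.prodMk_space ?_ ?_
    · exact (contMDiffAt_pi_space (n := 1).2 fun j =>
        (contMDiffAt_symb (h.smooth j _ hp)).of_le (by simp)).mdifferentiableAt (by simp)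
    · have hs1 : ContMDiffAt IC 𝓘(ℝ, ℝ) ∞ S.sqrtSigma p := by
        have h1 : ContMDiffAt IC 𝓘(ℝ, ℝ) ∞
            (fun p => ∑ i : Fin 3, symb (e (Fin.castSucc i)) p ^ 2) p :=
          contMDiffAt_finsetSum fun i _ => (contMDiffAt_symb (h.smooth _ _ hp)).pow 2
        have h2 := h.sigma_eq hp
        refine (ContMDiffAt.comp (g := Real.sqrt) p
          (Real.contDiffAt_sqrt (h2 ▸ h0)).contMDiffAt h1).congr_of_eventuallyEq ?_
        filter_upwards [h.eventually_mem hp] with p' hp'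
        rw [sqrtSigma, h.sigma_eq hp']; rfl
      have hs2 : ContMDiffAt IC 𝓘(ℝ, ℝ) ∞ (fun p => (S.sqrtSigma p)⁻¹) p :=
        ContMDiffAt.comp (g := fun t : ℝ => t⁻¹) p (contDiffAt_inv ℝ hr).contMDiffAt hs1
      exact (contMDiffAt_pi_space (n := 1).2 fun i =>
        ((contMDiffAt_symb (h.smooth _ _ hp)).mul hs2).of_le (by simp)).mdifferentiableAt (by simp)
  have hl : HasMFDerivAt IC IY (liftCoord S e) p
      ((ContinuousLinearMap.fst ℝ E4 (E4 →L[ℝ] ℝ)).prod (mfderiv IC 𝓘(ℝ, FrameCoord) k p)) :=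
    (hasMFDerivAt_proj (IB := 𝓡 4) (V := CoFib X) p).prodMk hk.hasMFDerivAt
  have hcomp : ∀ ℓ : FrameCoord →L[ℝ] ℝ,
      dC (fun p => ℓ (k p)) p w = ℓ (mfderiv IC 𝓘(ℝ, FrameCoord) k p w) := by
    intro ℓ
    have h1 := HasMFDerivAt.comp (g := ℓ) (f := k) p (ℓ.hasMFDerivAt) hk.hasMFDerivAt
    exact congrArg (fun l : E4 × (E4 →L[ℝ] ℝ) →L[ℝ] ℝ => l w) h1.mfderiv
  have hG := ((h.contMDiffOn_comp_psi hα hR hF) (liftCoord S e p) ⟨hp, hρ⟩).contMDiffAt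
    ((isOpen_coordDomain h.isOpen).mem_nhds ⟨hp, hρ⟩)
  have h1 := HasMFDerivAt.comp (g := F ∘ psi S α e) (f := liftCoord S e) p
    (hG.mdifferentiableAt (by simp)).hasMFDerivAt hl
  have h2 : (F ∘ S.lift) =ᶠ[𝓝 p] (F ∘ psi S α e) ∘ liftCoord S e := by
    filter_upwards [h.eventually_mem hp] with p' hp'
    simp only [Function.comp, h.lift_eq hα hR hp']
  have h3 := congrArg (fun l : E4 × (E4 →L[ℝ] ℝ) →L[ℝ] ℝ => l w)
    (h1.congr_of_eventuallyEq h2).mfderiv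
  refine Eq.trans h3 ?_
  change dY (F ∘ psi S α e) (liftCoord S e p) (w.1, mfderiv IC 𝓘(ℝ, FrameCoord) k p w) = _
  congr 1
  refine Prod.ext rfl (Prod.ext ?_ ?_)
  · funext j
    exact (hcomp ((ContinuousLinearMap.proj j).comp
      (ContinuousLinearMap.fst ℝ (Fin 4 → ℝ) (Fin 3 → ℝ)))).symm
  · funext i
    exact (hcomp ((ContinuousLinearMap.proj i).comp
      (ContinuousLinearMap.snd ℝ (Fin 4 → ℝ) (Fin 3 → ℝ)))).symm.trans (hv i).2

end AdaptedFrame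
end QCStructure

namespace QCStructure
open QuasiContact

variable {X : Type*} [TopologicalSpace X] [ChartedSpace E4 X] [IsManifold (𝓡 4) ∞ X]
  {S : QCStructure X} {α : ∀ x : X, CoFib X x} {R : ∀ x : X, TangentSpace (𝓡 4) x}
  {U : Set X} {e : Fin 4 → ∀ x : X, TangentSpace (𝓡 4) x}

/-! ### The function `Ω` in a frame -/

/-- The cubic forms that enter `Ω`. -/
def cub (κ : Fin 4 → ℝ) (v : Fin 3 → ℝ) : ℝ :=
  v 0 ^ 2 * (κ 0 * v 2 - κ 1 * v 1) + v 0 * (κ 2 * (v 1 * v 2) + κ 3 * (v 1 ^ 2 - v 2 ^ 2))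

/-- The partial derivatives of `cub` in the second variable. -/
def cubD (κ : Fin 4 → ℝ) (v : Fin 3 → ℝ) : Fin 3 → ℝ :=
  ![2 * v 0 * (κ 0 * v 2 - κ 1 * v 1) + (κ 2 * (v 1 * v 2) + κ 3 * (v 1 ^ 2 - v 2 ^ 2)),
    -(v 0 ^ 2 * κ 1) + v 0 * (κ 2 * v 2 + 2 * κ 3 * v 1),
    v 0 ^ 2 * κ 0 + v 0 * (κ 2 * v 1 - 2 * κ 3 * v 2)]

/-- The partial derivatives of `cub` in the first variable. -/
def cubM (v : Fin 3 → ℝ) : Fin 4 → ℝ :=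
  ![v 0 ^ 2 * v 2, -(v 0 ^ 2 * v 1), v 0 * (v 1 * v 2), v 0 * (v 1 ^ 2 - v 2 ^ 2)]

theorem hasDC_cub {κ : Fin 4 → CoTan X → ℝ} {v : Fin 3 → CoTan X → ℝ} {p : CoTan X}
    {w : E4 × (E4 →L[ℝ] ℝ)} {κ' : Fin 4 → ℝ} {v' : Fin 3 → ℝ} (hκ : ∀ m, HasDC (κ m) p w (κ' m))
    (hv : ∀ i, HasDC (v i) p w (v' i)) :
    HasDC (fun p => cub (fun m => κ m p) fun i => v i p) p w
      (∑ i, cubD (fun m => κ m p) (fun i => v i p) i * v' i +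
        ∑ m, cubM (fun i => v i p) m * κ' m) := by
  have hsub : ∀ {f g : CoTan X → ℝ} {a b : ℝ}, HasDC f p w a → HasDC g p w b →
      HasDC (fun q => f q - g q) p w (a - b) := by
    intro f g a b hf hg
    have := hf.add (hg.const_mul (-1))
    convert this using 1
    · funext q; ring
    · ring
  have h1 := (((hv 0).sq.mul (hsub ((hκ 0).mul (hv 2)) ((hκ 1).mul (hv 1)))).add
    ((hv 0).mul (((hκ 2).mul ((hv 1).mul (hv 2))).add
      ((hκ 3).mul (hsub (hv 1).sq (hv 2).sq)))))
  unfold cub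
  convert h1 using 1
  simp [Fin.sum_univ_three, Fin.sum_univ_four, cubD, cubM]
  ring

/-- The coefficients of the cubic form in a frame. -/
def cubicCoeff (S : QCStructure X) (α : ∀ x : X, CoFib X x)
    (e : Fin 4 → ∀ x : X, TangentSpace (𝓡 4) x) : Fin 4 → X → ℝ :=
  -- The first two coefficients are chosen to remove the `Z`-components of `[Z, e₁]` and `[Z, e₂]`,
  -- the last two the trace-free symmetric part of the matrix `c_{0i}^j` with `i, j ∈ {1, 2}`. The
  -- parts left over, trace and antisymmetric part, commute with rotations of `(v₁, v₂)`.
  ![structFn S α e 0 1 0, structFn S α e 0 2 0,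
    fun x => (structFn S α e 0 1 1 x - structFn S α e 0 2 2 x) / 2,
    fun x => -(structFn S α e 0 1 2 x + structFn S α e 0 2 1 x) / 4]

/-- The leading part of `|σ(R)| Ω / σ(R)`. -/
def mainTerm (S : QCStructure X) (R : ∀ x : X, TangentSpace (𝓡 4) x) (p : CoTan X) : ℝ :=
  (S.sigma p - symb S.charUnit p ^ 2) / 2 * (symb R p)⁻¹

/-- The third order part of `|σ(R)| Ω / σ(R)`. -/
def cubicTerm (S : QCStructure X) (α : ∀ x : X, CoFib X x)
    (e : Fin 4 → ∀ x : X, TangentSpace (𝓡 4) x) (p : CoTan X) : ℝ :=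
  cub (fun m => cubicCoeff S α e m p.1) (fun i => symb (e (Fin.castSucc i)) p) *
    (symb (e 3) p ^ 2)⁻¹

/-- The partial derivatives of the local form of `|σ(R)| Ω / σ(R)` in the symbols of the frame. -/
def partialH (κ : Fin 4 → ℝ) (ρ : ℝ) (h : Fin 3 → ℝ) : Fin 4 → ℝ :=
  ![cubD κ h 0 / ρ ^ 2, h 1 / ρ + cubD κ h 1 / ρ ^ 2, h 2 / ρ + cubD κ h 2 / ρ ^ 2,
    -((h 1 ^ 2 + h 2 ^ 2) / 2 / ρ ^ 2) - 2 * cub κ h / ρ ^ 3]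

namespace AdaptedFrame

theorem contMDiffAt_cubicCoeff (h : AdaptedFrame S α R U e) (hα : S.IsPoppForm α) {x : X}
    (hx : x ∈ U) (m : Fin 4) : ContMDiffAt (𝓡 4) 𝓘(ℝ, ℝ) ∞ (cubicCoeff S α e m) x := by
  have hc := fun j k l => h.contMDiffAt_structFn hα hx j k l
  have hdiv : ∀ (c : ℝ) {f : X → ℝ}, ContMDiffAt (𝓡 4) 𝓘(ℝ, ℝ) ∞ f x →
      ContMDiffAt (𝓡 4) 𝓘(ℝ, ℝ) ∞ (fun y => f y / c) x := fun c f hf =>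
    ContMDiffAt.comp (g := fun t : ℝ => t / c) x
      (ContDiff.contMDiff (contDiff_id.div_const c)).contMDiffAt hf
  fin_cases m
  · exact hc 0 1 0
  · exact hc 0 2 0
  · exact hdiv 2 ((hc 0 1 1).sub (hc 0 2 2))
  · exact hdiv 4 (((hc 0 1 2).add (hc 0 2 1)).neg)

theorem charUnit_eq [T2Space X] (h : AdaptedFrame S α R U e) (hα : S.IsPoppForm α)
    (hR : S.IsReeb α R) {x : X} (hx : x ∈ U) :
    S.charUnit x = e 0 x ∨ S.charUnit x = -e 0 x := by
  have h00 : S.g x (e 0 x) (e 0 x) = 1 := by simpa using h.orthonormal 0 0 x hx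
  obtain ⟨h1, h2⟩ := Classical.epsilon_spec
    (p := fun z : TangentSpace (𝓡 4) x => z ∈ S.L x ∧ S.g x z z = 1) ⟨e 0 x, h.mem_L x hx, h00⟩
  change S.charUnit x ∈ _ at h1
  change S.g x (S.charUnit x) (S.charUnit x) = 1 at h2
  obtain ⟨c, hc⟩ := (h.mem_L_iff_smul hα hR hx).1 h1
  rw [hc, ← gBilin_apply, map_smul, LinearMap.map_smul₂, gBilin_apply, h00, smul_eq_mul,
    smul_eq_mul, mul_one] at h2
  rcases mul_self_eq_one_iff.1 h2 with h3 | h3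
  · left; rw [hc, h3, one_smul]
  · right; rw [hc, h3, neg_smul, one_smul]

/-- The sign ambiguity of the unit characteristic vector disappears in the square of its symbol. So
the leading term of `Ω` is globally defined, and only the cubic term refers to a frame. -/
theorem mainTerm_eq [T2Space X] (h : AdaptedFrame S α R U e) (hα : S.IsPoppForm α)
    (hR : S.IsReeb α R) {p : CoTan X} (hp : p.1 ∈ U) :
    mainTerm S R p = (symb (e 1) p ^ 2 + symb (e 2) p ^ 2) * (2 * symb (e 3) p)⁻¹ := by
  have h1 : symb S.charUnit p ^ 2 = symb (e 0) p ^ 2 := by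
    rcases h.charUnit_eq hα hR hp with h2 | h2
    · rw [symb, h2]; rfl
    · rw [symb, h2, map_neg, neg_sq]; rfl
  rw [mainTerm, h1, h.sigma_eq hp, Fin.sum_univ_three, h.last, mul_inv]
  simp only [Fin.castSucc_zero, show (Fin.castSucc 1 : Fin 4) = 1 from rfl,
      show (Fin.castSucc 2 : Fin 4) = 2 from rfl]
  ring

theorem hasDC_cubicCoeff (h : AdaptedFrame S α R U e) (hα : S.IsPoppForm α) {p : CoTan X}
    (hp : p.1 ∈ U) (m : Fin 4) (w : E4 × (E4 →L[ℝ] ℝ)) :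
    HasDC (fun p : CoTan X => cubicCoeff S α e m p.1) p w
      (dC (fun p : CoTan X => cubicCoeff S α e m p.1) p w) :=
  HasDC.of_contMDiffAt (ContMDiffAt.comp (f := fun p : CoTan X => p.1) p
    (h.contMDiffAt_cubicCoeff hα hp m) contMDiff_coTan_proj.contMDiffAt) w

theorem hasDC_local [T2Space X] (h : AdaptedFrame S α R U e) (hα : S.IsPoppForm α)
    (hR : S.IsReeb α R) {p : CoTan X} (hp : p.1 ∈ U) (hρ : symb (e 3) p ≠ 0)
    (w : E4 × (E4 →L[ℝ] ℝ)) :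
    HasDC (fun p => mainTerm S R p + cubicTerm S α e p) p w
      (∑ k, partialH (fun m => cubicCoeff S α e m p.1) (symb (e 3) p)
          (fun i => symb (e (Fin.castSucc i)) p) k * dC (symb (e k)) p w +
        ∑ m, cubM (fun i => symb (e (Fin.castSucc i)) p) m / symb (e 3) p ^ 2 *
          dC (fun p : CoTan X => cubicCoeff S α e m p.1) p w) := by
  have hd := fun j => h.hasDC_symb hp j w
  have h1 := (((hd 1).sq.add (hd 2).sq).mul (((hd 3).const_mul 2).inv
    (mul_ne_zero two_ne_zero hρ))).add
    ((hasDC_cub (fun m => h.hasDC_cubicCoeff hα hp m w) fun i => hd (Fin.castSucc i)).mul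
      ((hd 3).sq.inv (pow_ne_zero 2 hρ)))
  have h2 := h1.congr_of_eventuallyEq (g := fun p => mainTerm S R p + cubicTerm S α e p) (by
    filter_upwards [h.eventually_mem hp] with p' hp'
    rw [h.mainTerm_eq hα hR hp', cubicTerm])
  convert h2 using 1
  simp only [Fin.sum_univ_three, Fin.sum_univ_four, partialH, Fin.castSucc_zero,
    show (Fin.castSucc 1 : Fin 4) = 1 from rfl, show (Fin.castSucc 2 : Fin 4) = 2 from rfl,
    Matrix.cons_val_zero, Matrix.cons_val_one, Matrix.cons_val]
  field_simp
  ring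

theorem ham_local [T2Space X] (h : AdaptedFrame S α R U e) (hα : S.IsPoppForm α)
    (hR : S.IsReeb α R) {p : CoTan X} (hp : p.1 ∈ U) (hρ : symb (e 3) p ≠ 0) :
    ham (fun p => mainTerm S R p + cubicTerm S α e p) p =
      ∑ k, partialH (fun m => cubicCoeff S α e m p.1) (symb (e 3) p)
          (fun i => symb (e (Fin.castSucc i)) p) k • ham (symb (e k)) p +
        ∑ m, (cubM (fun i => symb (e (Fin.castSucc i)) p) m / symb (e 3) p ^ 2) •
          ham (fun p : CoTan X => cubicCoeff S α e m p.1) p := by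
  have h1 := ham_eq_sum (s := Finset.univ) (p := p)
    (f := fun p => mainTerm S R p + cubicTerm S α e p)
    (c := Sum.elim (partialH (fun m => cubicCoeff S α e m p.1) (symb (e 3) p)
          (fun i => symb (e (Fin.castSucc i)) p))
        fun m => (cubM (fun i => symb (e (Fin.castSucc i)) p) m / symb (e 3) p ^ 2))
    (g := Sum.elim (fun k => symb (e k)) fun m => fun p : CoTan X => cubicCoeff S α e m p.1)
    fun w => by
      rw [(h.hasDC_local hα hR hp hρ w).2, Fintype.sum_sum_type]; rfl
  rw [h1, Fintype.sum_sum_type]; rfl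

theorem ham_sqrtSigma (h : AdaptedFrame S α R U e) {p : CoTan X} (hp : p.1 ∈ U)
    (h0 : S.sigma p ≠ 0) :
    ham S.sqrtSigma p = ∑ i : Fin 3, (symb (e (Fin.castSucc i)) p * (S.sqrtSigma p)⁻¹) •
      ham (symb (e (Fin.castSucc i))) p :=
  ham_eq_sum fun w => (h.hasDC_sqrtSigma hp h0 w).2

end AdaptedFrame

/-- The Poisson brackets of the symbols of the frame. -/
def bracketFn (S : QCStructure X) (α : ∀ x : X, CoFib X x)
    (e : Fin 4 → ∀ x : X, TangentSpace (𝓡 4) x) (q : CoTanSum X) (k j : Fin 4) : ℝ :=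
  ∑ l, structFn S α e k j l q.1 * q.2.1 (e l q.1)

/-- The derivatives of the symbols of the frame along `∑ b_k H_{h_k} + ∑ β_m H_{κ_m}`. -/
def hamComp (S : QCStructure X) (α : ∀ x : X, CoFib X x)
    (e : Fin 4 → ∀ x : X, TangentSpace (𝓡 4) x) {ι : Type*} [Fintype ι] (κ : ι → X → ℝ)
    (q : CoTanSum X) (b : Fin 4 → ℝ) (β : ι → ℝ) (j : Fin 4) : ℝ :=
  ∑ k, b k * bracketFn S α e q k j - ∑ m, β m * dX (κ m) q.1 (e j q.1)

/-- The projection of a vector to the tangent space of the unit sphere. -/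
def sphereProj (v a : Fin 3 → ℝ) (i : Fin 3) : ℝ := a i - v i * ∑ l, v l * a l

namespace AdaptedFrame

/-- The field `H_{κ}` of a function on the base is vertical, so the base velocity is `∑ b_k e_k`.
The derivatives of the symbols are Poisson brackets, given by the structure functions, and the
sphere component carries the factor `1 / r`, with `r = ξ(v) = σ^{1/2}`. -/
theorem dC_comp_lift_comb (h : AdaptedFrame S α R U e) (hα : S.IsPoppForm α)
    (hR : S.IsReeb α R) {F : CoTanSum X → ℝ} (hF : TestFn F) {q : CoTanSum X}
    (hq : q ∈ S.Blowup \ S.SN) (hU : q.1 ∈ U) (hρ : q.2.1 (e 3 q.1) ≠ 0) {ι : Type*} [Fintype ι]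
    {κ : ι → X → ℝ} (hκ : ∀ m, MDifferentiableAt (𝓡 4) 𝓘(ℝ, ℝ) (κ m) q.1) (b : Fin 4 → ℝ)
    (β : ι → ℝ) :
    dC (F ∘ S.lift) (beta q) (∑ k, b k • ham (symb (e k)) (beta q) +
      ∑ m, β m • ham (fun p : CoTan X => κ m p.1) (beta q)) =
      dY (F ∘ psi S α e) (coord S e q) (frameVec e q.1 b (hamComp S α e κ q b β)
        fun i => (q.2.1 q.2.2)⁻¹ * sphereProj (coord S e q).2.2
          (fun i => hamComp S α e κ q b β (Fin.castSucc i)) i) := by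
  obtain ⟨h1, h2, h3⟩ := interior_spec hq
  have h0 : S.sigma (beta q) ≠ 0 := fun hs => by
    rw [sqrtSigma, hs, Real.sqrt_zero] at h2
    exact h1.ne h2
  have hp : (beta q).1 ∈ U := hU
  have hd : ∀ j, dC (symb (e j)) (beta q) (∑ k, b k • ham (symb (e k)) (beta q) +
      ∑ m, β m • ham (fun p : CoTan X => κ m p.1) (beta q)) = hamComp S α e κ q b β j := by
    intro j
    rw [dC_add_vec, dC_sum_vec, dC_sum_vec, hamComp, sub_eq_add_neg, ← Finset.sum_neg_distrib]
    congr 1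
    · refine Finset.sum_congr rfl fun k _ => ?_
      rw [h.dC_symb_ham hα hR hp]
      rfl
    · refine Finset.sum_congr rfl fun m _ => ?_
      rw [ham_comp_proj (p := beta q) (hκ m), dC_symb (p := beta q) (h.smooth j _ hp).diffAt]
      have z1 : (beta q).2 (vfDeriv (e j) (beta q).1 0) = 0 :=
        (congrArg (beta q).2 (map_zero (vfDeriv (e j) (beta q).1))).trans (map_zero _)
      refine (congrArg (fun t : ℝ => β m * (_ + t)) z1).trans ?_
      rw [add_zero]
      exact mul_neg _ _
  rw [h.dC_comp_lift hα hR hF hp h0 hρ, h.liftCoord_beta hq hU, h2]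
  simp only [hd]
  congr 1
  refine Prod.ext ?_ rfl
  simp only [Prod.fst_add, Prod.fst_sum, Prod.smul_fst]
  have e1 : ∀ k, (ham (symb (e k)) (beta q)).1 = (show E4 from e k q.1) := fun k => by
    rw [ham_symb (p := beta q) (h.smooth k _ hp).diffAt]; rfl
  have e2 : ∀ m, (ham (fun p : CoTan X => κ m p.1) (beta q)).1 = 0 := fun m => by
    rw [ham_comp_proj (p := beta q) (hκ m)]
  simp only [e1, e2, smul_zero, Finset.sum_const_zero, add_zero]
  rfl

end AdaptedFrame
end QCStructure

namespace QCStructure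
open QuasiContact

variable {X : Type*} [TopologicalSpace X] [ChartedSpace E4 X] [IsManifold (𝓡 4) ∞ X]
  {S : QCStructure X} {α : ∀ x : X, CoFib X x} {R : ∀ x : X, TangentSpace (𝓡 4) x}
  {U : Set X} {e : Fin 4 → ∀ x : X, TangentSpace (𝓡 4) x}

/-! ### Limits at the boundary of the blowup -/

/-- `partialH` on the blowup, divided by `σ^{1/2}`. -/
def blowH (ρ r : ℝ) (v : Fin 3 → ℝ) (κ : Fin 4 → ℝ) : Fin 4 → ℝ :=
  ![r * cubD κ v 0 / ρ ^ 2, v 1 / ρ + r * cubD κ v 1 / ρ ^ 2, v 2 / ρ + r * cubD κ v 2 / ρ ^ 2,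
    -(r * ((v 1 ^ 2 + v 2 ^ 2) / 2 / ρ ^ 2)) - 2 * r ^ 2 * cub κ v / ρ ^ 3]

/-- The remainder of the components of `H_{σ^{1/2}} - (|σ(R)| / σ^{1/2}) H_Ω`, divided by
`σ^{1/2}`. -/
def remH (ρ r : ℝ) (v : Fin 3 → ℝ) (κ : Fin 4 → ℝ) : Fin 4 → ℝ :=
  ![-(cubD κ v 0 / ρ), -(cubD κ v 1 / ρ), -(cubD κ v 2 / ρ),
    (v 1 ^ 2 + v 2 ^ 2) / 2 / ρ + 2 * r * cub κ v / ρ ^ 2]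

/-- At `h = r v` every partial derivative is divisible by `r`, because the local function starts
with quadratic terms. The quotient `blowH` is regular at `r = 0`. -/
theorem partialH_smul (ρ r : ℝ) (v : Fin 3 → ℝ) (κ : Fin 4 → ℝ) :
    partialH κ ρ (fun i => r * v i) = fun k => r * blowH ρ r v κ k := by
  funext k
  fin_cases k <;> simp [partialH, blowH, cubD, cub] <;> ring

theorem cubM_smul (r : ℝ) (v : Fin 3 → ℝ) (m : Fin 4) :
    cubM (fun i => r * v i) m = r ^ 3 * cubM v m := by
  fin_cases m <;> simp [cubM] <;> ring

theorem cub_smul (r : ℝ) (v : Fin 3 → ℝ) (κ : Fin 4 → ℝ) :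
    cub κ (fun i => r * v i) = r ^ 3 * cub κ v := by
  simp only [cub]; ring

/-- This is the cancellation that makes the expansion finite. `H_{σ^{1/2}}` has components `v₀, v₁,
v₂, 0` along the `H_{h_k}`, and the oscillator contributes exactly `v₁` and `v₂`. Only `v₀` and a
remainder of order `r` survive, and the latter still matters because the lift divides by `r`. -/
theorem sub_blowH {ρ : ℝ} (hρ : ρ ≠ 0) (r : ℝ) (v : Fin 3 → ℝ) (κ : Fin 4 → ℝ) (k : Fin 4) :
    (![v 0, v 1, v 2, 0] : Fin 4 → ℝ) k - ρ * blowH ρ r v κ k =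
      (![v 0, 0, 0, 0] : Fin 4 → ℝ) k + r * remH ρ r v κ k := by
  fin_cases k <;> simp [blowH, remH] <;> field_simp <;> ring

section limits
variable {Q : Type*} {l : Filter Q} {ρ r : Q → ℝ} {v : Q → Fin 3 → ℝ} {κ : Q → Fin 4 → ℝ}
  {ρ₀ r₀ : ℝ} {v₀ : Fin 3 → ℝ} {κ₀ : Fin 4 → ℝ}

theorem tendsto_param (hρ : Tendsto ρ l (𝓝 ρ₀)) (hr : Tendsto r l (𝓝 r₀))
    (hv : Tendsto v l (𝓝 v₀)) (hκ : Tendsto κ l (𝓝 κ₀))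
    {f : ℝ → ℝ → (Fin 3 → ℝ) → (Fin 4 → ℝ) → ℝ}
    (hf : ContinuousAt (fun z : ℝ × ℝ × (Fin 3 → ℝ) × (Fin 4 → ℝ) => f z.1 z.2.1 z.2.2.1 z.2.2.2)
      (ρ₀, r₀, v₀, κ₀)) :
    Tendsto (fun q => f (ρ q) (r q) (v q) (κ q)) l (𝓝 (f ρ₀ r₀ v₀ κ₀)) :=
  hf.tendsto.comp (hρ.prodMk_nhds (hr.prodMk_nhds (hv.prodMk_nhds hκ)))

theorem continuous_cub : Continuous fun z : (Fin 3 → ℝ) × (Fin 4 → ℝ) => cub z.2 z.1 := by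
  unfold cub; fun_prop

theorem continuous_cubD (i : Fin 3) :
    Continuous fun z : (Fin 3 → ℝ) × (Fin 4 → ℝ) => cubD z.2 z.1 i := by
  fin_cases i <;> simp [cubD] <;> fun_prop

theorem continuous_cubM (m : Fin 4) : Continuous fun v : Fin 3 → ℝ => cubM v m := by
  fin_cases m <;> simp [cubM] <;> fun_prop

theorem tendsto_blowH (hρ : Tendsto ρ l (𝓝 ρ₀)) (hr : Tendsto r l (𝓝 r₀))
    (hv : Tendsto v l (𝓝 v₀)) (hκ : Tendsto κ l (𝓝 κ₀)) (h0 : ρ₀ ≠ 0) (k : Fin 4) :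
    Tendsto (fun q => blowH (ρ q) (r q) (v q) (κ q) k) l (𝓝 (blowH ρ₀ r₀ v₀ κ₀ k)) := by
  refine tendsto_param (f := fun ρ r v κ => blowH ρ r v κ k) hρ hr hv hκ ?_
  have h2 : ρ₀ ^ 2 ≠ 0 := pow_ne_zero 2 h0
  have h3 : ρ₀ ^ 3 ≠ 0 := pow_ne_zero 3 h0
  have hD : ∀ i, Continuous fun z : ℝ × ℝ × (Fin 3 → ℝ) × (Fin 4 → ℝ) => cubD z.2.2.2 z.2.2.1 i :=
    fun i => (continuous_cubD i).comp (continuous_snd.comp continuous_snd)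
  have hC : Continuous fun z : ℝ × ℝ × (Fin 3 → ℝ) × (Fin 4 → ℝ) => cub z.2.2.2 z.2.2.1 :=
    continuous_cub.comp (continuous_snd.comp continuous_snd)
  have hD0 := (hD 0).continuousAt (x := (ρ₀, r₀, v₀, κ₀))
  have hD1 := (hD 1).continuousAt (x := (ρ₀, r₀, v₀, κ₀))
  have hD2 := (hD 2).continuousAt (x := (ρ₀, r₀, v₀, κ₀))
  have hC' := hC.continuousAt (x := (ρ₀, r₀, v₀, κ₀))
  have hP : ContinuousAt (fun z : ℝ × ℝ × (Fin 3 → ℝ) × (Fin 4 → ℝ) => z.1) (ρ₀, r₀, v₀, κ₀) := by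
    fun_prop
  have hr' : ContinuousAt (fun z : ℝ × ℝ × (Fin 3 → ℝ) × (Fin 4 → ℝ) => z.2.1) (ρ₀, r₀, v₀, κ₀) := by
    fun_prop
  have hv' : ∀ i, ContinuousAt (fun z : ℝ × ℝ × (Fin 3 → ℝ) × (Fin 4 → ℝ) => z.2.2.1 i)
    (ρ₀, r₀, v₀, κ₀) := fun i => by fun_prop
  fin_cases k
  · exact (hr'.mul hD0).div₀ (hP.pow 2) h2
  · exact ((hv' 1).div₀ hP h0).add ((hr'.mul hD1).div₀ (hP.pow 2) h2)
  · exact ((hv' 2).div₀ hP h0).add ((hr'.mul hD2).div₀ (hP.pow 2) h2)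
  · exact (hr'.mul (((((hv' 1).pow 2).add ((hv' 2).pow 2)).div_const 2).div₀ (hP.pow 2) h2)).neg.sub
      (((continuousAt_const.mul (hr'.pow 2)).mul hC').div₀ (hP.pow 3) h3)

theorem tendsto_remH (hρ : Tendsto ρ l (𝓝 ρ₀)) (hr : Tendsto r l (𝓝 r₀))
    (hv : Tendsto v l (𝓝 v₀)) (hκ : Tendsto κ l (𝓝 κ₀)) (h0 : ρ₀ ≠ 0) (k : Fin 4) :
    Tendsto (fun q => remH (ρ q) (r q) (v q) (κ q) k) l (𝓝 (remH ρ₀ r₀ v₀ κ₀ k)) := by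
  refine tendsto_param (f := fun ρ r v κ => remH ρ r v κ k) hρ hr hv hκ ?_
  have h2 : ρ₀ ^ 2 ≠ 0 := pow_ne_zero 2 h0
  have hD : ∀ i, Continuous fun z : ℝ × ℝ × (Fin 3 → ℝ) × (Fin 4 → ℝ) => cubD z.2.2.2 z.2.2.1 i :=
    fun i => (continuous_cubD i).comp (continuous_snd.comp continuous_snd)
  have hC : Continuous fun z : ℝ × ℝ × (Fin 3 → ℝ) × (Fin 4 → ℝ) => cub z.2.2.2 z.2.2.1 :=
    continuous_cub.comp (continuous_snd.comp continuous_snd)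
  have hC' := hC.continuousAt (x := (ρ₀, r₀, v₀, κ₀))
  have hP : ContinuousAt (fun z : ℝ × ℝ × (Fin 3 → ℝ) × (Fin 4 → ℝ) => z.1) (ρ₀, r₀, v₀, κ₀) := by
    fun_prop
  have hr' : ContinuousAt (fun z : ℝ × ℝ × (Fin 3 → ℝ) × (Fin 4 → ℝ) => z.2.1) (ρ₀, r₀, v₀, κ₀) := by
    fun_prop
  have hv' : ∀ i, ContinuousAt (fun z : ℝ × ℝ × (Fin 3 → ℝ) × (Fin 4 → ℝ) => z.2.2.1 i)
    (ρ₀, r₀, v₀, κ₀) := fun i => by fun_prop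
  fin_cases k
  · exact ((hD 0).continuousAt.div₀ hP h0).neg
  · exact ((hD 1).continuousAt.div₀ hP h0).neg
  · exact ((hD 2).continuousAt.div₀ hP h0).neg
  · exact (((((hv' 1).pow 2).add ((hv' 2).pow 2)).div_const 2).div₀ hP h0).add
      (((continuousAt_const.mul hr').mul hC').div₀ (hP.pow 2) h2)

theorem tendsto_sphereProj {a : Q → Fin 3 → ℝ} {a₀ : Fin 3 → ℝ} (hv : Tendsto v l (𝓝 v₀))
    (ha : ∀ i, Tendsto (fun q => a q i) l (𝓝 (a₀ i))) (i : Fin 3) :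
    Tendsto (fun q => sphereProj (v q) (a q) i) l (𝓝 (sphereProj v₀ a₀ i)) := by
  have hv' := tendsto_pi_nhds.1 hv
  exact (ha i).sub ((hv' i).mul (tendsto_finsetSum _ fun l _ => (hv' l).mul (ha l)))

end limits

theorem sphereProj_smul (r : ℝ) (v a : Fin 3 → ℝ) (i : Fin 3) :
    sphereProj v (fun i => r * a i) i = r * sphereProj v a i := by
  simp only [sphereProj, mul_left_comm _ r, ← Finset.mul_sum]
  ring

theorem hamComp_smul {ι : Type*} [Fintype ι] (κ : ι → X → ℝ) (q : CoTanSum X) (r : ℝ)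
    (b : Fin 4 → ℝ) (β : ι → ℝ) (j : Fin 4) :
    hamComp S α e κ q (fun k => r * b k) (fun m => r * β m) j = r * hamComp S α e κ q b β j := by
  simp only [hamComp, mul_assoc, ← Finset.mul_sum]
  ring

theorem hamComp_add {ι : Type*} [Fintype ι] (κ : ι → X → ℝ) (q : CoTanSum X)
    (b b' : Fin 4 → ℝ) (β : ι → ℝ) (j : Fin 4) :
    hamComp S α e κ q (fun k => b k + b' k) β j =
      ∑ k, b k * bracketFn S α e q k j + hamComp S α e κ q b' β j := by
  simp only [hamComp, add_mul, Finset.sum_add_distrib]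
  ring

namespace AdaptedFrame

theorem tendsto_base {q : CoTanSum X} :
    Tendsto (fun q' : CoTanSum X => q'.1) (S.interiorNhds q) (𝓝 q.1) :=
  (contMDiff_coTanSum_proj.continuous.continuousAt (x := q)).tendsto.mono_left nhdsWithin_le_nhds

theorem tendsto_eval (h : AdaptedFrame S α R U e) {q : CoTanSum X} (hU : q.1 ∈ U) (j : Fin 4) :
    Tendsto (fun q' : CoTanSum X => q'.2.1 (e j q'.1)) (S.interiorNhds q) (𝓝 (q.2.1 (e j q.1))) :=
  (h.contMDiffAt_eval hU j).continuousAt.tendsto.mono_left nhdsWithin_le_nhds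

theorem tendsto_coord (h : AdaptedFrame S α R U e) {q : CoTanSum X} (hU : q.1 ∈ U) :
    Tendsto (coord S e) (S.interiorNhds q) (𝓝 (coord S e q)) :=
  (h.contMDiffAt_coord hU).continuousAt.tendsto.mono_left nhdsWithin_le_nhds

theorem tendsto_radius {q : CoTanSum X} :
    Tendsto (fun q' : CoTanSum X => q'.2.1 q'.2.2) (S.interiorNhds q) (𝓝 (q.2.1 q.2.2)) := by
  have h1 := contMDiffWithinAt_pairing (b := fun q : CoTanSum X => q.1) (ξ := fun q => q.2.1)
    (v := fun q => q.2.2) (m := q) contMDiff_beta.contMDiffAt.contMDiffWithinAt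
    (contMDiff_coTanSum_snd.contMDiffAt.contMDiffWithinAt (s := univ))
  exact (h1.continuousWithinAt.continuousAt univ_mem).tendsto.mono_left nhdsWithin_le_nhds

theorem tendsto_comp_base {f : X → ℝ} {q : CoTanSum X} (hf : ContinuousAt f q.1) :
    Tendsto (fun q' : CoTanSum X => f q'.1) (S.interiorNhds q) (𝓝 (f q.1)) :=
  hf.tendsto.comp tendsto_base

theorem tendsto_bracketFn (h : AdaptedFrame S α R U e) (hα : S.IsPoppForm α) {q : CoTanSum X}
    (hU : q.1 ∈ U) (k j : Fin 4) :
    Tendsto (fun q' => bracketFn S α e q' k j) (S.interiorNhds q) (𝓝 (bracketFn S α e q k j)) :=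
  tendsto_finsetSum _ fun l _ =>
    (tendsto_comp_base (h.contMDiffAt_structFn hα hU k j l).continuousAt).mul (h.tendsto_eval hU l)

theorem tendsto_hamComp (h : AdaptedFrame S α R U e) (hα : S.IsPoppForm α) {q : CoTanSum X}
    (hU : q.1 ∈ U) {ι : Type*} [Fintype ι] {κ : ι → X → ℝ}
    (hκ : ∀ m, ContMDiffOn (𝓡 4) 𝓘(ℝ, ℝ) ∞ (κ m) U) {b : CoTanSum X → Fin 4 → ℝ}
    {β : CoTanSum X → ι → ℝ} {b₀ : Fin 4 → ℝ} {β₀ : ι → ℝ}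
    (hb : ∀ k, Tendsto (fun q' => b q' k) (S.interiorNhds q) (𝓝 (b₀ k)))
    (hβ : ∀ k, Tendsto (fun q' => β q' k) (S.interiorNhds q) (𝓝 (β₀ k))) (j : Fin 4) :
    Tendsto (fun q' => hamComp S α e κ q' (b q') (β q') j) (S.interiorNhds q)
      (𝓝 (hamComp S α e κ q b₀ β₀ j)) :=
  (tendsto_finsetSum _ fun k _ => (hb k).mul (h.tendsto_bracketFn hα hU k j)).sub
    (tendsto_finsetSum _ fun m _ => (hβ m).mul (tendsto_comp_base
      (f := fun x => dX (κ m) x (e j x))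
      (contMDiffAt_mfderiv_vf h.isOpen hU (hκ m) (h.smooth j _ hU)).continuousAt))

theorem contMDiffOn_cubicCoeff (h : AdaptedFrame S α R U e) (hα : S.IsPoppForm α) (m : Fin 4) :
    ContMDiffOn (𝓡 4) 𝓘(ℝ, ℝ) ∞ (cubicCoeff S α e m) U := fun _ hx =>
  (h.contMDiffAt_cubicCoeff hα hx m).contMDiffWithinAt

/-- Points of the interior close to a boundary point over the domain of the frame. -/
theorem eventually_interior (h : AdaptedFrame S α R U e) {q : CoTanSum X}
    (hU : q.1 ∈ U) (hρ : q.2.1 (e 3 q.1) ≠ 0) :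
    ∀ᶠ q' in S.interiorNhds q, q' ∈ S.Blowup \ S.SN ∧ q'.1 ∈ U ∧ q'.2.1 (e 3 q'.1) ≠ 0 := by
  refine Filter.Eventually.and self_mem_nhdsWithin (Filter.Eventually.and ?_ ?_)
  · exact tendsto_base.eventually (h.isOpen.mem_nhds hU)
  · exact (h.tendsto_eval hU 3).eventually_ne hρ

theorem eval_interior (h : AdaptedFrame S α R U e) {q : CoTanSum X} (hq : q ∈ S.Blowup \ S.SN)
    (hU : q.1 ∈ U) : (fun i : Fin 3 => q.2.1 (e (Fin.castSucc i) q.1)) =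
      fun i => q.2.1 q.2.2 * (coord S e q).2.2 i := by
  funext i
  rw [(interior_spec hq).2.2 _ (h.mem_E i _ hU), S.symm_g]; rfl

/-- On `Σ` the symbols of `Z, e₁, e₂` vanish, so of each bracket only its `R`-component is seen. -/
theorem bracketFn_boundary (h : AdaptedFrame S α R U e) (hα : S.IsPoppForm α)
    (hR : S.IsReeb α R) {q : CoTanSum X} (hq : q ∈ S.SN) (hU : q.1 ∈ U) (k j : Fin 4) :
    bracketFn S α e q k j = structFn S α e k j 3 q.1 * q.2.1 (e 3 q.1) := by
  have h1 := ((mem_SN_iff hα hR).1 hq).2.1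
  have h0 : ∀ i : Fin 3, q.2.1 (e (Fin.castSucc i) q.1) = 0 := fun i => by
    rw [h1, smul_apply, h.apply_castSucc hα hU, smul_zero]
  rw [bracketFn, Fin.sum_univ_castSucc]
  simp only [h0, mul_zero, Finset.sum_const_zero, zero_add]
  rfl

theorem radius_boundary (hα : S.IsPoppForm α) (hR : S.IsReeb α R) {q : CoTanSum X}
    (hq : q ∈ S.SN) : q.2.1 q.2.2 = 0 := by
  obtain ⟨_, h1, h2, _⟩ := (mem_SN_iff hα hR).1 hq
  rw [h1, smul_apply, hα.apply_eq_zero h2, smul_zero]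

end AdaptedFrame
end QCStructure

/-! ### Limits of the Hamilton fields at the boundary, in one frame -/

namespace QCStructure
open QuasiContact

variable {X : Type*} [TopologicalSpace X] [ChartedSpace E4 X] [IsManifold (𝓡 4) ∞ X]
  {S : QCStructure X} {α : ∀ x : X, CoFib X x} {R : ∀ x : X, TangentSpace (𝓡 4) x}
  {U : Set X} {e : Fin 4 → ∀ x : X, TangentSpace (𝓡 4) x}

/-- The divergence-type structure function `b` with `[Z, R] = b R` modulo `E`. -/
def structB (S : QCStructure X) (α : ∀ x : X, CoFib X x)
    (e : Fin 4 → ∀ x : X, TangentSpace (𝓡 4) x) : X → ℝ := structFn S α e 0 3 3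

/-- The antisymmetric part of the bracket with `Z`. -/
def structC (S : QCStructure X) (α : ∀ x : X, CoFib X x)
    (e : Fin 4 → ∀ x : X, TangentSpace (𝓡 4) x) (x : X) : ℝ :=
  (structFn S α e 0 1 2 x - structFn S α e 0 2 1 x) / 2

/-- The spherical components of the boundary field in a frame. -/
def sphereField (b γ : ℝ) (v : Fin 3 → ℝ) : Fin 3 → ℝ :=
  ![-((v 1 ^ 2 + v 2 ^ 2) * b / 2), v 0 * (b / 2 * v 1 + γ * v 2), v 0 * (b / 2 * v 2 - γ * v 1)]

/-- The boundary field in the coordinates of a frame. -/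
def fieldVec (S : QCStructure X) (α : ∀ x : X, CoFib X x)
    (e : Fin 4 → ∀ x : X, TangentSpace (𝓡 4) x) (y : X × FrameCoord) : E4 × FrameCoord :=
  frameVec e y.1 ![y.2.2 0, 0, 0, 0] ![0, 0, 0, y.2.2 0 * structB S α e y.1 * y.2.1 3]
    (sphereField (structB S α e y.1) (structC S α e y.1) y.2.2)

theorem dY_frameVec_smul (G : X × FrameCoord → ℝ) (y : X × FrameCoord) (s : ℝ) (c η : Fin 4 → ℝ)
    (v : Fin 3 → ℝ) : dY G y (frameVec e y.1 (fun k => s * c k) (fun j => s * η j)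
      fun i => s * v i) = s * dY G y (frameVec e y.1 c η v) := by
  rw [dY_frameVec, dY_frameVec, Finset.mul_sum]
  refine Finset.sum_congr rfl fun m _ => ?_
  rcases m with k | j | i <;> simp [mul_assoc]

theorem tendsto_cub {Q : Type*} {l : Filter Q} {v : Q → Fin 3 → ℝ} {κ : Q → Fin 4 → ℝ}
    {v₀ : Fin 3 → ℝ} {κ₀ : Fin 4 → ℝ} (hv : Tendsto v l (𝓝 v₀)) (hκ : Tendsto κ l (𝓝 κ₀)) :
    Tendsto (fun q => cub (κ q) (v q)) l (𝓝 (cub κ₀ v₀)) := by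
  have hv' := tendsto_pi_nhds.1 hv
  have hκ' := tendsto_pi_nhds.1 hκ
  unfold cub
  exact (((hv' 0).pow 2).mul (((hκ' 0).mul (hv' 2)).sub ((hκ' 1).mul (hv' 1)))).add
    ((hv' 0).mul (((hκ' 2).mul ((hv' 1).mul (hv' 2))).add
      ((hκ' 3).mul (((hv' 1).pow 2).sub ((hv' 2).pow 2)))))

namespace AdaptedFrame

/-- The components of the Hamilton field are of order `r`, so the base point and the covector do not
move in the limit. The sphere component is divided by `r`, and there `{h₁, h₂} = -ρ` together with
the factor `1 / ρ` gives a rotation of unit speed. The cubic term is of higher order and does not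
contribute. -/
theorem tendsto_ham_local [T2Space X] (h : AdaptedFrame S α R U e) (hα : S.IsPoppForm α)
    (hR : S.IsReeb α R) {F : CoTanSum X → ℝ} (hF : TestFn F) {q : CoTanSum X} (hq : q ∈ S.SN)
    (hU : q.1 ∈ U) :
    Tendsto (fun q' => dC (F ∘ S.lift) (beta q')
        (ham (fun p => mainTerm S R p + cubicTerm S α e p) (beta q')))
      (S.interiorNhds q) (𝓝 (dY (F ∘ psi S α e) (coord S e q)
        (frameVec e q.1 0 0 ![0, (coord S e q).2.2 2, -(coord S e q).2.2 1]))) := by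
  have hρ : q.2.1 (e 3 q.1) ≠ 0 := by
    rw [h.last]; exact ((mem_SN_iff hα hR).1 hq).1
  let κ : CoTanSum X → Fin 4 → ℝ := fun q' m => cubicCoeff S α e m q'.1
  let v : CoTanSum X → Fin 3 → ℝ := fun q' => (coord S e q').2.2
  let ρ : CoTanSum X → ℝ := fun q' => q'.2.1 (e 3 q'.1)
  let r : CoTanSum X → ℝ := fun q' => q'.2.1 q'.2.2
  let bt : CoTanSum X → Fin 4 → ℝ := fun q' => blowH (ρ q') (r q') (v q') (κ q')
  let βt : CoTanSum X → Fin 4 → ℝ := fun q' m => r q' ^ 2 * cubM (v q') m / ρ q' ^ 2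
  let at' : CoTanSum X → Fin 4 → ℝ := fun q' =>
    hamComp S α e (cubicCoeff S α e) q' (bt q') (βt q')
  have hr0 : r q = 0 := radius_boundary hα hR hq
  have tκ : Tendsto κ (S.interiorNhds q) (𝓝 (κ q)) := tendsto_pi_nhds.2 fun m =>
    tendsto_comp_base (h.contMDiffAt_cubicCoeff hα hU m).continuousAt
  have tv : Tendsto v (S.interiorNhds q) (𝓝 (v q)) :=
    (continuous_snd.comp continuous_snd).continuousAt.tendsto.comp (h.tendsto_coord hU)
  have tρ : Tendsto ρ (S.interiorNhds q) (𝓝 (ρ q)) := h.tendsto_eval hU 3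
  have tr : Tendsto r (S.interiorNhds q) (𝓝 0) := hr0 ▸ tendsto_radius
  have tb : ∀ k, Tendsto (fun q' => bt q' k) (S.interiorNhds q)
      (𝓝 (blowH (ρ q) 0 (v q) (κ q) k)) := tendsto_blowH tρ tr tv tκ hρ
  have tβ : ∀ m, Tendsto (fun q' => βt q' m) (S.interiorNhds q) (𝓝 0) := fun m => by
    have h1 := ((tr.pow 2).mul (((continuous_cubM m).continuousAt (x := v q)).tendsto.comp tv)).div
      (tρ.pow 2) (pow_ne_zero 2 hρ)
    rw [show (0 : ℝ) = 0 ^ 2 * cubM (v q) m / ρ q ^ 2 by simp]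
    exact h1
  have ta := h.tendsto_hamComp hα hU (h.contMDiffOn_cubicCoeff hα) tb tβ
  have hmain := h.tendsto_dY (isOpen_coordDomain h.isOpen) (h.contMDiffOn_comp_psi hα hR hF)
    (h.tendsto_coord hU) (y₀ := coord S e q) ⟨hU, hρ⟩ hU
    (c := fun q' k => r q' * bt q' k) (c₀ := 0)
    (η := fun q' j => r q' * at' q' j) (η₀ := 0)
    (v := fun q' => sphereProj (v q') fun i => at' q' (Fin.castSucc i))
    (fun k => by simpa using tr.mul (tb k)) (fun j => by simpa using tr.mul (ta j))
    (fun i => tendsto_sphereProj tv (fun i => ta (Fin.castSucc i)) i)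
  have hlim : (sphereProj (v q) fun i => hamComp S α e (cubicCoeff S α e) q
      (blowH (ρ q) 0 (v q) (κ q)) (fun _ => 0) (Fin.castSucc i)) =
      ![0, (coord S e q).2.2 2, -(coord S e q).2.2 1] := by
    obtain ⟨c1, c2, c3, -, -⟩ := h.structFn_three_values hα hR hU
    have c4 : structFn S α e 2 1 3 q.1 = 1 := by rw [structFn_swap, c3, neg_neg]
    have c5 : structFn S α e 1 0 3 q.1 = 0 := by rw [structFn_swap, c1, neg_zero]
    have c6 : structFn S α e 2 0 3 q.1 = 0 := by rw [structFn_swap, c2, neg_zero]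
    have c7 : ∀ k l, structFn S α e k k l q.1 = 0 := fun k l => by
      have := structFn_swap (S := S) (α := α) (e := e) k k l q.1; linarith
    have hρ' : ρ q ≠ 0 := hρ
    have hv : v q = (coord S e q).2.2 := rfl
    have hb : ∀ k j, bracketFn S α e q k j = structFn S α e k j 3 q.1 * ρ q :=
      h.bracketFn_boundary hα hR hq hU
    have ha : (fun i : Fin 3 => hamComp S α e (cubicCoeff S α e) q
        (blowH (ρ q) 0 (v q) (κ q)) (fun _ => 0) (Fin.castSucc i)) =
        ![0, (coord S e q).2.2 2, -(coord S e q).2.2 1] := by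
      funext i
      simp only [hamComp, hb, Fin.sum_univ_four, blowH]
      fin_cases i <;> simp [c1, c2, c3, c4, c5, c6, c7, hv] <;> field_simp
    rw [ha]
    funext i
    simp only [sphereProj, Fin.sum_univ_three, hv]
    fin_cases i <;> simp <;> ring_nf <;> simp
  rw [hlim] at hmain
  refine hmain.congr' ?_
  filter_upwards [h.eventually_interior hU hρ] with q' hq'
  obtain ⟨hi, hU', hρ'⟩ := hq'
  have hr' : r q' ≠ 0 := (interior_spec hi).1.ne'
  have e0 : (fun i : Fin 3 => symb (e (Fin.castSucc i)) (beta q')) = fun i => r q' * v q' i :=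
    h.eval_interior hi hU'
  have e1 : partialH (fun m => cubicCoeff S α e m (beta q').1) (symb (e 3) (beta q'))
      (fun i => symb (e (Fin.castSucc i)) (beta q')) = fun k => r q' * bt q' k := by
    rw [e0]
    exact partialH_smul (ρ q') (r q') (v q') (κ q')
  have e2 : (fun m => cubM (fun i => symb (e (Fin.castSucc i)) (beta q')) m /
      symb (e 3) (beta q') ^ 2) = fun m => r q' * βt q' m := by
    funext m
    rw [e0, cubM_smul]
    change r q' ^ 3 * cubM (v q') m / ρ q' ^ 2 = r q' * (r q' ^ 2 * cubM (v q') m / ρ q' ^ 2)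
    ring
  rw [h.ham_local hα hR (p := beta q') hU' hρ',
    h.dC_comp_lift_comb hα hR hF hi hU' hρ' (fun m =>
      ((h.contMDiffAt_cubicCoeff hα hU' m).mdifferentiableAt (by simp))), e1, e2]
  have e7 : hamComp S α e (cubicCoeff S α e) q' (fun k => r q' * bt q' k)
      (fun m => r q' * βt q' m) = fun j => r q' * at' q' j :=
    funext fun j => hamComp_smul _ _ _ _ _ _
  rw [e7]
  simp only [sphereProj_smul]
  refine congrArg (fun z => dY (F ∘ psi S α e) (coord S e q') (frameVec e q'.1
    (fun k => r q' * bt q' k) (fun j => r q' * at' q' j) z)) (funext fun i => ?_)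
  change _ = (r q')⁻¹ * (r q' * _)
  rw [← mul_assoc, inv_mul_cancel₀ hr', one_mul]

/-- After the cancellation of `sub_blowH` two contributions to the sphere component remain: `v₀ {h₀,
h_i}`, which is of order `r` as `c_{0i}^3 = 0`, and the remainder of order `r` paired with brackets
of order one. The cubic term enters the second and compensates the part of the first that is not
equivariant. -/
theorem tendsto_singular [T2Space X] (h : AdaptedFrame S α R U e) (hα : S.IsPoppForm α)
    (hR : S.IsReeb α R) {F : CoTanSum X → ℝ} (hF : TestFn F) {q : CoTanSum X} (hq : q ∈ S.SN)
    (hU : q.1 ∈ U) :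
    Tendsto (fun q' => dC (F ∘ S.lift) (beta q') (ham S.sqrtSigma (beta q')) -
        symb R (beta q') / S.sqrtSigma (beta q') * dC (F ∘ S.lift) (beta q')
        (ham (fun p => mainTerm S R p + cubicTerm S α e p) (beta q')))
      (S.interiorNhds q) (𝓝 (dY (F ∘ psi S α e) (coord S e q) (fieldVec S α e (coord S e q)))) := by
  have hρ : q.2.1 (e 3 q.1) ≠ 0 := by
    rw [h.last]; exact ((mem_SN_iff hα hR).1 hq).1
  let κ : CoTanSum X → Fin 4 → ℝ := fun q' m => cubicCoeff S α e m q'.1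
  let v : CoTanSum X → Fin 3 → ℝ := fun q' => (coord S e q').2.2
  let ρ : CoTanSum X → ℝ := fun q' => q'.2.1 (e 3 q'.1)
  let r : CoTanSum X → ℝ := fun q' => q'.2.1 q'.2.2
  let n : CoTanSum X → Fin 4 → ℝ := fun q' j =>
    ∑ l : Fin 3, structFn S α e 0 j (Fin.castSucc l) q'.1 * v q' l
  let dt : CoTanSum X → Fin 4 → ℝ := fun q' => remH (ρ q') (r q') (v q') (κ q')
  let δt : CoTanSum X → Fin 4 → ℝ := fun q' m => -(r q' * cubM (v q') m / ρ q')
  let at' : CoTanSum X → Fin 4 → ℝ := fun q' =>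
    hamComp S α e (cubicCoeff S α e) q' (dt q') (δt q')
  have hr0 : r q = 0 := radius_boundary hα hR hq
  have tκ : Tendsto κ (S.interiorNhds q) (𝓝 (κ q)) := tendsto_pi_nhds.2 fun m =>
    tendsto_comp_base (h.contMDiffAt_cubicCoeff hα hU m).continuousAt
  have tv : Tendsto v (S.interiorNhds q) (𝓝 (v q)) :=
    (continuous_snd.comp continuous_snd).continuousAt.tendsto.comp (h.tendsto_coord hU)
  have tv' := tendsto_pi_nhds.1 tv
  have tρ : Tendsto ρ (S.interiorNhds q) (𝓝 (ρ q)) := h.tendsto_eval hU 3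
  have tr : Tendsto r (S.interiorNhds q) (𝓝 0) := hr0 ▸ tendsto_radius
  have td : ∀ k, Tendsto (fun q' => dt q' k) (S.interiorNhds q)
      (𝓝 (remH (ρ q) 0 (v q) (κ q) k)) := tendsto_remH tρ tr tv tκ hρ
  have tδ : ∀ m, Tendsto (fun q' => δt q' m) (S.interiorNhds q) (𝓝 0) := fun m => by
    have h1 := ((tr.mul (((continuous_cubM m).continuousAt (x := v q)).tendsto.comp tv)).div
      tρ hρ).neg
    rw [show (0 : ℝ) = -(0 * cubM (v q) m / ρ q) by simp]
    exact h1
  have tn : ∀ j, Tendsto (fun q' => n q' j) (S.interiorNhds q) (𝓝 (n q j)) := fun j =>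
    tendsto_finsetSum _ fun l _ => (tendsto_comp_base
      (h.contMDiffAt_structFn hα hU 0 j _).continuousAt).mul (tv' l)
  have ta := h.tendsto_hamComp hα hU (h.contMDiffOn_cubicCoeff hα) td tδ
  -- the components of the field near the boundary
  let c : CoTanSum X → Fin 4 → ℝ := fun q' k =>
    (![v q' 0, 0, 0, 0] : Fin 4 → ℝ) k + r q' * dt q' k
  let δ : CoTanSum X → Fin 4 → ℝ := fun q' m => r q' * δt q' m
  have tc : ∀ k, Tendsto (fun q' => c q' k) (S.interiorNhds q)
      (𝓝 ((![v q 0, 0, 0, 0] : Fin 4 → ℝ) k)) := fun k => by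
    have h1 : Tendsto (fun q' => (![v q' 0, 0, 0, 0] : Fin 4 → ℝ) k) (S.interiorNhds q)
        (𝓝 ((![v q 0, 0, 0, 0] : Fin 4 → ℝ) k)) := by
      fin_cases k
      · exact tv' 0
      · exact tendsto_const_nhds
      · exact tendsto_const_nhds
      · exact tendsto_const_nhds
    simpa using h1.add (tr.mul (td k))
  have tδ' : ∀ m, Tendsto (fun q' => δ q' m) (S.interiorNhds q) (𝓝 0) := fun m => by
    simpa using tr.mul (tδ m)
  have tη := h.tendsto_hamComp hα hU (h.contMDiffOn_cubicCoeff hα) tc tδ'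
  have hmain := h.tendsto_dY (isOpen_coordDomain h.isOpen) (h.contMDiffOn_comp_psi hα hR hF)
    (h.tendsto_coord hU) (y₀ := coord S e q) ⟨hU, hρ⟩ hU
    (c := c) (η := fun q' => hamComp S α e (cubicCoeff S α e) q' (c q') (δ q'))
    (v := fun q' => sphereProj (v q') fun i =>
      v q' 0 * n q' (Fin.castSucc i) + at' q' (Fin.castSucc i)) tc tη
    (fun i => tendsto_sphereProj tv (fun i => ((tv' 0).mul (tn _)).add (ta (Fin.castSucc i))) i)
  obtain ⟨c1, c2, c3, c8, c9⟩ := h.structFn_three_values hα hR hU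
  have c4 : structFn S α e 2 1 3 q.1 = 1 := by rw [structFn_swap, c3, neg_neg]
  have c5 : structFn S α e 1 0 3 q.1 = 0 := by rw [structFn_swap, c1, neg_zero]
  have c6 : structFn S α e 2 0 3 q.1 = 0 := by rw [structFn_swap, c2, neg_zero]
  have c7 : ∀ k l, structFn S α e k k l q.1 = 0 := fun k l => by
    have := structFn_swap (S := S) (α := α) (e := e) k k l q.1; linarith
  have c10 : structFn S α e 3 0 3 q.1 = -structFn S α e 0 3 3 q.1 := structFn_swap _ _ _ _
  have c11 : structFn S α e 3 1 3 q.1 = 0 := by rw [structFn_swap, c8, neg_zero]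
  have c12 : structFn S α e 3 2 3 q.1 = 0 := by rw [structFn_swap, c9, neg_zero]
  have c13 := h.structFn_trace hα hR hU
  have hb : ∀ k j, bracketFn S α e q k j = structFn S α e k j 3 q.1 * ρ q :=
    h.bracketFn_boundary hα hR hq hU
  have hρ₀ : ρ q ≠ 0 := hρ
  have hη : hamComp S α e (cubicCoeff S α e) q (![v q 0, 0, 0, 0] : Fin 4 → ℝ) (fun _ => 0) =
      ![0, 0, 0, v q 0 * structB S α e q.1 * ρ q] := by
    funext j
    simp only [hamComp, hb, Fin.sum_univ_four]
    fin_cases j <;> simp [c1, c2, c7, structB]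
    ring
  have hs : (sphereProj (v q) fun i => v q 0 * n q (Fin.castSucc i) +
      hamComp S α e (cubicCoeff S α e) q (remH (ρ q) 0 (v q) (κ q)) (fun _ => 0)
        (Fin.castSucc i)) =
      sphereField (structB S α e q.1) (structC S α e q.1) (v q) := by
    -- The choice of `cubicCoeff` is used here: the brackets with `±ρ` exchange the derivatives of
    -- the cubic form in `v₁` and `v₂`, which cancels all but the trace and the antisymmetric part
    -- of `c_{0i}^j`. The trace is then replaced by `b`. The component of `Z` comes from `{ρ, h₀}`.
    have ha : (fun i : Fin 3 => v q 0 * n q (Fin.castSucc i) +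
        hamComp S α e (cubicCoeff S α e) q (remH (ρ q) 0 (v q) (κ q)) (fun _ => 0)
        (Fin.castSucc i)) = sphereField (structB S α e q.1) (structC S α e q.1) (v q) := by
      funext i
      simp only [hamComp, hb, Fin.sum_univ_four, remH, n, κ, cubD, cubicCoeff,
        Fin.sum_univ_three, sphereField, structB, structC, ← c13]
      fin_cases i <;> simp [c1, c2, c3, c4, c5, c6, c7, c10, c11, c12, ← c13] <;> field_simp <;>
        ring
    rw [ha]
    funext i
    -- With the trace equal to `b` the limit is already tangent to the sphere, so the projection
    -- leaves it unchanged.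
    have h0 : ∑ l, v q l * sphereField (structB S α e q.1) (structC S α e q.1) (v q) l = 0 := by
      simp [Fin.sum_univ_three, sphereField]; ring
    rw [sphereProj, h0, mul_zero, sub_zero]
  change Tendsto _ _ (𝓝 (dY _ _ (frameVec e q.1 (![v q 0, 0, 0, 0] : Fin 4 → ℝ)
    (![0, 0, 0, v q 0 * structB S α e q.1 * ρ q]) (sphereField (structB S α e q.1)
      (structC S α e q.1) (v q)))))
  rw [← hη, ← hs]
  refine hmain.congr' ?_
  filter_upwards [h.eventually_interior hU hρ] with q' hq'
  obtain ⟨hi, hU', hρ'⟩ := hq'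
  obtain ⟨hr, hrs, -⟩ := interior_spec hi
  have hr' : r q' ≠ 0 := hr.ne'
  have hρ'' : ρ q' ≠ 0 := hρ'
  have e0 : (fun i : Fin 3 => symb (e (Fin.castSucc i)) (beta q')) = fun i => r q' * v q' i :=
    h.eval_interior hi hU'
  have hσ : S.sigma (beta q') ≠ 0 := fun hs => by
    rw [sqrtSigma, hs, Real.sqrt_zero] at hrs
    exact hr.ne hrs
  have e1 : (fun k => partialH (fun m => cubicCoeff S α e m (beta q').1) (symb (e 3) (beta q'))
      (fun i => symb (e (Fin.castSucc i)) (beta q')) k) =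
      fun k => r q' * blowH (ρ q') (r q') (v q') (κ q') k := by
    rw [e0]
    exact partialH_smul (ρ q') (r q') (v q') (κ q')
  have e2 : (fun m => cubM (fun i => symb (e (Fin.castSucc i)) (beta q')) m /
      symb (e 3) (beta q') ^ 2) = fun m => r q' ^ 3 * cubM (v q') m / ρ q' ^ 2 := by
    funext m
    rw [e0, cubM_smul]
    rfl
  have e3 : ham S.sqrtSigma (beta q') = ∑ k, (![v q' 0, v q' 1, v q' 2, 0] : Fin 4 → ℝ) k •
      ham (symb (e k)) (beta q') := by
    rw [h.ham_sqrtSigma (p := beta q') hU' hσ, Fin.sum_univ_castSucc (n := 3)]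
    have h4 : ∀ i : Fin 3, symb (e (Fin.castSucc i)) (beta q') * (S.sqrtSigma (beta q'))⁻¹ =
        v q' i := fun i => by
      rw [congrFun e0 i, hrs]
      change r q' * v q' i * (r q')⁻¹ = v q' i
      field_simp
    simp only [h4, Fin.sum_univ_three]
    simp [show (Fin.last 3 : Fin 4) = 3 from rfl]
  have e4 : (symb R (beta q') / S.sqrtSigma (beta q')) = ρ q' / r q' := by
    rw [hrs, ← h.last]; rfl
  -- combine the two Hamilton fields
  have e5 : ham S.sqrtSigma (beta q') + (-(ρ q' / r q')) •
      ham (fun p => mainTerm S R p + cubicTerm S α e p) (beta q') =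
      ∑ k, c q' k • ham (symb (e k)) (beta q') +
        ∑ m, δ q' m • ham (fun p : CoTan X => cubicCoeff S α e m p.1) (beta q') := by
    rw [h.ham_local hα hR (p := beta q') hU' hρ', e3]
    have e1' : ∀ k, partialH (fun m => cubicCoeff S α e m (beta q').1) (symb (e 3) (beta q'))
        (fun i => symb (e (Fin.castSucc i)) (beta q')) k =
        r q' * blowH (ρ q') (r q') (v q') (κ q') k := fun k => congrFun e1 k
    have e2' : ∀ m, cubM (fun i => symb (e (Fin.castSucc i)) (beta q')) m /
        symb (e 3) (beta q') ^ 2 = r q' ^ 3 * cubM (v q') m / ρ q' ^ 2 := fun m => congrFun e2 m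
    simp only [e1', e2', smul_add, Finset.smul_sum, smul_smul]
    rw [← add_assoc, ← Finset.sum_add_distrib]
    congr 1
    · refine Finset.sum_congr rfl fun k _ => ?_
      rw [← add_smul]
      congr 1
      have h5 := sub_blowH hρ'' (r q') (v q') (κ q') k
      change _ = (![v q' 0, 0, 0, 0] : Fin 4 → ℝ) k + r q' * remH (ρ q') (r q') (v q') (κ q') k
      rw [← h5]
      field_simp
      ring
    · refine Finset.sum_congr rfl fun m _ => ?_
      congr 1
      change _ = r q' * -(r q' * cubM (v q') m / ρ q')
      field_simp
  rw [e4, sub_eq_add_neg, ← neg_mul, ← dC_smul_vec, ← dC_add_vec, e5,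
    h.dC_comp_lift_comb hα hR hF hi hU' hρ' (fun m =>
      ((h.contMDiffAt_cubicCoeff hα hU' m).mdifferentiableAt (by simp)))]
  have e6 : ∀ i : Fin 3, hamComp S α e (cubicCoeff S α e) q' (c q') (δ q') (Fin.castSucc i) =
      r q' * (v q' 0 * n q' (Fin.castSucc i) + at' q' (Fin.castSucc i)) := by
    intro i
    -- The vanishing holds on the whole domain of the frame, not only at the boundary. Therefore
    -- `{h₀, h_i}` is exactly `r` times a bounded function and survives the division by `r`.
    have h6 : ∀ i : Fin 3, structFn S α e 0 (Fin.castSucc i) 3 q'.1 = 0 := fun i => by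
      rw [h.structFn_three hα hR hU', h.extD_zero hα hR hU' (h.mem_E i _ hU'), neg_zero]
    have h7 : bracketFn S α e q' 0 (Fin.castSucc i) = r q' * n q' (Fin.castSucc i) := by
      rw [bracketFn, Fin.sum_univ_castSucc, show (Fin.last 3 : Fin 4) = 3 from rfl, h6, zero_mul,
        add_zero, Finset.mul_sum]
      refine Finset.sum_congr rfl fun l _ => ?_
      rw [show q'.2.1 (e (Fin.castSucc l) q'.1) = r q' * v q' l from congrFun e0 l]
      ring
    have h8 := hamComp_add (S := S) (α := α) (e := e) (cubicCoeff S α e) q'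
      (![v q' 0, 0, 0, 0] : Fin 4 → ℝ) (fun k => r q' * dt q' k) (δ q') (Fin.castSucc i)
    refine h8.trans ?_
    rw [hamComp_smul, Fin.sum_univ_four]
    simp [h7]
    ring
  simp only [e6, sphereProj_smul]
  congr 1
  refine congrArg (frameVec e q'.1 (c q') _) (funext fun i => ?_)
  have h9 : (q'.2.1 q'.2.2)⁻¹ * (r q' * sphereProj (v q') (fun i => v q' 0 * n q' (Fin.castSucc i) +
    at' q' (Fin.castSucc i)) i) = sphereProj (v q') (fun i => v q' 0 * n q' (Fin.castSucc i) +
    at' q' (Fin.castSucc i)) i := by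
    change (r q')⁻¹ * (r q' * _) = _
    rw [← mul_assoc, inv_mul_cancel₀ hr', one_mul]
  exact h9.symm

/-- The lift of the vertical field `H_χ` has a sphere component of order `1 / r`; the prefactor `r
t` absorbs it, leaving `t` times a bounded vector. -/
theorem dC_comp_lift_cutoff (h : AdaptedFrame S α R U e) (hα : S.IsPoppForm α)
    (hR : S.IsReeb α R) {F : CoTanSum X → ℝ} (hF : TestFn F) {q : CoTanSum X}
    (hq : q ∈ S.Blowup \ S.SN) (hU : q.1 ∈ U) (hρ : q.2.1 (e 3 q.1) ≠ 0) {χ : X → ℝ}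
    (hχ : ContMDiff (𝓡 4) 𝓘(ℝ, ℝ) ∞ χ) (t : ℝ) :
    q.2.1 q.2.2 * t * dC (F ∘ S.lift) (beta q) (ham (fun p : CoTan X => χ p.1) (beta q)) =
      dY (F ∘ psi S α e) (coord S e q) (frameVec e q.1 (fun _ => 0)
        (fun j => q.2.1 q.2.2 * t * hamComp S α e (fun _ : Unit => χ) q 0 (fun _ => 1) j)
        fun i => t * sphereProj (coord S e q).2.2
          (fun i => hamComp S α e (fun _ : Unit => χ) q 0 (fun _ => 1) (Fin.castSucc i)) i) := by
  have hr : q.2.1 q.2.2 ≠ 0 := (interior_spec hq).1.ne'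
  have e2 := h.dC_comp_lift_comb hα hR hF hq hU hρ (κ := fun _ : Unit => χ)
    (fun _ => hχ.contMDiffAt.mdifferentiableAt (by simp)) 0 (fun _ => 1)
  simp only [Pi.zero_apply, zero_smul, Finset.sum_const_zero, zero_add, Finset.univ_unique,
    Finset.sum_singleton, one_smul] at e2
  rw [e2]
  refine (dY_frameVec_smul (e := e) (F ∘ psi S α e) (coord S e q) (q.2.1 q.2.2 * t)
    0 _ _).symm.trans ?_
  have h1 : (fun k : Fin 4 => q.2.1 q.2.2 * t * (0 : Fin 4 → ℝ) k) = fun _ => 0 :=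
    funext fun k => mul_zero _
  have h2 : (fun i => q.2.1 q.2.2 * t * ((q.2.1 q.2.2)⁻¹ * sphereProj (coord S e q).2.2
      (fun i => hamComp S α e (fun _ : Unit => χ) q 0 (fun _ => 1) (Fin.castSucc i)) i)) =
      fun i => t * sphereProj (coord S e q).2.2 (fun i => hamComp S α e (fun _ : Unit => χ) q 0
      (fun _ => 1) (Fin.castSucc i)) i := by
    funext i
    rw [← mul_assoc, mul_right_comm (q.2.1 q.2.2), mul_inv_cancel₀ hr, one_mul]
  rw [h1, h2]
  rfl

/-- Counting orders: `ρ / r` times the cubic term is of order `r²`, and the lift of `H_χ` is of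
order `1 / r`. The product is of order `r`. -/
theorem tendsto_ham_cutoff (h : AdaptedFrame S α R U e) (hα : S.IsPoppForm α)
    (hR : S.IsReeb α R) {F : CoTanSum X → ℝ} (hF : TestFn F) {q : CoTanSum X} (hq : q ∈ S.SN)
    (hU : q.1 ∈ U) {χ : X → ℝ} (hχ : ContMDiff (𝓡 4) 𝓘(ℝ, ℝ) ∞ χ) :
    Tendsto (fun q' => symb R (beta q') / S.sqrtSigma (beta q') * cubicTerm S α e (beta q') *
        dC (F ∘ S.lift) (beta q') (ham (fun p : CoTan X => χ p.1) (beta q')))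
      (S.interiorNhds q) (𝓝 0) := by
  have hρ : q.2.1 (e 3 q.1) ≠ 0 := by
    rw [h.last]; exact ((mem_SN_iff hα hR).1 hq).1
  have hr0 : q.2.1 q.2.2 = 0 := radius_boundary hα hR hq
  have tκ : Tendsto (fun (q' : CoTanSum X) m => cubicCoeff S α e m q'.1) (S.interiorNhds q)
      (𝓝 (fun m => cubicCoeff S α e m q.1)) := tendsto_pi_nhds.2 fun m =>
    tendsto_comp_base (h.contMDiffAt_cubicCoeff hα hU m).continuousAt
  have tv : Tendsto (fun q' => (coord S e q').2.2) (S.interiorNhds q) (𝓝 (coord S e q).2.2) :=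
    (continuous_snd.comp continuous_snd).continuousAt.tendsto.comp (h.tendsto_coord hU)
  have tρ := h.tendsto_eval hU 3
  have tr : Tendsto (fun q' : CoTanSum X => q'.2.1 q'.2.2) (S.interiorNhds q) (𝓝 0) :=
    hr0 ▸ tendsto_radius
  have tC : Tendsto (fun q' => cub (fun m => cubicCoeff S α e m q'.1) (coord S e q').2.2)
      (S.interiorNhds q) (𝓝 (cub (fun m => cubicCoeff S α e m q.1) (coord S e q).2.2)) :=
    tendsto_cub tv tκ
  have ts : Tendsto (fun q' => q'.2.1 q'.2.2 * cub (fun m => cubicCoeff S α e m q'.1)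
      (coord S e q').2.2 / q'.2.1 (e 3 q'.1)) (S.interiorNhds q) (𝓝 0) := by
    have h1 := (tr.mul tC).div tρ hρ
    rw [zero_mul, zero_div] at h1
    exact h1
  have tH : ∀ j, Tendsto (fun q' => hamComp S α e (fun _ : Unit => χ) q' 0 (fun _ => 1) j)
      (S.interiorNhds q) (𝓝 (hamComp S α e (fun _ : Unit => χ) q 0 (fun _ => 1) j)) :=
    h.tendsto_hamComp hα hU (fun _ => hχ.contMDiffOn) (b := fun _ => 0) (β := fun _ _ => 1)
      (b₀ := 0) (fun k => tendsto_const_nhds) (fun k => tendsto_const_nhds)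
  have hmain := h.tendsto_dY (isOpen_coordDomain h.isOpen) (h.contMDiffOn_comp_psi hα hR hF)
    (h.tendsto_coord hU) (y₀ := coord S e q) ⟨hU, hρ⟩ hU
    (c := fun q' _ => 0) (c₀ := 0)
    (η := fun q' j => q'.2.1 q'.2.2 * (q'.2.1 q'.2.2 * cub (fun m => cubicCoeff S α e m q'.1)
      (coord S e q').2.2 / q'.2.1 (e 3 q'.1)) *
      hamComp S α e (fun _ : Unit => χ) q' 0 (fun _ => 1) j) (η₀ := 0)
    (v := fun q' i => q'.2.1 q'.2.2 * cub (fun m => cubicCoeff S α e m q'.1)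
      (coord S e q').2.2 / q'.2.1 (e 3 q'.1) * sphereProj (coord S e q').2.2
      (fun i => hamComp S α e (fun _ : Unit => χ) q' 0 (fun _ => 1) (Fin.castSucc i)) i) (v₀ := 0)
    (fun k => tendsto_const_nhds) (fun j => by simpa using (tr.mul ts).mul (tH j))
    (fun i => by simpa using ts.mul (tendsto_sphereProj tv (fun i => tH (Fin.castSucc i)) i))
  have h0 : dY (F ∘ psi S α e) (coord S e q) (frameVec e (coord S e q).1 0 0 0) = 0 := by
    rw [dY_frameVec]
    refine Finset.sum_eq_zero fun m _ => ?_
    rcases m with k | j | i <;> simp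
  rw [h0] at hmain
  refine hmain.congr' ?_
  filter_upwards [h.eventually_interior hU hρ] with q' hq'
  obtain ⟨hi, hU', hρ'⟩ := hq'
  obtain ⟨hr, hrs, -⟩ := interior_spec hi
  have e0 : (fun i : Fin 3 => symb (e (Fin.castSucc i)) (beta q')) =
      fun i => q'.2.1 q'.2.2 * (coord S e q').2.2 i := h.eval_interior hi hU'
  have e1 : symb R (beta q') / S.sqrtSigma (beta q') * cubicTerm S α e (beta q') =
      q'.2.1 q'.2.2 * (q'.2.1 q'.2.2 * cub (fun m => cubicCoeff S α e m q'.1)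
        (coord S e q').2.2 / q'.2.1 (e 3 q'.1)) := by
    have h1 : cubicTerm S α e (beta q') = q'.2.1 q'.2.2 ^ 3 *
        cub (fun m => cubicCoeff S α e m q'.1) (coord S e q').2.2 *
        (q'.2.1 (e 3 q'.1) ^ 2)⁻¹ := by
      rw [cubicTerm, e0, cub_smul]; rfl
    rw [h1, hrs, ← h.last, show symb (e 3) (beta q') = q'.2.1 (e 3 q'.1) from rfl]
    have hr' := hr.ne'
    generalize q'.2.1 (e 3 q'.1) = ρ at *
    generalize q'.2.1 q'.2.2 = r at *
    field_simp
  rw [e1]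
  exact (h.dC_comp_lift_cutoff hα hR hF hi hU' hρ' hχ _).symm

end AdaptedFrame
end QCStructure

namespace QCStructure
open QuasiContact

variable {X : Type*} [TopologicalSpace X] [ChartedSpace E4 X] [IsManifold (𝓡 4) ∞ X]
  {S : QCStructure X} {α : ∀ x : X, CoFib X x} {R : ∀ x : X, TangentSpace (𝓡 4) x}
  {U : Set X} {e : Fin 4 → ∀ x : X, TangentSpace (𝓡 4) x}

/-! ### The spherical normal bundle in frame coordinates -/

/-- The coordinates of the points of `SNΣ` over the domain of a frame. -/
def sphereCoord (U : Set X) : Set (X × FrameCoord) :=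
  {y | y.1 ∈ U ∧ y.2.1 3 ≠ 0 ∧ (∀ i : Fin 3, y.2.1 (Fin.castSucc i) = 0) ∧ ∑ i, y.2.2 i ^ 2 = 1}

/-- Retraction of the frame coordinates to the coordinates of `SNΣ`. -/
def sphereRetract (z : FrameCoord) : FrameCoord :=
  (Pi.single 3 (z.1 3), fun i => z.2 i * (√(∑ l, z.2 l ^ 2))⁻¹)

theorem contDiffAt_sphereRetract {z : FrameCoord} (hz : ∑ l, z.2 l ^ 2 ≠ 0) :
    ContDiffAt ℝ ∞ sphereRetract z := by
  refine ContDiffAt.prodMk ?_ ?_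
  · refine contDiffAt_pi.2 fun j => ?_
    by_cases hj : j = 3
    · subst hj
      simp only [Pi.single_eq_same]
      fun_prop
    · simp only [Pi.single_eq_of_ne hj]
      fun_prop
  · refine contDiffAt_pi.2 fun i => ContDiffAt.mul (by fun_prop) (ContDiffAt.inv ?_ ?_)
    · exact ContDiffAt.sqrt (by fun_prop) hz
    · exact (Real.sqrt_pos.2 (lt_of_le_of_ne (Finset.sum_nonneg fun l _ => sq_nonneg _)
        hz.symm)).ne'

/-- Along the line in a tangent direction the norm is stationary, so the normalisation does not
contribute to first order and the retraction is the identity on tangent vectors. -/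
theorem fderiv_sphereRetract {z w : FrameCoord} (hz : ∑ l, z.2 l ^ 2 = 1)
    (hw : ∀ i : Fin 3, w.1 (Fin.castSucc i) = 0) (hw' : ∑ l, z.2 l * w.2 l = 0) :
    fderiv ℝ sphereRetract z w = w := by
  have hd := (contDiffAt_sphereRetract (z := z) (by rw [hz]; exact one_ne_zero)).differentiableAt
    (by simp)
  have hline : HasDerivAt (fun t : ℝ => z + t • w) w 0 := by
    simpa using ((hasDerivAt_id (0 : ℝ)).smul_const w).const_add z
  have h1 : HasDerivAt (fun t : ℝ => sphereRetract (z + t • w)) (fderiv ℝ sphereRetract z w) 0 :=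
    HasFDerivAt.comp_hasDerivAt (l := sphereRetract) (f := fun t : ℝ => z + t • w) 0
      (by simpa using hd.hasFDerivAt) hline
  refine h1.unique (HasDerivAt.prodMk ?_ ?_)
  · refine hasDerivAt_pi.2 fun j => ?_
    by_cases hj : j = 3
    · subst hj
      simp only [Pi.single_eq_same]
      simpa using ((hasDerivAt_id (0 : ℝ)).mul_const (w.1 3)).const_add (z.1 3)
    · simp only [Pi.single_eq_of_ne hj]
      have : w.1 j = 0 := by
        have h2 := hw (j.castPred hj)
        rwa [Fin.castSucc_castPred] at h2
      rw [this]
      exact hasDerivAt_const _ _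
  · have hl : ∀ i, HasDerivAt (fun t : ℝ => (z + t • w).2 i) (w.2 i) 0 := fun i => by
      simpa using ((hasDerivAt_id (0 : ℝ)).mul_const (w.2 i)).const_add (z.2 i)
    have h2 : HasDerivAt (fun t : ℝ => ∑ l, (z + t • w).2 l ^ 2) 0 0 := by
      have h3 := HasDerivAt.fun_sum (u := Finset.univ) fun l (_ : l ∈ Finset.univ) => (hl l).pow 2
      refine h3.congr_deriv ?_
      simp only [zero_smul, add_zero]
      have h4 : ∑ l, 2 * (z.2 l * w.2 l) = 0 := by rw [← Finset.mul_sum, hw', mul_zero]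
      refine (Finset.sum_congr rfl fun l _ => ?_).trans h4
      simp
      ring
    refine hasDerivAt_pi.2 fun i => ?_
    have h5 := (hl i).mul ((h2.sqrt (by simp [hz])).inv (by simp [hz]))
    refine h5.congr_deriv ?_
    simp [hz]

theorem dY_comp_snd {G : X × FrameCoord → ℝ} {y : X × FrameCoord} {φ : FrameCoord → FrameCoord}
    {φ' : FrameCoord →L[ℝ] FrameCoord} (hφ : HasFDerivAt φ φ' y.2)
    (hG : MDifferentiableAt IY 𝓘(ℝ, ℝ) G (y.1, φ y.2)) (w : E4 × FrameCoord) :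
    dY (fun z : X × FrameCoord => G (z.1, φ z.2)) y w = dY G (y.1, φ y.2) (w.1, φ' w.2) := by
  have h1 : HasMFDerivAt IY IY (fun z : X × FrameCoord => (z.1, φ z.2)) y
      ((ContinuousLinearMap.fst ℝ E4 FrameCoord).prod
        (φ'.comp (ContinuousLinearMap.snd ℝ E4 FrameCoord))) :=
    (hasMFDerivAt_fst y).prodMk (HasMFDerivAt.comp (g := φ) (f := fun z : X × FrameCoord => z.2) y
      hφ.hasMFDerivAt (hasMFDerivAt_snd y))
  have h2 := HasMFDerivAt.comp (g := G) (f := fun z : X × FrameCoord => (z.1, φ z.2)) y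
    hG.hasMFDerivAt h1
  exact congrArg (fun l : E4 × FrameCoord →L[ℝ] ℝ => l w) h2.mfderiv

/-- A function that vanishes on the coordinates of `SNΣ` is annihilated by their tangent vectors. -/
theorem dY_eq_zero_of_sphere (hU : IsOpen U) {G : X × FrameCoord → ℝ} {y : X × FrameCoord}
    (hy : y ∈ sphereCoord U) (hG : MDifferentiableAt IY 𝓘(ℝ, ℝ) G y)
    (h0 : ∀ᶠ z in 𝓝 y, z ∈ sphereCoord U → G z = 0) {w : E4 × FrameCoord}
    (hw : ∀ i : Fin 3, w.2.1 (Fin.castSucc i) = 0) (hw' : ∑ l, y.2.2 l * w.2.2 l = 0) :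
    dY G y w = 0 := by
  obtain ⟨hyU, hρ, hη, hv⟩ := hy
  have hfix : sphereRetract y.2 = y.2 := by
    refine Prod.ext ?_ ?_
    · funext j
      by_cases hj : j = 3
      · subst hj; simp [sphereRetract]
      · have h2 := hη (j.castPred hj)
        rw [Fin.castSucc_castPred] at h2
        simp [sphereRetract, hj, h2]
    · funext i
      simp [sphereRetract, hv]
  have hn : ∑ l, y.2.2 l ^ 2 ≠ 0 := by rw [hv]; exact one_ne_zero
  have hs := contDiffAt_sphereRetract hn
  have hd := (hs.differentiableAt (by simp)).hasFDerivAt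
  have hfix' : ((y.1, sphereRetract y.2) : X × FrameCoord) = y := by rw [hfix]
  have h1 := dY_comp_snd (G := G) (y := y) hd (by rw [hfix']; exact hG) w
  rw [fderiv_sphereRetract hv hw hw', hfix'] at h1
  refine h1.symm.trans ?_
  have hcont : Tendsto (fun z : X × FrameCoord => (z.1, sphereRetract z.2)) (𝓝 y) (𝓝 y) := by
    have h2 : ContinuousAt (fun z : X × FrameCoord => (z.1, sphereRetract z.2)) y :=
      continuousAt_fst.prodMk (ContinuousAt.comp (f := fun z : X × FrameCoord => z.2)
        hs.continuousAt continuousAt_snd)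
    have h3 := h2.tendsto
    rwa [hfix'] at h3
  -- The retraction lands in the coordinates of `SNΣ`, so `G` composed with it vanishes in a full
  -- neighbourhood, although `G` itself need not.
  have h4 : (fun z : X × FrameCoord => G (z.1, sphereRetract z.2)) =ᶠ[𝓝 y] fun _ => 0 := by
    have hρ' : ∀ᶠ z : X × FrameCoord in 𝓝 y, z.2.1 3 ≠ 0 :=
      ((continuous_apply (3 : Fin 4)).comp (continuous_fst.comp
        continuous_snd)).continuousAt.eventually_ne hρ
    have hn' : ∀ᶠ z : X × FrameCoord in 𝓝 y, ∑ l, z.2.2 l ^ 2 ≠ 0 :=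
      (Continuous.continuousAt (by fun_prop)).eventually_ne hn
    filter_upwards [hcont.eventually h0, continuousAt_fst.eventually (hU.mem_nhds hyU), hρ', hn']
      with z hz hzU hzρ hzn
    have hp : 0 < ∑ l, z.2.2 l ^ 2 :=
      lt_of_le_of_ne (Finset.sum_nonneg fun l _ => sq_nonneg _) hzn.symm
    refine hz ⟨hzU, ?_, fun i => ?_, ?_⟩
    · simpa [sphereRetract] using hzρ
    · simp only [sphereRetract]
      exact Pi.single_eq_of_ne (Fin.castSucc_lt_last i).ne _
    · simp only [sphereRetract, mul_pow, inv_pow, Real.sq_sqrt hp.le, ← Finset.sum_mul]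
      exact mul_inv_cancel₀ hzn
  have h5 : HasMFDerivAt IY 𝓘(ℝ, ℝ) (fun z : X × FrameCoord => G (z.1, sphereRetract z.2)) y 0 :=
    (hasMFDerivAt_const (I := IY) (I' := 𝓘(ℝ, ℝ)) (0 : ℝ) y).congr_of_eventuallyEq h4
  exact congrArg (fun l : E4 × FrameCoord →L[ℝ] ℝ => l w) h5.mfderiv

theorem psi_fst_eq {y : X × FrameCoord} (hy : y ∈ sphereCoord U) :
    (psi S α e y).2.1 = y.2.1 3 • α y.1 := by
  change ∑ j, y.2.1 j • coframe S α e j y.1 = _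
  rw [Fin.sum_univ_castSucc]
  simp only [hy.2.2.1, zero_smul, Finset.sum_const_zero, zero_add]
  rfl

namespace AdaptedFrame

theorem coord_mem (h : AdaptedFrame S α R U e) (hα : S.IsPoppForm α) (hR : S.IsReeb α R)
    {q : CoTanSum X} (hq : q ∈ S.SN) (hU : q.1 ∈ U) : coord S e q ∈ sphereCoord U := by
  obtain ⟨h1, h2, h3, h4⟩ := (mem_SN_iff hα hR).1 hq
  refine ⟨hU, ?_, fun i => ?_, ?_⟩
  · change q.2.1 (e 3 q.1) ≠ 0
    rw [h.last]; exact h1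
  · change q.2.1 (e (Fin.castSucc i) q.1) = 0
    rw [h2, smul_apply, h.apply_castSucc hα hU, smul_zero]
  · have h5 := h.metric_frame hU (coord S e q).2.2 (coord S e q).2.2
    have h6 : ∑ i, (coord S e q).2.2 i • e (Fin.castSucc i) q.1 = q.2.2 :=
      (h.eq_sum_E hU h3).symm
    rw [h6, h4] at h5
    simpa [sq] using h5.symm

theorem psi_mem (h : AdaptedFrame S α R U e) (hα : S.IsPoppForm α) (hR : S.IsReeb α R)
    {y : X × FrameCoord} (hy : y ∈ sphereCoord U) : psi S α e y ∈ S.SN := by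
  have h1 := psi_fst_eq (S := S) (α := α) (e := e) hy
  have h2 : (psi S α e y).2.1 (R y.1) = y.2.1 3 := by
    refine (congrArg (fun ξ : CoFib X y.1 => ξ (R y.1)) h1).trans ?_
    rw [smul_apply, hR.normalized, smul_eq_mul, mul_one]
  refine (mem_SN_iff hα hR).2 ⟨?_, ?_, h.frame_mem_E hy.1 _, ?_⟩
  · change (psi S α e y).2.1 (R y.1) ≠ 0
    rw [h2]; exact hy.2.1
  · change _ = (psi S α e y).2.1 (R y.1) • α y.1
    rw [h2, h1]
  · change S.g y.1 (∑ i, y.2.2 i • e (Fin.castSucc i) y.1)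
      (∑ i, y.2.2 i • e (Fin.castSucc i) y.1) = 1
    rw [h.metric_frame hy.1]
    simpa [sq] using hy.2.2.2

end AdaptedFrame

/-! ### The circle action in frame coordinates -/

/-- Rotations of the second and third components. -/
def rotV (φ : ℝ) (v : Fin 3 → ℝ) : Fin 3 → ℝ :=
  ![v 0, Real.cos φ * v 1 + Real.sin φ * v 2, Real.cos φ * v 2 - Real.sin φ * v 1]

/-- `rotV`, as a linear map of the frame coordinates. -/
def rotL (φ : ℝ) : FrameCoord →L[ℝ] FrameCoord :=
  LinearMap.toContinuousLinearMap
    { toFun := fun z => (z.1, rotV φ z.2)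
      map_add' := fun a b => by
        refine Prod.ext rfl ?_
        funext i
        fin_cases i <;> simp [rotV] <;> ring
      map_smul' := fun c a => by
        refine Prod.ext rfl ?_
        funext i
        fin_cases i <;> simp [rotV] <;> ring }

theorem rotL_apply (φ : ℝ) (z : FrameCoord) : rotL φ z = (z.1, rotV φ z.2) := rfl

theorem rotV_mem {φ : ℝ} {y : X × FrameCoord} (hy : y ∈ sphereCoord U) :
    (y.1, rotL φ y.2) ∈ sphereCoord U := by
  refine ⟨hy.1, hy.2.1, hy.2.2.1, ?_⟩
  have h1 := hy.2.2.2
  simp only [Fin.sum_univ_three] at h1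
  simp only [rotL_apply, rotV, Fin.sum_univ_three, Matrix.cons_val_zero, Matrix.cons_val_one,
    Matrix.cons_val]
  linear_combination h1 + (y.2.2 1 ^ 2 + y.2.2 2 ^ 2) * Real.sin_sq_add_cos_sq φ

/-- The first component depends only on `v₁² + v₂²`. The other two combine a scaling and a rotation
of `(v₁, v₂)` with coefficients that depend on `v₀`, and these commute with rotations. This is the
source of the field on the quotient. -/
theorem sphereField_rotV (b γ φ : ℝ) (v : Fin 3 → ℝ) :
    sphereField b γ (rotV φ v) = rotV φ (sphereField b γ v) := by
  funext i
  fin_cases i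
  · simp only [sphereField, rotV, Fin.zero_eta, Matrix.cons_val_zero, Matrix.cons_val_one,
      Matrix.cons_val]
    linear_combination (-(v 1 ^ 2 + v 2 ^ 2) * b / 2) * Real.sin_sq_add_cos_sq φ
  · simp [sphereField, rotV]; ring
  · simp [sphereField, rotV]; ring

theorem fieldVec_rotL (φ : ℝ) (y : X × FrameCoord) :
    fieldVec S α e (y.1, rotL φ y.2) =
      ((fieldVec S α e y).1, rotL φ (fieldVec S α e y).2) := by
  refine Prod.ext rfl (Prod.ext rfl ?_)
  exact sphereField_rotV _ _ _ _

namespace AdaptedFrame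

/-- By `proj0_eq` and `J_eq` the action fixes the `Z`-component and turns the other two; the sense
of rotation is the sign of the covector `ρ α`. -/
theorem rot_psi [T2Space X] (h : AdaptedFrame S α R U e) (hα : S.IsPoppForm α)
    (hR : S.IsReeb α R) {y : X × FrameCoord} (hy : y ∈ sphereCoord U) (θ : ℝ) :
    S.rot θ (psi S α e y) = psi S α e (y.1, rotL (SignType.sign (y.2.1 3) * θ) y.2) := by
  have h1 := psi_fst_eq (S := S) (α := α) (e := e) hy
  obtain ⟨hU, hρ, -, -⟩ := hy
  obtain ⟨x, η, v⟩ := y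
  change x ∈ U at hU
  change η 3 ≠ 0 at hρ
  have hb : beta (psi S α e (x, η, v)) = ⟨x, η 3 • α x⟩ := congrArg (Bundle.TotalSpace.mk x) h1
  have hsin : Real.sin (SignType.sign (η 3) * θ) = SignType.sign (η 3) * Real.sin θ := by
    rcases lt_or_gt_of_ne hρ with h | h
    · simp [sign_neg h]
    · simp [sign_pos h]
  have hcos : Real.cos (SignType.sign (η 3) * θ) = Real.cos θ := by
    rcases lt_or_gt_of_ne hρ with h | h
    · simp [sign_neg h]
    · simp [sign_pos h]
  have h2 : S.proj0 (⟨x, η 3 • α x⟩ : CoTan X) (∑ i, v i • e (Fin.castSucc i) x) =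
      ∑ i, ![v 0, 0, 0] i • e (Fin.castSucc i) x := h.proj0_eq hα hR hU hρ v
  have h3 : (∑ i, v i • e (Fin.castSucc i) x) - ∑ i, ![v 0, 0, 0] i • e (Fin.castSucc i) x =
      ∑ i, ![0, v 1, v 2] i • e (Fin.castSucc i) x := by
    rw [frame_sub]
    refine Finset.sum_congr rfl fun i _ => ?_
    fin_cases i <;> simp
  have h4 : S.J (⟨x, η 3 • α x⟩ : CoTan X) (∑ i, ![0, v 1, v 2] i • e (Fin.castSucc i) x) = _ :=
    h.J_eq hα hR hU hρ (v := ![0, v 1, v 2]) rfl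
  have key : ∀ p : CoTan X, ∀ hp : p = ⟨x, η 3 • α x⟩, ∀ u : TangentSpace (𝓡 4) p.1,
      (show E4 from u) = (show E4 from ∑ i, v i • e (Fin.castSucc i) x) →
      (show E4 from S.proj0 p u + Real.cos θ • (u - S.proj0 p u) +
        Real.sin θ • S.J p (u - S.proj0 p u)) =
      (show E4 from ∑ i, rotV (SignType.sign (η 3) * θ) v i • e (Fin.castSucc i) x) := by
    rintro p rfl u hu
    change u = ∑ i, v i • e (Fin.castSucc i) x at hu
    rw [hu]
    change (show TangentSpace (𝓡 4) x from S.proj0 (⟨x, η 3 • α x⟩ : CoTan X)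
        (∑ i, v i • e (Fin.castSucc i) x)) +
      Real.cos θ • ((∑ i, v i • e (Fin.castSucc i) x) -
        S.proj0 (⟨x, η 3 • α x⟩ : CoTan X) (∑ i, v i • e (Fin.castSucc i) x)) +
      Real.sin θ • S.J (⟨x, η 3 • α x⟩ : CoTan X) ((∑ i, v i • e (Fin.castSucc i) x) -
        S.proj0 (⟨x, η 3 • α x⟩ : CoTan X) (∑ i, v i • e (Fin.castSucc i) x)) = _
    rw [h2, h3, h4]
    simp only [Finset.smul_sum, smul_smul, ← Finset.sum_add_distrib, ← add_smul]
    refine Finset.sum_congr rfl fun i _ => ?_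
    congr 1
    fin_cases i <;> simp [rotV, hsin, hcos] <;> ring
  exact congrArg (fun u : E4 => (⟨x, ((psi S α e (x, η, v)).2.1, u)⟩ : CoTanSum X))
    (key _ hb _ rfl)

end AdaptedFrame
end QCStructure

namespace QuasiContact

variable {X : Type*} [TopologicalSpace X] [ChartedSpace E4 X] [IsManifold (𝓡 4) ∞ X]

theorem contMDiff_dilS (c : ℝ) : ContMDiff IS IS ∞ (dilS c : CoTanSum X → CoTanSum X) := by
  intro q
  have h1 := (Bundle.contMDiffAt_totalSpace (x₀ := q)).1 ((contMDiff_beta (X := X)).contMDiffAt (x := q))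
  refine contMDiffAt_coTanSum_mk (b := fun q : CoTanSum X => q.1) (ξ := fun q => c • q.2.1)
    (v := fun q => q.2.2) ?_ contMDiff_coTanSum_snd.contMDiffAt
  rw [Bundle.contMDiffAt_totalSpace]
  have h2 := ContMDiffAt.comp (g := fun z : E4 →L[ℝ] ℝ => c • z) q
    (contDiff_const_smul c).contMDiff.contMDiffAt h1.2
  refine ⟨h1.1, h2.congr_of_eventuallyEq ?_⟩
  filter_upwards [h1.1.continuousAt.preimage_mem_nhds
    ((trivializationAt (E4 →L[ℝ] ℝ) (CoFib X) q.1).open_baseSet.mem_nhds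
      (FiberBundle.mem_baseSet_trivializationAt' q.1))] with q' hq'
  exact ((trivializationAt (E4 →L[ℝ] ℝ) (CoFib X) q.1).linear ℝ hq').map_smul c q'.2.1

end QuasiContact

namespace QCStructure
open QuasiContact

variable {X : Type*} [TopologicalSpace X] [ChartedSpace E4 X] [IsManifold (𝓡 4) ∞ X]
  {S : QCStructure X} {α : ∀ x : X, CoFib X x} {R : ∀ x : X, TangentSpace (𝓡 4) x}
  {U : Set X} {e : Fin 4 → ∀ x : X, TangentSpace (𝓡 4) x}

/-! ### The boundary field over the domain of a frame -/

/-- The boundary field in the domain of a frame. -/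
def localField (S : QCStructure X) (α : ∀ x : X, CoFib X x)
    (e : Fin 4 → ∀ x : X, TangentSpace (𝓡 4) x) (q : CoTanSum X) : TangentSpace IS q :=
  (show E4 × ((E4 →L[ℝ] ℝ) × E4) from
    mfderiv IY IS (psi S α e) (coord S e q) (fieldVec S α e (coord S e q)))

/-- Dilations in frame coordinates. -/
def scaleL (c : ℝ) : FrameCoord →L[ℝ] FrameCoord :=
  (c • ContinuousLinearMap.fst ℝ (Fin 4 → ℝ) (Fin 3 → ℝ)).prod
    (ContinuousLinearMap.snd ℝ (Fin 4 → ℝ) (Fin 3 → ℝ))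

theorem dilS_psi (c : ℝ) (y : X × FrameCoord) :
    dilS c (psi S α e y) = psi S α e (y.1, scaleL c y.2) := by
  refine congrArg (Bundle.TotalSpace.mk y.1) (Prod.ext ?_ rfl)
  change c • ∑ j, y.2.1 j • coframe S α e j y.1 = ∑ j, (c * y.2.1 j) • coframe S α e j y.1
  rw [Finset.smul_sum]
  simp only [smul_smul]

theorem fieldVec_scaleL (c : ℝ) (y : X × FrameCoord) :
    fieldVec S α e (y.1, scaleL c y.2) =
      ((fieldVec S α e y).1, scaleL c (fieldVec S α e y).2) := by
  refine Prod.ext rfl (Prod.ext ?_ rfl)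
  funext j
  change (![0, 0, 0, y.2.2 0 * structB S α e y.1 * (c * y.2.1 3)] : Fin 4 → ℝ) j =
    c * (![0, 0, 0, y.2.2 0 * structB S α e y.1 * y.2.1 3] : Fin 4 → ℝ) j
  fin_cases j <;> simp
  ring

namespace AdaptedFrame

theorem hasMFDerivAt_psi (h : AdaptedFrame S α R U e) (hα : S.IsPoppForm α) {y : X × FrameCoord}
    (hy : y.1 ∈ U) : HasMFDerivAt IY IS (psi S α e) y (mfderiv IY IS (psi S α e) y) :=
  ((h.contMDiffAt_psi hα hy).mdifferentiableAt (by simp)).hasMFDerivAt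

theorem mfderiv_psi (h : AdaptedFrame S α R U e) (hα : S.IsPoppForm α) {y : X × FrameCoord}
    (hy : y.1 ∈ U) {F : CoTanSum X → ℝ} (hF : MDifferentiableAt IS 𝓘(ℝ, ℝ) F (psi S α e y))
    (w : E4 × FrameCoord) :
    mfderiv IS 𝓘(ℝ, ℝ) F (psi S α e y) (mfderiv IY IS (psi S α e) y w) =
      dY (F ∘ psi S α e) y w := by
  have h1 := HasMFDerivAt.comp (g := F) (f := psi S α e) y hF.hasMFDerivAt
    (h.hasMFDerivAt_psi hα hy)
  exact (congrArg (fun l : E4 × FrameCoord →L[ℝ] ℝ => l w) h1.mfderiv).symm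

theorem mfderiv_localField (h : AdaptedFrame S α R U e) (hα : S.IsPoppForm α)
    (hR : S.IsReeb α R) {q : CoTanSum X} (hq : q ∈ S.SN) (hU : q.1 ∈ U) {F : CoTanSum X → ℝ}
    (hF : MDifferentiableAt IS 𝓘(ℝ, ℝ) F q) :
    mfderiv IS 𝓘(ℝ, ℝ) F q (localField S α e q) =
      dY (F ∘ psi S α e) (coord S e q) (fieldVec S α e (coord S e q)) := by
  have h1 := h.psi_coord hα hR hU ((mem_SN_iff hα hR).1 hq).2.2.1
  have h2 : ∀ q' : CoTanSum X, q' = q → MDifferentiableAt IS 𝓘(ℝ, ℝ) F q' ∧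
      (mfderiv IS 𝓘(ℝ, ℝ) F q (localField S α e q) : ℝ) =
      (show E4 × ((E4 →L[ℝ] ℝ) × E4) →L[ℝ] ℝ from mfderiv IS 𝓘(ℝ, ℝ) F q')
        (localField S α e q) := by
    rintro q' rfl
    exact ⟨hF, rfl⟩
  obtain ⟨h3, h4⟩ := h2 _ h1
  exact h4.trans (h.mfderiv_psi hα (y := coord S e q) hU h3 _)

theorem fieldVec_tangent (y : X × FrameCoord) :
    (∀ i : Fin 3, (fieldVec S α e y).2.1 (Fin.castSucc i) = 0) ∧
      ∑ l, y.2.2 l * (fieldVec S α e y).2.2 l = 0 := by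
  refine ⟨fun i => ?_, ?_⟩
  · simp only [fieldVec, frameVec]
    fin_cases i <;> rfl
  · simp [fieldVec, frameVec, sphereField, Fin.sum_univ_three]
    ring

/-- In coordinates the field keeps `h₀ = h₁ = h₂ = 0` and is orthogonal to `v`, so it annihilates
functions that vanish on the coordinates of `SNΣ`, and `psi` maps these coordinates into `SNΣ`. -/
theorem localField_tangent (h : AdaptedFrame S α R U e) (hα : S.IsPoppForm α)
    (hR : S.IsReeb α R) {q : CoTanSum X} (hq : q ∈ S.SN) (hU : q.1 ∈ U) :
    localField S α e q ∈ tangentTo IS S.SN q := by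
  intro F hF hF0
  have h1 := h.psi_coord hα hR hU ((mem_SN_iff hα hR).1 hq).2.2.1
  rw [h.mfderiv_localField hα hR hq hU (hF.mdifferentiableAt (by simp))]
  have hF1 : ContMDiffAt IS 𝓘(ℝ, ℝ) ∞ F (psi S α e (coord S e q)) := by rw [h1]; exact hF
  have hψ := h.contMDiffAt_psi hα (y := coord S e q) hU
  refine dY_eq_zero_of_sphere h.isOpen (h.coord_mem hα hR hq hU)
    ((hF1.comp _ hψ).mdifferentiableAt (by simp)) ?_ (fieldVec_tangent _).1 (fieldVec_tangent _).2
  have h2 := hψ.continuousAt.tendsto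
  rw [h1] at h2
  filter_upwards [h2.eventually (eventually_nhdsWithin_iff.1 hF0)] with z hz hzs
  exact hz (h.psi_mem hα hR hzs)

-- On `SNΣ` the composition of `psi` with `coord` is the identity, so the field there is the tangent
-- map of `psi` applied to a field with smooth frame components.
set_option synthInstance.maxHeartbeats 200000 in
theorem localField_smooth (h : AdaptedFrame S α R U e) (hα : S.IsPoppForm α)
    (hR : S.IsReeb α R) {q : CoTanSum X} (hq : q ∈ S.SN) (hU : q.1 ∈ U) :
    ContMDiffWithinAt IS IS.tangent ∞
      (fun q => (⟨q, localField S α e q⟩ : TangentBundle IS (CoTanSum X))) S.SN q := by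
  have hO : IsOpen {y : X × FrameCoord | y.1 ∈ U} := h.isOpen.preimage continuous_fst
  have h1 : ContMDiffOn IY.tangent IS.tangent ∞
      (tangentMapWithin IY IS (psi S α e) {y : X × FrameCoord | y.1 ∈ U})
      (Bundle.TotalSpace.proj ⁻¹' {y : X × FrameCoord | y.1 ∈ U}) :=
    ContMDiffOn.contMDiffOn_tangentMapWithin
      (fun y hy => (h.contMDiffAt_psi hα hy).contMDiffWithinAt) (by simp) hO.uniqueMDiffOn
  have hv : ContMDiffAt IS IY.tangent ∞ (fun q : CoTanSum X =>
      (⟨coord S e q, fieldVec S α e (coord S e q)⟩ : TangentBundle IY (X × FrameCoord))) q := by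
    have hc := h.contMDiffAt_coord (q := q) hU
    have hc2 : ContMDiffAt IS 𝓘(ℝ, FrameCoord) ∞ (fun q => (coord S e q).2) q :=
      ContMDiffAt.comp (g := fun y : X × FrameCoord => y.2) q contMDiffAt_snd hc
    have hv : ∀ i, ContMDiffAt IS 𝓘(ℝ, ℝ) ∞ (fun q => (coord S e q).2.2 i) q := fun i =>
      h.contMDiffAt_comp_frame hU _
    have hρ : ContMDiffAt IS 𝓘(ℝ, ℝ) ∞ (fun q => (coord S e q).2.1 3) q := h.contMDiffAt_eval hU 3
    have hst : ∀ j k l, ContMDiffAt IS 𝓘(ℝ, ℝ) ∞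
        (fun q : CoTanSum X => structFn S α e j k l q.1) q := fun j k l =>
      ContMDiffAt.comp (g := structFn S α e j k l) q (h.contMDiffAt_structFn hα hU j k l)
        contMDiff_coTanSum_proj.contMDiffAt
    have hdiv : ∀ {f : CoTanSum X → ℝ}, ContMDiffAt IS 𝓘(ℝ, ℝ) ∞ f q →
        ContMDiffAt IS 𝓘(ℝ, ℝ) ∞ (fun q => f q / 2) q := fun hf =>
      ContMDiffAt.comp (g := fun t : ℝ => t / 2) q
        (ContDiff.contMDiff (contDiff_id.div_const 2)).contMDiffAt hf
    have hb := hst 0 3 3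
    have hγ : ContMDiffAt IS 𝓘(ℝ, ℝ) ∞ (fun q : CoTanSum X => structC S α e q.1) q :=
      hdiv ((hst 0 1 2).sub (hst 0 2 1))
    have hz : ContMDiffAt IS 𝓘(ℝ, FrameCoord) ∞
        (fun q => (fieldVec S α e (coord S e q)).2) q := by
      refine ContMDiffAt.prodMk_space (contMDiffAt_pi_space.2 fun j => ?_)
        (contMDiffAt_pi_space.2 fun i => ?_)
      · fin_cases j
        · exact contMDiffAt_const
        · exact contMDiffAt_const
        · exact contMDiffAt_const
        · exact ((hv 0).mul hb).mul hρ
      · fin_cases i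
        · exact (hdiv ((((hv 1).pow 2).add ((hv 2).pow 2)).mul hb)).neg
        · exact (hv 0).mul (((hdiv hb).mul (hv 1)).add (hγ.mul (hv 2)))
        · exact (hv 0).mul (((hdiv hb).mul (hv 2)).sub (hγ.mul (hv 1)))
    have hu : ContMDiffAt IS (𝓡 4).tangent ∞ (fun q : CoTanSum X => (⟨q.1, ∑ k,
        (![(coord S e q).2.2 0, 0, 0, 0] : Fin 4 → ℝ) k • e k q.1⟩ : TangentBundle (𝓡 4) X)) q := by
      refine contMDiffAt_totalSpace_sum contMDiff_coTanSum_proj.contMDiffAt (fun k => ?_)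
        fun k => h.smooth k q.1 hU
      fin_cases k
      · exact hv 0
      · exact contMDiffAt_const
      · exact contMDiffAt_const
      · exact contMDiffAt_const
    exact contMDiffAt_tangent_mk hu hc2 hz
  have h2 : ContMDiffAt IY.tangent IS.tangent ∞ (tangentMapWithin IY IS (psi S α e)
      {y : X × FrameCoord | y.1 ∈ U}) ⟨coord S e q, fieldVec S α e (coord S e q)⟩ :=
    (h1 ⟨coord S e q, fieldVec S α e (coord S e q)⟩ hU).contMDiffAt
      (((FiberBundle.continuous_proj (E4 × FrameCoord)
        (TangentSpace IY : X × FrameCoord → Type _)).isOpen_preimage _ hO).mem_nhds hU)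
  have h3 := ContMDiffAt.comp (f := fun q : CoTanSum X =>
      (⟨coord S e q, fieldVec S α e (coord S e q)⟩ : TangentBundle IY (X × FrameCoord)))
    (g := tangentMapWithin IY IS (psi S α e) {y : X × FrameCoord | y.1 ∈ U}) q h2 hv
  have hcongr : ∀ q' ∈ S.SN, q'.1 ∈ U →
      (⟨q', localField S α e q'⟩ : TangentBundle IS (CoTanSum X)) =
      tangentMapWithin IY IS (psi S α e) {y : X × FrameCoord | y.1 ∈ U}
        ⟨coord S e q', fieldVec S α e (coord S e q')⟩ := by
    intro q' hq' hU'
    have h4 := h.psi_coord hα hR hU' ((mem_SN_iff hα hR).1 hq').2.2.1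
    have h5 : ∀ (z z' : CoTanSum X) (_ : z' = z) (w : E4 × ((E4 →L[ℝ] ℝ) × E4)),
        (⟨z, (w : TangentSpace IS z)⟩ : TangentBundle IS (CoTanSum X)) =
          ⟨z', (w : TangentSpace IS z')⟩ := by
      rintro z _ rfl w; rfl
    refine (h5 _ _ h4 _).trans ?_
    have h6 : mfderivWithin IY IS (psi S α e) {y : X × FrameCoord | y.1 ∈ U} (coord S e q') =
        mfderiv IY IS (psi S α e) (coord S e q') := mfderivWithin_of_isOpen hO hU'
    exact congrArg (fun l : E4 × FrameCoord →L[ℝ] E4 × ((E4 →L[ℝ] ℝ) × E4) =>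
      (⟨psi S α e (coord S e q'), l (fieldVec S α e (coord S e q'))⟩ :
        TangentBundle IS (CoTanSum X))) h6.symm
  refine h3.contMDiffWithinAt.congr_of_eventuallyEq ?_ (hcongr q hq hU)
  filter_upwards [self_mem_nhdsWithin, mem_nhdsWithin_of_mem_nhds
    (contMDiff_coTanSum_proj.continuous.continuousAt.preimage_mem_nhds
      (h.isOpen.mem_nhds hU))] with q' hq' hU'
  exact hcongr q' hq' hU'

/-- Dilations act on frame coordinates by multiplying the covector components, and the only nonzero
covector component of the field, `v₀ b ρ`, is linear in `ρ`. -/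
theorem localField_dilS (h : AdaptedFrame S α R U e) (hα : S.IsPoppForm α)
    (hR : S.IsReeb α R) {q : CoTanSum X} (hq : q ∈ S.SN) (hU : q.1 ∈ U) (c : ℝ) :
    mfderiv IS IS (dilS c) q (localField S α e q) = localField S α e (dilS c q) := by
  have h1 := h.psi_coord hα hR hU ((mem_SN_iff hα hR).1 hq).2.2.1
  let y := coord S e q
  have h2 : ∀ q' : CoTanSum X, q' = q →
      (show E4 × ((E4 →L[ℝ] ℝ) × E4) from mfderiv IS IS (dilS c) q (localField S α e q)) =
      (show E4 × ((E4 →L[ℝ] ℝ) × E4) →L[ℝ] E4 × ((E4 →L[ℝ] ℝ) × E4) from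
        mfderiv IS IS (dilS c) q') (localField S α e q) := by
    rintro q' rfl
    rfl
  refine (h2 _ h1).trans ?_
  have h3 := HasMFDerivAt.comp (g := dilS c) (f := psi S α e) y
    (((contMDiff_dilS c) _).mdifferentiableAt (by simp)).hasMFDerivAt (h.hasMFDerivAt_psi hα hU)
  have h4 : HasMFDerivAt IY IY (fun z : X × FrameCoord => (z.1, scaleL c z.2)) y
      ((ContinuousLinearMap.fst ℝ E4 FrameCoord).prod
        ((scaleL c).comp (ContinuousLinearMap.snd ℝ E4 FrameCoord))) :=
    (hasMFDerivAt_fst y).prodMk (HasMFDerivAt.comp (g := scaleL c)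
      (f := fun z : X × FrameCoord => z.2) y (scaleL c).hasMFDerivAt (hasMFDerivAt_snd y))
  have h5 := HasMFDerivAt.comp (g := psi S α e) (f := fun z : X × FrameCoord => (z.1, scaleL c z.2))
    y (h.hasMFDerivAt_psi hα (y := (y.1, scaleL c y.2)) hU) h4
  have h6 : dilS c ∘ psi S α e = psi S α e ∘ fun z : X × FrameCoord => (z.1, scaleL c z.2) :=
    funext fun z => dilS_psi c z
  rw [h6] at h3
  have h7 := congrArg (fun l : E4 × FrameCoord →L[ℝ] E4 × ((E4 →L[ℝ] ℝ) × E4) =>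
    l (fieldVec S α e y)) (hasMFDerivAt_unique h3 h5)
  refine Eq.trans h7 ?_
  exact congrArg (fun w : E4 × FrameCoord => (show E4 × FrameCoord →L[ℝ] E4 × ((E4 →L[ℝ] ℝ) × E4)
    from mfderiv IY IS (psi S α e) (y.1, scaleL c y.2)) w) (fieldVec_scaleL c y).symm

theorem pushBase_localField (h : AdaptedFrame S α R U e) (hα : S.IsPoppForm α)
    (hR : S.IsReeb α R) {q : CoTanSum X} (hq : q ∈ S.SN) (hU : q.1 ∈ U) :
    pushBase (localField S α e) q = S.g q.1 (e 0 q.1) q.2.2 • e 0 q.1 := by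
  have h1 := h.psi_coord hα hR hU ((mem_SN_iff hα hR).1 hq).2.2.1
  let y := coord S e q
  have h2 : ∀ q' : CoTanSum X, q' = q →
      (show E4 from mfderiv IS (𝓡 4) (fun q' : CoTanSum X => q'.1) q (localField S α e q)) =
      (show E4 × ((E4 →L[ℝ] ℝ) × E4) →L[ℝ] E4 from
        mfderiv IS (𝓡 4) (fun q' : CoTanSum X => q'.1) q') (localField S α e q) := by
    rintro q' rfl
    rfl
  refine (h2 _ h1).trans ?_
  have h3 := HasMFDerivAt.comp (g := fun q' : CoTanSum X => q'.1) (f := psi S α e) y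
    ((contMDiff_coTanSum_proj _).mdifferentiableAt (by simp)).hasMFDerivAt
    (h.hasMFDerivAt_psi hα hU)
  have h4 : HasMFDerivAt IY (𝓡 4) (fun z : X × FrameCoord => z.1) y
    (ContinuousLinearMap.fst ℝ E4 FrameCoord) := hasMFDerivAt_fst y
  have h7 := congrArg (fun l : E4 × FrameCoord →L[ℝ] E4 => l (fieldVec S α e y))
    (hasMFDerivAt_unique h3 h4)
  refine Eq.trans h7 ?_
  change (∑ k, (![S.g q.1 (e 0 q.1) q.2.2, 0, 0, 0] : Fin 4 → ℝ) k • e k q.1) =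
    S.g q.1 (e 0 q.1) q.2.2 • e 0 q.1
  simp [Fin.sum_univ_four]

end AdaptedFrame
end QCStructure

namespace QCStructure
open QuasiContact

variable {X : Type*} [TopologicalSpace X] [ChartedSpace E4 X] [IsManifold (𝓡 4) ∞ X]
  {S : QCStructure X} {α : ∀ x : X, CoFib X x} {R : ∀ x : X, TangentSpace (𝓡 4) x}
  {U : Set X} {e : Fin 4 → ∀ x : X, TangentSpace (𝓡 4) x}

/-! ### Gluing with a partition of unity -/

theorem AdaptedFrame.mono (h : AdaptedFrame S α R U e) {V : Set X} (hV : IsOpen V) (hVU : V ⊆ U) :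
    AdaptedFrame S α R V e where
  isOpen := hV
  smooth j x hx := h.smooth j x (hVU hx)
  last := h.last
  mem_E i x hx := h.mem_E i x (hVU hx)
  orthonormal i j x hx := h.orthonormal i j x (hVU hx)
  mem_L x hx := h.mem_L x (hVU hx)
  oriented x hx := h.oriented x (hVU hx)

/-- A finite cover by the domains of adapted frames, each contained in the domain of a chart,
with a subordinate partition of unity. -/
structure FrameCover (S : QCStructure X) (α : ∀ x : X, CoFib X x)
    (R : ∀ x : X, TangentSpace (𝓡 4) x) {ι : Type*} [Fintype ι] (c : ι → X) (U : ι → Set X)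
    (e : ι → Fin 4 → ∀ x : X, TangentSpace (𝓡 4) x) (χ : ι → X → ℝ) : Prop where
  frame : ∀ i, AdaptedFrame S α R (U i) (e i)
  subset_chart : ∀ i, U i ⊆ (chartAt E4 (c i)).source
  smooth : ∀ i, ContMDiff (𝓡 4) 𝓘(ℝ, ℝ) ∞ (χ i)
  sum_eq : ∀ x, ∑ i, χ i x = 1
  tsupport_subset : ∀ i, tsupport (χ i) ⊆ U i

theorem exists_frameCover [CompactSpace X] [T2Space X] (hα : S.IsPoppForm α) (hR : S.IsReeb α R) :
    ∃ (t : Finset X) (c : t → X) (U : t → Set X)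
      (e : t → Fin 4 → ∀ x : X, TangentSpace (𝓡 4) x) (χ : t → X → ℝ),
      FrameCover S α R c U e χ := by
  choose V e hVe hxV using exists_adaptedFrame hα hR
  let W : X → Set X := fun x => V x ∩ (chartAt E4 x).source
  have hWo : ∀ x, IsOpen (W x) := fun x => (hVe x).isOpen.inter (chartAt E4 x).open_source
  obtain ⟨t, ht⟩ := isCompact_univ.elim_finite_subcover W hWo
    (fun x _ => mem_iUnion.2 ⟨x, hxV x, mem_chart_source E4 x⟩)
  obtain ⟨f, hf⟩ := SmoothPartitionOfUnity.exists_isSubordinate (𝓡 4) (s := univ) isClosed_univ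
    (fun i : t => W i) (fun i => hWo i) (by
      intro x hx
      obtain ⟨i, hi, hxi⟩ := mem_iUnion₂.1 (ht hx)
      exact mem_iUnion.2 ⟨⟨i, hi⟩, hxi⟩)
  refine ⟨t, fun i => i, fun i => W i, fun i => e i, fun i => f i,
    fun i => (hVe i).mono (hWo i) inter_subset_left, fun i => inter_subset_right,
    fun i => (f i).contMDiff, fun x => ?_, fun i => hf i⟩
  rw [← finsum_eq_sum_of_fintype]
  exact f.sum_eq_one (mem_univ x)

variable {ι : Type*} [Fintype ι] {c : ι → X} {V : ι → Set X}
  {E : ι → Fin 4 → ∀ x : X, TangentSpace (𝓡 4) x} {χ : ι → X → ℝ}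

/-- The function `|σ(R)| Ω / σ(R)`. -/
def glueFn (S : QCStructure X) (α : ∀ x : X, CoFib X x) (R : ∀ x : X, TangentSpace (𝓡 4) x)
    (E : ι → Fin 4 → ∀ x : X, TangentSpace (𝓡 4) x) (χ : ι → X → ℝ) (p : CoTan X) : ℝ :=
  ∑ i, χ i p.1 * (mainTerm S R p + cubicTerm S α (E i) p)

/-- The function `Ω`. -/
def omegaFn (S : QCStructure X) (α : ∀ x : X, CoFib X x) (R : ∀ x : X, TangentSpace (𝓡 4) x)
    (E : ι → Fin 4 → ∀ x : X, TangentSpace (𝓡 4) x) (χ : ι → X → ℝ) (p : CoTan X) : ℝ :=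
  SignType.sign (symb R p) * glueFn S α R E χ p

/-- The boundary field. -/
def glueField (S : QCStructure X) (α : ∀ x : X, CoFib X x)
    (E : ι → Fin 4 → ∀ x : X, TangentSpace (𝓡 4) x) (χ : ι → X → ℝ) (q : CoTanSum X) :
    TangentSpace IS q :=
  ∑ i, χ i q.1 • localField S α (E i) q

theorem mainTerm_dil (h : AdaptedFrame S α R U e) [T2Space X] (hα : S.IsPoppForm α)
    (hR : S.IsReeb α R) {p : CoTan X} (hp : p.1 ∈ U) {c : ℝ} (hc : c ≠ 0) :
    mainTerm S R (dil c p) = c * mainTerm S R p := by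
  rw [h.mainTerm_eq hα hR (p := dil c p) hp, h.mainTerm_eq hα hR hp]
  have h1 : ∀ j, symb (e j) (dil c p) = c * symb (e j) p := fun j => rfl
  simp only [h1, mul_inv]
  field_simp

theorem cubicTerm_dil {p : CoTan X} {c : ℝ} (hc : c ≠ 0) :
    cubicTerm S α e (dil c p) = c * cubicTerm S α e p := by
  have h1 : ∀ j, symb (e j) (dil c p) = c * symb (e j) p := fun j => rfl
  simp only [cubicTerm, h1, cub_smul, mul_pow, mul_inv, show (dil c p).1 = p.1 from rfl]
  field_simp

theorem contMDiffAt_sign {p : CoTan X} (hR : SmoothVF R) (hp : symb R p ≠ 0) :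
    ∀ᶠ p' in 𝓝 p, (SignType.sign (symb R p') : ℝ) = SignType.sign (symb R p) := by
  have h1 : ContinuousAt (symb R) p := (contMDiffAt_symb hR.contMDiffAt).continuousAt
  rcases lt_or_gt_of_ne hp with h | h
  · filter_upwards [h1.eventually_lt continuousAt_const h] with p' hp'
    rw [sign_neg h, sign_neg hp']
  · filter_upwards [(continuousAt_const (y := (0 : ℝ))).eventually_lt h1 h] with p' hp'
    rw [sign_pos h, sign_pos hp']

namespace AdaptedFrame

theorem contMDiffAt_mainTerm [T2Space X] (h : AdaptedFrame S α R U e) (hα : S.IsPoppForm α)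
    (hR : S.IsReeb α R) {p : CoTan X} (hp : p.1 ∈ U) (hρ : symb R p ≠ 0) :
    ContMDiffAt IC 𝓘(ℝ, ℝ) ∞ (mainTerm S R) p := by
  have hs : ∀ j, ContMDiffAt IC 𝓘(ℝ, ℝ) ∞ (symb (e j)) p := fun j =>
    contMDiffAt_symb (h.smooth j _ hp)
  rw [← h.last] at hρ
  have h1 : ContMDiffAt IC 𝓘(ℝ, ℝ) ∞ (fun p => (2 * symb (e 3) p)⁻¹) p :=
    ContMDiffAt.comp (g := fun t : ℝ => (2 * t)⁻¹) p
      (ContDiffAt.contMDiffAt ((contDiffAt_const.mul contDiffAt_id).inv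
        (mul_ne_zero two_ne_zero hρ))) (hs 3)
  refine ((((hs 1).pow 2).add ((hs 2).pow 2)).mul h1).congr_of_eventuallyEq ?_
  filter_upwards [h.eventually_mem hp] with p' hp'
  exact h.mainTerm_eq hα hR hp'

theorem contMDiffAt_cubicTerm (h : AdaptedFrame S α R U e) (hα : S.IsPoppForm α)
    {p : CoTan X} (hp : p.1 ∈ U) (hρ : symb R p ≠ 0) :
    ContMDiffAt IC 𝓘(ℝ, ℝ) ∞ (cubicTerm S α e) p := by
  have hs : ∀ j, ContMDiffAt IC 𝓘(ℝ, ℝ) ∞ (symb (e j)) p := fun j =>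
    contMDiffAt_symb (h.smooth j _ hp)
  rw [← h.last] at hρ
  have h1 : ContMDiffAt IC 𝓘(ℝ, ℝ) ∞ (fun p => (symb (e 3) p ^ 2)⁻¹) p :=
    ContMDiffAt.comp (g := fun t : ℝ => (t ^ 2)⁻¹) p
      (ContDiffAt.contMDiffAt ((contDiffAt_id.pow 2).inv (pow_ne_zero 2 hρ))) (hs 3)
  have hκ : ∀ m, ContMDiffAt IC 𝓘(ℝ, ℝ) ∞ (fun p : CoTan X => cubicCoeff S α e m p.1) p :=
    fun m => ContMDiffAt.comp (g := cubicCoeff S α e m) p (h.contMDiffAt_cubicCoeff hα hp m)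
      contMDiff_coTan_proj.contMDiffAt
  have h0 := hs 0
  have h2 := hs 1
  have h3 := hs 2
  exact (((h0.pow 2).mul (((hκ 0).mul h3).sub ((hκ 1).mul h2))).add
    (h0.mul (((hκ 2).mul (h2.mul h3)).add ((hκ 3).mul ((h2.pow 2).sub (h3.pow 2)))))).mul h1

end AdaptedFrame

namespace FrameCover

theorem exists_mem (h : FrameCover S α R c V E χ) (x : X) : ∃ i, x ∈ V i := by
  by_contra hne
  push Not at hne
  have h1 : ∀ i, χ i x = 0 := fun i => image_eq_zero_of_notMem_tsupport fun hx =>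
    hne i (h.tsupport_subset i hx)
  have h2 := h.sum_eq x
  simp [h1] at h2

theorem eventually_eq_zero (h : FrameCover S α R c V E χ) {i : ι} {x : X} (hx : x ∉ V i) :
    ∀ᶠ y in 𝓝 x, χ i y = 0 :=
  notMem_tsupport_iff_eventuallyEq.1 fun hx' => hx (h.tsupport_subset i hx')

theorem eventually_coTan_eq_zero (h : FrameCover S α R c V E χ) {i : ι} {p : CoTan X}
    (hx : p.1 ∉ V i) : ∀ᶠ p' in 𝓝 p, χ i (p'.1) = 0 :=
  (contMDiff_coTan_proj.continuous.continuousAt (x := p)).eventually (h.eventually_eq_zero hx)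

theorem contMDiffAt_glueFn [T2Space X] (h : FrameCover S α R c V E χ) (hα : S.IsPoppForm α)
    (hR : S.IsReeb α R) {p : CoTan X} (hρ : symb R p ≠ 0) :
    ContMDiffAt IC 𝓘(ℝ, ℝ) ∞ (glueFn S α R E χ) p := by
  refine contMDiffAt_finsetSum fun i _ => ?_
  by_cases hx : p.1 ∈ V i
  · exact (ContMDiffAt.comp (g := χ i) p (h.smooth i).contMDiffAt
      contMDiff_coTan_proj.contMDiffAt).mul (((h.frame i).contMDiffAt_mainTerm hα hR hx hρ).add
        ((h.frame i).contMDiffAt_cubicTerm hα hx hρ))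
  · refine (contMDiffAt_const (c := (0 : ℝ))).congr_of_eventuallyEq ?_
    filter_upwards [h.eventually_coTan_eq_zero hx] with p' hp'
    rw [hp', zero_mul]

theorem contMDiffAt_omegaFn [T2Space X] (h : FrameCover S α R c V E χ) (hα : S.IsPoppForm α)
    (hR : S.IsReeb α R) {p : CoTan X} (hρ : symb R p ≠ 0) :
    ContMDiffAt IC 𝓘(ℝ, ℝ) ∞ (omegaFn S α R E χ) p := by
  refine ((contMDiffAt_const (c := (SignType.sign (symb R p) : ℝ))).mul
    (h.contMDiffAt_glueFn hα hR hρ)).congr_of_eventuallyEq ?_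
  filter_upwards [contMDiffAt_sign hR.smooth hρ] with p' hp'
  rw [omegaFn, hp']; rfl

theorem omegaFn_dil [T2Space X] (h : FrameCover S α R c V E χ) (hα : S.IsPoppForm α)
    (hR : S.IsReeb α R) (p : CoTan X) {t : ℝ} (ht : 0 < t) :
    omegaFn S α R E χ (dil t p) = t * omegaFn S α R E χ p := by
  obtain ⟨i, hi⟩ := h.exists_mem p.1
  have h1 : SignType.sign (symb R (dil t p)) = SignType.sign (symb R p) := by
    change SignType.sign (t * symb R p) = _
    rw [sign_mul, sign_pos ht, one_mul]
  have h2 : glueFn S α R E χ (dil t p) = t * glueFn S α R E χ p := by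
    rw [glueFn, glueFn, Finset.mul_sum]
    refine Finset.sum_congr rfl fun j _ => ?_
    rw [mainTerm_dil (h.frame i) hα hR hi ht.ne', cubicTerm_dil ht.ne',
      show (dil t p).1 = p.1 from rfl]
    ring
  rw [omegaFn, omegaFn, h1, h2]
  ring

open Classical in
/-- The frames whose domain contains a given point. -/
def active (V : ι → Set X) (x : X) : Finset ι := Finset.univ.filter fun i => x ∈ V i

theorem mem_active {x : X} {i : ι} : i ∈ active V x ↔ x ∈ V i := by
  simp [active]

/-- The cover is finite, so near a point the sums over all frames reduce to the frames defined at
that point; outside those domains nothing is known about the local terms. -/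
theorem eventually_active (h : FrameCover S α R c V E χ) (x : X) :
    ∀ᶠ y in 𝓝 x, (∀ i ∈ active V x, y ∈ V i) ∧ (∀ i ∉ active V x, χ i y = 0) := by
  refine Filter.Eventually.and ?_ ?_
  · rw [Filter.eventually_all_finset]
    exact fun i hi => (h.frame i).isOpen.mem_nhds (mem_active.1 hi)
  · rw [Filter.eventually_all]
    intro i
    by_cases hi : i ∈ active V x
    · exact Eventually.of_forall fun y hn => (hn hi).elim
    · filter_upwards [h.eventually_eq_zero fun hx => hi (mem_active.2 hx)] with y hy _
      exact hy

theorem sum_active {x : X} {I : Finset ι}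
    (hx : ∀ i ∉ I, χ i x = 0) (f : ι → ℝ) :
    ∑ i, χ i x * f i = ∑ i ∈ I, χ i x * f i :=
  (Finset.sum_subset (Finset.subset_univ I) fun i _ hi => by rw [hx i hi, zero_mul]).symm

/-- Differentiating `∑ χ_i = 1` shows that the derivatives of the cutoffs cancel against the common
leading term. They remain only in front of the cubic terms, which are small enough to be neglected.
-/
theorem dC_glueFn [T2Space X] (h : FrameCover S α R c V E χ) (hα : S.IsPoppForm α)
    (hR : S.IsReeb α R) {x : X} {p : CoTan X}
    (hp : ∀ᶠ y in 𝓝 p.1, (∀ i ∈ active V x, y ∈ V i) ∧ (∀ i ∉ active V x, χ i y = 0))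
    (hρ : symb R p ≠ 0) (w : E4 × (E4 →L[ℝ] ℝ)) :
    dC (glueFn S α R E χ) p w = ∑ i ∈ active V x,
      (χ i p.1 * dC (fun p => mainTerm S R p + cubicTerm S α (E i) p) p w +
        cubicTerm S α (E i) p * dC (fun p : CoTan X => χ i p.1) p w) := by
  have hp' := (contMDiff_coTan_proj.continuous.continuousAt (x := p)).eventually hp
  obtain ⟨hV, -⟩ := hp.self_of_nhds
  have hχ : ∀ i, HasDC (fun p : CoTan X => χ i p.1) p w (dC (fun p : CoTan X => χ i p.1) p w) :=
    fun i => HasDC.of_contMDiffAt (ContMDiffAt.comp (g := χ i) p (h.smooth i).contMDiffAt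
      contMDiff_coTan_proj.contMDiffAt) w
  have hf : ∀ i ∈ active V x, HasDC (fun p => mainTerm S R p + cubicTerm S α (E i) p) p w
      (dC (fun p => mainTerm S R p + cubicTerm S α (E i) p) p w) := fun i hi =>
    HasDC.of_contMDiffAt (((h.frame i).contMDiffAt_mainTerm hα hR (hV i hi) hρ).add
        ((h.frame i).contMDiffAt_cubicTerm hα (hV i hi) hρ)) w
  have h1 := (HasDC.sum (s := active V x) fun i hi => (hχ i).mul (hf i hi)).congr_of_eventuallyEq
    (g := glueFn S α R E χ) (by
      filter_upwards [hp'] with p' hp'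
      exact sum_active hp'.2 _)
  have h2 := ((HasDC.sum (s := active V x) fun i _ => hχ i).congr_of_eventuallyEq
    (g := fun _ => (1 : ℝ)) (by
      filter_upwards [hp'] with p' hp'
      have := sum_active hp'.2 (fun _ => 1)
      simp only [mul_one, h.sum_eq] at this
      exact this)).2
  rw [(HasDC.const 1 p w).2] at h2
  rw [h1.2]
  simp only [add_mul, Finset.sum_add_distrib]
  rw [← Finset.mul_sum, ← h2, mul_zero, zero_add]

theorem ham_glueFn [T2Space X] (h : FrameCover S α R c V E χ) (hα : S.IsPoppForm α)
    (hR : S.IsReeb α R) {x : X} {p : CoTan X}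
    (hp : ∀ᶠ y in 𝓝 p.1, (∀ i ∈ active V x, y ∈ V i) ∧ (∀ i ∉ active V x, χ i y = 0))
    (hρ : symb R p ≠ 0) (G : CoTan X → ℝ) :
    dC G p (ham (omegaFn S α R E χ) p) = SignType.sign (symb R p) * ∑ i ∈ active V x,
      (χ i p.1 * dC G p (ham (fun p => mainTerm S R p + cubicTerm S α (E i) p) p) +
        cubicTerm S α (E i) p * dC G p (ham (fun p : CoTan X => χ i p.1) p)) := by
  have h1 : ∀ w, dC (omegaFn S α R E χ) p w =
      SignType.sign (symb R p) * dC (glueFn S α R E χ) p w := fun w =>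
    ((HasDC.of_contMDiffAt (h.contMDiffAt_glueFn hα hR hρ) w).const_mul
      (SignType.sign (symb R p) : ℝ)).congr_of_eventuallyEq (by
        filter_upwards [contMDiffAt_sign hR.smooth hρ] with p' hp'
        rw [omegaFn, hp']) |>.2
  have h2 := ham_eq_sum (s := (active V x).disjSum (active V x)) (p := p)
    (f := glueFn S α R E χ)
    (c := Sum.elim (fun i => χ i p.1) fun i => cubicTerm S α (E i) p)
    (g := Sum.elim (fun i => fun p => mainTerm S R p + cubicTerm S α (E i) p)
      fun i => fun p : CoTan X => χ i p.1) fun w => by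
      rw [h.dC_glueFn hα hR hp hρ, Finset.sum_disjSum, Finset.sum_add_distrib]; rfl
  have h3 := ham_eq_sum (s := {()}) (f := omegaFn S α R E χ) (p := p)
    (c := fun _ => (SignType.sign (symb R p) : ℝ)) (g := fun _ => glueFn S α R E χ)
    fun w => by rw [h1]; simp
  rw [h3, Finset.sum_singleton, dC_smul_vec, h2, dC_sum_vec, Finset.sum_disjSum,
    Finset.sum_add_distrib]
  rfl

end FrameCover
end QCStructure

/-! ### Boundary behaviour of the glued function and properties of the glued field -/

namespace QCStructure
open QuasiContact

variable {X : Type*} [TopologicalSpace X] [ChartedSpace E4 X] [IsManifold (𝓡 4) ∞ X]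
  {S : QCStructure X} {α : ∀ x : X, CoFib X x} {R : ∀ x : X, TangentSpace (𝓡 4) x}
  {U : Set X} {e : Fin 4 → ∀ x : X, TangentSpace (𝓡 4) x}
  {ι : Type*} [Fintype ι] {c : ι → X} {V : ι → Set X}
  {E : ι → Fin 4 → ∀ x : X, TangentSpace (𝓡 4) x} {χ : ι → X → ℝ}

theorem mdifferentiableAt_of_mem_SN (hα : S.IsPoppForm α) (hR : S.IsReeb α R)
    {F : CoTanSum X → ℝ} (hF : TestFn F) {q : CoTanSum X} (hq : q ∈ S.SN) :
    MDifferentiableAt IS 𝓘(ℝ, ℝ) F q :=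
  (TestFn.contMDiffAt hF (V := R) (U := univ) (fun x _ => hR.smooth.contMDiffAt) (mem_univ _)
    ((mem_SN_iff hα hR).1 hq).1).mdifferentiableAt (by simp)

theorem sign_mul_sign {t : ℝ} (ht : t ≠ 0) : (SignType.sign t : ℝ) * SignType.sign t = 1 := by
  rcases lt_or_gt_of_ne ht with h | h
  · simp [sign_neg h]
  · simp [sign_pos h]

namespace AdaptedFrame

theorem contMDiffAt_comp_psi (h : AdaptedFrame S α R U e) (hα : S.IsPoppForm α)
    (hR : S.IsReeb α R) {F : CoTanSum X → ℝ} (hF : TestFn F) {y : X × FrameCoord}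
    (hy : y ∈ sphereCoord U) : ContMDiffAt IY 𝓘(ℝ, ℝ) ∞ (F ∘ psi S α e) y :=
  (h.contMDiffOn_comp_psi hα hR hF y ⟨hy.1, hy.2.1⟩).contMDiffAt
    ((isOpen_coordDomain h.isOpen).mem_nhds ⟨hy.1, hy.2.1⟩)

/-- The rotational field in frame coordinates. -/
theorem rotDeriv_eq [T2Space X] (h : AdaptedFrame S α R U e) (hα : S.IsPoppForm α)
    (hR : S.IsReeb α R) {F : CoTanSum X → ℝ} (hF : TestFn F) {q : CoTanSum X} (hq : q ∈ S.SN)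
    (hU : q.1 ∈ U) : S.rotDeriv F q = SignType.sign (symb R (beta q)) *
      dY (F ∘ psi S α e) (coord S e q)
        (frameVec e q.1 0 0 ![0, (coord S e q).2.2 2, -(coord S e q).2.2 1]) := by
  have hm := h.coord_mem hα hR hq hU
  have h1 := h.psi_coord hα hR hU ((mem_SN_iff hα hR).1 hq).2.2.1
  set y := coord S e q with hy
  have hs : (SignType.sign (symb R (beta q)) : ℝ) = SignType.sign (y.2.1 3) := by
    rw [← h.last]; rfl
  have h2 : (fun θ => F (S.rot θ q)) = fun θ =>
      (F ∘ psi S α e) (y.1, rotL (SignType.sign (y.2.1 3) * θ) y.2) := by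
    funext θ
    conv_lhs => rw [← h1, h.rot_psi hα hR hm]
    rfl
  rw [rotDeriv, h2, hs]
  generalize (SignType.sign (y.2.1 3) : ℝ) = s
  have h3 : HasDerivAt (fun θ : ℝ => rotL (s * θ) y.2)
      ((0 : Fin 4 → ℝ), fun i => s * (![0, y.2.2 2, -y.2.2 1] : Fin 3 → ℝ) i) 0 := by
    have hθ : HasDerivAt (fun θ : ℝ => s * θ) s 0 := by
      simpa using (hasDerivAt_id (0 : ℝ)).const_mul s
    refine HasDerivAt.prodMk (hasDerivAt_const _ _) (hasDerivAt_pi.2 fun i => ?_)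
    fin_cases i
    · simpa [rotV] using hasDerivAt_const (0 : ℝ) (y.2.2 0)
    · have := (hθ.cos.mul_const (y.2.2 1)).add (hθ.sin.mul_const (y.2.2 2))
      refine this.congr_deriv ?_
      simp
    · have := (hθ.cos.mul_const (y.2.2 2)).sub (hθ.sin.mul_const (y.2.2 1))
      refine this.congr_deriv ?_
      simp
  have h0 : ((y.1, rotL (s * 0) y.2) : X × FrameCoord) = y := by
    refine Prod.ext rfl (Prod.ext rfl ?_)
    funext i
    fin_cases i <;> simp [rotL_apply, rotV]
  have h4 : HasMFDerivAt 𝓘(ℝ, ℝ) IY (fun θ : ℝ => ((y.1, rotL (s * θ) y.2) : X × FrameCoord)) 0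
      ((0 : ℝ →L[ℝ] E4).prod (ContinuousLinearMap.toSpanSingleton ℝ
        (((0 : Fin 4 → ℝ), fun i => s * (![0, y.2.2 2, -y.2.2 1] : Fin 3 → ℝ) i) : FrameCoord))) :=
    (hasMFDerivAt_const y.1 (0 : ℝ)).prodMk h3.hasFDerivAt.hasMFDerivAt
  have hG : MDifferentiableAt IY 𝓘(ℝ, ℝ) (F ∘ psi S α e) (y.1, rotL (s * 0) y.2) := by
    rw [h0]
    exact (h.contMDiffAt_comp_psi hα hR hF hm).mdifferentiableAt (by simp)
  have h5 := HasMFDerivAt.comp (g := F ∘ psi S α e)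
    (f := fun θ : ℝ => ((y.1, rotL (s * θ) y.2) : X × FrameCoord)) 0 hG.hasMFDerivAt h4
  have h6 : HasFDerivAt (fun θ : ℝ => (F ∘ psi S α e) (y.1, rotL (s * θ) y.2))
      ((show E4 × FrameCoord →L[ℝ] ℝ from
        mfderiv IY 𝓘(ℝ, ℝ) (F ∘ psi S α e) (y.1, rotL (s * 0) y.2)).comp
        ((0 : ℝ →L[ℝ] E4).prod (ContinuousLinearMap.toSpanSingleton ℝ
        (((0 : Fin 4 → ℝ), fun i => s * (![0, y.2.2 2, -y.2.2 1] : Fin 3 → ℝ) i) : FrameCoord))))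
      0 := hasMFDerivAt_iff_hasFDerivAt.1 h5
  refine h6.hasDerivAt.deriv.trans ?_
  rw [h0]
  refine Eq.trans ?_ (dY_frameVec_smul (e := e) (F ∘ psi S α e) y s 0 0 ![0, y.2.2 2, -y.2.2 1])
  change (show E4 × FrameCoord →L[ℝ] ℝ from mfderiv IY 𝓘(ℝ, ℝ) (F ∘ psi S α e) y)
    ((0 : ℝ →L[ℝ] E4) 1, (1 : ℝ) • (((0 : Fin 4 → ℝ),
      fun i => s * (![0, y.2.2 2, -y.2.2 1] : Fin 3 → ℝ) i) : FrameCoord)) = _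
  rw [one_smul]
  refine congrArg (show E4 × FrameCoord →L[ℝ] ℝ from mfderiv IY 𝓘(ℝ, ℝ) (F ∘ psi S α e) y)
    (Prod.ext ?_ (Prod.ext ?_ rfl))
  · have h7 : ∀ k, (s * (0 : Fin 4 → ℝ) k) • e k y.1 = 0 := fun k => by simp
    exact (Finset.sum_eq_zero (s := Finset.univ) (f := fun k =>
      (s * (0 : Fin 4 → ℝ) k) • e k y.1) fun k _ => h7 k).symm
  · funext j
    simp [frameVec]

/-- The derivative along the boundary field is constant on circle orbits, for invariant
functions. -/
theorem dY_fieldVec_rotL [T2Space X] (h : AdaptedFrame S α R U e) (hα : S.IsPoppForm α)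
    (hR : S.IsReeb α R) {F : CoTanSum X → ℝ} (hF : TestFn F) (hinv : S.CircleInvariant F)
    {y : X × FrameCoord} (hy : y ∈ sphereCoord U) (φ : ℝ) :
    dY (F ∘ psi S α e) (y.1, rotL φ y.2) (fieldVec S α e (y.1, rotL φ y.2)) =
      dY (F ∘ psi S α e) y (fieldVec S α e y) := by
  have hG := (h.contMDiffAt_comp_psi hα hR hF hy).mdifferentiableAt (by simp)
  have hG' := (h.contMDiffAt_comp_psi hα hR hF (rotV_mem (φ := φ) hy)).mdifferentiableAt (by simp)
  have h1 := dY_comp_snd (φ := rotL φ) (rotL φ).hasFDerivAt hG' (fieldVec S α e y)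
  rw [fieldVec_rotL, ← h1, ← sub_eq_zero]
  have hc : MDifferentiableAt IY 𝓘(ℝ, ℝ)
      (fun z : X × FrameCoord => (F ∘ psi S α e) (z.1, rotL φ z.2)) y :=
    MDifferentiableAt.comp (g := F ∘ psi S α e)
      (f := fun z : X × FrameCoord => (z.1, rotL φ z.2)) y hG'
      (mdifferentiableAt_fst.prodMk (MDifferentiableAt.comp (g := rotL φ)
        (f := fun z : X × FrameCoord => z.2) y (rotL φ).mdifferentiableAt mdifferentiableAt_snd))
  -- By invariance the function and its rotated copy agree on the coordinates of `SNΣ`. The field is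
  -- tangent there, so it has the same derivative on both, and `fieldVec_rotL` carries the field
  -- along with the rotation.
  have h2 := dY_eq_zero_of_sphere (U := U) (y := y) (G := fun z =>
      (F ∘ psi S α e) (z.1, rotL φ z.2) - (F ∘ psi S α e) z) h.isOpen hy (hc.sub hG)
    (Eventually.of_forall fun z hz => by
      have hz3 := hz.2.1
      have h3 := hinv _ (h.psi_mem hα hR hz) (SignType.sign (z.2.1 3) * φ)
      rw [h.rot_psi hα hR hz, ← mul_assoc, sign_mul_sign hz3, one_mul] at h3
      exact sub_eq_zero.2 h3)
    (fieldVec_tangent (S := S) (α := α) (e := e) y).1 (fieldVec_tangent y).2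
  rw [← h2]
  have h4 := (hc.hasMFDerivAt.sub hG.hasMFDerivAt).mfderiv
  exact (congrArg (fun l : E4 × FrameCoord →L[ℝ] ℝ => l (fieldVec S α e y)) h4).symm

theorem g_frame_eq [T2Space X] (h : AdaptedFrame S α R U e) (hα : S.IsPoppForm α)
    (hR : S.IsReeb α R) {U' : Set X} {e' : Fin 4 → ∀ x : X, TangentSpace (𝓡 4) x}
    (h' : AdaptedFrame S α R U' e') {x : X} (hx : x ∈ U) (hx' : x ∈ U') :
    e' 0 x = e 0 x ∨ e' 0 x = -e 0 x := by
  rcases h.charUnit_eq hα hR hx with h1 | h1 <;> rcases h'.charUnit_eq hα hR hx' with h2 | h2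
  · left; rw [← h1, ← h2]
  · right; rw [← h1, h2, neg_neg]
  · right; rw [← h2, h1]
  · left; rw [← neg_inj, ← h1, ← h2]

theorem absXi_eq [T2Space X] (h : AdaptedFrame S α R U e) (hα : S.IsPoppForm α)
    (hR : S.IsReeb α R) {q : CoTanSum X} (hq : q ∈ S.SN) (hU : q.1 ∈ U) :
    S.absXi q = |S.g q.1 (e 0 q.1) q.2.2| := by
  obtain ⟨h1, h2, h3, h4⟩ := (mem_SN_iff hα hR).1 hq
  obtain ⟨x, ξ, v⟩ := q
  change x ∈ U at hU
  change ξ = ξ (R x) • α x at h2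
  change ξ (R x) ≠ 0 at h1
  change v ∈ S.E x at h3
  generalize ξ (R x) = t at h1 h2
  subst h2
  have h5 : v = ∑ i, (coord S e (⟨x, (t • α x, v)⟩ : CoTanSum X)).2.2 i •
    e (Fin.castSucc i) x := h.eq_sum_E hU h3
  have h6 := h.proj0_eq hα hR hU h1 (coord S e (⟨x, (t • α x, v)⟩ : CoTanSum X)).2.2
  rw [← h5] at h6
  change √(S.g x (S.proj0 (⟨x, t • α x⟩ : CoTan X) v) (S.proj0 (⟨x, t • α x⟩ : CoTan X) v)) = _
  rw [h6, h.metric_frame hU]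
  simp only [Fin.sum_univ_three, Matrix.cons_val_zero, Matrix.cons_val_one, Matrix.cons_val,
    mul_zero, add_zero]
  exact Real.sqrt_mul_self_eq_abs _

end AdaptedFrame

namespace FrameCover

theorem derivAlong_glueField (h : FrameCover S α R c V E χ) (hα : S.IsPoppForm α)
    (hR : S.IsReeb α R) {F : CoTanSum X → ℝ} {q : CoTanSum X}
    (hF : MDifferentiableAt IS 𝓘(ℝ, ℝ) F q) (hq : q ∈ S.SN) {I : Finset ι} (hI : ∀ i ∈ I, q.1 ∈ V i)
    (hI' : ∀ i ∉ I, χ i q.1 = 0) :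
    derivAlong (glueField S α E χ) F q = ∑ i ∈ I, χ i q.1 *
      dY (F ∘ psi S α (E i)) (coord S (E i) q) (fieldVec S α (E i) (coord S (E i) q)) := by
  let A : E4 × ((E4 →L[ℝ] ℝ) × E4) →L[ℝ] ℝ := mfderiv IS 𝓘(ℝ, ℝ) F q
  have h1 : derivAlong (glueField S α E χ) F q =
      ∑ i, χ i q.1 * A (localField S α (E i) q) := by
    change A (∑ i, χ i q.1 • (show E4 × ((E4 →L[ℝ] ℝ) × E4) from localField S α (E i) q)) = _
    rw [map_sum]
    exact Finset.sum_congr rfl fun i _ => A.map_smul _ _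
  rw [h1, sum_active hI']
  refine Finset.sum_congr rfl fun i hi => ?_
  exact congrArg (fun t : ℝ => χ i q.1 * t)
    ((h.frame i).mfderiv_localField hα hR hq (hI i hi) hF)

theorem active_spec (h : FrameCover S α R c V E χ) (x : X) :
    (∀ i ∈ active V x, x ∈ V i) ∧ ∀ i ∉ active V x, χ i x = 0 :=
  (h.eventually_active x).self_of_nhds

theorem sum_active_eq_one (h : FrameCover S α R c V E χ) {x : X} {I : Finset ι}
    (hI : ∀ i ∉ I, χ i x = 0) : ∑ i ∈ I, χ i x = 1 := by
  have h1 := sum_active hI (fun _ => 1)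
  simp only [mul_one, h.sum_eq] at h1
  exact h1.symm

theorem eventually_interior [T2Space X] (h : FrameCover S α R c V E χ) (hα : S.IsPoppForm α)
    (hR : S.IsReeb α R) {q : CoTanSum X} (hq : q ∈ S.SN) :
    ∀ᶠ q' in S.interiorNhds q, q' ∈ S.Blowup \ S.SN ∧
      SignType.sign (symb R (beta q')) = SignType.sign (symb R (beta q)) ∧
      symb R (beta q') ≠ 0 ∧
      ∀ᶠ y in 𝓝 (beta q').1, (∀ i ∈ active V q.1, y ∈ V i) ∧ (∀ i ∉ active V q.1, χ i y = 0) := by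
  have h0 : symb R (beta q) ≠ 0 := ((mem_SN_iff hα hR).1 hq).1
  obtain ⟨i, hi⟩ := h.exists_mem q.1
  have ht : Tendsto (fun q' => symb R (beta q')) (S.interiorNhds q) (𝓝 (symb R (beta q))) := by
    have := (h.frame i).tendsto_eval hi 3
    rw [(h.frame i).last] at this
    exact this
  refine Filter.Eventually.and self_mem_nhdsWithin (Filter.Eventually.and ?_ (Filter.Eventually.and
    (ht.eventually_ne h0) ?_))
  · rcases lt_or_gt_of_ne h0 with h1 | h1
    · filter_upwards [ht.eventually_lt_const h1] with q' hq'
      rw [sign_neg h1, sign_neg hq']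
    · filter_upwards [ht.eventually_const_lt h1] with q' hq'
      rw [sign_pos h1, sign_pos hq']
  · exact AdaptedFrame.tendsto_base.eventually
      (eventually_eventually_nhds.2 (h.eventually_active q.1))

/-- This is `tendsto_ham_cutoff` multiplied by `r / ρ`, which itself tends to zero. -/
theorem tendsto_cutoff [T2Space X] (h : FrameCover S α R c V E χ) (hα : S.IsPoppForm α)
    (hR : S.IsReeb α R) {F : CoTanSum X → ℝ} (hF : TestFn F) {q : CoTanSum X} (hq : q ∈ S.SN)
    {i : ι} (hi : q.1 ∈ V i) :
    Tendsto (fun q' => cubicTerm S α (E i) (beta q') *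
        dC (F ∘ S.lift) (beta q') (ham (fun p : CoTan X => χ i p.1) (beta q')))
      (S.interiorNhds q) (𝓝 0) := by
  have h0 : symb R (beta q) ≠ 0 := ((mem_SN_iff hα hR).1 hq).1
  have h1 := (h.frame i).tendsto_ham_cutoff hα hR hF hq hi (h.smooth i)
  have h2 : Tendsto (fun q' : CoTanSum X => q'.2.1 q'.2.2) (S.interiorNhds q) (𝓝 0) :=
    AdaptedFrame.radius_boundary hα hR hq ▸ AdaptedFrame.tendsto_radius
  have h3 := (h.frame i).tendsto_eval hi 3
  rw [(h.frame i).last] at h3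
  have h4 := (h2.div h3 h0).mul h1
  rw [mul_zero] at h4
  refine h4.congr' ?_
  filter_upwards [h.eventually_interior hα hR hq] with q' hq'
  obtain ⟨hi', -, hρ, -⟩ := hq'
  obtain ⟨hr, hrs, -⟩ := interior_spec hi'
  rw [hrs]
  change q'.2.1 q'.2.2 / symb R (beta q') * _ = _
  generalize q'.2.1 q'.2.2 = r at *
  have hr' := hr.ne'
  field_simp

/-- In every frame the limit is the same intrinsic rotation, so the weights `χ_i` add up to one and
the cutoff terms vanish. -/
theorem hamRestricts [T2Space X] (h : FrameCover S α R c V E χ) (hα : S.IsPoppForm α)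
    (hR : S.IsReeb α R) : S.HamRestrictsToRotation (omegaFn S α R E χ) := by
  intro F hF q hq
  have hI := h.active_spec q.1
  have h1 : Tendsto (fun q' => (SignType.sign (symb R (beta q)) : ℝ) * ∑ i ∈ active V q.1,
      (χ i q'.1 * dC (F ∘ S.lift) (beta q')
        (ham (fun p => mainTerm S R p + cubicTerm S α (E i) p) (beta q')) +
      cubicTerm S α (E i) (beta q') *
        dC (F ∘ S.lift) (beta q') (ham (fun p : CoTan X => χ i p.1) (beta q'))))
      (S.interiorNhds q) (𝓝 ((SignType.sign (symb R (beta q)) : ℝ) * ∑ i ∈ active V q.1,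
        (χ i q.1 * dY (F ∘ psi S α (E i)) (coord S (E i) q)
        (frameVec (E i) q.1 0 0 ![0, (coord S (E i) q).2.2 2, -(coord S (E i) q).2.2 1]) + 0))) :=
    (tendsto_finsetSum _ fun i hi => ((AdaptedFrame.tendsto_comp_base
      (h.smooth i).continuous.continuousAt).mul ((h.frame i).tendsto_ham_local hα hR hF hq
        (hI.1 i hi))).add (h.tendsto_cutoff hα hR hF hq (hI.1 i hi))).const_mul _
  have h2 : (SignType.sign (symb R (beta q)) : ℝ) * ∑ i ∈ active V q.1,
        (χ i q.1 * dY (F ∘ psi S α (E i)) (coord S (E i) q)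
        (frameVec (E i) q.1 0 0 ![0, (coord S (E i) q).2.2 2, -(coord S (E i) q).2.2 1]) + 0) =
      S.rotDeriv F q := by
    rw [Finset.mul_sum]
    have h3 : ∀ i ∈ active V q.1, (SignType.sign (symb R (beta q)) : ℝ) *
        (χ i q.1 * dY (F ∘ psi S α (E i)) (coord S (E i) q)
        (frameVec (E i) q.1 0 0 ![0, (coord S (E i) q).2.2 2, -(coord S (E i) q).2.2 1]) + 0) =
        χ i q.1 * S.rotDeriv F q := fun i hi => by
      rw [(h.frame i).rotDeriv_eq hα hR hF hq (hI.1 i hi)]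
      ring
    rw [Finset.sum_congr rfl h3, ← Finset.sum_mul, h.sum_active_eq_one hI.2, one_mul]
  rw [h2] at h1
  refine h1.congr' ?_
  filter_upwards [h.eventually_interior hα hR hq] with q' hq'
  obtain ⟨-, hs, hρ, hp⟩ := hq'
  rw [hamLift, h.ham_glueFn hα hR hp hρ, hs]
  rfl

/-- `H_{σ^{1/2}}` is distributed over the frames with the weights `χ_i`, and `|ρ|` times the sign in
`Ω` restores `ρ`; what remains is the local expansion in each frame, minus the negligible cutoff
terms. -/
theorem singularExpansion [T2Space X] (h : FrameCover S α R c V E χ) (hα : S.IsPoppForm α)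
    (hR : S.IsReeb α R) :
    S.HasSingularExpansion R (omegaFn S α R E χ) (glueField S α E χ) := by
  intro F hF q hq
  have hI := h.active_spec q.1
  have h1 : Tendsto (fun q' => ∑ i ∈ active V q.1,
      (χ i q'.1 * (dC (F ∘ S.lift) (beta q') (ham S.sqrtSigma (beta q')) -
        symb R (beta q') / S.sqrtSigma (beta q') * dC (F ∘ S.lift) (beta q')
        (ham (fun p => mainTerm S R p + cubicTerm S α (E i) p) (beta q'))) -
      symb R (beta q') / S.sqrtSigma (beta q') * cubicTerm S α (E i) (beta q') *
        dC (F ∘ S.lift) (beta q') (ham (fun p : CoTan X => χ i p.1) (beta q'))))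
      (S.interiorNhds q) (𝓝 (∑ i ∈ active V q.1,
        (χ i q.1 * dY (F ∘ psi S α (E i)) (coord S (E i) q)
          (fieldVec S α (E i) (coord S (E i) q)) - 0))) :=
    tendsto_finsetSum _ fun i hi => ((AdaptedFrame.tendsto_comp_base
      (h.smooth i).continuous.continuousAt).mul ((h.frame i).tendsto_singular hα hR hF hq
        (hI.1 i hi))).sub ((h.frame i).tendsto_ham_cutoff hα hR hF hq (hI.1 i hi) (h.smooth i))
  simp only [sub_zero] at h1
  rw [← h.derivAlong_glueField hα hR (mdifferentiableAt_of_mem_SN hα hR hF hq) hq hI.1 hI.2] at h1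
  refine h1.congr' ?_
  filter_upwards [h.eventually_interior hα hR hq] with q' hq'
  obtain ⟨-, hs, hρ, hp⟩ := hq'
  have h2 : |symb R (beta q')| * SignType.sign (symb R (beta q')) = symb R (beta q') := by
    rw [mul_comm]; exact sign_mul_abs _
  have h3 := h.sum_active_eq_one hp.self_of_nhds.2
  rw [hamLift, hamLift, h.ham_glueFn hα hR hp hρ, ← mul_assoc, div_mul_eq_mul_div, h2]
  simp only [mul_sub, Finset.sum_sub_distrib, mul_add, Finset.sum_add_distrib, Finset.mul_sum]
  rw [← Finset.sum_mul, show ∑ i ∈ active V q.1, χ i q'.1 = 1 from h3, one_mul, sub_sub]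
  congr 2
  · refine Finset.sum_congr rfl fun i _ => ?_
    change χ i q'.1 * _ = _ * (χ i q'.1 * _)
    ring
  · refine Finset.sum_congr rfl fun i _ => ?_
    ring

theorem smoothField [T2Space X] (h : FrameCover S α R c V E χ) (hα : S.IsPoppForm α)
    (hR : S.IsReeb α R) : S.IsSmoothFieldSN (glueField S α E χ) := by
  refine ⟨fun q hq => ?_, fun q hq F hF hF0 => ?_⟩
  · refine ContMDiffWithinAt.sum_section fun i _ => ?_
    have hχ : ContMDiffWithinAt IS 𝓘(ℝ, ℝ) ∞ (fun q : CoTanSum X => χ i q.1) S.SN q :=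
      (ContMDiffAt.comp (g := χ i) q (h.smooth i).contMDiffAt
        contMDiff_coTanSum_proj.contMDiffAt).contMDiffWithinAt
    by_cases hi : q.1 ∈ V i
    · exact hχ.smul_section ((h.frame i).localField_smooth hα hR hq hi)
    · have h0 : ContMDiffWithinAt IS IS.tangent ∞
          (fun q => (⟨q, (0 : TangentSpace IS q)⟩ : TangentBundle IS (CoTanSum X))) S.SN q :=
        (Bundle.contMDiff_zeroSection ℝ
          (TangentSpace IS : CoTanSum X → Type _)).contMDiffAt.contMDiffWithinAt
      have hz : ∀ q' : CoTanSum X, χ i q'.1 = 0 →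
          (⟨q', χ i q'.1 • localField S α (E i) q'⟩ : TangentBundle IS (CoTanSum X)) =
            ⟨q', (0 : TangentSpace IS q')⟩ := fun q' hq' => by rw [hq', zero_smul]
      have he := (contMDiff_coTanSum_proj.continuous.continuousAt (x := q)).eventually
        (h.eventually_eq_zero hi)
      refine h0.congr_of_eventuallyEq ?_ (hz q he.self_of_nhds)
      filter_upwards [mem_nhdsWithin_of_mem_nhds he] with q' hq'
      exact hz q' hq'
  · let A : E4 × ((E4 →L[ℝ] ℝ) × E4) →L[ℝ] ℝ := mfderiv IS 𝓘(ℝ, ℝ) F q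
    change A (∑ i, χ i q.1 • (show E4 × ((E4 →L[ℝ] ℝ) × E4) from localField S α (E i) q)) = 0
    rw [map_sum]
    refine Finset.sum_eq_zero fun i _ => ?_
    rw [map_smul]
    by_cases hi : q.1 ∈ V i
    · have h1 : A (localField S α (E i) q) = 0 :=
        (h.frame i).localField_tangent hα hR hq hi F hF hF0
      rw [h1, smul_zero]
    · rw [(h.eventually_eq_zero hi).self_of_nhds, zero_smul]

theorem homogeneousField [T2Space X] (h : FrameCover S α R c V E χ) (hα : S.IsPoppForm α)
    (hR : S.IsReeb α R) : S.IsHomogeneousField (glueField S α E χ) := by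
  intro q hq t _
  let A : E4 × ((E4 →L[ℝ] ℝ) × E4) →L[ℝ] E4 × ((E4 →L[ℝ] ℝ) × E4) := mfderiv IS IS (dilS t) q
  change A (∑ i, χ i q.1 • (show E4 × ((E4 →L[ℝ] ℝ) × E4) from localField S α (E i) q)) =
    ∑ i, χ i q.1 • (show E4 × ((E4 →L[ℝ] ℝ) × E4) from localField S α (E i) (dilS t q))
  rw [map_sum]
  refine Finset.sum_congr rfl fun i _ => ?_
  rw [map_smul]
  by_cases hi : q.1 ∈ V i
  · exact congrArg (fun z : E4 × ((E4 →L[ℝ] ℝ) × E4) => χ i q.1 • z)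
      ((h.frame i).localField_dilS hα hR hq hi t)
  · rw [(h.eventually_eq_zero hi).self_of_nhds, zero_smul, zero_smul]

/-- Two adapted frames have the same `Z` up to sign, and `g(Z, v) Z` does not see the sign. So all
frames give the same projected vector. -/
theorem pushBase_glueField [T2Space X] (h : FrameCover S α R c V E χ) (hα : S.IsPoppForm α)
    (hR : S.IsReeb α R) {q : CoTanSum X} (hq : q ∈ S.SN) {j : ι} (hj : q.1 ∈ V j) :
    pushBase (glueField S α E χ) q = S.g q.1 (E j 0 q.1) q.2.2 • E j 0 q.1 := by
  let A : E4 × ((E4 →L[ℝ] ℝ) × E4) →L[ℝ] E4 :=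
    mfderiv IS (𝓡 4) (fun q' : CoTanSum X => q'.1) q
  change A (∑ i, χ i q.1 • (show E4 × ((E4 →L[ℝ] ℝ) × E4) from localField S α (E i) q)) = _
  rw [map_sum]
  let z : E4 := S.g q.1 (E j 0 q.1) q.2.2 • E j 0 q.1
  have h1 : ∀ i, A (χ i q.1 • (show E4 × ((E4 →L[ℝ] ℝ) × E4) from localField S α (E i) q)) =
      χ i q.1 • z := fun i => by
    rw [map_smul]
    by_cases hi : q.1 ∈ V i
    · have h2 : A (localField S α (E i) q) = (show E4 from S.g q.1 (E i 0 q.1) q.2.2 • E i 0 q.1) :=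
        (h.frame i).pushBase_localField hα hR hq hi
      have h3 : S.g q.1 (E i 0 q.1) q.2.2 • E i 0 q.1 =
          S.g q.1 (E j 0 q.1) q.2.2 • E j 0 q.1 := by
        rcases (h.frame j).g_frame_eq hα hR (h.frame i) hj hi with h4 | h4
        · rw [h4]
        · rw [h4, map_neg, neg_apply, neg_smul, smul_neg, neg_neg]
      exact congrArg (fun u : E4 => χ i q.1 • u) (h2.trans h3)
    · rw [(h.eventually_eq_zero hi).self_of_nhds, zero_smul, zero_smul]
  rw [Finset.sum_congr rfl fun i _ => h1 i, ← Finset.sum_smul, h.sum_eq, one_smul]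

theorem pushBase_spec [T2Space X] (h : FrameCover S α R c V E χ) (hα : S.IsPoppForm α)
    (hR : S.IsReeb α R) {q : CoTanSum X} (hq : q ∈ S.SN) :
    pushBase (glueField S α E χ) q ∈ S.L q.1 ∧
      √(S.g q.1 (pushBase (glueField S α E χ) q) (pushBase (glueField S α E χ) q)) = S.absXi q := by
  obtain ⟨j, hj⟩ := h.exists_mem q.1
  rw [h.pushBase_glueField hα hR hq hj]
  refine ⟨((h.frame j).mem_L_iff_smul hα hR hj).2 ⟨_, rfl⟩, ?_⟩
  have h00 : S.g q.1 (E j 0 q.1) (E j 0 q.1) = 1 := by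
    simpa using (h.frame j).orthonormal 0 0 q.1 hj
  rw [(h.frame j).absXi_eq hα hR hq hj, map_smul, map_smul, smul_apply, h00, smul_eq_mul,
    smul_eq_mul, mul_one, Real.sqrt_mul_self_eq_abs]

/-- The action preserves the base point, hence the weights `χ_i`, and each local derivative is
constant along the orbit by `dY_fieldVec_rotL`. -/
theorem descends [T2Space X] (h : FrameCover S α R c V E χ) (hα : S.IsPoppForm α)
    (hR : S.IsReeb α R) : S.DescendsToQuotient (glueField S α E χ) := by
  intro F hF hinv q hq θ
  have hI := h.active_spec q.1
  obtain ⟨j, hj⟩ := h.exists_mem q.1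
  have hrot : ∀ i, q.1 ∈ V i → S.rot θ q = psi S α (E i) (q.1,
      rotL (SignType.sign ((coord S (E i) q).2.1 3) * θ) (coord S (E i) q).2) := fun i hi => by
    have h1 := (h.frame i).psi_coord hα hR hi ((mem_SN_iff hα hR).1 hq).2.2.1
    have h2 := (h.frame i).rot_psi hα hR ((h.frame i).coord_mem hα hR hq hi) θ
    rw [h1] at h2
    exact h2
  have hq' : S.rot θ q ∈ S.SN := by
    rw [hrot j hj]
    exact (h.frame j).psi_mem hα hR (rotV_mem ((h.frame j).coord_mem hα hR hq hj))
  have hq1 : (S.rot θ q).1 = q.1 := rfl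
  rw [h.derivAlong_glueField hα hR (mdifferentiableAt_of_mem_SN hα hR hF hq') hq' hI.1 hI.2,
    h.derivAlong_glueField hα hR (mdifferentiableAt_of_mem_SN hα hR hF hq) hq hI.1 hI.2]
  refine Finset.sum_congr rfl fun i hi => ?_
  have hi' := hI.1 i hi
  have hm := (h.frame i).coord_mem hα hR hq hi'
  have h3 : coord S (E i) (S.rot θ q) = (q.1,
      rotL (SignType.sign ((coord S (E i) q).2.1 3) * θ) (coord S (E i) q).2) := by
    rw [hrot i hi', (h.frame i).coord_psi hα hR hi']
  rw [h3, hq1]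
  congr 1
  exact (h.frame i).dY_fieldVec_rotL hα hR hF hinv hm _

end FrameCover
end QCStructure

namespace QuasiContact

/-! ### The divergence theorem for the density dual to a frame -/

/-- The determinant is multilinear in the columns, so its derivative is the sum over the columns
with one column differentiated. -/
theorem hasDerivAt_det {n : Type*} [Fintype n] [DecidableEq n] {M : ℝ → Matrix n n ℝ}
    {M' : Matrix n n ℝ} {t : ℝ} (h : ∀ i j, HasDerivAt (fun t => M t i j) (M' i j) t) :
    HasDerivAt (fun t => (M t).det) (∑ k, ((M t).updateCol k fun i => M' i k).det) t := by
  have h1 : HasDerivAt (fun t => (M t).det) (∑ σ : Equiv.Perm n, (Equiv.Perm.sign σ : ℝ) *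
      ∑ k, (∏ i ∈ Finset.univ.erase k, M t (σ i) i) * M' (σ k) k) t := by
    simp only [Matrix.det_apply']
    refine HasDerivAt.fun_sum fun σ _ => HasDerivAt.const_mul _ ?_
    exact HasDerivAt.fun_finsetProd fun i _ => h (σ i) i
  refine h1.congr_deriv ?_
  simp only [Finset.mul_sum]
  rw [Finset.sum_comm]
  refine Finset.sum_congr rfl fun k _ => ?_
  rw [Matrix.det_apply']
  refine Finset.sum_congr rfl fun σ _ => ?_
  congr 1
  rw [← Finset.mul_prod_erase Finset.univ _ (Finset.mem_univ k), mul_comm, Matrix.updateCol_self]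
  congr 1
  refine Finset.prod_congr rfl fun i hi => ?_
  rw [Matrix.updateCol_ne (Finset.ne_of_mem_erase hi)]

/-- By Cramer's rule, replacing column `k` of `M` by `M` applied to a vector yields `det M` times
the `k`-th entry of that vector. -/
theorem sum_det_updateCol {n : Type*} [Fintype n] [DecidableEq n] (M m : Matrix n n ℝ) :
    ∑ k, (M.updateCol k fun i => (M * m) i k).det = M.det * m.trace := by
  rw [Matrix.trace, Finset.mul_sum]
  refine Finset.sum_congr rfl fun k _ => ?_
  have h1 : (fun i => (M * m) i k) = M.mulVec fun l => m l k := rfl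
  rw [h1, ← Matrix.cramer_apply, Matrix.cramer_eq_adjugate_mulVec, Matrix.mulVec_mulVec,
    Matrix.adjugate_mul, Matrix.smul_mulVec, Matrix.one_mulVec]
  rfl

/-- The matrix of the components of a frame. -/
def frameMatrix (f : Fin 4 → E4 → E4) (y : E4) : Matrix (Fin 4) (Fin 4) ℝ :=
  Matrix.of fun i k => f k y i

theorem integral_fderiv_eq_zero_of_hasCompactSupport {g : E4 → ℝ} (hg : ContDiff ℝ 1 g)
    (hK : HasCompactSupport g) (v : E4) :
    Integrable (fun y => fderiv ℝ g y v) ∧ ∫ y, fderiv ℝ g y v = 0 := by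
  have hc : Continuous fun y => fderiv ℝ g y v :=
    (hg.continuous_fderiv one_ne_zero).clm_apply continuous_const
  have h1 : Integrable (fun y => fderiv ℝ g y v) :=
    hc.integrable_of_hasCompactSupport (hK.fderiv_apply ℝ v)
  have h2 : Integrable g := hg.continuous.integrable_of_hasCompactSupport hK
  refine ⟨h1, ?_⟩
  have h3 := integral_mul_fderiv_eq_neg_fderiv_mul_of_integrable (μ := (volume : Measure E4))
    (f := fun _ => (1 : ℝ)) (g := g) (v := v) (by simp) (by simpa using h1) (by simpa using h2)
    (fun x _ => differentiableAt_const _) (fun x _ => hg.differentiable one_ne_zero x)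
  simpa using h3

section divergence
variable {O : Set E4} {F : Fin 4 → E4 → E4} {C : Fin 4 → Fin 4 → E4 → ℝ} {f : E4 → ℝ}

theorem contDiffAt_frameMatrix_det (hO : IsOpen O) (hF : ∀ k, ContDiffOn ℝ ∞ (F k) O) {y : E4}
    (hy : y ∈ O) : ContDiffAt ℝ ∞ (fun y => (frameMatrix F y).det) y := by
  simp only [Matrix.det_apply']
  refine ContDiffAt.sum fun σ _ => contDiffAt_const.mul (contDiffAt_prod fun i _ => ?_)
  exact (contDiffAt_piLp_apply (i := σ i) (p := 2)).comp y ((hF i).contDiffAt (hO.mem_nhds hy))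

theorem contDiffAt_abs_det_inv (hO : IsOpen O) (hF : ∀ k, ContDiffOn ℝ ∞ (F k) O)
    {y : E4} (hy : y ∈ O) (hdet : (frameMatrix F y).det ≠ 0) :
    ContDiffAt ℝ ∞ (fun y => |(frameMatrix F y).det|⁻¹) y := by
  have h : ContDiffAt ℝ ∞ (fun y => |(frameMatrix F y).det|) y :=
    ContDiffAt.comp (g := fun t : ℝ => |t|) y (contDiffAt_abs hdet)
      (contDiffAt_frameMatrix_det hO hF hy)
  exact h.inv (abs_ne_zero.2 hdet)

theorem sum_eq_apply_single (L : E4 →L[ℝ] ℝ) (v : E4) :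
    ∑ i, L (EuclideanSpace.single i 1) * v i = L v := by
  have hv : v = ∑ i : Fin 4, v i • EuclideanSpace.single i (1 : ℝ) := by
    ext j; simp [Finset.sum_apply, Pi.single_apply]
  conv_rhs => rw [hv]
  simp [mul_comm]

/-- The divergence of the first field of a frame with respect to the dual density. -/
theorem fderiv_abs_det_inv (hO : IsOpen O) (hF : ∀ k, ContDiffOn ℝ ∞ (F k) O) {y : E4}
    (hy : y ∈ O) (hdet : (frameMatrix F y).det ≠ 0)
    (hC : ∀ k, fderiv ℝ (F k) y (F 0 y) - fderiv ℝ (F 0) y (F k y) = ∑ l, C k l y • F l y) :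
    fderiv ℝ (fun y => |(frameMatrix F y).det|⁻¹) y (F 0 y) +
      |(frameMatrix F y).det|⁻¹ * ∑ i, fderiv ℝ (F 0) y (EuclideanSpace.single i 1) i =
      -(|(frameMatrix F y).det|⁻¹ * ∑ k, C k k y) := by
  let M := frameMatrix F y
  let J : Matrix (Fin 4) (Fin 4) ℝ := Matrix.of fun i j =>
    fderiv ℝ (F 0) y (EuclideanSpace.single j 1) i
  let D : Matrix (Fin 4) (Fin 4) ℝ := Matrix.of fun i k => fderiv ℝ (F k) y (F 0 y) i
  let K : Matrix (Fin 4) (Fin 4) ℝ := Matrix.of fun l k => C k l y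
  have hM : IsUnit M.det := isUnit_iff_ne_zero.2 hdet
  -- The bracket relations in matrix form. Multiplication by `M⁻¹` and the trace give `tr J + tr K`:
  -- the first term is the Euclidean divergence of the field `F 0`, which cancels in the final
  -- identity, the second is the sum of the structure functions.
  have hD : D = J * M + M * K := by
    ext i k
    have h1 := congrArg (fun v : E4 => v i) (hC k)
    have h2 : (J * M) i k = fderiv ℝ (F 0) y (F k y) i :=
      sum_eq_apply_single ((EuclideanSpace.proj i).comp (fderiv ℝ (F 0) y)) (F k y)
    have h3 : (M * K) i k = (∑ l, C k l y • F l y) i := by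
      change _ = (EuclideanSpace.proj i : E4 →L[ℝ] ℝ) (∑ l, C k l y • F l y)
      rw [map_sum, Matrix.mul_apply]
      exact Finset.sum_congr rfl fun l _ => mul_comm _ _
    rw [Matrix.add_apply, h2, h3, ← h1]
    exact (add_sub_cancel _ _).symm
  have hdF : ∀ k, DifferentiableAt ℝ (F k) y := fun k =>
    ((hF k).contDiffAt (hO.mem_nhds hy)).differentiableAt (by simp)
  have hline : HasDerivAt (fun t : ℝ => y + t • F 0 y) (F 0 y) 0 := by
    simpa using ((hasDerivAt_id (0 : ℝ)).smul_const (F 0 y)).const_add y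
  have h0 : y + (0 : ℝ) • F 0 y = y := by simp
  have hdet' : HasDerivAt (fun t : ℝ => (frameMatrix F (y + t • F 0 y)).det)
      (M.det * (M⁻¹ * D).trace) 0 := by
    have h1 : HasDerivAt (fun t : ℝ => (frameMatrix F (y + t • F 0 y)).det) _ 0 :=
      hasDerivAt_det (M := fun t => frameMatrix F (y + t • F 0 y)) (M' := D) fun i k => by
        have h2 : HasFDerivAt (fun z => F k z i)
            ((EuclideanSpace.proj i : E4 →L[ℝ] ℝ).comp (fderiv ℝ (F k) y)) (y + (0 : ℝ) • F 0 y) := by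
          rw [h0]
          exact (EuclideanSpace.proj i : E4 →L[ℝ] ℝ).hasFDerivAt.comp y (hdF k).hasFDerivAt
        exact h2.comp_hasDerivAt (0 : ℝ) hline
    refine h1.congr_deriv ?_
    rw [h0, ← sum_det_updateCol M (M⁻¹ * D), ← Matrix.mul_assoc, Matrix.mul_nonsing_inv _ hM,
      Matrix.one_mul]
  have htr : (M⁻¹ * D).trace = J.trace + K.trace := by
    rw [hD, Matrix.mul_add, Matrix.trace_add, ← Matrix.mul_assoc, ← Matrix.mul_assoc,
      Matrix.nonsing_inv_mul _ hM, Matrix.one_mul, Matrix.trace_mul_comm, ← Matrix.mul_assoc,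
      Matrix.mul_nonsing_inv _ hM, Matrix.one_mul]
  have habs : HasDerivAt (fun t : ℝ => |(frameMatrix F (y + t • F 0 y)).det|⁻¹)
      (-(|M.det|⁻¹ * (M⁻¹ * D).trace)) 0 := by
    have hd0 : (frameMatrix F (y + (0 : ℝ) • F 0 y)).det ≠ 0 := by rw [h0]; exact hdet
    have h1 := ((hasDerivAt_abs hd0).comp (0 : ℝ) hdet').inv (by simpa using hdet)
    refine h1.congr_deriv ?_
    simp only [Function.comp, h0]
    change -(SignType.sign M.det * (M.det * (M⁻¹ * D).trace)) / |M.det| ^ 2 = _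
    rw [← mul_assoc, sign_mul_self]
    have : |M.det| ≠ 0 := abs_ne_zero.2 hdet
    field_simp
  have h1 : fderiv ℝ (fun y => |(frameMatrix F y).det|⁻¹) y (F 0 y) =
      -(|M.det|⁻¹ * (M⁻¹ * D).trace) := by
    have h2 : HasFDerivAt (fun y => |(frameMatrix F y).det|⁻¹)
        (fderiv ℝ (fun y => |(frameMatrix F y).det|⁻¹) y) (y + (0 : ℝ) • F 0 y) := by
      rw [h0]
      exact ((contDiffAt_abs_det_inv hO hF hy hdet).differentiableAt (by simp)).hasFDerivAt
    have h3 : HasDerivAt (fun t : ℝ => |(frameMatrix F (y + t • F 0 y)).det|⁻¹) _ 0 :=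
      HasFDerivAt.comp_hasDerivAt (l := fun y => |(frameMatrix F y).det|⁻¹)
        (f := fun t : ℝ => y + t • F 0 y) (0 : ℝ) h2 hline
    exact h3.unique habs
  rw [h1, htr]
  have hJ : J.trace = ∑ i, fderiv ℝ (F 0) y (EuclideanSpace.single i 1) i := rfl
  have hK : K.trace = ∑ k, C k k y := rfl
  rw [← hJ, ← hK]
  change -(|M.det|⁻¹ * _) + |M.det|⁻¹ * _ = -(|M.det|⁻¹ * _)
  ring

/-- The integrand is the Euclidean divergence of `f |det F|⁻¹ F₀`, by `fderiv_abs_det_inv`. This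
field is compactly supported in `O`, so the derivatives of its components integrate to zero. -/
theorem integral_fderiv_frame (hO : IsOpen O) (hF : ∀ k, ContDiffOn ℝ ∞ (F k) O)
    (hdet : ∀ y ∈ O, (frameMatrix F y).det ≠ 0)
    (hC : ∀ y ∈ O, ∀ k, fderiv ℝ (F k) y (F 0 y) - fderiv ℝ (F 0) y (F k y) =
      ∑ l, C k l y • F l y)
    (hf : ContDiff ℝ 1 f) (hK : HasCompactSupport f) (hfO : tsupport f ⊆ O) :
    ∫ y, (fderiv ℝ f y (F 0 y) - f y * ∑ k, C k k y) * |(frameMatrix F y).det|⁻¹ = 0 := by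
  let p : E4 → ℝ := fun y => |(frameMatrix F y).det|⁻¹
  let g : Fin 4 → E4 → ℝ := fun i y => f y * p y * F 0 y i
  have hz : ∀ y ∉ tsupport f, f =ᶠ[𝓝 y] 0 := fun y hy => notMem_tsupport_iff_eventuallyEq.1 hy
  have hgz : ∀ i, ∀ y ∉ tsupport f, g i =ᶠ[𝓝 y] 0 := fun i y hy => by
    filter_upwards [hz y hy] with z hz
    simp [g, hz]
  have hp : ∀ y ∈ O, ContDiffAt ℝ ∞ p y := fun y hy =>
    contDiffAt_abs_det_inv hO hF hy (hdet y hy)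
  have hF0 : ∀ i, ∀ y ∈ O, ContDiffAt ℝ ∞ (fun y => F 0 y i) y := fun i y hy =>
    (contDiffAt_piLp_apply (i := i) (p := 2)).comp y ((hF 0).contDiffAt (hO.mem_nhds hy))
  have hg : ∀ i, ContDiff ℝ 1 (g i) := fun i => by
    refine contDiff_iff_contDiffAt.2 fun y => ?_
    by_cases hy : y ∈ tsupport f
    · have hyO := hfO hy
      exact (hf.contDiffAt.mul ((hp y hyO).of_le (by simp))).mul ((hF0 i y hyO).of_le (by simp))
    · exact contDiffAt_const.congr_of_eventuallyEq (hgz i y hy)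
  have hgK : ∀ i, HasCompactSupport (g i) := fun i =>
    hK.mono' (by
      intro y hy
      by_contra hne
      exact hy (hgz i y hne).self_of_nhds)
  have h1 := fun i => integral_fderiv_eq_zero_of_hasCompactSupport (hg i) (hgK i)
    (EuclideanSpace.single i 1)
  have h2 : ∫ y, ∑ i, fderiv ℝ (g i) y (EuclideanSpace.single i 1) = 0 := by
    rw [integral_finsetSum _ fun i _ => (h1 i).1]
    exact Finset.sum_eq_zero fun i _ => (h1 i).2
  rw [← h2]
  congr 1
  funext y
  by_cases hy : y ∈ tsupport f
  · have hyO := hfO hy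
    have hfd := (hf.differentiable one_ne_zero y).hasFDerivAt
    have hpd := ((hp y hyO).differentiableAt (by simp)).hasFDerivAt
    have hFd := (((hF 0).contDiffAt (hO.mem_nhds hyO)).differentiableAt (by simp)).hasFDerivAt
    have h3 : ∀ i, fderiv ℝ (g i) y (EuclideanSpace.single i 1) =
        (f y * fderiv ℝ p y (EuclideanSpace.single i 1) +
          p y * fderiv ℝ f y (EuclideanSpace.single i 1)) * F 0 y i +
          f y * p y * fderiv ℝ (F 0) y (EuclideanSpace.single i 1) i := fun i => by
      have h4 := (hfd.mul hpd).mul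
        ((EuclideanSpace.proj i : E4 →L[ℝ] ℝ).hasFDerivAt.comp y hFd)
      have h5 : fderiv ℝ (g i) y = _ := h4.fderiv
      rw [h5]
      simp only [add_apply, smul_apply, smul_eq_mul, ContinuousLinearMap.comp_apply,
        Function.comp, PiLp.proj_apply, Pi.mul_apply]
      ring
    have h6 := fderiv_abs_det_inv hO hF hyO (hdet y hyO) (hC y hyO)
    have h7 := sum_eq_apply_single (fderiv ℝ f y) (F 0 y)
    have h8 := sum_eq_apply_single (fderiv ℝ p y) (F 0 y)
    have h9 : ∑ i, fderiv ℝ (g i) y (EuclideanSpace.single i 1) =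
        f y * fderiv ℝ p y (F 0 y) + p y * fderiv ℝ f y (F 0 y) +
          f y * p y * ∑ i, fderiv ℝ (F 0) y (EuclideanSpace.single i 1) i := by
      rw [← h7, ← h8, Finset.mul_sum, Finset.mul_sum, Finset.mul_sum, ← Finset.sum_add_distrib,
        ← Finset.sum_add_distrib]
      exact Finset.sum_congr rfl fun i _ => by rw [h3]; ring
    rw [h9]
    change fderiv ℝ p y (F 0 y) + p y * _ = -(p y * _) at h6
    change _ * p y = _
    linear_combination (-f y) * h6
  · have h3 : ∀ i, fderiv ℝ (g i) y = 0 := fun i => by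
      rw [(hgz i y hy).fderiv_eq]; exact fderiv_const_apply 0
    have h4 : fderiv ℝ f y = 0 := by
      rw [(hz y hy).fderiv_eq]; exact fderiv_const_apply 0
    have h5 : f y = 0 := (hz y hy).self_of_nhds
    simp [h3, h4, h5]

end divergence
end QuasiContact

namespace QCStructure
open QuasiContact

variable {X : Type*} [TopologicalSpace X] [ChartedSpace E4 X] [IsManifold (𝓡 4) ∞ X]
  {S : QCStructure X} {α : ∀ x : X, CoFib X x} {R : ∀ x : X, TangentSpace (𝓡 4) x}
  {U : Set X} {e : Fin 4 → ∀ x : X, TangentSpace (𝓡 4) x}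

/-! ### The Popp density -/

theorem sum_perm_eq_det (M : Matrix (Fin 4) (Fin 4) ℝ) (r : Fin 4 → Fin 4) :
    ∑ s : Equiv.Perm (Fin 4), ((Equiv.Perm.sign s : ℤ) : ℝ) *
      (M (r 0) (s 0) * M (r 1) (s 1) * (M (r 2) (s 2) * M (r 3) (s 3))) =
        (M.submatrix r id).det := by
  rw [← Matrix.det_transpose, Matrix.det_apply']
  refine Finset.sum_congr rfl fun s _ => ?_
  simp only [Fin.prod_univ_four, Matrix.transpose_apply, Matrix.submatrix_apply, id]
  ring

theorem bilin_sum_smul {W ι : Type*} [Fintype ι] [AddCommGroup W] [Module ℝ W]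
    (B : W →ₗ[ℝ] W →ₗ[ℝ] ℝ) (a b : ι → ℝ) (e : ι → W) :
    B (∑ j, a j • e j) (∑ k, b k • e k) = ∑ j, ∑ k, a j * (b k * B (e j) (e k)) := by
  simp only [map_sum, LinearMap.sum_apply, map_smul, LinearMap.smul_apply, smul_eq_mul,
    Finset.mul_sum]
  rw [Finset.sum_comm]
  exact Finset.sum_congr rfl fun j _ => Finset.sum_congr rfl fun k _ => by ring

namespace AdaptedFrame

/-- Among the values of `dα` on the frame only `dα(e₁, e₂) = 1` and `dα(Z, R) = -c_{03}^3` are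
nonzero up to antisymmetry. -/
theorem extD_coframe [T2Space X] (h : AdaptedFrame S α R U e) (hα : S.IsPoppForm α)
    (hR : S.IsReeb α R) {x : X} (hx : x ∈ U) (u v : TangentSpace (𝓡 4) x) :
    extD α x u v = coframe S α e 1 x u * coframe S α e 2 x v -
      coframe S α e 2 x u * coframe S α e 1 x v -
      structFn S α e 0 3 3 x * (coframe S α e 0 x u * coframe S α e 3 x v -
        coframe S α e 3 x u * coframe S α e 0 x v) := by
  have hjk : ∀ j k, extDBilin α x (e j x) (e k x) = -structFn S α e j k 3 x := fun j k => by
    rw [extDBilin_apply, h.structFn_three hα hR hx, neg_neg]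
  obtain ⟨h1, h2, h3, h4, h5⟩ := h.structFn_three_values hα hR hx
  have hs := structFn_swap (S := S) (α := α) (e := e) (x := x)
  have hd : ∀ j, structFn S α e j j 3 x = 0 := fun j => by
    have := hs j j 3; linarith
  rw [← extDBilin_apply]
  conv_lhs => rw [h.eq_sum hα hR hx u, h.eq_sum hα hR hx v]
  refine (bilin_sum_smul (extDBilin α x) _ _ _).trans ?_
  simp only [hjk, Fin.sum_univ_four, hd, h1, h2, h3, h4, h5, hs 1 0, hs 2 0, hs 2 1, hs 3 0, hs 3 1, hs 3 2]
  ring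

/-- `Z^*` is `±` the first coframe form, and `α` is the last. In the wedge product the second term
of `dα` repeats these two and drops out, leaving `±` the volume form of the coframe. The factor
`1/2` in the definition offsets the two orders of arguments of `dα`. -/
theorem poppDensity_eq [T2Space X] (h : AdaptedFrame S α R U e) (hα : S.IsPoppForm α)
    (hR : S.IsReeb α R) {x : X} (hx : x ∈ U) (u : Fin 4 → TangentSpace (𝓡 4) x) :
    S.poppDensity α R x u = |(Matrix.of fun j i => coframe S α e j x (u i)).det| := by
  set M : Matrix (Fin 4) (Fin 4) ℝ := Matrix.of fun j i => coframe S α e j x (u i) with hM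
  have hM' : ∀ j i, coframe S α e j x (u i) = M j i := fun j i => rfl
  have hα' : ∀ i, α x (u i) = M 3 i := fun i => by rw [← hM', coframe_three]
  have hZ : ∃ z : ℝ, |z| = 1 ∧ ∀ i, S.Zstar α R x (u i) = z * M 0 i := by
    have h0 : ∀ i, S.g x (e 0 x) (u i - α x (u i) • R x) = M 0 i := fun i => by
      rw [← hM']
      have := coframe_castSucc (S := S) (α := α) (e := e) 0 x (u i)
      refine Eq.trans ?_ this.symm
      rw [map_sub, map_smul, h.last, smul_eq_mul, mul_comm]
      rfl
    rcases h.charUnit_eq hα hR hx with hc | hc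
    · exact ⟨1, by simp, fun i => by rw [Zstar, hc, h0, one_mul]⟩
    · refine ⟨-1, by simp, fun i => ?_⟩
      rw [Zstar, hc, ← h0, map_neg]
      simp
  obtain ⟨z, hz, hZ⟩ := hZ
  have hdet : ∀ r : Fin 4 → Fin 4, ∀ i j, i ≠ j → r i = r j → (M.submatrix r id).det = 0 :=
    fun r i j hij hr => Matrix.det_zero_of_row_eq hij (by
      funext k; simp [hr])
  have h1 : ∑ s : Equiv.Perm (Fin 4), ((Equiv.Perm.sign s : ℤ) : ℝ) *
      (S.Zstar α R x (u (s 0)) * α x (u (s 1)) * extD α x (u (s 2)) (u (s 3))) =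
      z * ((M.submatrix ![0, 3, 1, 2] id).det - (M.submatrix ![0, 3, 2, 1] id).det -
        structFn S α e 0 3 3 x * ((M.submatrix ![0, 3, 0, 3] id).det -
          (M.submatrix ![0, 3, 3, 0] id).det)) := by
    simp only [← sum_perm_eq_det, ← Finset.sum_sub_distrib, Finset.mul_sum]
    refine Finset.sum_congr rfl fun s _ => ?_
    rw [hZ, hα', h.extD_coframe hα hR hx]
    simp only [hM', Matrix.cons_val]
    ring
  have h2 : ∀ p : Equiv.Perm (Fin 4), (M.submatrix p id).det = (Equiv.Perm.sign p : ℤ) * M.det :=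
    fun p => Matrix.det_permute p M
  have hA : (M.submatrix ![0, 3, 1, 2] id).det = M.det := by
    have := h2 (Equiv.swap 1 2 * Equiv.swap 1 3)
    have hp : (⇑(Equiv.swap 1 2 * Equiv.swap 1 3 : Equiv.Perm (Fin 4))) = ![0, 3, 1, 2] := by
      decide
    have hs : Equiv.Perm.sign (Equiv.swap 1 2 * Equiv.swap 1 3 : Equiv.Perm (Fin 4)) = 1 := by
      decide
    rw [hp, hs] at this
    simpa using this
  have hB : (M.submatrix ![0, 3, 2, 1] id).det = -M.det := by
    have := h2 (Equiv.swap 1 3)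
    have hp : (⇑(Equiv.swap 1 3 : Equiv.Perm (Fin 4))) = ![0, 3, 2, 1] := by decide
    rw [hp, Equiv.Perm.sign_swap (by decide)] at this
    simpa using this
  rw [poppDensity, h1, hA, hB, hdet ![0, 3, 0, 3] 0 2 (by decide) rfl,
    hdet ![0, 3, 3, 0] 0 3 (by decide) rfl]
  have : (1 / 2 : ℝ) * (z * (M.det - -M.det - structFn S α e 0 3 3 x * (0 - 0))) = z * M.det := by
    ring
  rw [this, abs_mul, hz, one_mul]

end AdaptedFrame

/-- In coframe components the density is the absolute value of a determinant, which is
multiplicative; this is the transformation law of a density. -/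
theorem poppDensity_comp [T2Space X] (hα : S.IsPoppForm α) (hR : S.IsReeb α R) (x : X)
    (L : E4 →L[ℝ] TangentSpace (𝓡 4) x) (A : E4 →L[ℝ] E4) :
    (S.poppDensity α R x fun i => L (A (EuclideanSpace.single i 1))) =
      |A.det| * S.poppDensity α R x fun i => L (EuclideanSpace.single i 1) := by
  obtain ⟨U, e, h, hx⟩ := exists_adaptedFrame hα hR x
  rw [h.poppDensity_eq hα hR hx, h.poppDensity_eq hα hR hx]
  let B := (EuclideanSpace.basisFun (Fin 4) ℝ).toBasis
  have hdet : A.det = (LinearMap.toMatrix B B A.toLinearMap).det := by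
    rw [LinearMap.det_toMatrix]
  rw [hdet, mul_comm, ← abs_mul, ← Matrix.det_mul]
  congr 2
  ext j i
  have h1 := sum_eq_apply_single
    ((show E4 →L[ℝ] ℝ from coframe S α e j x).comp (show E4 →L[ℝ] E4 from L)) (A (EuclideanSpace.single i 1))
  refine Eq.trans h1.symm ?_
  rw [Matrix.mul_apply]
  refine Finset.sum_congr rfl fun k _ => ?_
  rw [LinearMap.toMatrix_apply]
  simp [B]
  exact Or.inl rfl

end QCStructure

namespace QCStructure
open QuasiContact

variable {X : Type*} [TopologicalSpace X] [ChartedSpace E4 X] [IsManifold (𝓡 4) ∞ X]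
  {S : QCStructure X} {α : ∀ x : X, CoFib X x} {R : ∀ x : X, TangentSpace (𝓡 4) x}
  {U : Set X} {e : Fin 4 → ∀ x : X, TangentSpace (𝓡 4) x} {c : X} {y : E4}

/-! ### The Popp measure in charts -/

theorem contMDiffAt_chart_symm (hy : y ∈ (chartAt E4 c).target) :
    ContMDiffAt (𝓡 4) (𝓡 4) ∞ (chartAt E4 c).symm y :=
  (contMDiffOn_chart_symm y hy).contMDiffAt ((chartAt E4 c).open_target.mem_nhds hy)

theorem isInvertible_mfderiv_chart_symm (hy : y ∈ (chartAt E4 c).target) :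
    (mfderiv (𝓡 4) (𝓡 4) (chartAt E4 c).symm y).IsInvertible :=
  have : IsManifold (𝓡 4) 1 X := .of_le (n := ∞) (by simp)
  ⟨((mdifferentiable_chart (I := 𝓡 4) c).symm).mfderiv hy, rfl⟩

/-- The components of a frame in a chart. -/
def chartFrame (c : X) (e : Fin 4 → ∀ x : X, TangentSpace (𝓡 4) x) (k : Fin 4) (y : E4) : E4 :=
  VectorField.mpullback (𝓡 4) (𝓡 4) (chartAt E4 c).symm (e k) y

theorem mfderiv_chartFrame (hy : y ∈ (chartAt E4 c).target) (k : Fin 4) :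
    mfderiv (𝓡 4) (𝓡 4) (chartAt E4 c).symm y (chartFrame c e k y) =
      e k ((chartAt E4 c).symm y) :=
  (isInvertible_mfderiv_chart_symm hy).self_apply_inverse _

theorem contDiffAt_chartFrame {k : Fin 4} (hy : y ∈ (chartAt E4 c).target)
    (he : VFSmoothAt (e k) ((chartAt E4 c).symm y)) :
    ContDiffAt ℝ ∞ (chartFrame c e k) y :=
  contMDiffAt_vectorSpace_iff_contDiffAt.1
    (ContMDiffAt.mpullback_vectorField_preimage (n := ∞) he (contMDiffAt_chart_symm hy)
      (isInvertible_mfderiv_chart_symm hy) le_rfl)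

theorem mlieBracket_eq_lieBracket (V W : ∀ y : E4, TangentSpace (𝓡 4) y) :
    VectorField.mlieBracket (𝓡 4) V W = VectorField.lieBracket ℝ V W := by
  rw [← VectorField.mlieBracketWithin_univ, VectorField.mlieBracketWithin_eq_lieBracketWithin]
  exact VectorField.lieBracketWithin_univ

theorem lieBracket_chartFrame {j k : Fin 4} (hy : y ∈ (chartAt E4 c).target)
    (hj : VFSmoothAt (e j) ((chartAt E4 c).symm y))
    (hk : VFSmoothAt (e k) ((chartAt E4 c).symm y)) :
    mfderiv (𝓡 4) (𝓡 4) (chartAt E4 c).symm y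
      (VectorField.lieBracket ℝ (chartFrame c e j) (chartFrame c e k) y : E4) =
      VectorField.mlieBracket (𝓡 4) (e j) (e k) ((chartAt E4 c).symm y) := by
  have : IsManifold (𝓡 4) (minSmoothness ℝ 2) X :=
    .of_le (n := ∞) (by rw [minSmoothness_of_isRCLikeNormedField]; exact WithTop.coe_le_coe.2 le_top)
  have h1 := VectorField.mpullback_mlieBracket (n := ∞) (I := 𝓡 4) (I' := 𝓡 4)
    (f := (chartAt E4 c).symm) hj.diffAt hk.diffAt (contMDiffAt_chart_symm hy)
    (by rw [minSmoothness_of_isRCLikeNormedField]; exact WithTop.coe_le_coe.2 le_top)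
  have h2 := congrFun (mlieBracket_eq_lieBracket (chartFrame c e j) (chartFrame c e k)) y
  have h3 := (isInvertible_mfderiv_chart_symm hy).self_apply_inverse
    (VectorField.mlieBracket (𝓡 4) (e j) (e k) ((chartAt E4 c).symm y))
  refine Eq.trans ?_ h3
  exact congrArg _ (h2.symm.trans h1.symm)

/-- The Popp density in a chart. -/
def chartDensity (S : QCStructure X) (α : ∀ x : X, CoFib X x)
    (R : ∀ x : X, TangentSpace (𝓡 4) x) (c : X) (y : E4) : ℝ :=
  S.poppDensity α R ((chartAt E4 c).symm y) fun i =>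
    mfderiv (𝓡 4) (𝓡 4) (chartAt E4 c).symm y (EuclideanSpace.single i (1 : ℝ) : E4)

theorem chartDensity_nonneg : 0 ≤ S.chartDensity α R c y := abs_nonneg _

namespace AdaptedFrame

/-- The coframe matrix is the inverse of the frame matrix in the chart. This identifies the Popp
density with the dual density in the divergence theorem above. -/
theorem chartDensity_eq [T2Space X] (h : AdaptedFrame S α R U e) (hα : S.IsPoppForm α)
    (hR : S.IsReeb α R) (hy : y ∈ (chartAt E4 c).target) (hU : (chartAt E4 c).symm y ∈ U) :
    (frameMatrix (chartFrame c e) y).det ≠ 0 ∧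
      S.chartDensity α R c y = |(frameMatrix (chartFrame c e) y).det|⁻¹ := by
  let L : E4 →L[ℝ] E4 := mfderiv (𝓡 4) (𝓡 4) (chartAt E4 c).symm y
  let Θ : Matrix (Fin 4) (Fin 4) ℝ := Matrix.of fun j i =>
    coframe S α e j ((chartAt E4 c).symm y) (L (EuclideanSpace.single i 1))
  have h1 : Θ * frameMatrix (chartFrame c e) y = 1 := by
    ext j k
    rw [Matrix.mul_apply, Matrix.one_apply, ← h.coframe_frame hα hR hU j k]
    have h2 := sum_eq_apply_single
      ((show E4 →L[ℝ] ℝ from coframe S α e j ((chartAt E4 c).symm y)).comp L) (chartFrame c e k y)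
    refine Eq.trans h2 ?_
    exact congrArg (coframe S α e j ((chartAt E4 c).symm y)) (mfderiv_chartFrame hy k)
  have h2 : Θ.det * (frameMatrix (chartFrame c e) y).det = 1 := by
    rw [← Matrix.det_mul, h1, Matrix.det_one]
  refine ⟨right_ne_zero_of_mul_eq_one h2, ?_⟩
  rw [chartDensity, h.poppDensity_eq hα hR hU, ← abs_inv]
  exact congrArg abs (eq_inv_of_mul_eq_one_left h2)

end AdaptedFrame

theorem continuousAt_chartDensity [T2Space X] (hα : S.IsPoppForm α) (hR : S.IsReeb α R)
    (hy : y ∈ (chartAt E4 c).target) : ContinuousAt (S.chartDensity α R c) y := by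
  obtain ⟨U, e, h, hU⟩ := exists_adaptedFrame hα hR ((chartAt E4 c).symm y)
  have hO : IsOpen ((chartAt E4 c).target ∩ (chartAt E4 c).symm ⁻¹' U) :=
    (chartAt E4 c).isOpen_inter_preimage_symm h.isOpen
  have h1 := contDiffAt_abs_det_inv hO (F := chartFrame c e) (fun k z hz =>
    (contDiffAt_chartFrame hz.1 (h.smooth k _ hz.2)).contDiffWithinAt) ⟨hy, hU⟩
    (h.chartDensity_eq hα hR hy hU).1
  refine h1.continuousAt.congr ?_
  filter_upwards [hO.mem_nhds ⟨hy, hU⟩] with z hz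
  exact (h.chartDensity_eq hα hR hz.1 hz.2).2.symm

theorem poppDensity_congr {x x' : X} (h : x = x') {u : Fin 4 → TangentSpace (𝓡 4) x}
    {u' : Fin 4 → TangentSpace (𝓡 4) x'} (hu : ∀ i, (show E4 from u i) = (show E4 from u' i)) :
    S.poppDensity α R x u = S.poppDensity α R x' u' := by
  subst h
  exact congrArg _ (funext hu)

theorem chartDensity_transition [T2Space X] (hα : S.IsPoppForm α) (hR : S.IsReeb α R) {c' : X}
    (hy : y ∈ (chartAt E4 c).target) (hy' : (chartAt E4 c).symm y ∈ (chartAt E4 c').source) :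
    DifferentiableAt ℝ (chartAt E4 c' ∘ (chartAt E4 c).symm) y ∧
    S.chartDensity α R c y = |(fderiv ℝ (chartAt E4 c' ∘ (chartAt E4 c).symm) y).det| *
      S.chartDensity α R c' ((chartAt E4 c' ∘ (chartAt E4 c).symm) y) := by
  let T : E4 → E4 := chartAt E4 c' ∘ (chartAt E4 c).symm
  have h1 : MDifferentiableAt (𝓡 4) (𝓡 4) T y :=
    (((contMDiffOn_chart (n := ∞) _ hy').contMDiffAt
      ((chartAt E4 c').open_source.mem_nhds hy')).comp y
      (contMDiffAt_chart_symm hy)).mdifferentiableAt (by simp)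
  have hT : DifferentiableAt ℝ T y := h1.differentiableAt
  have hTy : T y ∈ (chartAt E4 c').target := (chartAt E4 c').map_source hy'
  refine ⟨hT, ?_⟩
  have h2 : HasMFDerivAt (𝓡 4) (𝓡 4) ((chartAt E4 c').symm ∘ T) y
      ((mfderiv (𝓡 4) (𝓡 4) (chartAt E4 c').symm (T y)).comp (fderiv ℝ T y)) :=
    ((contMDiffAt_chart_symm hTy).mdifferentiableAt (by simp)).hasMFDerivAt.comp y
      hT.hasFDerivAt.hasMFDerivAt
  have h3 : (chartAt E4 c).symm =ᶠ[𝓝 y] (chartAt E4 c').symm ∘ T := by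
    filter_upwards [((chartAt E4 c).isOpen_inter_preimage_symm
      (chartAt E4 c').open_source).mem_nhds ⟨hy, hy'⟩] with z hz
    exact ((chartAt E4 c').left_inv hz.2).symm
  have h4 := (h2.congr_of_eventuallyEq h3).mfderiv
  refine (poppDensity_congr h3.self_of_nhds fun i => ?_).trans (poppDensity_comp hα hR _
    (mfderiv (𝓡 4) (𝓡 4) (chartAt E4 c').symm (T y)) (fderiv ℝ T y))
  exact congrArg (fun L : E4 →L[ℝ] E4 => L (EuclideanSpace.single i 1)) h4

section measure
variable [MeasurableSpace X] [BorelSpace X]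

theorem aemeasurable_chart_symm :
    AEMeasurable (chartAt E4 c).symm ((volume : Measure E4).restrict (chartAt E4 c).target) :=
  (chartAt E4 c).continuousOn_symm.aemeasurable (chartAt E4 c).open_target.measurableSet

theorem chartPopp_apply {B : Set X} (hB : MeasurableSet B) :
    S.chartPopp α R c B = ∫⁻ y in (chartAt E4 c).target ∩ (chartAt E4 c).symm ⁻¹' B,
      ENNReal.ofReal (S.chartDensity α R c y) := by
  rw [chartPopp, Measure.map_apply_of_aemeasurable
    (aemeasurable_chart_symm.mono_ac (withDensity_absolutelyContinuous _ _)) hB,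
    withDensity_apply', Measure.restrict_restrict' (chartAt E4 c).open_target.measurableSet,
    inter_comm]
  rfl

/-- Under the transition map the density changes by the absolute value of the Jacobian determinant,
exactly as in the change of variables formula. -/
theorem chartPopp_congr [T2Space X] (hα : S.IsPoppForm α) (hR : S.IsReeb α R) {c' : X} {B : Set X}
    (hB : MeasurableSet B) (hc : B ⊆ (chartAt E4 c).source) (hc' : B ⊆ (chartAt E4 c').source) :
    S.chartPopp α R c' B = S.chartPopp α R c B := by
  let T : E4 → E4 := chartAt E4 c' ∘ (chartAt E4 c).symm
  let s := (chartAt E4 c).target ∩ (chartAt E4 c).symm ⁻¹' B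
  have hs : MeasurableSet s := by
    have h1 := (chartAt E4 c).open_target.measurableSet.subtype_image
      ((continuousOn_iff_continuous_domRestrict.1 (chartAt E4 c).continuousOn_symm).measurable hB)
    convert h1 using 1
    ext y
    simp [s, and_comm]
  have himg : (chartAt E4 c').target ∩ (chartAt E4 c').symm ⁻¹' B = T '' s := by
    ext z
    constructor
    · rintro ⟨hz, hzB⟩
      refine ⟨chartAt E4 c ((chartAt E4 c').symm z),
        ⟨(chartAt E4 c).map_source (hc hzB), ?_⟩, ?_⟩
      · change (chartAt E4 c).symm _ ∈ B
        rwa [(chartAt E4 c).left_inv (hc hzB)]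
      · change chartAt E4 c' ((chartAt E4 c).symm _) = z
        rw [(chartAt E4 c).left_inv (hc hzB), (chartAt E4 c').right_inv hz]
    · rintro ⟨w, hw, rfl⟩
      refine ⟨(chartAt E4 c').map_source (hc' hw.2), ?_⟩
      change (chartAt E4 c').symm (chartAt E4 c' _) ∈ B
      rw [(chartAt E4 c').left_inv (hc' hw.2)]
      exact hw.2
  have hinj : InjOn T s := fun z hz w hw hzw =>
    (chartAt E4 c).symm.injOn hz.1 hw.1 ((chartAt E4 c').injOn (hc' hz.2) (hc' hw.2) hzw)
  rw [chartPopp_apply hB, chartPopp_apply hB, himg,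
    lintegral_image_eq_lintegral_abs_det_fderiv_mul volume hs (f' := fun y => fderiv ℝ T y)
      (fun y hy => (chartDensity_transition hα hR hy.1
        (hc' hy.2)).1.hasFDerivAt.hasFDerivWithinAt) hinj]
  refine setLIntegral_congr_fun hs fun y hy => ?_
  rw [(chartDensity_transition (c' := c') hα hR hy.1 (hc' hy.2)).2,
    ENNReal.ofReal_mul (abs_nonneg _)]

theorem chartPopp_compl : S.chartPopp α R c (chartAt E4 c).sourceᶜ = 0 := by
  rw [chartPopp_apply (chartAt E4 c).open_source.measurableSet.compl]
  have : (chartAt E4 c).target ∩ (chartAt E4 c).symm ⁻¹' (chartAt E4 c).sourceᶜ = ∅ :=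
    eq_empty_of_forall_notMem fun y hy => hy.2 ((chartAt E4 c).map_target hy.1)
  rw [this, Measure.restrict_empty, lintegral_zero_measure]

/-- The measure `chartPopp c`, plus the restriction of the supremum to the complement of the chart
domain, dominates every local measure, since these agree on overlaps. Hence it dominates their
supremum, and restricting to the domain gives the nontrivial inequality. -/
theorem restrict_popp [T2Space X] (hα : S.IsPoppForm α) (hR : S.IsReeb α R) (c : X) :
    (S.popp α R).restrict (chartAt E4 c).source = S.chartPopp α R c := by
  have hm : MeasurableSet (chartAt E4 c).source := (chartAt E4 c).open_source.measurableSet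
  have h0 : (S.chartPopp α R c).restrict (chartAt E4 c).source = S.chartPopp α R c :=
    Measure.restrict_eq_self_of_ae_mem (measure_eq_zero_iff_ae_notMem.1 chartPopp_compl |>.mono
      fun x hx => not_not.1 hx)
  apply le_antisymm
  · have h1 : S.popp α R ≤
        S.chartPopp α R c + (S.popp α R).restrict (chartAt E4 c).sourceᶜ := by
      refine iSup_le fun c' => Measure.le_iff.2 fun B hB => ?_
      rw [← measure_inter_add_sdiff B hm, Measure.add_apply, Measure.restrict_apply hB]
      refine add_le_add ?_ (Measure.le_iff'.1 (le_iSup (S.chartPopp α R) c') _)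
      have h2 : S.chartPopp α R c' ((B ∩ (chartAt E4 c).source) \ (chartAt E4 c').source) = 0 :=
        measure_mono_null (fun x hx => hx.2) chartPopp_compl
      rw [← measure_inter_add_sdiff (B ∩ _) (chartAt E4 c').open_source.measurableSet, h2, add_zero,
        chartPopp_congr (c := c) hα hR
          ((hB.inter hm).inter (chartAt E4 c').open_source.measurableSet)
          (fun x hx => hx.1.2) inter_subset_right]
      exact measure_mono fun x hx => hx.1.1
    calc (S.popp α R).restrict (chartAt E4 c).source
        ≤ (S.chartPopp α R c + (S.popp α R).restrict (chartAt E4 c).sourceᶜ).restrict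
          (chartAt E4 c).source := Measure.restrict_mono le_rfl h1
      _ = S.chartPopp α R c := by
          rw [Measure.restrict_add, h0, Measure.restrict_restrict hm, inter_compl_self,
            Measure.restrict_empty, add_zero]
  · conv_lhs => rw [← h0]
    exact Measure.restrict_mono le_rfl (le_iSup (S.chartPopp α R) c)

/-- The density is continuous in charts, so every point has a neighbourhood of finite measure, and
`X` is compact. -/
theorem isFiniteMeasure_popp [CompactSpace X] [T2Space X] (hα : S.IsPoppForm α)
    (hR : S.IsReeb α R) : IsFiniteMeasure (S.popp α R) := by
  have : IsLocallyFiniteMeasure (S.popp α R) := ⟨fun c => by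
    have hc := mem_chart_target E4 c
    have h1 := (continuousAt_chartDensity hα hR hc).eventually_lt continuousAt_const
      (lt_add_one (S.chartDensity α R c (chartAt E4 c c)))
    obtain ⟨r, hr, hr'⟩ := Metric.mem_nhds_iff.1 h1
    let B : Set X := (chartAt E4 c).source ∩ chartAt E4 c ⁻¹' Metric.ball (chartAt E4 c c) r
    have hB : IsOpen B := (chartAt E4 c).isOpen_inter_preimage Metric.isOpen_ball
    refine ⟨B, hB.mem_nhds ⟨mem_chart_source E4 c, Metric.mem_ball_self hr⟩, ?_⟩
    rw [← Measure.restrict_eq_self (S.popp α R) (inter_subset_left : B ⊆ (chartAt E4 c).source),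
      restrict_popp hα hR, chartPopp_apply hB.measurableSet]
    have hsub : (chartAt E4 c).target ∩ (chartAt E4 c).symm ⁻¹' B ⊆
        Metric.ball (chartAt E4 c c) r := fun y hy => by
      have := hy.2.2
      rwa [mem_preimage, (chartAt E4 c).right_inv hy.1] at this
    refine (lintegral_mono_set hsub).trans_lt ?_
    refine (setLIntegral_mono' measurableSet_ball (g := fun _ => ENNReal.ofReal
      (S.chartDensity α R c (chartAt E4 c c) + 1)) fun y hy =>
        ENNReal.ofReal_le_ofReal (hr' hy).le).trans_lt ?_
    rw [setLIntegral_const]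
    exact ENNReal.mul_lt_top ENNReal.ofReal_lt_top measure_ball_lt_top⟩
  infer_instance

theorem integral_popp [T2Space X] (hα : S.IsPoppForm α) (hR : S.IsReeb α R) {f : X → ℝ}
    (hf : Continuous f) (hz : ∀ x ∉ (chartAt E4 c).source, f x = 0) :
    ∫ x, f x ∂(S.popp α R) =
      ∫ y in (chartAt E4 c).target, f ((chartAt E4 c).symm y) * S.chartDensity α R c y := by
  rw [← setIntegral_eq_integral_of_forall_compl_eq_zero hz, restrict_popp hα hR, chartPopp,
    integral_map (aemeasurable_chart_symm.mono_ac (withDensity_absolutelyContinuous _ _))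
      hf.aestronglyMeasurable]
  have hd : AEMeasurable (S.chartDensity α R c)
      ((volume : Measure E4).restrict (chartAt E4 c).target) :=
    ContinuousOn.aemeasurable
      (fun y hy => (continuousAt_chartDensity hα hR hy).continuousWithinAt)
      (chartAt E4 c).open_target.measurableSet
  refine (integral_withDensity_eq_integral_toReal_smul₀ (f := fun y =>
    ENNReal.ofReal (S.chartDensity α R c y)) hd.ennreal_ofReal
    (ae_of_all _ fun _ => ENNReal.ofReal_lt_top) _).trans ?_
  congr 1
  funext y
  rw [ENNReal.toReal_ofReal chartDensity_nonneg, smul_eq_mul, mul_comm]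

end measure
end QCStructure

namespace QCStructure
open QuasiContact

variable {X : Type*} [TopologicalSpace X] [ChartedSpace E4 X] [IsManifold (𝓡 4) ∞ X]
  {S : QCStructure X} {α : ∀ x : X, CoFib X x} {R : ∀ x : X, TangentSpace (𝓡 4) x}
  {U : Set X} {e : Fin 4 → ∀ x : X, TangentSpace (𝓡 4) x} {c : X} {y : E4}

/-! ### The divergence of the characteristic field -/

namespace AdaptedFrame

theorem lieBracket_chartFrame_eq (h : AdaptedFrame S α R U e) (hα : S.IsPoppForm α)
    (hR : S.IsReeb α R) (hy : y ∈ (chartAt E4 c).target) (hU : (chartAt E4 c).symm y ∈ U)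
    (j k : Fin 4) :
    VectorField.lieBracket ℝ (chartFrame c e j) (chartFrame c e k) y =
      ∑ l, structFn S α e j k l ((chartAt E4 c).symm y) • chartFrame c e l y := by
  let L : E4 →L[ℝ] E4 := mfderiv (𝓡 4) (𝓡 4) (chartAt E4 c).symm y
  have hinj : Function.Injective L := (isInvertible_mfderiv_chart_symm hy).injective
  apply hinj
  refine (lieBracket_chartFrame hy (h.smooth j _ hU) (h.smooth k _ hU)).trans ?_
  refine (h.mlieBracket_eq_sum hα hR hU j k).trans ?_
  refine Eq.trans ?_ (map_sum L _ _).symm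
  refine Finset.sum_congr rfl fun l _ => ?_
  refine Eq.trans ?_ (map_smul L _ _).symm
  exact congrArg _ (mfderiv_chartFrame hy l).symm

/-- The Jacobi identity makes `c_{01}^1 + c_{02}^2` equal to `c_{03}^3`, so the trace is twice the
latter. It is this factor two that matches the weight `1 - Ξ₀²` on the fibres. -/
theorem sum_structFn [T2Space X] (h : AdaptedFrame S α R U e) (hα : S.IsPoppForm α)
    (hR : S.IsReeb α R) {x : X} (hx : x ∈ U) :
    ∑ k, structFn S α e 0 k k x = 2 * structB S α e x := by
  have h0 : structFn S α e 0 0 0 x = 0 := by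
    have := structFn_swap (S := S) (α := α) (e := e) 0 0 0 x
    linarith
  have h1 := h.structFn_trace hα hR hx
  rw [Fin.sum_univ_four, h0]
  change _ = 2 * structFn S α e 0 3 3 x
  linarith

theorem divergence_eq_zero {f : X → ℝ} {x : X} (hx : f =ᶠ[𝓝 x] 0) :
    dX f x (e 0 x) - f x * (2 * structB S α e x) = 0 := by
  have h2 : dX f x = 0 :=
    (Filter.EventuallyEq.mfderiv_eq (I := 𝓡 4) (I' := 𝓘(ℝ, ℝ)) hx).trans mfderiv_const
  have h3 : dX f x (e 0 x) = 0 := by rw [h2]; rfl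
  rw [h3, hx.self_of_nhds]
  simp

theorem continuous_divergence (h : AdaptedFrame S α R U e) (hα : S.IsPoppForm α) {f : X → ℝ}
    (hf : ContMDiff (𝓡 4) 𝓘(ℝ, ℝ) ∞ f) (hfU : tsupport f ⊆ U) :
    Continuous fun x => dX f x (e 0 x) - f x * (2 * structB S α e x) := by
  refine continuous_iff_continuousAt.2 fun x => ?_
  by_cases hx : x ∈ tsupport f
  · have h1 := contMDiffAt_mfderiv_vf isOpen_univ (mem_univ x) hf.contMDiffOn
      (h.smooth 0 x (hfU hx))
    have h2 : ContMDiffAt (𝓡 4) 𝓘(ℝ, ℝ) ∞ (structB S α e) x :=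
      h.contMDiffAt_structFn hα (hfU hx) 0 3 3
    exact h1.continuousAt.sub (hf.continuous.continuousAt.mul
      (continuousAt_const.mul h2.continuousAt))
  · have h1 := notMem_tsupport_iff_eventuallyEq.1 hx
    refine (continuousAt_const (y := (0 : ℝ))).congr ?_
    filter_upwards [h1.eventually_nhds] with z hz
    exact (divergence_eq_zero hz).symm

/-- The divergence of `e₀` for the Popp measure is `-2b`. -/
theorem integral_divergence [CompactSpace X] [T2Space X] [MeasurableSpace X] [BorelSpace X]
    (h : AdaptedFrame S α R U e) (hα : S.IsPoppForm α) (hR : S.IsReeb α R) {f : X → ℝ}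
    (hf : ContMDiff (𝓡 4) 𝓘(ℝ, ℝ) ∞ f) (hfU : tsupport f ⊆ U)
    (hc : U ⊆ (chartAt E4 c).source) :
    ∫ x, (dX f x (e 0 x) - f x * (2 * structB S α e x)) ∂(S.popp α R) = 0 := by
  let φ := chartAt E4 c
  let O : Set E4 := φ.target ∩ φ.symm ⁻¹' U
  let K : Set E4 := φ '' tsupport f
  -- The function is transported to `ℝ⁴` and extended by zero. The extension is smooth because its
  -- support lies in the compact image `K` of the support of `f`, inside the chart.
  let fh : E4 → ℝ := indicator φ.target (f ∘ φ.symm)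
  have hO : IsOpen O := φ.isOpen_inter_preimage_symm h.isOpen
  have hK : IsCompact K := (isClosed_tsupport f).isCompact.image_of_continuousOn
    (φ.continuousOn.mono (hfU.trans hc))
  have hKO : K ⊆ O := by
    rintro _ ⟨x, hx, rfl⟩
    refine ⟨φ.map_source (hc (hfU hx)), ?_⟩
    change φ.symm (φ x) ∈ U
    rw [φ.left_inv (hc (hfU hx))]
    exact hfU hx
  have hKs : ∀ y ∈ φ.target, y ∉ K → φ.symm y ∉ tsupport f := fun y hy hyK hs =>
    hyK ⟨_, hs, φ.right_inv hy⟩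
  have hz : ∀ y ∉ K, fh y = 0 := fun y hy => by
    by_cases hyt : y ∈ φ.target
    · rw [show fh y = f (φ.symm y) from indicator_of_mem hyt _]
      exact image_eq_zero_of_notMem_tsupport (hKs y hyt hy)
    · exact indicator_of_notMem hyt _
  have hz' : ∀ y ∉ K, fh =ᶠ[𝓝 y] 0 := fun y hy => by
    filter_upwards [hK.isClosed.isOpen_compl.mem_nhds hy] with z hzK
    exact hz z hzK
  have hfh : ∀ y ∈ φ.target, fh =ᶠ[𝓝 y] f ∘ φ.symm := fun y hy => by
    filter_upwards [φ.open_target.mem_nhds hy] with z hz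
    exact indicator_of_mem hz _
  have hsm : ∀ y ∈ φ.target, ContMDiffAt (𝓡 4) 𝓘(ℝ, ℝ) ∞ (f ∘ φ.symm) y := fun y hy =>
    hf.contMDiffAt.comp y (contMDiffAt_chart_symm hy)
  have hfc : ContDiff ℝ 1 fh := by
    refine contDiff_iff_contDiffAt.2 fun y => ?_
    by_cases hy : y ∈ K
    · exact ((hsm y (hKO hy).1).contDiffAt.congr_of_eventuallyEq (hfh y (hKO hy).1)).of_le
        (by simp)
    · exact contDiffAt_const.congr_of_eventuallyEq (hz' y hy)
  have hfK : HasCompactSupport fh := HasCompactSupport.intro hK fun y hy => hz y hy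
  have hfO : tsupport fh ⊆ O := (closure_minimal (fun y hy => by
    by_contra hyK
    exact hy (hz y hyK)) hK.isClosed).trans hKO
  have key := integral_fderiv_frame hO (F := chartFrame c e) (f := fh)
    (C := fun k l y => structFn S α e 0 k l (φ.symm y))
    (fun k y hy => (contDiffAt_chartFrame hy.1 (h.smooth k _ hy.2)).contDiffWithinAt)
    (fun y hy => (h.chartDensity_eq hα hR hy.1 hy.2).1)
    (fun y hy k => h.lieBracket_chartFrame_eq hα hR hy.1 hy.2 0 k) hfc hfK hfO
  rw [integral_popp (c := c) hα hR (h.continuous_divergence hα hf hfU)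
    fun x hx => divergence_eq_zero (notMem_tsupport_iff_eventuallyEq.1 fun hxs => hx (hc (hfU hxs))), ← key]
  have hK0 : ∀ y ∉ K, (fderiv ℝ fh y (chartFrame c e 0 y) -
      fh y * ∑ k, structFn S α e 0 k k (φ.symm y)) * |(frameMatrix (chartFrame c e) y).det|⁻¹ = 0 :=
    fun y hy => by
      have h1 : fderiv ℝ fh y = 0 := by
        rw [(hz' y hy).fderiv_eq]; exact fderiv_const_apply 0
      rw [h1, hz y hy]
      simp
  rw [← setIntegral_eq_integral_of_forall_compl_eq_zero (s := φ.target)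
    fun y hy => hK0 y fun hyK => hy (hKO hyK).1]
  refine setIntegral_congr_fun φ.open_target.measurableSet fun y hy => ?_
  by_cases hyK : y ∈ K
  · have hyO := hKO hyK
    have h1 : fderiv ℝ fh y (chartFrame c e 0 y) = dX f (φ.symm y) (e 0 (φ.symm y)) := by
      rw [(hfh y hy).fderiv_eq, ← mfderiv_eq_fderiv]
      have h2 := mfderiv_comp (I := 𝓡 4) (I' := 𝓡 4) (I'' := 𝓘(ℝ, ℝ)) y
        (hf.contMDiffAt.mdifferentiableAt (x := φ.symm y) (by simp))
        ((contMDiffAt_chart_symm hy).mdifferentiableAt (by simp))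
      refine (congrArg (fun L : E4 →L[ℝ] ℝ => L (chartFrame c e 0 y)) h2).trans ?_
      exact congrArg (dX f (φ.symm y)) (mfderiv_chartFrame hy 0)
    have h2 : fh y = f (φ.symm y) := (hfh y hy).self_of_nhds
    have h3 := (h.chartDensity_eq hα hR hy hyO.2).2
    have h4 := h.sum_structFn hα hR hyO.2
    refine Eq.trans (congrArg₂ _ (congrArg₂ _ h1.symm ?_) h3) rfl
    rw [h2, h4]
  · refine Eq.trans ?_ (hK0 y hyK).symm
    rw [divergence_eq_zero
      (notMem_tsupport_iff_eventuallyEq.1 (hKs y hy hyK)), zero_mul]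

end AdaptedFrame
end QCStructure

namespace QCStructure
open QuasiContact

variable {X : Type*} [TopologicalSpace X] [ChartedSpace E4 X] [IsManifold (𝓡 4) ∞ X]
  {S : QCStructure X} {α : ∀ x : X, CoFib X x} {R : ∀ x : X, TangentSpace (𝓡 4) x}
  {U : Set X} {e : Fin 4 → ∀ x : X, TangentSpace (𝓡 4) x} {F : CoTanSum X → ℝ} {s : ℝ} {x : X}

/-! ### The boundary field along a meridian of the fibre -/

/-- The coordinates of the points of a meridian of the fibre of `SNΣ`. -/
def merid (s θ : ℝ) : FrameCoord := (Pi.single 3 s, ![Real.cos θ, Real.sin θ, 0])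

theorem merid_mem (hs : s ≠ 0) (hx : x ∈ U) (θ : ℝ) : (x, merid s θ) ∈ sphereCoord U := by
  refine ⟨hx, by simpa [merid] using hs, fun i => ?_, ?_⟩
  · exact Pi.single_eq_of_ne (Fin.castSucc_lt_last i).ne _
  · simp [merid, Fin.sum_univ_three]

theorem hasDerivAt_merid (s θ : ℝ) :
    HasDerivAt (merid s) (0, ![-Real.sin θ, Real.cos θ, 0]) θ := by
  refine (hasDerivAt_const θ _).prodMk (hasDerivAt_pi.2 fun i => ?_)
  fin_cases i
  · exact Real.hasDerivAt_cos θ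
  · exact Real.hasDerivAt_sin θ
  · exact hasDerivAt_const θ 0

theorem continuous_merid (s : ℝ) : Continuous (merid s) :=
  continuous_iff_continuousAt.2 fun θ => (hasDerivAt_merid s θ).continuousAt

theorem hasDerivAt_comp_curve {G : X × FrameCoord → ℝ} {γ : ℝ → FrameCoord} {γ' : FrameCoord}
    {t : ℝ} (hγ : HasDerivAt γ γ' t) (hG : MDifferentiableAt IY 𝓘(ℝ, ℝ) G (x, γ t)) :
    HasDerivAt (fun t => G (x, γ t)) (dY G (x, γ t) (0, γ')) t := by
  let L : ℝ →L[ℝ] E4 × FrameCoord :=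
    (0 : ℝ →L[ℝ] E4).prod (ContinuousLinearMap.toSpanSingleton ℝ γ')
  have h1 : HasMFDerivAt 𝓘(ℝ, ℝ) IY (fun t => (x, γ t)) t L :=
    (hasMFDerivAt_const x t).prodMk hγ.hasFDerivAt.hasMFDerivAt
  let M : E4 × FrameCoord →L[ℝ] ℝ := mfderiv IY 𝓘(ℝ, ℝ) G (x, γ t)
  have h2 : HasFDerivAt (fun t => G (x, γ t)) (M.comp L) t := hasMFDerivAt_iff_hasFDerivAt.1
    (HasMFDerivAt.comp (g := G) (f := fun t : ℝ => (x, γ t)) t hG.hasMFDerivAt h1)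
  refine h2.hasDerivAt.congr_deriv ?_
  have h3 : L 1 = (0, γ') := by simp [L]
  exact congrArg M h3

theorem frameVec_zero (x : X) (η : Fin 4 → ℝ) (v : Fin 3 → ℝ) :
    frameVec e x 0 η v = (0, (η, v)) := by
  have h : ∑ k, (0 : Fin 4 → ℝ) k • e k x = 0 := Finset.sum_eq_zero fun k _ => zero_smul ℝ (e k x)
  exact Prod.ext h rfl

theorem dX_comp_mk {G : X × FrameCoord → ℝ} {z : FrameCoord}
    (hG : MDifferentiableAt IY 𝓘(ℝ, ℝ) G (x, z)) (u : E4) :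
    dX (fun x => G (x, z)) x u = dY G (x, z) (u, 0) := by
  have h1 : HasMFDerivAt (𝓡 4) IY (fun x : X => (x, z)) x
      ((ContinuousLinearMap.id ℝ E4).prod (0 : E4 →L[ℝ] FrameCoord)) :=
    (hasMFDerivAt_id x).prodMk (hasMFDerivAt_const z x)
  have h2 := HasMFDerivAt.comp (g := G) (f := fun x : X => (x, z)) x hG.hasMFDerivAt h1
  exact congrArg (fun l : E4 →L[ℝ] ℝ => l u) h2.mfderiv

/-- A function on a meridian. -/
def meridVal (S : QCStructure X) (α : ∀ x : X, CoFib X x)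
    (e : Fin 4 → ∀ x : X, TangentSpace (𝓡 4) x) (F : CoTanSum X → ℝ) (s : ℝ) (x : X) (θ : ℝ) : ℝ :=
  (F ∘ psi S α e) (x, merid s θ)

/-- The derivative of a function in the direction of the first frame field. -/
def meridChar (S : QCStructure X) (α : ∀ x : X, CoFib X x)
    (e : Fin 4 → ∀ x : X, TangentSpace (𝓡 4) x) (F : CoTanSum X → ℝ) (s : ℝ) (x : X) (θ : ℝ) : ℝ :=
  dY (F ∘ psi S α e) (x, merid s θ) (baseVec e x (Sum.inl 0))

/-- The derivative of a function along the boundary field. -/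
def meridField (S : QCStructure X) (α : ∀ x : X, CoFib X x)
    (e : Fin 4 → ∀ x : X, TangentSpace (𝓡 4) x) (F : CoTanSum X → ℝ) (s : ℝ) (x : X) (θ : ℝ) : ℝ :=
  dY (F ∘ psi S α e) (x, merid s θ) (fieldVec S α e (x, merid s θ))

namespace AdaptedFrame

/-- Euler's relation in degree zero: the derivative at `t = 1` of a function that is constant along
the dilations. -/
theorem dY_dil_eq_zero (h : AdaptedFrame S α R U e) (hα : S.IsPoppForm α) (hR : S.IsReeb α R)
    (hF : TestFn F) (hd : S.DilInvariant F) {y : X × FrameCoord} (hy : y ∈ sphereCoord U) :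
    dY (F ∘ psi S α e) y (0, (y.2.1, 0)) = 0 := by
  have h1 : HasDerivAt (fun t : ℝ => scaleL t y.2) (y.2.1, 0) 1 := by
    have h2 : HasDerivAt (fun t : ℝ => t • y.2.1) y.2.1 1 := by
      simpa using (hasDerivAt_id (1 : ℝ)).smul_const y.2.1
    exact h2.prodMk (hasDerivAt_const 1 y.2.2)
  have h0 : scaleL 1 y.2 = y.2 := Prod.ext (one_smul ℝ y.2.1) rfl
  have hG : MDifferentiableAt IY 𝓘(ℝ, ℝ) (F ∘ psi S α e) (y.1, scaleL 1 y.2) := by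
    rw [h0]
    exact (h.contMDiffAt_comp_psi hα hR hF hy).mdifferentiableAt (by simp)
  have h2 := hasDerivAt_comp_curve h1 hG
  have h3 : (fun t : ℝ => (F ∘ psi S α e) (y.1, scaleL t y.2)) =ᶠ[𝓝 1] fun _ => F (psi S α e y) := by
    filter_upwards [lt_mem_nhds (zero_lt_one : (0 : ℝ) < 1)] with t ht
    change F (psi S α e (y.1, scaleL t y.2)) = _
    rw [← dilS_psi]
    exact hd _ (h.psi_mem hα hR hy) t ht
  have h4 := h2.unique ((hasDerivAt_const (1 : ℝ) (F (psi S α e y))).congr_of_eventuallyEq h3)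
  rwa [h0] at h4

/-- For an invariant function the derivative along the orbit is zero, and in coordinates this
derivative is `±` the one along the rotational vector. -/
theorem dY_rot_eq_zero [T2Space X] (h : AdaptedFrame S α R U e) (hα : S.IsPoppForm α)
    (hR : S.IsReeb α R) (hF : TestFn F) (hc : S.CircleInvariant F) {y : X × FrameCoord}
    (hy : y ∈ sphereCoord U) :
    dY (F ∘ psi S α e) y (frameVec e y.1 0 0 ![0, y.2.2 2, -y.2.2 1]) = 0 := by
  have hq := h.psi_mem hα hR hy
  have h1 := h.rotDeriv_eq hα hR hF hq hy.1
  have h2 : S.rotDeriv F (psi S α e y) = 0 := by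
    rw [rotDeriv, show (fun θ => F (S.rot θ (psi S α e y))) = fun _ => F (psi S α e y) from
      funext fun θ => hc _ hq θ, deriv_const]
  rw [h2, h.coord_psi hα hR hy.1] at h1
  refine (mul_eq_zero.1 h1.symm).resolve_left ?_
  have h3 : symb R (beta (psi S α e y)) = y.2.1 3 := by
    have h4 := congrArg (fun z : X × FrameCoord => z.2.1 3) (h.coord_psi hα hR (y := y) hy.1)
    rw [← h.last]
    exact h4
  rw [h3]
  rcases lt_or_gt_of_ne hy.2.1 with h4 | h4
  · rw [sign_neg h4]; simp
  · rw [sign_pos h4]; simp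

theorem hasDerivAt_meridVal (h : AdaptedFrame S α R U e) (hα : S.IsPoppForm α)
    (hR : S.IsReeb α R) (hF : TestFn F) (hs : s ≠ 0) (hx : x ∈ U) (θ : ℝ) :
    HasDerivAt (meridVal S α e F s x) (dY (F ∘ psi S α e) (x, merid s θ)
      (frameVec e x 0 0 ![-Real.sin θ, Real.cos θ, 0])) θ := by
  have h1 := hasDerivAt_comp_curve (x := x) (hasDerivAt_merid s θ)
    ((h.contMDiffAt_comp_psi hα hR hF (merid_mem hs hx θ)).mdifferentiableAt (by simp))
  rw [frameVec_zero]
  exact h1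

/-- The covector part of the field points along the dilations and the `γ`-part of its sphere
component along the circle action. Both annihilate the invariant function. What remains is `v₀ Z`
and, along the meridian, the angular velocity `(b/2) sin θ`. -/
theorem meridField_eq [T2Space X] (h : AdaptedFrame S α R U e) (hα : S.IsPoppForm α)
    (hR : S.IsReeb α R) (hF : TestFn F) (hc : S.CircleInvariant F) (hd : S.DilInvariant F)
    (hs : s ≠ 0) (hx : x ∈ U) (θ : ℝ) :
    meridField S α e F s x θ = Real.cos θ * meridChar S α e F s x θ +
      structB S α e x / 2 * Real.sin θ * dY (F ∘ psi S α e) (x, merid s θ)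
        (frameVec e x 0 0 ![-Real.sin θ, Real.cos θ, 0]) := by
  have hy := merid_mem hs hx θ
  have h1 := h.dY_dil_eq_zero hα hR hF hd hy
  have h2 := h.dY_rot_eq_zero hα hR hF hc hy
  have h1' : dY (F ∘ psi S α e) (x, merid s θ) (frameVec e x 0 (Pi.single 3 s) 0) = 0 := by
    rw [frameVec_zero]
    exact h1
  rw [meridField, meridChar, fieldVec]
  have hexp := dY_frameVec (e := e) (F ∘ psi S α e) (x, merid s θ)
  dsimp only at hexp h2 ⊢
  rw [hexp] at h1' h2 ⊢
  rw [hexp]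
  simp only [Fintype.sum_sum_type, Sum.elim_inl, Sum.elim_inr, Fin.sum_univ_four,
    Fin.sum_univ_three, merid, sphereField, Matrix.cons_val, Pi.single_eq_same, Pi.zero_apply] at h1' h2 ⊢
  simp only [zero_mul, zero_add, add_zero, mul_zero, ne_eq, Fin.reduceEq, not_false_eq_true,
    Pi.single_eq_of_ne] at h1' h2 ⊢
  have h1'' := (mul_eq_zero.1 h1').resolve_left hs
  linear_combination (Real.cos θ * structB S α e x * s) * h1'' + Real.cos θ * structC S α e x * h2

/-- Integration by parts on a meridian. -/
theorem integral_meridField [T2Space X] (h : AdaptedFrame S α R U e) (hα : S.IsPoppForm α)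
    (hR : S.IsReeb α R) (hF : TestFn F) (hc : S.CircleInvariant F) (hd : S.DilInvariant F)
    (hs : s ≠ 0) (hx : x ∈ U) (hK : Continuous (meridChar S α e F s x))
    (hT : Continuous fun θ => dY (F ∘ psi S α e) (x, merid s θ)
        (frameVec e x 0 0 ![-Real.sin θ, Real.cos θ, 0])) :
    ∫ θ in (0 : ℝ)..Real.pi, meridField S α e F s x θ * Real.sin θ ^ 3 =
      ∫ θ in (0 : ℝ)..Real.pi, Real.cos θ * Real.sin θ ^ 3 *
        (meridChar S α e F s x θ - meridVal S α e F s x θ * (2 * structB S α e x)) := by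
  have hf := h.hasDerivAt_meridVal hα hR hF hs hx
  have hfc : Continuous (meridVal S α e F s x) :=
    continuous_iff_continuousAt.2 fun θ => (hf θ).continuousAt
  -- The factor `sin⁴ θ` is the weight `sin³ θ` times the `sin θ` of the angular velocity. It
  -- vanishes at both poles, so there are no boundary terms, and its derivative `4 sin³ θ cos θ`
  -- produces the `2b cos θ` that compensates the divergence of `Z`.
  have h1 : ∀ θ, HasDerivAt (fun θ => structB S α e x / 2 *
      (Real.sin θ ^ 4 * meridVal S α e F s x θ))
      (structB S α e x / 2 * (4 * Real.sin θ ^ 3 * Real.cos θ * meridVal S α e F s x θ +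
        Real.sin θ ^ 4 * dY (F ∘ psi S α e) (x, merid s θ)
        (frameVec e x 0 0 ![-Real.sin θ, Real.cos θ, 0]))) θ := fun θ => by
    refine ((((Real.hasDerivAt_sin θ).pow 4).mul (hf θ)).const_mul _).congr_deriv ?_
    simp
  have hs' := Real.continuous_sin
  have hc' := Real.continuous_cos
  have hcont : Continuous fun θ => structB S α e x / 2 * (4 * Real.sin θ ^ 3 * Real.cos θ *
      meridVal S α e F s x θ + Real.sin θ ^ 4 * dY (F ∘ psi S α e) (x, merid s θ)
        (frameVec e x 0 0 ![-Real.sin θ, Real.cos θ, 0])) := by fun_prop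
  have h2 := intervalIntegral.integral_eq_sub_of_hasDerivAt (fun θ _ => h1 θ)
    (hcont.intervalIntegrable 0 Real.pi)
  have h3 : ∀ θ, meridField S α e F s x θ * Real.sin θ ^ 3 =
      Real.cos θ * Real.sin θ ^ 3 *
        (meridChar S α e F s x θ - meridVal S α e F s x θ * (2 * structB S α e x)) +
      structB S α e x / 2 * (4 * Real.sin θ ^ 3 * Real.cos θ * meridVal S α e F s x θ +
        Real.sin θ ^ 4 * dY (F ∘ psi S α e) (x, merid s θ)
        (frameVec e x 0 0 ![-Real.sin θ, Real.cos θ, 0])) := fun θ => by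
    rw [h.meridField_eq hα hR hF hc hd hs hx]
    ring
  simp only [h3]
  rw [intervalIntegral.integral_add _ (hcont.intervalIntegrable _ _), h2]
  · simp
  · exact Continuous.intervalIntegrable (by fun_prop) _ _

theorem continuousAt_dY_merid (h : AdaptedFrame S α R U e) (hα : S.IsPoppForm α)
    (hR : S.IsReeb α R) (hF : TestFn F) (hs : s ≠ 0) (hx : x ∈ U) (θ : ℝ)
    (m : Fin 4 ⊕ Fin 4 ⊕ Fin 3) :
    ContinuousAt (fun z : X × ℝ => dY (F ∘ psi S α e) (z.1, merid s z.2) (baseVec e z.1 m))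
      (x, θ) := by
  have h1 := h.continuousAt_dY_baseVec (isOpen_coordDomain h.isOpen)
    (h.contMDiffOn_comp_psi hα hR hF) (y := (x, merid s θ))
    ⟨hx, (merid_mem hs hx θ).2.1⟩ hx m
  exact ContinuousAt.comp (g := fun y : X × FrameCoord => dY (F ∘ psi S α e) y (baseVec e y.1 m))
    (f := fun z : X × ℝ => (z.1, merid s z.2)) h1
    (continuous_fst.prodMk ((continuous_merid s).comp continuous_snd)).continuousAt

theorem continuousAt_meridVal (h : AdaptedFrame S α R U e) (hα : S.IsPoppForm α)
    (hR : S.IsReeb α R) (hF : TestFn F) (hs : s ≠ 0) (hx : x ∈ U) (θ : ℝ) :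
    ContinuousAt (fun z : X × ℝ => meridVal S α e F s z.1 z.2) (x, θ) :=
  ContinuousAt.comp (g := F ∘ psi S α e) (f := fun z : X × ℝ => (z.1, merid s z.2))
    (h.contMDiffAt_comp_psi hα hR hF (merid_mem hs hx θ)).continuousAt
    (continuous_fst.prodMk ((continuous_merid s).comp continuous_snd)).continuousAt

end AdaptedFrame
end QCStructure

namespace QCStructure
open QuasiContact

variable {X : Type*} [TopologicalSpace X] [ChartedSpace E4 X] [IsManifold (𝓡 4) ∞ X]
  {S : QCStructure X} {α : ∀ x : X, CoFib X x} {R : ∀ x : X, TangentSpace (𝓡 4) x}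
  {U : Set X} {e : Fin 4 → ∀ x : X, TangentSpace (𝓡 4) x} {F : CoTanSum X → ℝ} {s : ℝ} {x : X}

/-! ### Integrals over the fibres -/

theorem exists_angle {a b : ℝ} (h : a ^ 2 + b ^ 2 = 1) : ∃ φ, Real.cos φ = a ∧ Real.sin φ = b := by
  have hn : ‖(⟨a, b⟩ : ℂ)‖ = 1 := by
    rw [Complex.norm_def, Complex.normSq_mk, show a * a + b * b = 1 by linarith, Real.sqrt_one]
  have h0 : (⟨a, b⟩ : ℂ) ≠ 0 := fun h0 => by rw [h0] at hn; simp at hn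
  refine ⟨Complex.arg ⟨a, b⟩, ?_, ?_⟩
  · rw [Complex.cos_arg h0, hn, div_one]
  · rw [Complex.sin_arg, hn, div_one]

theorem merid_pi_sub (s θ : ℝ) :
    merid s (Real.pi - θ) = (Pi.single 3 s, ![-Real.cos θ, Real.sin θ, 0]) := by
  simp [merid]

theorem integral_merid_flip (f : ℝ → ℝ) :
    ∫ θ in (0 : ℝ)..Real.pi, f (Real.pi - θ) = ∫ θ in (0 : ℝ)..Real.pi, f θ := by
  rw [intervalIntegral.integral_comp_sub_left f Real.pi]
  simp

/-- The meridian through two unit vectors of `N₀Σ` and `N₁Σ` in the coordinates of a frame. -/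
theorem AdaptedFrame.exists_merid [T2Space X] (h : AdaptedFrame S α R U e) (hα : S.IsPoppForm α)
    (hR : S.IsReeb α R) (hs : s ≠ 0) (hx : x ∈ U) {n0 n1 : TangentSpace (𝓡 4) x}
    (h0 : n0 ∈ S.N0 (⟨x, s • α x⟩ : CoTan X)) (h0' : S.g x n0 n0 = 1)
    (h1 : n1 ∈ S.N1 (⟨x, s • α x⟩ : CoTan X)) (h1' : S.g x n1 n1 = 1) :
    ∃ φ : ℝ, (n0 = e 0 x ∧ ∀ θ : ℝ,
        (⟨x, (s • α x, Real.cos θ • n0 + Real.sin θ • n1)⟩ : CoTanSum X) =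
          psi S α e (x, rotL φ (merid s θ))) ∨
      (n0 = -e 0 x ∧ ∀ θ : ℝ,
        (⟨x, (s • α x, Real.cos θ • n0 + Real.sin θ • n1)⟩ : CoTanSum X) =
          psi S α e (x, rotL φ (merid s (Real.pi - θ)))) := by
  obtain ⟨v, rfl⟩ := h.exists_coords hx h0.1
  obtain ⟨w, rfl⟩ := h.exists_coords hx (N1_subset_E h1)
  obtain ⟨hv1, hv2⟩ := (h.mem_N0_iff hα hR hx hs v).1 h0
  have hw := (h.mem_N1_iff hα hR hx hs w).1 h1
  rw [h.metric_frame hx, Fin.sum_univ_three, hv1, hv2] at h0'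
  rw [h.metric_frame hx, Fin.sum_univ_three, hw] at h1'
  -- `rotV φ` sends `(·, sin θ, 0)` to `(·, cos φ sin θ, -sin φ sin θ)`, whence the sign of the
  -- sine.
  obtain ⟨φ, hφ, hφ'⟩ := exists_angle (a := w 1) (b := -w 2) (by linarith)
  have key : ∀ (θ : ℝ) (z : FrameCoord), z.1 = Pi.single 3 s →
      z.2 = ![v 0 * Real.cos θ, Real.sin θ, 0] →
      (⟨x, (s • α x, Real.cos θ • (∑ i, v i • e (Fin.castSucc i) x) +
        Real.sin θ • ∑ i, w i • e (Fin.castSucc i) x)⟩ : CoTanSum X) =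
          psi S α e (x, rotL φ z) := fun θ z hz1 hz2 => by
    refine congrArg (Bundle.TotalSpace.mk x) (Prod.ext ?_ ?_)
    · change s • α x = ∑ j, z.1 j • coframe S α e j x
      rw [hz1, Finset.sum_eq_single 3 (fun j _ hj => by rw [Pi.single_eq_of_ne hj, zero_smul])
        (by simp), Pi.single_eq_same, coframe_three]
    · change (Real.cos θ • (∑ i, v i • e (Fin.castSucc i) x) +
        Real.sin θ • ∑ i, w i • e (Fin.castSucc i) x : TangentSpace (𝓡 4) x) =
        ∑ i, rotV φ z.2 i • e (Fin.castSucc i) x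
      rw [hz2, Finset.smul_sum, Finset.smul_sum, ← Finset.sum_add_distrib]
      refine Finset.sum_congr rfl fun i _ => ?_
      rw [smul_smul, smul_smul, ← add_smul]
      congr 1
      fin_cases i
      · simp [rotV, hw, mul_comm]
      · simp [rotV, hv1, hφ, mul_comm]
      · simp [rotV, hv2, hφ', mul_comm]
  have he : ∑ i, v i • e (Fin.castSucc i) x = v 0 • e 0 x := by
    rw [Fin.sum_univ_three, hv1, hv2, zero_smul, zero_smul, add_zero, add_zero]
    rfl
  refine ⟨φ, ?_⟩
  rcases mul_self_eq_one_iff.1 (show v 0 * v 0 = 1 by linarith) with h2 | h2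
  · refine Or.inl ⟨by rw [he, h2, one_smul], fun θ => key θ _ rfl ?_⟩
    rw [h2, one_mul]; rfl
  · refine Or.inr ⟨by rw [he, h2, neg_one_smul], fun θ => key θ _ rfl ?_⟩
    rw [h2, neg_one_mul, merid_pi_sub]

/-- Substitution `t = cos θ`: the weight `1 - t²` gives `sin² θ` and the differential a further `sin
θ`. In the angle the meridian is smooth up to the poles, whereas `√(1 - t²)` is not. -/
theorem fibreIntegral_eq (x : X) (H : CoTanSum X → ℝ) {n0 n1 : TangentSpace (𝓡 4) x}
    (h0 : n0 = Classical.epsilon fun n => n ∈ S.N0 (⟨x, s • α x⟩ : CoTan X) ∧ S.g x n n = 1)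
    (h1 : n1 = Classical.epsilon fun n => n ∈ S.N1 (⟨x, s • α x⟩ : CoTan X) ∧ S.g x n n = 1) :
    S.fibreIntegral ⟨x, s • α x⟩ H = ∫ θ in (0 : ℝ)..Real.pi,
      H ⟨x, (s • α x, Real.cos θ • n0 + Real.sin θ • n1)⟩ * Real.sin θ ^ 3 := by
  have h2 : S.fibreIntegral ⟨x, s • α x⟩ H = ∫ t in (-1 : ℝ)..1,
      H ⟨x, (s • α x, t • n0 + √(1 - t ^ 2) • n1)⟩ * (1 - t ^ 2) := by
    rw [h0, h1]; rfl
  rw [h2, intervalIntegral.integral_of_le (by norm_num), ← integral_Icc_eq_integral_Ioc,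
    ← Real.bijOn_cos.image_eq, integral_image_eq_integral_abs_deriv_smul measurableSet_Icc
      (fun θ _ => (Real.hasDerivAt_cos θ).hasDerivWithinAt) Real.injOn_cos,
    intervalIntegral.integral_of_le Real.pi_pos.le, ← integral_Icc_eq_integral_Ioc]
  refine setIntegral_congr_fun measurableSet_Icc fun θ hθ => ?_
  have hsin : 0 ≤ Real.sin θ := Real.sin_nonneg_of_nonneg_of_le_pi hθ.1 hθ.2
  have h3 : 1 - Real.cos θ ^ 2 = Real.sin θ ^ 2 := by
    rw [← Real.sin_sq_add_cos_sq θ]; ring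
  change |-Real.sin θ| • (H ⟨x, (s • α x, Real.cos θ • n0 + √(1 - Real.cos θ ^ 2) • n1)⟩ *
    (1 - Real.cos θ ^ 2)) = _
  rw [h3, Real.sqrt_sq hsin, abs_neg, abs_of_nonneg hsin, smul_eq_mul]
  ring

namespace AdaptedFrame

theorem continuous_meridChar (h : AdaptedFrame S α R U e) (hα : S.IsPoppForm α)
    (hR : S.IsReeb α R) (hF : TestFn F) (hs : s ≠ 0) (hx : x ∈ U) :
    Continuous (meridChar S α e F s x) :=
  continuous_iff_continuousAt.2 fun θ => ContinuousAt.comp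
    (g := fun z : X × ℝ => dY (F ∘ psi S α e) (z.1, merid s z.2) (baseVec e z.1 (Sum.inl 0)))
    (f := fun θ : ℝ => (x, θ)) (h.continuousAt_dY_merid hα hR hF hs hx θ _)
    (by fun_prop)

theorem continuous_meridTangent (h : AdaptedFrame S α R U e) (hα : S.IsPoppForm α)
    (hR : S.IsReeb α R) (hF : TestFn F) (hs : s ≠ 0) (hx : x ∈ U) :
    Continuous fun θ => dY (F ∘ psi S α e) (x, merid s θ)
        (frameVec e x 0 0 ![-Real.sin θ, Real.cos θ, 0]) := by
  have h1 : ∀ m, Continuous fun θ => dY (F ∘ psi S α e) (x, merid s θ) (baseVec e x m) := fun m =>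
    continuous_iff_continuousAt.2 fun θ => ContinuousAt.comp
      (g := fun z : X × ℝ => dY (F ∘ psi S α e) (z.1, merid s z.2) (baseVec e z.1 m))
      (f := fun θ : ℝ => (x, θ)) (h.continuousAt_dY_merid hα hR hF hs hx θ _)
      (by fun_prop)
  have h2 : ∀ θ, dY (F ∘ psi S α e) (x, merid s θ)
      (frameVec e x 0 0 ![-Real.sin θ, Real.cos θ, 0]) = _ := fun θ =>
    dY_frameVec (e := e) (F ∘ psi S α e) (x, merid s θ) 0 0 _
  simp only [h2]
  refine continuous_finsetSum _ fun m _ => Continuous.mul ?_ (h1 m)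
  rcases m with m | m | m
  · exact continuous_const
  · exact continuous_const
  · have hs' := Real.continuous_sin
    have hc' := Real.continuous_cos
    fin_cases m
    · exact hs'.neg
    · exact hc'
    · exact continuous_const

theorem continuous_meridField [T2Space X] (h : AdaptedFrame S α R U e) (hα : S.IsPoppForm α)
    (hR : S.IsReeb α R) (hF : TestFn F) (hc : S.CircleInvariant F) (hd : S.DilInvariant F)
    (hs : s ≠ 0) (hx : x ∈ U) : Continuous (meridField S α e F s x) := by
  rw [funext (h.meridField_eq hα hR hF hc hd hs hx)]
  exact (Real.continuous_cos.mul (h.continuous_meridChar hα hR hF hs hx)).add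
    ((continuous_const.mul Real.continuous_sin).mul (h.continuous_meridTangent hα hR hF hs hx))

end AdaptedFrame

/-- The integrand of the fibre integral in a frame. -/
def meridDiv (S : QCStructure X) (α : ∀ x : X, CoFib X x)
    (e : Fin 4 → ∀ x : X, TangentSpace (𝓡 4) x) (F : CoTanSum X → ℝ) (s : ℝ) (χ : X → ℝ)
    (x : X) (θ : ℝ) : ℝ :=
  χ x * (Real.cos θ * Real.sin θ ^ 3 *
    (meridChar S α e F s x θ - meridVal S α e F s x θ * (2 * structB S α e x)))

variable {ι : Type*} [Fintype ι] {c : ι → X} {V : ι → Set X}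
  {E : ι → Fin 4 → ∀ x : X, TangentSpace (𝓡 4) x} {χ : ι → X → ℝ}

theorem exists_unit_normal [T2Space X] (h : AdaptedFrame S α R U e) (hα : S.IsPoppForm α)
    (hR : S.IsReeb α R) (hs : s ≠ 0) (hx : x ∈ U) :
    (e 0 x ∈ S.N0 (⟨x, s • α x⟩ : CoTan X) ∧ S.g x (e 0 x) (e 0 x) = 1) ∧
      (e 1 x ∈ S.N1 (⟨x, s • α x⟩ : CoTan X) ∧ S.g x (e 1 x) (e 1 x) = 1) := by
  have h0 : ∑ i, (![1, 0, 0] : Fin 3 → ℝ) i • e (Fin.castSucc i) x = e 0 x := by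
    simp [Fin.sum_univ_three]
  have h1 : ∑ i, (![0, 1, 0] : Fin 3 → ℝ) i • e (Fin.castSucc i) x = e 1 x := by
    simp [Fin.sum_univ_three]
  refine ⟨⟨?_, by simpa using h.orthonormal 0 0 x hx⟩, ?_, by simpa using h.orthonormal 1 1 x hx⟩
  · rw [← h0]
    exact (h.mem_N0_iff hα hR hx hs _).2 ⟨rfl, rfl⟩
  · rw [← h1]
    exact (h.mem_N1_iff hα hR hx hs _).2 rfl

/-- The chosen unit vector of `N₀Σ` may be `Z` or `-Z`, depending on the frame. In the second case
the meridian is run through backwards, which the substitution `θ ↦ π - θ` undoes. Integration by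
parts is then carried out in each frame separately. -/
theorem FrameCover.fibreIntegral_glueField [T2Space X] (h : FrameCover S α R c V E χ)
    (hα : S.IsPoppForm α) (hR : S.IsReeb α R) (hF : TestFn F) (hc : S.CircleInvariant F)
    (hd : S.DilInvariant F) (hs : s ≠ 0) (x : X) :
    S.fibreIntegral ⟨x, s • α x⟩ (derivAlong (glueField S α E χ) F) =
      ∑ i, ∫ θ in (0 : ℝ)..Real.pi, meridDiv S α (E i) F s (χ i) x θ := by
  obtain ⟨i₀, hi₀⟩ := h.exists_mem x
  obtain ⟨⟨h0, h0'⟩, h1, h1'⟩ := exists_unit_normal (h.frame i₀) hα hR hs hi₀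
  obtain ⟨hn0, hn0'⟩ := Classical.epsilon_spec (p := fun n => n ∈ S.N0 (⟨x, s • α x⟩ : CoTan X) ∧
    S.g x n n = 1) ⟨_, h0, h0'⟩
  obtain ⟨hn1, hn1'⟩ := Classical.epsilon_spec (p := fun n => n ∈ S.N1 (⟨x, s • α x⟩ : CoTan X) ∧
    S.g x n n = 1) ⟨_, h1, h1'⟩
  rw [fibreIntegral_eq x _ rfl rfl]
  set n0 : TangentSpace (𝓡 4) x :=
    Classical.epsilon fun n => n ∈ S.N0 (⟨x, s • α x⟩ : CoTan X) ∧ S.g x n n = 1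
  set n1 : TangentSpace (𝓡 4) x :=
    Classical.epsilon fun n => n ∈ S.N1 (⟨x, s • α x⟩ : CoTan X) ∧ S.g x n n = 1
  obtain ⟨hI, hI'⟩ := h.active_spec x
  have hmer : ∀ i ∈ active V x, ∃ ρ : ℝ → ℝ, (ρ = id ∨ ρ = fun θ => Real.pi - θ) ∧ ∃ φ : ℝ, ∀ θ : ℝ,
      (⟨x, (s • α x, Real.cos θ • n0 + Real.sin θ • n1)⟩ : CoTanSum X) =
          psi S α (E i) (x, rotL φ (merid s (ρ θ))) := fun i hi => by
    obtain ⟨φ, ⟨-, hφ⟩ | ⟨-, hφ⟩⟩ := (h.frame i).exists_merid hα hR hs (hI i hi) hn0 hn0' hn1 hn1'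
    · exact ⟨id, Or.inl rfl, φ, hφ⟩
    · exact ⟨_, Or.inr rfl, φ, hφ⟩
  choose! ρ hρ φ hφ using hmer
  have hterm : ∀ i ∈ active V x, ∀ θ, dY (F ∘ psi S α (E i))
      (coord S (E i) (⟨x, (s • α x, Real.cos θ • n0 + Real.sin θ • n1)⟩ : CoTanSum X))
      (fieldVec S α (E i)
        (coord S (E i) (⟨x, (s • α x, Real.cos θ • n0 + Real.sin θ • n1)⟩ : CoTanSum X))) =
      meridField S α (E i) F s x (ρ i θ) := fun i hi θ => by
    have hm := merid_mem hs (hI i hi) (ρ i θ)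
    rw [hφ i hi, (h.frame i).coord_psi hα hR (hI i hi)]
    exact (h.frame i).dY_fieldVec_rotL hα hR hF hc hm (φ i)
  have hval : ∀ θ, derivAlong (glueField S α E χ) F
      (⟨x, (s • α x, Real.cos θ • n0 + Real.sin θ • n1)⟩ : CoTanSum X) =
      ∑ i ∈ active V x, χ i x * meridField S α (E i) F s x (ρ i θ) := fun θ => by
    have hq : (⟨x, (s • α x, Real.cos θ • n0 + Real.sin θ • n1)⟩ : CoTanSum X) ∈ S.SN := by
      rw [hφ i₀ (mem_active.2 hi₀)]
      exact (h.frame i₀).psi_mem hα hR (rotV_mem (merid_mem hs hi₀ _))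
    rw [h.derivAlong_glueField hα hR (mdifferentiableAt_of_mem_SN hα hR hF hq) hq hI hI']
    exact Finset.sum_congr rfl fun i hi => congrArg (fun t => χ i x * t) (hterm i hi θ)
  have hcont : ∀ i ∈ active V x, Continuous fun θ =>
      χ i x * meridField S α (E i) F s x (ρ i θ) * Real.sin θ ^ 3 := fun i hi => by
    have h2 := (h.frame i).continuous_meridField hα hR hF hc hd hs (hI i hi)
    have h3 : Continuous (ρ i) := by
      rcases hρ i hi with h3 | h3 <;> rw [h3] <;> fun_prop
    have h4 := Real.continuous_sin
    exact (continuous_const.mul (h2.comp h3)).mul (h4.pow 3)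
  simp only [hval, Finset.sum_mul]
  rw [intervalIntegral.integral_finsetSum fun i hi => (hcont i hi).intervalIntegrable _ _,
    ← Finset.sum_subset (Finset.subset_univ (active V x)) fun i _ hi => by
      simp [meridDiv, hI' i hi]]
  refine Finset.sum_congr rfl fun i hi => ?_
  have h2 : ∫ θ in (0 : ℝ)..Real.pi, χ i x * meridField S α (E i) F s x (ρ i θ) *
      Real.sin θ ^ 3 = ∫ θ in (0 : ℝ)..Real.pi,
        χ i x * meridField S α (E i) F s x θ * Real.sin θ ^ 3 := by
    rcases hρ i hi with h3 | h3
    · rw [h3]; rfl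
    · rw [h3, ← integral_merid_flip fun θ =>
        χ i x * meridField S α (E i) F s x θ * Real.sin θ ^ 3]
      simp only [Real.sin_pi_sub]
  rw [h2]
  simp only [meridDiv, mul_assoc (χ i x)]
  rw [intervalIntegral.integral_const_mul, intervalIntegral.integral_const_mul,
    (h.frame i).integral_meridField hα hR hF hc hd hs (hI i hi)
      ((h.frame i).continuous_meridChar hα hR hF hs (hI i hi))
      ((h.frame i).continuous_meridTangent hα hR hF hs (hI i hi))]

end QCStructure

namespace QCStructure
open QuasiContact

variable {X : Type*} [TopologicalSpace X] [ChartedSpace E4 X] [IsManifold (𝓡 4) ∞ X]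
  {S : QCStructure X} {α : ∀ x : X, CoFib X x} {R : ∀ x : X, TangentSpace (𝓡 4) x}
  {U : Set X} {e : Fin 4 → ∀ x : X, TangentSpace (𝓡 4) x} {F : CoTanSum X → ℝ} {s : ℝ}

/-! ### Invariance of the lifted Popp measure -/

/-- Away from the closed set `T` the function vanishes on an open set. So continuity is only
required where the frame is defined. -/
theorem continuous_of_zero_off {Y : Type*} [TopologicalSpace Y] {T : Set X} (hT : IsClosed T)
    (hTU : T ⊆ U) {g : X → Y → ℝ} (hg : ∀ x ∈ U, ∀ t, ContinuousAt (Function.uncurry g) (x, t))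
    (h0 : ∀ x ∉ T, ∀ t, g x t = 0) : Continuous (Function.uncurry g) := by
  refine continuous_iff_continuousAt.2 fun ⟨x, t⟩ => ?_
  by_cases hx : x ∈ T
  · exact hg x (hTU hx) t
  · refine (continuousAt_const (y := (0 : ℝ))).congr ?_
    filter_upwards [(hT.isOpen_compl.preimage continuous_fst).mem_nhds
      (show (x, t) ∈ Prod.fst ⁻¹' Tᶜ from hx)] with z hz
    exact (h0 z.1 hz z.2).symm

theorem integrable_uncurry [CompactSpace X] [T2Space X] [MeasurableSpace X] [BorelSpace X] {μ : Measure X}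
    [IsFiniteMeasure μ] {g : X → ℝ → ℝ} (hg : Continuous (Function.uncurry g)) :
    Integrable (Function.uncurry g) (μ.prod (volume.restrict (Ioc 0 Real.pi))) := by
  have h1 : IntegrableOn (Function.uncurry g) (univ ×ˢ Icc 0 Real.pi) (μ.prod volume) :=
    hg.continuousOn.integrableOn_compact (isCompact_univ.prod isCompact_Icc)
  have h2 := h1.mono_set (prod_mono_right (s := univ) (Ioc_subset_Icc_self (a := 0) (b := Real.pi)))
  rwa [IntegrableOn, ← Measure.prod_restrict, Measure.restrict_univ] at h2

theorem dX_mul {f g : X → ℝ} {x : X} (hf : MDifferentiableAt (𝓡 4) 𝓘(ℝ, ℝ) f x)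
    (hg : MDifferentiableAt (𝓡 4) 𝓘(ℝ, ℝ) g x) (u : TangentSpace (𝓡 4) x) :
    dX (fun x => f x * g x) x u = f x * dX g x u + g x * dX f x u :=
  congrArg (fun l : E4 →L[ℝ] ℝ => l u) (hf.hasMFDerivAt.mul hg.hasMFDerivAt).mfderiv

/-- The contribution of the derivative of a cutoff to the fibre integral. -/
def meridCutoff (S : QCStructure X) (α : ∀ x : X, CoFib X x)
    (e : Fin 4 → ∀ x : X, TangentSpace (𝓡 4) x) (F : CoTanSum X → ℝ) (s : ℝ) (χ : X → ℝ)
    (x : X) (θ : ℝ) : ℝ :=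
  Real.cos θ * Real.sin θ ^ 3 * meridVal S α e F s x θ * dX χ x (e 0 x)

theorem dX_eq_zero_of_notMem_tsupport {χ : X → ℝ} {x : X} (hx : x ∉ tsupport χ)
    (u : TangentSpace (𝓡 4) x) : dX χ x u = 0 :=
  congrArg (fun l : E4 →L[ℝ] ℝ => l u) ((Filter.EventuallyEq.mfderiv_eq (I := 𝓡 4)
    (I' := 𝓘(ℝ, ℝ)) (notMem_tsupport_iff_eventuallyEq.1 hx)).trans mfderiv_const)

namespace AdaptedFrame

theorem continuous_meridDiv (h : AdaptedFrame S α R U e) (hα : S.IsPoppForm α)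
    (hR : S.IsReeb α R) (hF : TestFn F) (hs : s ≠ 0) {χ : X → ℝ} (hχ : Continuous χ)
    (hχU : tsupport χ ⊆ U) : Continuous (Function.uncurry (meridDiv S α e F s χ)) := by
  refine continuous_of_zero_off (isClosed_tsupport χ) hχU (fun x hx t => ?_) fun x hx t => ?_
  · have h1 := h.continuousAt_dY_merid hα hR hF hs hx t (Sum.inl 0)
    have h2 := h.continuousAt_meridVal hα hR hF hs hx t
    have h3 : ContinuousAt (fun z : X × ℝ => structB S α e z.1) (x, t) :=
      ContinuousAt.comp (g := structB S α e) (f := Prod.fst)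
        (h.contMDiffAt_structFn hα hx 0 3 3).continuousAt continuousAt_fst
    have h4 : Continuous fun z : X × ℝ => Real.cos z.2 * Real.sin z.2 ^ 3 := by fun_prop
    exact (hχ.comp continuous_fst).continuousAt.mul
      (h4.continuousAt.mul (h1.sub (h2.mul (continuousAt_const.mul h3))))
  · rw [meridDiv, image_eq_zero_of_notMem_tsupport hx, zero_mul]

theorem continuous_meridCutoff (h : AdaptedFrame S α R U e) (hα : S.IsPoppForm α)
    (hR : S.IsReeb α R) (hF : TestFn F) (hs : s ≠ 0) {χ : X → ℝ}
    (hχ : ContMDiff (𝓡 4) 𝓘(ℝ, ℝ) ∞ χ) (hχU : tsupport χ ⊆ U) :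
    Continuous (Function.uncurry (meridCutoff S α e F s χ)) := by
  refine continuous_of_zero_off (isClosed_tsupport χ) hχU (fun x hx t => ?_) fun x hx t => ?_
  · have h2 := h.continuousAt_meridVal hα hR hF hs hx t
    have h3 : ContinuousAt (fun z : X × ℝ => dX χ z.1 (e 0 z.1)) (x, t) :=
      ContinuousAt.comp (g := fun x => dX χ x (e 0 x)) (f := Prod.fst)
        (contMDiffAt_mfderiv_vf isOpen_univ (mem_univ x) hχ.contMDiffOn
          (h.smooth 0 x hx)).continuousAt continuousAt_fst
    have h4 : Continuous fun z : X × ℝ => Real.cos z.2 * Real.sin z.2 ^ 3 := by fun_prop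
    exact (h4.continuousAt.mul h2).mul h3
  · rw [meridCutoff, dX_eq_zero_of_notMem_tsupport hx, mul_zero]

/-- For fixed `θ` this is the divergence theorem for `Z` applied to `χ` times the value on the
meridian; the product rule separates the derivative of the cutoff. -/
theorem integral_meridDiv [CompactSpace X] [T2Space X] [MeasurableSpace X] [BorelSpace X]
    (h : AdaptedFrame S α R U e) (hα : S.IsPoppForm α) (hR : S.IsReeb α R) (hF : TestFn F)
    (hs : s ≠ 0) {χ : X → ℝ} (hχ : ContMDiff (𝓡 4) 𝓘(ℝ, ℝ) ∞ χ) (hχU : tsupport χ ⊆ U) {c : X}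
    (hc : U ⊆ (chartAt E4 c).source) (θ : ℝ) :
    ∫ x, (meridDiv S α e F s χ x θ + meridCutoff S α e F s χ x θ) ∂(S.popp α R) = 0 := by
  let g : X → ℝ := fun x => χ x * meridVal S α e F s x θ
  have hv : ∀ x ∈ U, ContMDiffAt (𝓡 4) 𝓘(ℝ, ℝ) ∞ (fun x => meridVal S α e F s x θ) x :=
    fun x hx => ContMDiffAt.comp (g := F ∘ psi S α e) (f := fun x : X => (x, merid s θ)) x
      (h.contMDiffAt_comp_psi hα hR hF (merid_mem hs hx θ)) (contMDiffAt_id.prodMk contMDiffAt_const)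
  have hgs : tsupport g ⊆ tsupport χ := tsupport_mul_subset_left
  have hg : ContMDiff (𝓡 4) 𝓘(ℝ, ℝ) ∞ g := fun x => by
    by_cases hx : x ∈ tsupport χ
    · exact hχ.contMDiffAt.mul (hv x (hχU hx))
    · refine (contMDiffAt_const (c := (0 : ℝ))).congr_of_eventuallyEq ?_
      filter_upwards [notMem_tsupport_iff_eventuallyEq.1 hx] with z hz
      simp [g, hz]
  have h1 := h.integral_divergence hα hR hg (hgs.trans hχU) hc
  have h2 : ∀ x, meridDiv S α e F s χ x θ + meridCutoff S α e F s χ x θ =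
      (Real.cos θ * Real.sin θ ^ 3) * (dX g x (e 0 x) - g x * (2 * structB S α e x)) := fun x => by
    by_cases hx : x ∈ tsupport χ
    · have h3 := dX_mul (hχ.contMDiffAt.mdifferentiableAt (x := x) (by simp))
        ((hv x (hχU hx)).mdifferentiableAt (by simp)) (e 0 x)
      have h4 : dX (fun x => meridVal S α e F s x θ) x (e 0 x) = meridChar S α e F s x θ :=
        dX_comp_mk ((h.contMDiffAt_comp_psi hα hR hF
          (merid_mem hs (hχU hx) θ)).mdifferentiableAt (by simp)) _
      rw [h4] at h3
      have h5 : dX g x (e 0 x) = _ := h3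
      rw [h5, meridDiv, meridCutoff]
      ring
    · have h3 : dX g x (e 0 x) = 0 := dX_eq_zero_of_notMem_tsupport (fun hx' => hx (hgs hx')) _
      have h4 : χ x = 0 := image_eq_zero_of_notMem_tsupport hx
      rw [h3, meridDiv, meridCutoff, dX_eq_zero_of_notMem_tsupport hx]
      simp [g, h4]
  simp only [h2]
  rw [integral_const_mul, h1, mul_zero]

/-- Dependence of the first moment along a meridian on the frame. -/
theorem moment_mul_eq [T2Space X] (h : AdaptedFrame S α R U e) (hα : S.IsPoppForm α)
    (hR : S.IsReeb α R) (hc : S.CircleInvariant F) (hs : s ≠ 0) {U' : Set X}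
    {e' : Fin 4 → ∀ x : X, TangentSpace (𝓡 4) x} (h' : AdaptedFrame S α R U' e') {x : X}
    (hx : x ∈ U) (hx' : x ∈ U') (l : E4 →L[ℝ] ℝ) :
    (∫ θ in (0 : ℝ)..Real.pi, Real.cos θ * Real.sin θ ^ 3 * meridVal S α e' F s x θ) * l (e' 0 x) =
      (∫ θ in (0 : ℝ)..Real.pi, Real.cos θ * Real.sin θ ^ 3 * meridVal S α e F s x θ) *
        l (e 0 x) := by
  obtain ⟨⟨h0, h0'⟩, h1, h1'⟩ := exists_unit_normal h' hα hR hs hx'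
  have hinv : ∀ φ θ, F (psi S α e (x, rotL φ (merid s θ))) = meridVal S α e F s x θ := fun φ θ => by
    have hm := merid_mem hs hx θ
    have h2 := h.rot_psi hα hR hm (SignType.sign s * φ)
    have h3 : (merid s θ).1 3 = s := Pi.single_eq_same (M := fun _ : Fin 4 => ℝ) 3 s
    dsimp only at h2
    rw [h3, ← mul_assoc, sign_mul_sign hs, one_mul] at h2
    rw [← h2]
    exact hc _ (h.psi_mem hα hR hm) _
  have hval : ∀ θ, meridVal S α e' F s x θ =
      F (⟨x, (s • α x, Real.cos θ • e' 0 x + Real.sin θ • e' 1 x)⟩ : CoTanSum X) := fun θ => by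
    refine congrArg F (congrArg (Bundle.TotalSpace.mk x) (Prod.ext ?_ ?_))
    · change ∑ j, (Pi.single 3 s : Fin 4 → ℝ) j • coframe S α e' j x = s • α x
      rw [Finset.sum_eq_single 3 (fun j _ hj => by rw [Pi.single_eq_of_ne hj, zero_smul])
        (by simp), Pi.single_eq_same, coframe_three]
    · change ∑ i, (![Real.cos θ, Real.sin θ, 0] : Fin 3 → ℝ) i • e' (Fin.castSucc i) x =
        Real.cos θ • e' 0 x + Real.sin θ • e' 1 x
      rw [Fin.sum_univ_three]
      simp
  obtain ⟨φ, ⟨he, hφ⟩ | ⟨he, hφ⟩⟩ := h.exists_merid hα hR hs hx h0 h0' h1 h1'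
  · simp only [hval, hφ, hinv]
    rw [he]
  · simp only [hval, hφ, hinv]
    -- When the two fields `Z` are opposite, reversing the meridian changes the sign of `cos θ`,
    -- hence of the moment, and `l` changes sign as well; the product is unaffected.
    rw [← integral_merid_flip fun θ => Real.cos θ * Real.sin θ ^ 3 * meridVal S α e F s x θ, he]
    have h2 : l (show E4 from -e 0 x) = -l (e 0 x) := map_neg l _
    simp only [Real.cos_pi_sub, Real.sin_pi_sub, neg_mul, intervalIntegral.integral_neg]
    refine (congrArg _ h2).trans ?_
    ring

end AdaptedFrame

namespace FrameCover

variable {ι : Type*} [Fintype ι] {c : ι → X} {V : ι → Set X}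
  {E : ι → Fin 4 → ∀ x : X, TangentSpace (𝓡 4) x} {χ : ι → X → ℝ}

theorem sum_dX_eq_zero (h : FrameCover S α R c V E χ) (x : X) (u : TangentSpace (𝓡 4) x) :
    ∑ i, dX (χ i) x u = 0 := by
  classical
  have h0 : ∀ t : Finset ι, MDifferentiableAt (𝓡 4) 𝓘(ℝ, ℝ) (∑ i ∈ t, χ i) x ∧
      dX (∑ i ∈ t, χ i) x u = ∑ i ∈ t, dX (χ i) x u := fun t => by
    induction t using Finset.induction_on with
    | empty =>
      refine ⟨mdifferentiableAt_const (c := (0 : ℝ)), ?_⟩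
      exact congrArg (fun l : E4 →L[ℝ] ℝ => l u) (mfderiv_const (c := (0 : ℝ)))
    | insert i t hi IH =>
      have hi' : MDifferentiableAt (𝓡 4) 𝓘(ℝ, ℝ) (χ i) x :=
        (h.smooth i).contMDiffAt.mdifferentiableAt (by simp)
      rw [Finset.sum_insert hi, Finset.sum_insert hi, ← IH.2]
      exact ⟨hi'.add IH.1, congrArg (fun l : E4 →L[ℝ] ℝ => l u) (mfderiv_add hi' IH.1)⟩
  have h2 : ∑ i, χ i = fun _ => (1 : ℝ) := funext fun y => by
    rw [Finset.sum_apply, h.sum_eq]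
  rw [← (h0 Finset.univ).2, h2]
  exact congrArg (fun l : E4 →L[ℝ] ℝ => l u) (mfderiv_const (c := (1 : ℝ)))

/-- The moment times `Z` is the same vector in all frames by `moment_mul_eq`. So the sum is one
fixed moment times the derivative of `∑ χ_i = 1` along one fixed vector. -/
theorem sum_moment_eq_zero [T2Space X] (h : FrameCover S α R c V E χ) (hα : S.IsPoppForm α)
    (hR : S.IsReeb α R) (hc : S.CircleInvariant F) (hs : s ≠ 0) (x : X) :
    ∑ i, ∫ θ in (0 : ℝ)..Real.pi, meridCutoff S α (E i) F s (χ i) x θ = 0 := by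
  obtain ⟨i₀, hi₀⟩ := h.exists_mem x
  have h1 : ∀ i, ∫ θ in (0 : ℝ)..Real.pi, meridCutoff S α (E i) F s (χ i) x θ =
      (∫ θ in (0 : ℝ)..Real.pi, Real.cos θ * Real.sin θ ^ 3 * meridVal S α (E i₀) F s x θ) *
        dX (χ i) x (E i₀ 0 x) := fun i => by
    simp only [meridCutoff]
    rw [intervalIntegral.integral_mul_const]
    by_cases hi : x ∈ V i
    · exact (h.frame i₀).moment_mul_eq hα hR hc hs (h.frame i) hi₀ hi (dX (χ i) x)
    · have h2 : x ∉ tsupport (χ i) := fun hx => hi (h.tsupport_subset i hx)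
      rw [dX_eq_zero_of_notMem_tsupport h2, dX_eq_zero_of_notMem_tsupport h2, mul_zero, mul_zero]
  rw [Finset.sum_congr rfl fun i _ => h1 i, ← Finset.mul_sum, h.sum_dX_eq_zero, mul_zero]

/-- Each frame contributes minus its cutoff term after integration over `X`, and the cutoff terms
cancel at each point once they are integrated over the fibre and summed over the frames. -/
theorem preservesLiftedPopp [CompactSpace X] [T2Space X] [MeasurableSpace X] [BorelSpace X]
    (h : FrameCover S α R c V E χ) (hα : S.IsPoppForm α) (hR : S.IsReeb α R) :
    S.PreservesLiftedPopp α R (glueField S α E χ) := by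
  intro F hF hc hd s hs
  have hs : s ≠ 0 := by rcases hs with rfl | rfl <;> norm_num
  have := isFiniteMeasure_popp hα hR
  have hA : ∀ i, Integrable (Function.uncurry (meridDiv S α (E i) F s (χ i)))
      ((S.popp α R).prod (volume.restrict (Ioc 0 Real.pi))) := fun i => integrable_uncurry
    ((h.frame i).continuous_meridDiv hα hR hF hs (h.smooth i).continuous (h.tsupport_subset i))
  have hB : ∀ i, Integrable (Function.uncurry (meridCutoff S α (E i) F s (χ i)))
      ((S.popp α R).prod (volume.restrict (Ioc 0 Real.pi))) := fun i => integrable_uncurry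
    ((h.frame i).continuous_meridCutoff hα hR hF hs (h.smooth i) (h.tsupport_subset i))
  have hA' : ∀ i, Integrable (fun x => ∫ θ in Ioc 0 Real.pi, meridDiv S α (E i) F s (χ i) x θ)
      (S.popp α R) := fun i => (hA i).integral_prod_left
  have hB' : ∀ i, Integrable (fun x => ∫ θ in Ioc 0 Real.pi, meridCutoff S α (E i) F s (χ i) x θ)
      (S.popp α R) := fun i => (hB i).integral_prod_left
  have hzero := h.sum_moment_eq_zero hα hR hc hs
  simp only [h.fibreIntegral_glueField hα hR hF hc hd hs, intervalIntegral.integral_of_le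
    Real.pi_pos.le] at hzero ⊢
  refine ⟨integrable_finsetSum _ fun i _ => hA' i, ?_⟩
  have h1 : ∀ i, (∫ x, (∫ θ in Ioc 0 Real.pi, meridDiv S α (E i) F s (χ i) x θ) ∂(S.popp α R)) =
      -∫ x, (∫ θ in Ioc 0 Real.pi, meridCutoff S α (E i) F s (χ i) x θ) ∂(S.popp α R) := fun i => by
    have h2 := integral_integral_add (hA i) (hB i)
    simp only [Function.uncurry_apply_pair] at h2
    -- Fubini's theorem: the divergence theorem holds on `X` for each fixed `θ`, while the fibre
    -- integral is given for each fixed `x`.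
    rw [eq_neg_iff_add_eq_zero, ← h2, integral_integral_swap ((hA i).add (hB i))]
    simp only [(h.frame i).integral_meridDiv hα hR hF hs (h.smooth i) (h.tsupport_subset i)
      (h.subset_chart i), integral_zero]
  rw [integral_finsetSum _ fun i _ => hA' i, Finset.sum_congr rfl fun i _ => h1 i,
    Finset.sum_neg_distrib, ← integral_finsetSum _ fun i _ => hB' i]
  simp only [hzero, integral_zero, neg_zero]

end FrameCover
end QCStructure

end

theorem mainTheorem10 {X : Type*} [TopologicalSpace X] [ChartedSpace E4 X]
    [IsManifold (𝓡 4) ∞ X] [CompactSpace X] [T2Space X] [MeasurableSpace X] [BorelSpace X]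
    (S : QCStructure X) (α : ∀ x : X, CoFib X x) (hα : S.IsPoppForm α)
    (R : ∀ x : X, TangentSpace (𝓡 4) x) (hR : S.IsReeb α R) :
    ∃ (U : Set (CoTan X)) (Ω : CoTan X → ℝ) (Zhat : ∀ q : CoTanSum X, TangentSpace IS q),
      -- `Ω` is smooth and homogeneous of degree one on a conic neighbourhood of `Σ`
      (IsOpen U ∧ S.Char ⊆ U ∧ ContMDiffOn IC 𝓘(ℝ, ℝ) ∞ Ω U ∧
        ∀ p ∈ U, ∀ c : ℝ, 0 < c → dil c p ∈ U ∧ Ω (dil c p) = c * Ω p) ∧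
      S.HamRestrictsToRotation Ω ∧
      S.IsSmoothFieldSN Zhat ∧
      S.IsHomogeneousField Zhat ∧
      S.HasSingularExpansion R Ω Zhat ∧
      -- `(π ∘ β)_* Zhat` lies in the characteristic line and has length `|Ξ₀|`
      (∀ q ∈ S.SN, QCStructure.pushBase Zhat q ∈ S.L q.1 ∧
        √(S.g q.1 (QCStructure.pushBase Zhat q) (QCStructure.pushBase Zhat q)) = S.absXi q) ∧
      S.DescendsToQuotient Zhat ∧
      S.PreservesLiftedPopp α R Zhat := by
  obtain ⟨t, c, V, E, χ, h⟩ := QCStructure.exists_frameCover hα hR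
  have hO : IsOpen {p : CoTan X | symb R p ≠ 0} := isOpen_ne.preimage
    (continuous_iff_continuousAt.2 fun p => (contMDiffAt_symb hR.smooth.contMDiffAt).continuousAt)
  -- The set where `ξ(R) ≠ 0` is conic and open, contains `Σ`, and on it the negative powers of
  -- `ξ(R)` in `Ω` are smooth and the sign of `ξ(R)` is locally constant.
  refine ⟨{p | symb R p ≠ 0}, QCStructure.omegaFn S α R E χ, QCStructure.glueField S α E χ,
    ⟨hO, fun p hp => ((QCStructure.mem_Char_iff hα hR).1 hp).1,
      fun p hp => (h.contMDiffAt_omegaFn hα hR hp).contMDiffWithinAt,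
      fun p hp c hc => ⟨mul_ne_zero hc.ne' hp, h.omegaFn_dil hα hR p hc⟩⟩,
    h.hamRestricts hα hR, h.smoothField hα hR, h.homogeneousField hα hR,
    h.singularExpansion hα hR, fun q hq => h.pushBase_spec hα hR hq, h.descends hα hR,
    h.preservesLiftedPopp hα hR⟩
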